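/- Let $W$ be a planar $5$-web of class $C^\infty$ on an open set $U\subset\mathbb R^2$, i.e. five foliations given by smooth $1$-forms that are pairwise linearly independent at every point of $U$. Let $\omega_1,\dots,\omega_5$ be multiples of these forms, by smooth nonvanishing functions, in the standard normalization $$\omega_1+\omega_2+\omega_3=0,\qquad a\,\omega_1+\omega_2+\omega_4=0,\qquad b\,\omega_1+\omega_2+\omega_5=0,$$ where the functions $a,b$ are the basic invariants of the web. (Every $5$-web has such a normalization, unique up to a common factor.) The rank of $W$ at $p\in U$ is the dimension of the space of germs at $p$ of smooth solutions $(\lambda_1,\dots,\lambda_5)$ of the abelian equation $\sum_i\lambda_i\omega_i=0$, $d(\lambda_i\omega_i)=0$ $(i=1,\dots,5)$; the web is of maximum rank at $p$ if this dimension is $6$. The web is parallelizable at $p$ if a local diffeomorphism defined near $p$ sends it to a web of five families of parallel straight lines. Let $\gamma=g_1\omega_1+g_2\omega_2$ be the Chern form of the $3$-subweb $[1,2,3]$, defined by $d\omega_i=\omega_i\wedge\gamma$ for $i=1,2,3$. Let $\partial_1,\partial_2$ be the frame dual to $\omega_1,\omega_2$, and for a function $f$ of weight $k$ let $\delta_i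 f=\partial_i f-k g_i f$, which has weight $k+1$; $w,u,v$ have weight $1$ and $a,b$ have weight $0$. Put $\Delta_1=\delta_1-\delta_2$, $\Delta_2=\delta_1-\delta_2\circ a$, $\Delta_3=\delta_1-\delta_2\circ b$. With $\lambda_3=w$, $\lambda_4=u$, $\lambda_5=v$, $\lambda_1=w+au+bv$, $\lambda_2=w+u+v$ the abelian equation becomes $$\Delta_1 w=0,\quad \Delta_2u=0,\quad \Delta_3v=0,\quad \delta_1w+\delta_1u+\delta_1v=0 .$$ Let $\mathfrak A_3$ be its prolongation to $3$-jets: the $3$-jets of $(w,u,v)$ at points $p$ for which the left-hand sides vanish at $p$ together with their derivatives of order at most $2$. The obstruction is $$\varkappa=(\Delta_1\Delta_2\Delta_3\delta_1-\delta_1\Delta_2\Delta_3\Delta_1)w+(\Delta_1\Delta_2\Delta_3\delta_1-\Delta_1\delta_1\Delta_3\Delta_2)u+(\Delta_1\Delta_2\Delta_3\delta_1-\Delta_1\Delta_2\delta_1\Delta_3)v .$$ The curvature function of a $3$-subweb $[i,j,k]$ is the function $K_{ijk}$ with $d\gamma_{ijk}=K_{ijk}\,\omega_1\wedge\omega_2$,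 where $\gamma_{ijk}$ is the Chern form of the subweb (the form $d\gamma_{ijk}$ depends only on the three foliations). The curvature function of $W$ is the arithmetic mean of the curvature functions of its ten $3$-subwebs. Then: 1. There are unique functions $c_0,\dots,c_5$ on $U$ such that on $\mathfrak A_3$ $$\varkappa=-10(1-a)(1-b)\,\bigl(c_0\,\delta_2\delta_2w+c_1\,\delta_2w+c_2\,\delta_2v+c_3\,w+c_4\,u+c_5\,v\bigr),$$ and they are smooth. 2. For every $p\in U$, the web is of maximum rank at $p$ if and only if $c_0,c_1,\dots,c_5$ vanish in a neighbourhood of $p$. 3. $c_0$ equals the curvature function of the web. Consequently, if the web is of maximum rank at $p$, its curvature function vanishes in a neighbourhood of $p$. 4. If the basic invariants $a,b$ are constant near $p$, then $c_0,\dots,c_5$ vanish near $p$ (equivalently, the web is of maximum rank at $p$) if and only if the web is parallelizable at $p$. -/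

import Mathlib

open scoped ContDiff Topology

noncomputable section

namespace PlanarWebs

/-- The plane, with coordinates `(x, y)`. -/
abbrev Plane : Type := ℝ × ℝ

/-- Differential `1`-forms on the plane. -/
abbrev OneForm : Type := Plane → (Plane →L[ℝ] ℝ)

/-- The coefficient of `dx ∧ dy` in `α ∧ β`. -/
def wedge (α β : OneForm) (p : Plane) : ℝ :=
  α p (1, 0) * β p (0, 1) - α p (0, 1) * β p (1, 0)

/-- The coefficient of `dx ∧ dy` in the exterior derivative `dα`. -/
def extD (α : OneForm) (p : Plane) : ℝ :=
  fderiv ℝ α p (1, 0) (0, 1) - fderiv ℝ α p (0, 1) (1, 0)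

/-- A planar `d`-web on an open set: `d` foliations in general position, the `i`-th one being
given by the equation `form i = 0`. -/
structure PlanarWeb (d : ℕ) where
  /-- the domain of the web -/
  domain : Set Plane
  isOpen_domain : IsOpen domain
  /-- the forms that define the foliations -/
  form : Fin d → OneForm
  smooth : ∀ i, ContDiffOn ℝ ∞ (form i) domain
  transverse : ∀ i j, i ≠ j → ∀ p ∈ domain, wedge (form i) (form j) p ≠ 0

/-! ### Abelian equation, rank, parallelizability -/

/-- `lam` is, near `p`, a smooth solution of the abelian equation of the web: `∑ λᵢ ωᵢ = 0`, and
every form `λᵢ ωᵢ` is closed. -/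
def SolvesAbelianNear {d : ℕ} (W : PlanarWeb d) (p : Plane) (lam : Plane → Fin d → ℝ) : Prop :=
  ∀ᶠ q in 𝓝 p, ContDiffAt ℝ ∞ lam q ∧ ∑ i, lam q i • W.form i q = 0 ∧
    ∀ i, extD (fun r => lam r i • W.form i r) q = 0

lemma extD_zero (p : Plane) : extD (fun _ => 0) p = 0 := by
  simp [extD]

lemma extD_add {α β : OneForm} {p : Plane} (hα : DifferentiableAt ℝ α p)
    (hβ : DifferentiableAt ℝ β p) :
    extD (fun q => α q + β q) p = extD α p + extD β p := by
  simp only [extD]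
  rw [fderiv_fun_add hα hβ]
  simp only [add_apply]
  ring

lemma extD_const_smul {α : OneForm} {p : Plane} (c : ℝ) (hα : DifferentiableAt ℝ α p) :
    extD (fun q => c • α q) p = c * extD α p := by
  simp only [extD]
  rw [fderiv_fun_const_smul hα c]
  simp only [smul_apply, smul_eq_mul]
  ring

lemma differentiableAt_smul_form {d : ℕ} (W : PlanarWeb d) {q : Plane} (hq : q ∈ W.domain)
    {lam : Plane → Fin d → ℝ} (h : ContDiffAt ℝ ∞ lam q) (i : Fin d) :
    DifferentiableAt ℝ (fun r => lam r i • W.form i r) q := by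
  have h1 : DifferentiableAt ℝ (W.form i) q :=
    ((W.smooth i).contDiffAt (W.isOpen_domain.mem_nhds hq)).differentiableAt (by simp)
  have h2 : DifferentiableAt ℝ lam q := h.differentiableAt (by simp)
  exact (differentiableAt_pi.1 h2 i).smul h1

/-- The real vector space of germs at `p` of solutions of the abelian equation of the web. -/
def abelianGerms {d : ℕ} (W : PlanarWeb d) {p : Plane} (hp : p ∈ W.domain) :
    Submodule ℝ (Filter.Germ (𝓝 p) (Fin d → ℝ)) where
  carrier := {g | ∃ lam : Plane → Fin d → ℝ,
    g = (lam : Filter.Germ (𝓝 p) (Fin d → ℝ)) ∧ SolvesAbelianNear W p lam}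
  zero_mem' := by
    refine ⟨0, rfl, Filter.Eventually.of_forall fun q => ⟨contDiffAt_const, by simp, fun i => ?_⟩⟩
    simpa using extD_zero q
  add_mem' := by
    rintro _ _ ⟨l, rfl, hl⟩ ⟨m, rfl, hm⟩
    refine ⟨l + m, rfl, ?_⟩
    filter_upwards [hl, hm, W.isOpen_domain.mem_nhds hp] with q h1 h2 hq
    refine ⟨h1.1.add h2.1, ?_, fun i => ?_⟩
    · simp only [Pi.add_apply, add_smul, Finset.sum_add_distrib, h1.2.1, h2.2.1, add_zero]
    · simp only [Pi.add_apply, add_smul]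
      rw [extD_add (differentiableAt_smul_form W hq h1.1 i)
        (differentiableAt_smul_form W hq h2.1 i), h1.2.2 i, h2.2.2 i, add_zero]
  smul_mem' := by
    rintro c _ ⟨l, rfl, hl⟩
    refine ⟨c • l, rfl, ?_⟩
    filter_upwards [hl, W.isOpen_domain.mem_nhds hp] with q h1 hq
    refine ⟨contDiffAt_const.smul h1.1, ?_, fun i => ?_⟩
    · simp only [Pi.smul_apply, smul_eq_mul, mul_smul, ← Finset.smul_sum, h1.2.1, smul_zero]
    · simp only [Pi.smul_apply, smul_eq_mul, mul_smul]
      rw [extD_const_smul c (differentiableAt_smul_form W hq h1.1 i), h1.2.2 i, mul_zero]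

/-- The (local) rank of the web at a point of its domain. -/
def rankAt {d : ℕ} (W : PlanarWeb d) {p : Plane} (hp : p ∈ W.domain) : ℕ :=
  Module.finrank ℝ (abelianGerms W hp)

/-- The web is of maximum rank `(d - 1)(d - 2)/2` at `p`. -/
def IsMaxRankAt {d : ℕ} (W : PlanarWeb d) {p : Plane} (hp : p ∈ W.domain) : Prop :=
  rankAt W hp = (d - 1) * (d - 2) / 2

/-- Near `p` a local diffeomorphism of the plane sends the web to a web of parallel straight
lines: the `i`-th foliation goes to the lines `ℓ i = const`. -/
def IsParallelizableAt {d : ℕ} (W : PlanarWeb d) (p : Plane) : Prop :=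
  ∃ (e : OpenPartialHomeomorph Plane Plane) (ℓ : Fin d → (Plane →L[ℝ] ℝ)),
    p ∈ e.source ∧ e.source ⊆ W.domain ∧
    ContDiffOn ℝ ∞ e e.source ∧ ContDiffOn ℝ ∞ e.symm e.target ∧
    (∀ i, ℓ i ≠ 0) ∧
    ∀ i, ∀ q ∈ e.source, ∀ v, W.form i q v = 0 ↔ ℓ i (fderiv ℝ e q v) = 0

/-! ### Chern connection and curvature of 3-webs -/

/-- First coefficient of the Chern form `γ = g₁ η₁ + g₂ η₂` of the `3`-web given by the normalized
forms `η₁`, `η₂`, `η₃ = - η₁ - η₂`. -/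
def chernCoeff₁ (η₁ η₂ : OneForm) (p : Plane) : ℝ := -(extD η₂ p) / wedge η₁ η₂ p

/-- Second coefficient of the Chern form `γ = g₁ η₁ + g₂ η₂`. -/
def chernCoeff₂ (η₁ η₂ : OneForm) (p : Plane) : ℝ := extD η₁ p / wedge η₁ η₂ p

/-- The Chern form `γ` of the `3`-web given by the normalized forms `η₁`, `η₂`,
`η₃ = - η₁ - η₂`. -/
def chernForm (η₁ η₂ : OneForm) : OneForm :=
  fun p => chernCoeff₁ η₁ η₂ p • η₁ p + chernCoeff₂ η₁ η₂ p • η₂ p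

/-- The structure equations `dη₁ = η₁ ∧ γ` and `dη₂ = η₂ ∧ γ`, which characterize `γ`. -/
lemma chernForm_unique (η₁ η₂ γ : OneForm) (p : Plane) (h : wedge η₁ η₂ p ≠ 0) :
    (extD η₁ p = wedge η₁ γ p ∧ extD η₂ p = wedge η₂ γ p) ↔ γ p = chernForm η₁ η₂ p := by
  have key : ∀ θ : Plane →L[ℝ] ℝ, γ p = θ ↔
      (γ p (1, 0) = θ (1, 0) ∧ γ p (0, 1) = θ (0, 1)) := by
    intro θ
    refine ⟨fun h => by simp [h], fun h => ?_⟩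
    ext <;> simp [h.1, h.2]
  rw [key]
  simp only [chernForm, chernCoeff₁, chernCoeff₂, add_apply, smul_apply, smul_eq_mul]
  have hw : ∀ x y z t : ℝ,
      x / wedge η₁ η₂ p * y + z / wedge η₁ η₂ p * t = (x * y + z * t) / wedge η₁ η₂ p := by
    intros; ring
  rw [hw, hw, eq_div_iff h, eq_div_iff h]
  constructor
  · rintro ⟨h1, h2⟩
    rw [h1, h2]
    simp only [wedge]
    constructor <;> ring
  · rintro ⟨h1, h2⟩
    constructor
    · apply mul_right_cancel₀ h
      simp only [wedge] at *
      linear_combination (η₁ p (0, 1)) * h1 - (η₁ p (1, 0)) * h2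
    · apply mul_right_cancel₀ h
      simp only [wedge] at *
      linear_combination (η₂ p (0, 1)) * h1 - (η₂ p (1, 0)) * h2

/-- The curvature form `dγ` (the coefficient of `dx ∧ dy`) of the `3`-web given by three forms
that are pairwise independent. The multiples `(β ∧ χ) α`, `(χ ∧ α) β`, `(α ∧ β) χ`
have sum zero, so they normalize the `3`-web. -/
def curvatureForm (α β χ : OneForm) (p : Plane) : ℝ :=
  extD (chernForm (fun q => wedge β χ q • α q) (fun q => wedge χ α q • β q)) p

/-! ### 5-webs in the standard normalization -/

/-- A standard normalization of a `5`-web: multiples `ωᵢ = sᵢ · form i` of the given forms with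
`ω₁ + ω₂ + ω₃ = 0`, `a ω₁ + ω₂ + ω₄ = 0`, `b ω₁ + ω₂ + ω₅ = 0`
(the indices in the code start from `0`). -/
structure Normalization (W : PlanarWeb 5) where
  /-- the multipliers -/
  scale : Fin 5 → Plane → ℝ
  scale_smooth : ∀ i, ContDiffOn ℝ ∞ (scale i) W.domain
  scale_ne_zero : ∀ i, ∀ p ∈ W.domain, scale i p ≠ 0
  /-- the first basic invariant -/
  a : Plane → ℝ
  /-- the second basic invariant -/
  b : Plane → ℝ
  eq_three : ∀ p ∈ W.domain,
    scale 0 p • W.form 0 p + scale 1 p • W.form 1 p + scale 2 p • W.form 2 p = 0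
  eq_four : ∀ p ∈ W.domain,
    a p • scale 0 p • W.form 0 p + scale 1 p • W.form 1 p + scale 3 p • W.form 3 p = 0
  eq_five : ∀ p ∈ W.domain,
    b p • scale 0 p • W.form 0 p + scale 1 p • W.form 1 p + scale 4 p • W.form 4 p = 0

lemma wedge_smooth (W : PlanarWeb 5) (i j : Fin 5) :
    ContDiffOn ℝ ∞ (wedge (W.form i) (W.form j)) W.domain := by
  unfold wedge
  have h := W.smooth
  exact (((h i).clm_apply contDiffOn_const).mul ((h j).clm_apply contDiffOn_const)).sub
    (((h i).clm_apply contDiffOn_const).mul ((h j).clm_apply contDiffOn_const))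

/-- Every `5`-web has a standard normalization. -/
theorem exists_normalization (W : PlanarWeb 5) : Nonempty (Normalization W) := by
  let D : Fin 5 → Fin 5 → Plane → ℝ := fun i j => wedge (W.form i) (W.form j)
  have hD : ∀ i j, ContDiffOn ℝ ∞ (D i j) W.domain := wedge_smooth W
  have h0 : ∀ i j, i ≠ j → ∀ p ∈ W.domain, D i j p ≠ 0 := W.transverse
  have plane : ∀ (k : Fin 5) (p : Plane),
      D 1 k p • W.form 0 p + D k 0 p • W.form 1 p + D 0 1 p • W.form k p = 0 := by
    intro k p
    ext <;> simp [D, wedge] <;> ring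
  have main : ∀ k : Fin 5, k ≠ 0 → k ≠ 1 → ∀ p ∈ W.domain,
      (D 2 0 p * D 1 k p / (D 1 2 p * D k 0 p)) • D 1 2 p • W.form 0 p
        + D 2 0 p • W.form 1 p + (D 2 0 p * D 0 1 p / D k 0 p) • W.form k p = 0 := by
    intro k hk0 hk1 p hp
    have e1 := h0 k 0 hk0 p hp
    have e2 := h0 1 2 (by decide) p hp
    have e3 := congrArg (fun θ => (D 2 0 p / D k 0 p) • θ) (plane k p)
    simp only [smul_add, smul_smul, smul_zero] at e3
    rw [← e3, smul_smul]
    congr 3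
    · field_simp
    · field_simp
    · ring
  refine ⟨⟨![D 1 2, D 2 0, D 0 1, fun p => D 2 0 p * D 0 1 p / D 3 0 p,
    fun p => D 2 0 p * D 0 1 p / D 4 0 p], ?_, ?_,
    fun p => D 2 0 p * D 1 3 p / (D 1 2 p * D 3 0 p),
    fun p => D 2 0 p * D 1 4 p / (D 1 2 p * D 4 0 p), ?_, ?_, ?_⟩⟩
  · intro i
    fin_cases i
    · exact hD 1 2
    · exact hD 2 0
    · exact hD 0 1
    · exact ((hD 2 0).mul (hD 0 1)).div (hD 3 0) (h0 3 0 (by decide))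
    · exact ((hD 2 0).mul (hD 0 1)).div (hD 4 0) (h0 4 0 (by decide))
  · intro i p hp
    have a1 := h0 2 0 (by decide) p hp
    have a2 := h0 0 1 (by decide) p hp
    fin_cases i
    · exact h0 1 2 (by decide) p hp
    · exact a1
    · exact a2
    · exact div_ne_zero (mul_ne_zero a1 a2) (h0 3 0 (by decide) p hp)
    · exact div_ne_zero (mul_ne_zero a1 a2) (h0 4 0 (by decide) p hp)
  · intro p _
    exact plane 2 p
  · intro p hp
    exact main 3 (by decide) (by decide) p hp
  · intro p hp
    exact main 4 (by decide) (by decide) p hp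

namespace Normalization

variable {W : PlanarWeb 5} (N : Normalization W)

/-- The normalized forms. -/
def nform (i : Fin 5) : OneForm := fun p => N.scale i p • W.form i p

/-- `ω₁ ∧ ω₂`. -/
def area (p : Plane) : ℝ := wedge (N.nform 0) (N.nform 1) p

/-- `∂₁ f`, where `∂₁, ∂₂` is the frame dual to `ω₁, ω₂`, i.e. `df = (∂₁ f) ω₁ + (∂₂ f) ω₂`. -/
def pd₁ (f : Plane → ℝ) (p : Plane) : ℝ := wedge (fderiv ℝ f) (N.nform 1) p / N.area p

/-- `∂₂ f`. -/
def pd₂ (f : Plane → ℝ) (p : Plane) : ℝ := wedge (N.nform 0) (fderiv ℝ f) p / N.area p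

/-- The covariant derivative `δ₁ f = ∂₁ f - k g₁ f` of a function of weight `k` with respect to
the Chern connection of the `3`-subweb `[1,2,3]`; the result has weight `k + 1`. -/
def δ₁ (k : ℕ) (f : Plane → ℝ) : Plane → ℝ :=
  fun p => N.pd₁ f p - k * chernCoeff₁ (N.nform 0) (N.nform 1) p * f p

/-- The covariant derivative `δ₂ f = ∂₂ f - k g₂ f` of a function of weight `k`. -/
def δ₂ (k : ℕ) (f : Plane → ℝ) : Plane → ℝ :=
  fun p => N.pd₂ f p - k * chernCoeff₂ (N.nform 0) (N.nform 1) p * f p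

/-- `Δ₁ = δ₁ - δ₂` on functions of weight `k`. -/
def Δ₁ (k : ℕ) (f : Plane → ℝ) : Plane → ℝ := N.δ₁ k f - N.δ₂ k f

/-- `Δ₂ = δ₁ - δ₂ ∘ a` on functions of weight `k`. -/
def Δ₂ (k : ℕ) (f : Plane → ℝ) : Plane → ℝ := N.δ₁ k f - N.δ₂ k (N.a * f)

/-- `Δ₃ = δ₁ - δ₂ ∘ b` on functions of weight `k`. -/
def Δ₃ (k : ℕ) (f : Plane → ℝ) : Plane → ℝ := N.δ₁ k f - N.δ₂ k (N.b * f)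

/-- The left hand sides of the abelian equation for
`λ₁ = w + a u + b v`, `λ₂ = w + u + v`, `λ₃ = w`, `λ₄ = u`, `λ₅ = v`. -/
def abelianOp (w u v : Plane → ℝ) : Fin 4 → Plane → ℝ :=
  ![N.Δ₁ 1 w, N.Δ₂ 1 u, N.Δ₃ 1 v, N.δ₁ 1 w + N.δ₁ 1 u + N.δ₁ 1 v]

/-- The `k`-jet of `(w, u, v)` at `p` belongs to the prolongation `𝔄ₖ` of the abelian equation:
the left hand sides of the equation vanish at `p` with all their derivatives of order
less than `k`. -/
def JetSolves (k : ℕ) (w u v : Plane → ℝ) (p : Plane) : Prop :=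
  ∀ j : Fin 4, ∀ m < k, iteratedFDeriv ℝ m (N.abelianOp w u v j) p = 0

/-- The obstruction
`ϰ = (Δ₁Δ₂Δ₃δ₁ - δ₁Δ₂Δ₃Δ₁) w + (Δ₁Δ₂Δ₃δ₁ - Δ₁δ₁Δ₃Δ₂) u + (Δ₁Δ₂Δ₃δ₁ - Δ₁Δ₂δ₁Δ₃) v`,
where `w`, `u`, `v` have weight `1`. -/
def obstruction (w u v : Plane → ℝ) : Plane → ℝ :=
  (N.Δ₁ 4 (N.Δ₂ 3 (N.Δ₃ 2 (N.δ₁ 1 w))) - N.δ₁ 4 (N.Δ₂ 3 (N.Δ₃ 2 (N.Δ₁ 1 w)))) +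
  (N.Δ₁ 4 (N.Δ₂ 3 (N.Δ₃ 2 (N.δ₁ 1 u))) - N.Δ₁ 4 (N.δ₁ 3 (N.Δ₃ 2 (N.Δ₂ 1 u)))) +
  (N.Δ₁ 4 (N.Δ₂ 3 (N.Δ₃ 2 (N.δ₁ 1 v))) - N.Δ₁ 4 (N.Δ₂ 3 (N.δ₁ 2 (N.Δ₃ 1 v))))

/-- `c₀, …, c₅` are the coefficients of the obstruction on `𝔄₃` in the canonical coordinates
`w₂₂, w₂, v₂, w, u, v`, the obstruction being divided by the factor `-10 (1 - a) (1 - b)`: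
`ϰ = -10 (1 - a) (1 - b) (c₀ w₂₂ + c₁ w₂ + c₂ v₂ + c₃ w + c₄ u + c₅ v)` on `𝔄₃`. -/
def IsObstructionCoeffs (c : Fin 6 → Plane → ℝ) : Prop :=
  ∀ p ∈ W.domain, ∀ w u v : Plane → ℝ,
    ContDiff ℝ ∞ w → ContDiff ℝ ∞ u → ContDiff ℝ ∞ v → N.JetSolves 3 w u v p →
    N.obstruction w u v p = -10 * (1 - N.a p) * (1 - N.b p) *
      (c 0 p * N.δ₂ 2 (N.δ₂ 1 w) p + c 1 p * N.δ₂ 1 w p + c 2 p * N.δ₂ 1 v p +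
        c 3 p * w p + c 4 p * u p + c 5 p * v p)

/-- The curvature function of the `3`-subweb `[i,j,k]`, i.e. the coefficient `K` in
`dγ = K ω₁ ∧ ω₂`, where `γ` is the Chern form of the subweb. -/
def subwebCurvature (i j k : Fin 5) (p : Plane) : ℝ :=
  curvatureForm (W.form i) (W.form j) (W.form k) p / N.area p

/-- The curvature function of the `5`-web: the arithmetic mean of the curvature functions of its
ten `3`-subwebs. -/
def curvature (p : Plane) : ℝ :=
  (∑ t : Fin 5 × Fin 5 × Fin 5 with t.1 < t.2.1 ∧ t.2.1 < t.2.2,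
    N.subwebCurvature t.1 t.2.1 t.2.2 p) / 10

end Normalization

end PlanarWebs

end

/-! The abelian equation is overdetermined of finite type. To top order, `δ₁` acts on `w`, `u`, `v`
as `1`, `a`, `b` times `δ₂`, and `0, 1, a, b` are pairwise distinct. Modulo the first three
equations the fourth one is `P = δ₂ w + δ₂ (a u) + δ₂ (b v) = 0`. Its prolongations give one, two
and three relations between the pure `δ₂`-derivatives of `w, u, v` of orders one, two and three. By
a Vandermonde argument these relations are independent, so the orders 0, 1, 2, 3 leave 3, 2, 1, 0
free parameters: the six coordinates `w₂₂, w₂, v₂, w, u, v`. Their first derivatives are again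
linear combinations of them (`exists_connection`). Solutions are therefore parallel sections of a
linear connection of rank 6.

The obstruction is a combination of third derivatives of the four left-hand sides
(`obstruction_eq`), so it vanishes on solutions. Its fourth-order terms cancel because principal
symbols commute, so on `𝔄₃` it is a linear form in the six coordinates (`canonical_obstruction`).
The `cᵢ` are the coefficients of this form. They are unique because every value of the coordinates
is attained by a jet in `𝔄₃`: there are as many unknown Taylor coefficients as conditions plus
coordinates, and the homogeneous problem has only the zero solution (`exists_solution_order_three`).

If the rank is maximal at `p`, solutions near `p` have arbitrary coordinates at `p`, and then at all
nearby points, since a determinant stays nonzero. Hence the form vanishes near `p`. Conversely,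
where the form vanishes, one of the conditions for solving the equation one order further is
redundant. The same count then realizes every value of the coordinates by a jet that solves the
equation to order four (`exists_solution_order_four`). Equality of mixed derivatives on such jets is
flatness of the connection (`connectionMatrix_flat`). A flat linear connection has parallel sections
with arbitrary initial value (`exists_parallel_section`), and these are solutions of the abelian
equation. Together this is `isMaxRankAt_iff`.

For `c₀` the elimination keeps track of the coefficient of `w₂₂`. The Chern form of each `3`-subweb
is, up to a closed form, `γ + ρ₁ ω₁ + ρ₂ ω₂`, where `ρ₁, ρ₂` solve two linear equations. The sum of
the ten curvatures and the coefficient of `w₂₂` are then compared as rational functions of `a`, `b`,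
their covariant derivatives and `K` (`map_leadObstruction`).

If `a` and `b` are constant, all the `ρ` vanish and `c₀ = K`. When `K = 0` the form `γ` is exact, `γ
= dφ`, and the primitives of `e^φ ω₁` and `e^φ ω₂` are coordinates that straighten the web.
Conversely, in a parallel web three linear first integrals with a constant linear relation produce a
nonvanishing covariantly constant function of weight one. This forces `K = 0`; then all the
operators commute and the obstruction is zero.

Weights are encoded as degrees in a polynomial ring `R[X]`, and jets as functions modulo the ideals
of functions that vanish to a given order. The elimination is carried out once in an abstract ring
and transported by ring homomorphisms. -/

set_option linter.unusedVariables false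
set_option linter.unusedSimpArgs false

/-! ### Elimination in the prolonged abelian equation -/

namespace PlanarWebs

/-- A commutative ring of homogeneous functions with the two covariant derivatives `d₁`, `d₂` of
the Chern connection (of curvature `K`), the Euler derivation `e` that measures the weight, and the
two basic invariants `a`, `b` of a `5`-web, together with the inverses of `a`, `b`, `1 - a`,
`1 - b`, `a - b`. -/
structure GradedWebAlgebra (S : Type) [CommRing S] where
  /-- the first covariant derivative -/
  d₁ : Derivation ℤ S S
  /-- the second covariant derivative -/
  d₂ : Derivation ℤ S S
  /-- the weight -/
  e : Derivation ℤ S S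
  /-- the curvature -/
  K : S
  /-- the first basic invariant -/
  a : S
  /-- the second basic invariant -/
  b : S
  /-- the inverse of `a` -/
  ia : S
  /-- the inverse of `b` -/
  ib : S
  /-- the inverse of `1 - a` -/
  i1a : S
  /-- the inverse of `1 - b` -/
  i1b : S
  /-- the inverse of `a - b` -/
  iab : S
  comm : ∀ f, d₁ (d₂ f) = d₂ (d₁ f) - K * e f
  e_d₁ : ∀ f, e (d₁ f) = d₁ (e f) + d₁ f
  e_d₂ : ∀ f, e (d₂ f) = d₂ (e f) + d₂ f
  e_a : e a = 0
  e_b : e b = 0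
  e_K : e K = K + K
  a_mul_ia : ia * a = 1
  b_mul_ib : ib * b = 1
  one_sub_a_mul : i1a * (1 - a) = 1
  one_sub_b_mul : i1b * (1 - b) = 1
  sub_mul_iab : iab * (a - b) = 1

namespace GradedWebAlgebra

variable {S : Type} [CommRing S] (G : GradedWebAlgebra S)

/-- A ring homomorphism kills `f` and its covariant derivatives of order at most two. -/
structure KillsTwoJet {T : Type} [CommRing T] (φ : S →+* T) (f : S) : Prop where
  z : φ f = 0
  z₁ : φ (G.d₁ f) = 0
  z₂ : φ (G.d₂ f) = 0
  z₁₁ : φ (G.d₁ (G.d₁ f)) = 0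
  z₁₂ : φ (G.d₂ (G.d₁ f)) = 0
  z₂₂ : φ (G.d₂ (G.d₂ f)) = 0

/-- The equation for `λ₃ = w`. -/
def eqW (w : S) : S := G.d₁ w - G.d₂ w

/-- The equation for `λ₄ = u`. -/
def eqU (u : S) : S := G.d₁ u - G.d₂ (G.a * u)

/-- The equation for `λ₅ = v`. -/
def eqV (v : S) : S := G.d₁ v - G.d₂ (G.b * v)

/-- The equation for `λ₁ = w + a u + b v`. -/
def eqP (w u v : S) : S := G.d₂ w + G.d₂ (G.a * u) + G.d₂ (G.b * v)

/-- A ring homomorphism kills the abelian equation and its derivatives of order at most two. -/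
structure KillsAbelian {T : Type} [CommRing T] (φ : S →+* T) (w u v : S) : Prop where
  onW : G.KillsTwoJet φ (G.eqW w)
  onU : G.KillsTwoJet φ (G.eqU u)
  onV : G.KillsTwoJet φ (G.eqV v)
  onP : G.KillsTwoJet φ (G.eqP w u v)

/-- The canonical coordinates `w₂₂, w₂, v₂, w, u, v` on the solution space. -/
def coord (w u v : S) : Fin 6 → S := ![G.d₂ (G.d₂ w), G.d₂ w, G.d₂ v, w, u, v]

/-- On solutions of the abelian equation, `F` is a linear combination of the canonical coordinates,
and the coefficient of `w₂₂` is `α`. -/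
def Canonical (F : S → S → S → S) (α : S) : Prop :=
  ∃ c : Fin 6 → S, c 0 = α ∧ ∀ w u v, G.e w = w → G.e u = u → G.e v = v →
    ∀ (T : Type) [CommRing T] (φ : S →+* T), G.KillsAbelian φ w u v →
      φ (F w u v) = ∑ i, φ (c i) * φ (G.coord w u v i)

variable {G}

lemma Canonical.add {F F' : S → S → S → S} {α α' : S} (h : G.Canonical F α)
    (h' : G.Canonical F' α') :
    G.Canonical (fun w u v => F w u v + F' w u v) (α + α') := by
  obtain ⟨c, hc, hF⟩ := h
  obtain ⟨c', hc', hF'⟩ := h'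
  refine ⟨c + c', by simp [hc, hc'], fun w u v hw hu hv T _ φ hφ => ?_⟩
  rw [map_add, hF w u v hw hu hv T φ hφ, hF' w u v hw hu hv T φ hφ, ← Finset.sum_add_distrib]
  exact Finset.sum_congr rfl fun i _ => by simp [add_mul]

lemma Canonical.smul {F : S → S → S → S} {α : S} (h : G.Canonical F α) (r : S) :
    G.Canonical (fun w u v => r * F w u v) (r * α) := by
  obtain ⟨c, hc, hF⟩ := h
  refine ⟨fun i => r * c i, by simp [hc], fun w u v hw hu hv T _ φ hφ => ?_⟩
  rw [map_mul, hF w u v hw hu hv T φ hφ, Finset.mul_sum]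
  exact Finset.sum_congr rfl fun i _ => by rw [map_mul, mul_assoc]

lemma Canonical.cast {F : S → S → S → S} {α α' : S} (h : G.Canonical F α) (hα : α = α') :
    G.Canonical F α' := hα ▸ h

/-- This is the reduction step of the elimination: `E` is a combination of the prolonged equations,
and it disappears under every `φ` that kills them. -/
lemma Canonical.congr {F : S → S → S → S} {α : S} (h : G.Canonical F α)
    (F' E : S → S → S → S)
    (hF : ∀ w u v, G.e w = w → G.e u = u → G.e v = v → F' w u v = F w u v + E w u v)
    (hE : ∀ w u v (T : Type) [CommRing T] (φ : S →+* T), G.KillsAbelian φ w u v →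
      φ (E w u v) = 0) : G.Canonical F' α := by
  obtain ⟨c, hc, hc'⟩ := h
  refine ⟨c, hc, fun w u v hw hu hv T _ φ hφ => ?_⟩
  rw [hF w u v hw hu hv, map_add, hE w u v T φ hφ, add_zero, hc' w u v hw hu hv T φ hφ]

/-- Solves a relation for a jet coordinate whose coefficient `x` is invertible; the inverses come
from general position of the web. -/
lemma Canonical.divide {F : S → S → S → S} {x α : S}
    (h : G.Canonical (fun w u v => x * F w u v) α) (y : S) (hy : y * x = 1) :
    G.Canonical F (y * α) := by
  refine (h.smul y).congr F (fun _ _ _ => 0) (fun w u v _ _ _ => ?_) fun _ _ _ _ _ _ _ =>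
    map_zero _
  linear_combination -F w u v * hy

lemma canonical_coord (F : S → S → S → S) (j : Fin 6)
    (hF : ∀ w u v, F w u v = G.coord w u v j) :
    G.Canonical F (if j = 0 then 1 else 0) := by
  refine ⟨fun i => if j = i then 1 else 0, rfl, fun w u v _ _ _ T _ φ _ => ?_⟩
  simp [hF, apply_ite φ]

variable (G)

lemma canonical_w_22 : G.Canonical (fun w _ _ => G.d₂ (G.d₂ w)) 1 :=
  canonical_coord _ 0 fun _ _ _ => rfl

lemma canonical_w_2 : G.Canonical (fun w _ _ => G.d₂ w) 0 :=
  canonical_coord _ 1 fun _ _ _ => rfl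

lemma canonical_v_2 : G.Canonical (fun _ _ v => G.d₂ v) 0 :=
  canonical_coord _ 2 fun _ _ _ => rfl

lemma canonical_w : G.Canonical (fun w _ _ => w) 0 :=
  canonical_coord _ 3 fun _ _ _ => rfl

lemma canonical_u : G.Canonical (fun _ u _ => u) 0 :=
  canonical_coord _ 4 fun _ _ _ => rfl

lemma canonical_v : G.Canonical (fun _ _ v => v) 0 :=
  canonical_coord _ 5 fun _ _ _ => rfl

/-- The coefficient of `w₂₂` in `u₂₂` on solutions. -/
def leadU : S := -(1 - G.b) * (G.ia * G.iab)

/-- The coefficient of `w₂₂` in `v₂₂` on solutions. -/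
def leadV : S := (1 - G.a) * (G.ib * G.iab)

/-- The coefficient of `w₂₂` in `u₂₂₂` on solutions. -/
def leadU₃ : S :=
  G.i1a * G.ia * G.iab * (6 * G.a ^ 2 * G.d₂ G.a * G.leadU + 3 * G.a * G.d₁ G.a * G.leadU + 3 * G.d₂ G.a * G.b * G.leadU + G.b ^ 2 * G.d₂ G.b * G.leadV + 2 * G.b * G.d₁ G.b * G.leadV - 5 * G.a * G.d₂ G.a * G.b * G.leadU - 5 * G.a * G.d₂ G.a * G.leadU - G.d₁ G.a * G.b * G.leadU - G.d₁ G.a * G.leadU - 2 * G.b * G.d₂ G.b * G.leadV - G.d₁ G.b * G.leadV)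

/-- The coefficient of `w₂₂` in `v₂₂₂` on solutions. -/
def leadV₃ : S :=
  G.i1b * G.ib * G.iab * (2 * G.a * G.d₂ G.a * G.leadU + 5 * G.a * G.b * G.d₂ G.b * G.leadV + G.a * G.d₁ G.b * G.leadV + G.d₁ G.a * G.leadU + 5 * G.b * G.d₂ G.b * G.leadV + G.d₁ G.b * G.leadV - G.a ^ 2 * G.d₂ G.a * G.leadU - 2 * G.a * G.d₁ G.a * G.leadU - 3 * G.a * G.d₂ G.b * G.leadV - 6 * G.b ^ 2 * G.d₂ G.b * G.leadV - 3 * G.b * G.d₁ G.b * G.leadV)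

/-- The coefficient of `w₂₂` in `w₂₂₂` on solutions. -/
def leadW₃ : S :=
  -G.leadU₃ * G.a - G.leadV₃ * G.b - 3 * G.d₂ G.a * G.leadU - 3 * G.d₂ G.b * G.leadV


/-- `Δ₁ = d₁ - d₂`. -/
def Δ₁ (f : S) : S := G.d₁ f - G.d₂ f

/-- `Δ₂ = d₁ - d₂ ∘ a`. -/
def Δ₂ (f : S) : S := G.d₁ f - G.d₂ (G.a * f)

/-- `Δ₃ = d₁ - d₂ ∘ b`. -/
def Δ₃ (f : S) : S := G.d₁ f - G.d₂ (G.b * f)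

/-- The part of the obstruction that contains `w`. -/
def obstructionW (w : S) : S :=
  G.Δ₁ (G.Δ₂ (G.Δ₃ (G.d₁ w))) - G.d₁ (G.Δ₂ (G.Δ₃ (G.Δ₁ w)))

/-- The part of the obstruction that contains `u`. -/
def obstructionU (u : S) : S :=
  G.Δ₁ (G.Δ₂ (G.Δ₃ (G.d₁ u))) - G.Δ₁ (G.d₁ (G.Δ₃ (G.Δ₂ u)))

/-- The part of the obstruction that contains `v`. -/
def obstructionV (v : S) : S :=
  G.Δ₁ (G.Δ₂ (G.Δ₃ (G.d₁ v))) - G.Δ₁ (G.Δ₂ (G.d₁ (G.Δ₃ v)))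

/-- The normal forms are found order by order, each from earlier ones and a combination of the
prolonged equations. The obligations recur in every proof: an identity of differential polynomials,
in which `G.comm` moves `d₂` to the outside of `d₁`; the vanishing of the combination under `φ`; the
invertibility of the coefficient where one divides; and the resulting coefficient of `w₂₂`. -/
lemma canonical_w_1 : G.Canonical (fun w u v => G.d₁ w)
    (0) := by
  refine (((G.canonical_w_2.smul (1))).congr
    (fun w u v => G.d₁ w)
    (fun w u v => (G.eqW w)) ?_ ?_).cast ?_
  · intro w u v hw hu hv
    simp only [eqW, eqU, eqV, eqP, Derivation.leibniz, map_add, map_sub, smul_eq_mul, G.comm, G.e_d₁, G.e_d₂, G.e_a, G.e_b,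
      G.e_K, map_zero, hw, hu, hv]
    ring
  · intro w u v T _ φ h
    simp [h.onW.z, h.onW.z₁, h.onW.z₂, h.onW.z₁₁, h.onW.z₁₂, h.onW.z₂₂, h.onU.z, h.onU.z₁, h.onU.z₂, h.onU.z₁₁, h.onU.z₁₂,
      h.onU.z₂₂, h.onV.z, h.onV.z₁, h.onV.z₂, h.onV.z₁₁, h.onV.z₁₂, h.onV.z₂₂, h.onP.z, h.onP.z₁, h.onP.z₂, h.onP.z₁₁,
      h.onP.z₁₂, h.onP.z₂₂]
  · ring

lemma canonical_u_2 : G.Canonical (fun w u v => G.d₂ u)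
    (0) := by
  refine (((((((G.canonical_v_2.smul (-G.b)).add
      (G.canonical_w_2.smul (-1))).add
      (G.canonical_u.smul (-G.d₂ G.a))).add
      (G.canonical_v.smul (-G.d₂ G.b)))).congr
    (fun w u v => G.a * G.d₂ u)
    (fun w u v => (G.eqP w u v)) ?_ ?_).divide (G.ia) ?_).cast ?_
  · intro w u v hw hu hv
    simp only [eqW, eqU, eqV, eqP, Derivation.leibniz, map_add, map_sub, smul_eq_mul, G.comm, G.e_d₁, G.e_d₂, G.e_a, G.e_b,
      G.e_K, map_zero, hw, hu, hv]
    ring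
  · intro w u v T _ φ h
    simp [h.onW.z, h.onW.z₁, h.onW.z₂, h.onW.z₁₁, h.onW.z₁₂, h.onW.z₂₂, h.onU.z, h.onU.z₁, h.onU.z₂, h.onU.z₁₁, h.onU.z₁₂,
      h.onU.z₂₂, h.onV.z, h.onV.z₁, h.onV.z₂, h.onV.z₁₁, h.onV.z₁₂, h.onV.z₂₂, h.onP.z, h.onP.z₁, h.onP.z₂, h.onP.z₁₁,
      h.onP.z₁₂, h.onP.z₂₂]
  · linear_combination G.a_mul_ia
  · ring

lemma canonical_u_1 : G.Canonical (fun w u v => G.d₁ u)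
    (0) := by
  refine ((((G.canonical_u_2.smul (G.a)).add
      (G.canonical_u.smul (G.d₂ G.a)))).congr
    (fun w u v => G.d₁ u)
    (fun w u v => (G.eqU u)) ?_ ?_).cast ?_
  · intro w u v hw hu hv
    simp only [eqW, eqU, eqV, eqP, Derivation.leibniz, map_add, map_sub, smul_eq_mul, G.comm, G.e_d₁, G.e_d₂, G.e_a, G.e_b,
      G.e_K, map_zero, hw, hu, hv]
    ring
  · intro w u v T _ φ h
    simp [h.onW.z, h.onW.z₁, h.onW.z₂, h.onW.z₁₁, h.onW.z₁₂, h.onW.z₂₂, h.onU.z, h.onU.z₁, h.onU.z₂, h.onU.z₁₁, h.onU.z₁₂,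
      h.onU.z₂₂, h.onV.z, h.onV.z₁, h.onV.z₂, h.onV.z₁₁, h.onV.z₁₂, h.onV.z₂₂, h.onP.z, h.onP.z₁, h.onP.z₂, h.onP.z₁₁,
      h.onP.z₁₂, h.onP.z₂₂]
  · ring

lemma canonical_v_1 : G.Canonical (fun w u v => G.d₁ v)
    (0) := by
  refine ((((G.canonical_v_2.smul (G.b)).add
      (G.canonical_v.smul (G.d₂ G.b)))).congr
    (fun w u v => G.d₁ v)
    (fun w u v => (G.eqV v)) ?_ ?_).cast ?_
  · intro w u v hw hu hv
    simp only [eqW, eqU, eqV, eqP, Derivation.leibniz, map_add, map_sub, smul_eq_mul, G.comm, G.e_d₁, G.e_d₂, G.e_a, G.e_b,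
      G.e_K, map_zero, hw, hu, hv]
    ring
  · intro w u v T _ φ h
    simp [h.onW.z, h.onW.z₁, h.onW.z₂, h.onW.z₁₁, h.onW.z₁₂, h.onW.z₂₂, h.onU.z, h.onU.z₁, h.onU.z₂, h.onU.z₁₁, h.onU.z₁₂,
      h.onU.z₂₂, h.onV.z, h.onV.z₁, h.onV.z₂, h.onV.z₁₁, h.onV.z₁₂, h.onV.z₂₂, h.onP.z, h.onP.z₁, h.onP.z₂, h.onP.z₁₁,
      h.onP.z₁₂, h.onP.z₂₂]
  · ring

/-- To top order `d₂ P` is `w₂₂ + a u₂₂ + b v₂₂` and `d₁ P` is `w₂₂ + a² u₂₂ + b² v₂₂`. The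
combination `d₁ P - b d₂ P` removes `v₂₂` and leaves `a (a - b) u₂₂ = -(1 - b) w₂₂` up to lower
order, whence `leadU`. For `v₂₂` the multiplier `a` takes the place of `b`. -/
lemma canonical_u_22 : G.Canonical (fun w u v => G.d₂ (G.d₂ u))
    (G.leadU) := by
  refine (((((((((((G.canonical_w_22.smul (G.b - 1)).add
      (G.canonical_u_2.smul (2 * G.d₂ G.a * G.b - 2 * G.a * G.d₂ G.a - G.d₁ G.a))).add
      (G.canonical_u_1.smul (-G.d₂ G.a))).add
      (G.canonical_v_2.smul (-G.d₁ G.b))).add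
      (G.canonical_v_1.smul (-G.d₂ G.b))).add
      (G.canonical_u.smul (G.K * G.a + G.d₂ (G.d₂ G.a) * G.b - G.a * G.d₂ (G.d₂ G.a) - G.d₂ (G.d₁ G.a)))).add
      (G.canonical_v.smul (G.K * G.b - G.d₂ (G.d₁ G.b)))).add
      (G.canonical_w.smul (G.K)))).congr
    (fun w u v => (G.a * G.a - G.a * G.b) * G.d₂ (G.d₂ u))
    (fun w u v => (G.d₁ (G.eqP w u v)) + (-G.b) * (G.d₂ (G.eqP w u v)) + (-1) * (G.d₂ (G.eqW w)) + (-G.a) * (G.d₂ (G.eqU u)) + (-G.b) * (G.d₂ (G.eqV v))) ?_ ?_).divide (G.ia * G.iab) ?_).cast ?_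
  · intro w u v hw hu hv
    simp only [eqW, eqU, eqV, eqP, Derivation.leibniz, map_add, map_sub, smul_eq_mul, G.comm, G.e_d₁, G.e_d₂, G.e_a, G.e_b,
      G.e_K, map_zero, hw, hu, hv]
    ring
  · intro w u v T _ φ h
    simp [h.onW.z, h.onW.z₁, h.onW.z₂, h.onW.z₁₁, h.onW.z₁₂, h.onW.z₂₂, h.onU.z, h.onU.z₁, h.onU.z₂, h.onU.z₁₁, h.onU.z₁₂,
      h.onU.z₂₂, h.onV.z, h.onV.z₁, h.onV.z₂, h.onV.z₁₁, h.onV.z₁₂, h.onV.z₂₂, h.onP.z, h.onP.z₁, h.onP.z₂, h.onP.z₁₁,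
      h.onP.z₁₂, h.onP.z₂₂]
  · linear_combination G.a_mul_ia * G.iab * (G.a - G.b) + G.sub_mul_iab
  · simp only [leadU]
    ring

lemma canonical_v_22 : G.Canonical (fun w u v => G.d₂ (G.d₂ v))
    (G.leadV) := by
  refine (((((((((((G.canonical_w_22.smul (1 - G.a)).add
      (G.canonical_u_2.smul (G.d₁ G.a))).add
      (G.canonical_u_1.smul (G.d₂ G.a))).add
      (G.canonical_v_2.smul (2 * G.b * G.d₂ G.b + G.d₁ G.b - 2 * G.a * G.d₂ G.b))).add
      (G.canonical_v_1.smul (G.d₂ G.b))).add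
      (G.canonical_u.smul (G.d₂ (G.d₁ G.a) - G.K * G.a))).add
      (G.canonical_v.smul (G.b * G.d₂ (G.d₂ G.b) + G.d₂ (G.d₁ G.b) - G.K * G.b - G.a * G.d₂ (G.d₂ G.b)))).add
      (G.canonical_w.smul (-G.K)))).congr
    (fun w u v => (G.a * G.b - G.b * G.b) * G.d₂ (G.d₂ v))
    (fun w u v => (-1) * (G.d₁ (G.eqP w u v)) + (G.a) * (G.d₂ (G.eqP w u v)) + (G.d₂ (G.eqW w)) + (G.a) * (G.d₂ (G.eqU u)) + (G.b) * (G.d₂ (G.eqV v))) ?_ ?_).divide (G.ib * G.iab) ?_).cast ?_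
  · intro w u v hw hu hv
    simp only [eqW, eqU, eqV, eqP, Derivation.leibniz, map_add, map_sub, smul_eq_mul, G.comm, G.e_d₁, G.e_d₂, G.e_a, G.e_b,
      G.e_K, map_zero, hw, hu, hv]
    ring
  · intro w u v T _ φ h
    simp [h.onW.z, h.onW.z₁, h.onW.z₂, h.onW.z₁₁, h.onW.z₁₂, h.onW.z₂₂, h.onU.z, h.onU.z₁, h.onU.z₂, h.onU.z₁₁, h.onU.z₁₂,
      h.onU.z₂₂, h.onV.z, h.onV.z₁, h.onV.z₂, h.onV.z₁₁, h.onV.z₁₂, h.onV.z₂₂, h.onP.z, h.onP.z₁, h.onP.z₂, h.onP.z₁₁,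
      h.onP.z₁₂, h.onP.z₂₂]
  · linear_combination G.b_mul_ib * G.iab * (G.a - G.b) + G.sub_mul_iab
  · simp only [leadV]
    ring

lemma canonical_w_12 : G.Canonical (fun w u v => G.d₂ (G.d₁ w))
    (1) := by
  refine (((G.canonical_w_22.smul (1))).congr
    (fun w u v => G.d₂ (G.d₁ w))
    (fun w u v => (G.d₂ (G.eqW w))) ?_ ?_).cast ?_
  · intro w u v hw hu hv
    simp only [eqW, eqU, eqV, eqP, Derivation.leibniz, map_add, map_sub, smul_eq_mul, G.comm, G.e_d₁, G.e_d₂, G.e_a, G.e_b,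
      G.e_K, map_zero, hw, hu, hv]
    ring
  · intro w u v T _ φ h
    simp [h.onW.z, h.onW.z₁, h.onW.z₂, h.onW.z₁₁, h.onW.z₁₂, h.onW.z₂₂, h.onU.z, h.onU.z₁, h.onU.z₂, h.onU.z₁₁, h.onU.z₁₂,
      h.onU.z₂₂, h.onV.z, h.onV.z₁, h.onV.z₂, h.onV.z₁₁, h.onV.z₁₂, h.onV.z₂₂, h.onP.z, h.onP.z₁, h.onP.z₂, h.onP.z₁₁,
      h.onP.z₁₂, h.onP.z₂₂]
  · ring

lemma canonical_w_11 : G.Canonical (fun w u v => G.d₁ (G.d₁ w))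
    (1) := by
  refine ((((G.canonical_w_12.smul (1)).add
      (G.canonical_w.smul (-G.K)))).congr
    (fun w u v => G.d₁ (G.d₁ w))
    (fun w u v => (G.d₁ (G.eqW w))) ?_ ?_).cast ?_
  · intro w u v hw hu hv
    simp only [eqW, eqU, eqV, eqP, Derivation.leibniz, map_add, map_sub, smul_eq_mul, G.comm, G.e_d₁, G.e_d₂, G.e_a, G.e_b,
      G.e_K, map_zero, hw, hu, hv]
    ring
  · intro w u v T _ φ h
    simp [h.onW.z, h.onW.z₁, h.onW.z₂, h.onW.z₁₁, h.onW.z₁₂, h.onW.z₂₂, h.onU.z, h.onU.z₁, h.onU.z₂, h.onU.z₁₁, h.onU.z₁₂,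
      h.onU.z₂₂, h.onV.z, h.onV.z₁, h.onV.z₂, h.onV.z₁₁, h.onV.z₁₂, h.onV.z₂₂, h.onP.z, h.onP.z₁, h.onP.z₂, h.onP.z₁₁,
      h.onP.z₁₂, h.onP.z₂₂]
  · ring

lemma canonical_u_12 : G.Canonical (fun w u v => G.d₂ (G.d₁ u))
    (G.a * G.leadU) := by
  refine (((((G.canonical_u_22.smul (G.a)).add
      (G.canonical_u_2.smul (2 * G.d₂ G.a))).add
      (G.canonical_u.smul (G.d₂ (G.d₂ G.a))))).congr
    (fun w u v => G.d₂ (G.d₁ u))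
    (fun w u v => (G.d₂ (G.eqU u))) ?_ ?_).cast ?_
  · intro w u v hw hu hv
    simp only [eqW, eqU, eqV, eqP, Derivation.leibniz, map_add, map_sub, smul_eq_mul, G.comm, G.e_d₁, G.e_d₂, G.e_a, G.e_b,
      G.e_K, map_zero, hw, hu, hv]
    ring
  · intro w u v T _ φ h
    simp [h.onW.z, h.onW.z₁, h.onW.z₂, h.onW.z₁₁, h.onW.z₁₂, h.onW.z₂₂, h.onU.z, h.onU.z₁, h.onU.z₂, h.onU.z₁₁, h.onU.z₁₂,
      h.onU.z₂₂, h.onV.z, h.onV.z₁, h.onV.z₂, h.onV.z₁₁, h.onV.z₁₂, h.onV.z₂₂, h.onP.z, h.onP.z₁, h.onP.z₂, h.onP.z₁₁,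
      h.onP.z₁₂, h.onP.z₂₂]
  · ring

lemma canonical_u_11 : G.Canonical (fun w u v => G.d₁ (G.d₁ u))
    (G.a ^ 2 * G.leadU) := by
  refine ((((((G.canonical_u_12.smul (G.a)).add
      (G.canonical_u_2.smul (G.d₁ G.a))).add
      (G.canonical_u_1.smul (G.d₂ G.a))).add
      (G.canonical_u.smul (G.d₂ (G.d₁ G.a) - G.K * G.a)))).congr
    (fun w u v => G.d₁ (G.d₁ u))
    (fun w u v => (G.d₁ (G.eqU u))) ?_ ?_).cast ?_
  · intro w u v hw hu hv
    simp only [eqW, eqU, eqV, eqP, Derivation.leibniz, map_add, map_sub, smul_eq_mul, G.comm, G.e_d₁, G.e_d₂, G.e_a, G.e_b,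
      G.e_K, map_zero, hw, hu, hv]
    ring
  · intro w u v T _ φ h
    simp [h.onW.z, h.onW.z₁, h.onW.z₂, h.onW.z₁₁, h.onW.z₁₂, h.onW.z₂₂, h.onU.z, h.onU.z₁, h.onU.z₂, h.onU.z₁₁, h.onU.z₁₂,
      h.onU.z₂₂, h.onV.z, h.onV.z₁, h.onV.z₂, h.onV.z₁₁, h.onV.z₁₂, h.onV.z₂₂, h.onP.z, h.onP.z₁, h.onP.z₂, h.onP.z₁₁,
      h.onP.z₁₂, h.onP.z₂₂]
  · ring

lemma canonical_v_12 : G.Canonical (fun w u v => G.d₂ (G.d₁ v))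
    (G.b * G.leadV) := by
  refine (((((G.canonical_v_22.smul (G.b)).add
      (G.canonical_v_2.smul (2 * G.d₂ G.b))).add
      (G.canonical_v.smul (G.d₂ (G.d₂ G.b))))).congr
    (fun w u v => G.d₂ (G.d₁ v))
    (fun w u v => (G.d₂ (G.eqV v))) ?_ ?_).cast ?_
  · intro w u v hw hu hv
    simp only [eqW, eqU, eqV, eqP, Derivation.leibniz, map_add, map_sub, smul_eq_mul, G.comm, G.e_d₁, G.e_d₂, G.e_a, G.e_b,
      G.e_K, map_zero, hw, hu, hv]
    ring
  · intro w u v T _ φ h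
    simp [h.onW.z, h.onW.z₁, h.onW.z₂, h.onW.z₁₁, h.onW.z₁₂, h.onW.z₂₂, h.onU.z, h.onU.z₁, h.onU.z₂, h.onU.z₁₁, h.onU.z₁₂,
      h.onU.z₂₂, h.onV.z, h.onV.z₁, h.onV.z₂, h.onV.z₁₁, h.onV.z₁₂, h.onV.z₂₂, h.onP.z, h.onP.z₁, h.onP.z₂, h.onP.z₁₁,
      h.onP.z₁₂, h.onP.z₂₂]
  · ring

lemma canonical_v_11 : G.Canonical (fun w u v => G.d₁ (G.d₁ v))
    (G.b ^ 2 * G.leadV) := by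
  refine ((((((G.canonical_v_12.smul (G.b)).add
      (G.canonical_v_2.smul (G.d₁ G.b))).add
      (G.canonical_v_1.smul (G.d₂ G.b))).add
      (G.canonical_v.smul (G.d₂ (G.d₁ G.b) - G.K * G.b)))).congr
    (fun w u v => G.d₁ (G.d₁ v))
    (fun w u v => (G.d₁ (G.eqV v))) ?_ ?_).cast ?_
  · intro w u v hw hu hv
    simp only [eqW, eqU, eqV, eqP, Derivation.leibniz, map_add, map_sub, smul_eq_mul, G.comm, G.e_d₁, G.e_d₂, G.e_a, G.e_b,
      G.e_K, map_zero, hw, hu, hv]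
    ring
  · intro w u v T _ φ h
    simp [h.onW.z, h.onW.z₁, h.onW.z₂, h.onW.z₁₁, h.onW.z₁₂, h.onW.z₂₂, h.onU.z, h.onU.z₁, h.onU.z₂, h.onU.z₁₁, h.onU.z₁₂,
      h.onU.z₂₂, h.onV.z, h.onV.z₁, h.onV.z₂, h.onV.z₁₁, h.onV.z₁₂, h.onV.z₂₂, h.onP.z, h.onP.z₁, h.onP.z₂, h.onP.z₁₁,
      h.onP.z₁₂, h.onP.z₂₂]
  · ring

/-- The second derivatives of `P` have top terms `w₂₂₂ + aᵏ u₂₂₂ + bᵏ v₂₂₂` with `k = 1, 2, 3`. The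
multipliers `-1`, `1 + b`, `-b` are the coefficients of `-(x - 1) (x - b)`. This quadratic kills the
contributions of `w` and `v` and leaves `a (1 - a) (a - b) u₂₂₂`. So no free parameter appears at
order three. -/
lemma canonical_u_222 : G.Canonical (fun w u v => G.d₂ (G.d₂ (G.d₂ u)))
    (G.leadU₃) := by
  refine ((((((((((((((((((G.canonical_u_22.smul (3 * G.a ^ 2 * G.d₂ G.a + G.a * G.d₁ G.a + 3 * G.d₂ G.a * G.b - 3 * G.a * G.d₂ G.a - 3 * G.a * G.d₂ G.a * G.b - G.d₁ G.a - G.d₁ G.a * G.b)).add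
      (G.canonical_u_12.smul (2 * G.a * G.d₂ G.a + 2 * G.d₁ G.a - 2 * G.d₂ G.a - 2 * G.d₂ G.a * G.b))).add
      (G.canonical_u_11.smul (G.d₂ G.a))).add
      (G.canonical_v_22.smul (-G.d₁ G.b))).add
      (G.canonical_v_12.smul (2 * G.d₁ G.b - 2 * G.d₂ G.b))).add
      (G.canonical_v_11.smul (G.d₂ G.b))).add
      (G.canonical_u_2.smul (G.K * G.a + G.K * G.a * G.b + 3 * G.a ^ 2 * G.d₂ (G.d₂ G.a) + 2 * G.a * G.d₂ (G.d₁ G.a) + 3 * G.d₂ (G.d₂ G.a) * G.b + G.d₁ (G.d₁ G.a) - G.K * G.a ^ 2 - 3 * G.a * G.d₂ (G.d₂ G.a) - 3 * G.a * G.d₂ (G.d₂ G.a) * G.b - 2 * G.d₂ (G.d₁ G.a) - 2 * G.d₂ (G.d₁ G.a) * G.b))).add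
      (G.canonical_u_1.smul (G.a * G.d₂ (G.d₂ G.a) + 2 * G.d₂ (G.d₁ G.a) - 3 * G.K * G.a - G.d₂ (G.d₂ G.a) - G.d₂ (G.d₂ G.a) * G.b))).add
      (G.canonical_v_2.smul (G.K * G.b + G.d₁ (G.d₁ G.b) - 2 * G.d₂ (G.d₁ G.b)))).add
      (G.canonical_v_1.smul (2 * G.d₂ (G.d₁ G.b) - 3 * G.K * G.b - G.d₂ (G.d₂ G.b)))).add
      (G.canonical_w_2.smul (G.K * G.b))).add
      (G.canonical_w_1.smul (-3 * G.K))).add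
      (G.canonical_u.smul (G.K * G.d₂ G.a + G.K * G.d₂ G.a * G.b + G.d₂ G.K * G.a + G.d₂ G.K * G.a * G.b + G.a ^ 2 * G.d₂ (G.d₂ (G.d₂ G.a)) + G.a * G.d₂ (G.d₂ (G.d₁ G.a)) + G.d₂ (G.d₂ (G.d₂ G.a)) * G.b + G.d₂ (G.d₁ (G.d₁ G.a)) - G.K * G.a * G.d₂ G.a - 3 * G.K * G.d₁ G.a - G.d₂ G.K * G.a ^ 2 - G.d₁ G.K * G.a - G.a * G.d₂ (G.d₂ (G.d₂ G.a)) - G.a * G.d₂ (G.d₂ (G.d₂ G.a)) * G.b - G.d₂ (G.d₂ (G.d₁ G.a)) - G.d₂ (G.d₂ (G.d₁ G.a)) * G.b))).add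
      (G.canonical_v.smul (G.K * G.d₂ G.b + G.d₂ G.K * G.b + G.d₂ (G.d₁ (G.d₁ G.b)) - 3 * G.K * G.d₁ G.b - G.d₁ G.K * G.b - G.d₂ (G.d₂ (G.d₁ G.b))))).add
      (G.canonical_w.smul (G.d₂ G.K * G.b - G.d₁ G.K)))).congr
    (fun w u v => ((1 - G.a) * G.a * (G.a - G.b)) * G.d₂ (G.d₂ (G.d₂ u)))
    (fun w u v => (-1) * (G.d₁ (G.d₁ (G.eqP w u v))) + (1 + G.b) * (G.d₂ (G.d₁ (G.eqP w u v))) + (-G.b) * (G.d₂ (G.d₂ (G.eqP w u v))) + (G.d₂ (G.d₁ (G.eqW w))) + (G.a) * (G.d₂ (G.d₁ (G.eqU u))) + (G.b) * (G.d₂ (G.d₁ (G.eqV v))) + (-G.b) * (G.d₂ (G.d₂ (G.eqW w))) + (G.a ^ 2 - G.a - G.a * G.b) * (G.d₂ (G.d₂ (G.eqU u))) + (-G.b) * (G.d₂ (G.d₂ (G.eqV v)))) ?_ ?_).divide (G.i1a * G.ia * G.iab) ?_).cast ?_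
  · intro w u v hw hu hv
    simp only [eqW, eqU, eqV, eqP, Derivation.leibniz, map_add, map_sub, smul_eq_mul, G.comm, G.e_d₁, G.e_d₂, G.e_a, G.e_b,
      G.e_K, map_zero, hw, hu, hv]
    ring
  · intro w u v T _ φ h
    simp [h.onW.z, h.onW.z₁, h.onW.z₂, h.onW.z₁₁, h.onW.z₁₂, h.onW.z₂₂, h.onU.z, h.onU.z₁, h.onU.z₂, h.onU.z₁₁, h.onU.z₁₂,
      h.onU.z₂₂, h.onV.z, h.onV.z₁, h.onV.z₂, h.onV.z₁₁, h.onV.z₁₂, h.onV.z₂₂, h.onP.z, h.onP.z₁, h.onP.z₂, h.onP.z₁₁,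
      h.onP.z₁₂, h.onP.z₂₂]
  · linear_combination (G.a_mul_ia * G.iab * (G.a - G.b) + G.sub_mul_iab) * G.i1a * (1 - G.a) + G.one_sub_a_mul
  · simp only [leadU₃]
    ring

/-- The multipliers of the second derivatives of `P` are here the coefficients of `(x - 1) (x - a)`,
which vanishes at `1` and `a` and equals `(1 - b) (a - b)` at `b`. -/
lemma canonical_v_222 : G.Canonical (fun w u v => G.d₂ (G.d₂ (G.d₂ v)))
    (G.leadV₃) := by
  refine ((((((((((((((((((G.canonical_u_22.smul (G.d₁ G.a)).add
      (G.canonical_u_12.smul (2 * G.d₂ G.a - 2 * G.d₁ G.a))).add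
      (G.canonical_u_11.smul (-G.d₂ G.a))).add
      (G.canonical_v_22.smul (3 * G.a * G.b * G.d₂ G.b + G.a * G.d₁ G.b + 3 * G.b * G.d₂ G.b + G.d₁ G.b - 3 * G.a * G.d₂ G.b - 3 * G.b ^ 2 * G.d₂ G.b - G.b * G.d₁ G.b))).add
      (G.canonical_v_12.smul (2 * G.a * G.d₂ G.b + 2 * G.d₂ G.b - 2 * G.b * G.d₂ G.b - 2 * G.d₁ G.b))).add
      (G.canonical_v_11.smul (-G.d₂ G.b))).add
      (G.canonical_u_2.smul (2 * G.d₂ (G.d₁ G.a) - G.K * G.a - G.d₁ (G.d₁ G.a)))).add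
      (G.canonical_u_1.smul (3 * G.K * G.a + G.d₂ (G.d₂ G.a) - 2 * G.d₂ (G.d₁ G.a)))).add
      (G.canonical_v_2.smul (G.K * G.b ^ 2 + 3 * G.a * G.b * G.d₂ (G.d₂ G.b) + 2 * G.a * G.d₂ (G.d₁ G.b) + 3 * G.b * G.d₂ (G.d₂ G.b) + 2 * G.d₂ (G.d₁ G.b) - G.K * G.a * G.b - G.K * G.b - 3 * G.a * G.d₂ (G.d₂ G.b) - 3 * G.b ^ 2 * G.d₂ (G.d₂ G.b) - 2 * G.b * G.d₂ (G.d₁ G.b) - G.d₁ (G.d₁ G.b)))).add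
      (G.canonical_v_1.smul (3 * G.K * G.b + G.a * G.d₂ (G.d₂ G.b) + G.d₂ (G.d₂ G.b) - G.b * G.d₂ (G.d₂ G.b) - 2 * G.d₂ (G.d₁ G.b)))).add
      (G.canonical_w_2.smul (-G.K * G.a))).add
      (G.canonical_w_1.smul (3 * G.K))).add
      (G.canonical_u.smul (3 * G.K * G.d₁ G.a + G.d₁ G.K * G.a + G.d₂ (G.d₂ (G.d₁ G.a)) - G.K * G.d₂ G.a - G.d₂ G.K * G.a - G.d₂ (G.d₁ (G.d₁ G.a))))).add
      (G.canonical_v.smul (G.K * G.b * G.d₂ G.b + 3 * G.K * G.d₁ G.b + G.d₂ G.K * G.b ^ 2 + G.d₁ G.K * G.b + G.a * G.b * G.d₂ (G.d₂ (G.d₂ G.b)) + G.a * G.d₂ (G.d₂ (G.d₁ G.b)) + G.b * G.d₂ (G.d₂ (G.d₂ G.b)) + G.d₂ (G.d₂ (G.d₁ G.b)) - G.K * G.a * G.d₂ G.b - G.K * G.d₂ G.b - G.d₂ G.K * G.a * G.b - G.d₂ G.K * G.b - G.a * G.d₂ (G.d₂ (G.d₂ G.b)) - G.b ^ 2 * G.d₂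 (G.d₂ (G.d₂ G.b)) - G.b * G.d₂ (G.d₂ (G.d₁ G.b)) - G.d₂ (G.d₁ (G.d₁ G.b))))).add
      (G.canonical_w.smul (G.d₁ G.K - G.d₂ G.K * G.a)))).congr
    (fun w u v => ((1 - G.b) * G.b * (G.a - G.b)) * G.d₂ (G.d₂ (G.d₂ v)))
    (fun w u v => (G.d₁ (G.d₁ (G.eqP w u v))) + (-1 - G.a) * (G.d₂ (G.d₁ (G.eqP w u v))) + (G.a) * (G.d₂ (G.d₂ (G.eqP w u v))) + (-1) * (G.d₂ (G.d₁ (G.eqW w))) + (-G.a) * (G.d₂ (G.d₁ (G.eqU u))) + (-G.b) * (G.d₂ (G.d₁ (G.eqV v))) + (G.a) * (G.d₂ (G.d₂ (G.eqW w))) + (G.a) * (G.d₂ (G.d₂ (G.eqU u))) + (G.a * G.b + G.b - G.b ^ 2) * (G.d₂ (G.d₂ (G.eqV v)))) ?_ ?_).divide (G.i1b * G.ib * G.iab) ?_).cast ?_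
  · intro w u v hw hu hv
    simp only [eqW, eqU, eqV, eqP, Derivation.leibniz, map_add, map_sub, smul_eq_mul, G.comm, G.e_d₁, G.e_d₂, G.e_a, G.e_b,
      G.e_K, map_zero, hw, hu, hv]
    ring
  · intro w u v T _ φ h
    simp [h.onW.z, h.onW.z₁, h.onW.z₂, h.onW.z₁₁, h.onW.z₁₂, h.onW.z₂₂, h.onU.z, h.onU.z₁, h.onU.z₂, h.onU.z₁₁, h.onU.z₁₂,
      h.onU.z₂₂, h.onV.z, h.onV.z₁, h.onV.z₂, h.onV.z₁₁, h.onV.z₁₂, h.onV.z₂₂, h.onP.z, h.onP.z₁, h.onP.z₂, h.onP.z₁₁,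
      h.onP.z₁₂, h.onP.z₂₂]
  · linear_combination (G.b_mul_ib * G.iab * (G.a - G.b) + G.sub_mul_iab) * G.i1b * (1 - G.b) + G.one_sub_b_mul
  · simp only [leadV₃]
    ring

lemma canonical_w_222 : G.Canonical (fun w u v => G.d₂ (G.d₂ (G.d₂ w)))
    (G.leadW₃) := by
  refine ((((((((((G.canonical_u_222.smul (-G.a)).add
      (G.canonical_v_222.smul (-G.b))).add
      (G.canonical_u_22.smul (-3 * G.d₂ G.a))).add
      (G.canonical_v_22.smul (-3 * G.d₂ G.b))).add
      (G.canonical_u_2.smul (-3 * G.d₂ (G.d₂ G.a)))).add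
      (G.canonical_v_2.smul (-3 * G.d₂ (G.d₂ G.b)))).add
      (G.canonical_u.smul (-G.d₂ (G.d₂ (G.d₂ G.a))))).add
      (G.canonical_v.smul (-G.d₂ (G.d₂ (G.d₂ G.b)))))).congr
    (fun w u v => G.d₂ (G.d₂ (G.d₂ w)))
    (fun w u v => (G.d₂ (G.d₂ (G.eqP w u v)))) ?_ ?_).cast ?_
  · intro w u v hw hu hv
    simp only [eqW, eqU, eqV, eqP, Derivation.leibniz, map_add, map_sub, smul_eq_mul, G.comm, G.e_d₁, G.e_d₂, G.e_a, G.e_b,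
      G.e_K, map_zero, hw, hu, hv]
    ring
  · intro w u v T _ φ h
    simp [h.onW.z, h.onW.z₁, h.onW.z₂, h.onW.z₁₁, h.onW.z₁₂, h.onW.z₂₂, h.onU.z, h.onU.z₁, h.onU.z₂, h.onU.z₁₁, h.onU.z₁₂,
      h.onU.z₂₂, h.onV.z, h.onV.z₁, h.onV.z₂, h.onV.z₁₁, h.onV.z₁₂, h.onV.z₂₂, h.onP.z, h.onP.z₁, h.onP.z₂, h.onP.z₁₁,
      h.onP.z₁₂, h.onP.z₂₂]
  · simp only [leadW₃]
    ring

lemma canonical_w_122 : G.Canonical (fun w u v => G.d₂ (G.d₂ (G.d₁ w)))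
    (G.leadW₃) := by
  refine (((G.canonical_w_222.smul (1))).congr
    (fun w u v => G.d₂ (G.d₂ (G.d₁ w)))
    (fun w u v => (G.d₂ (G.d₂ (G.eqW w)))) ?_ ?_).cast ?_
  · intro w u v hw hu hv
    simp only [eqW, eqU, eqV, eqP, Derivation.leibniz, map_add, map_sub, smul_eq_mul, G.comm, G.e_d₁, G.e_d₂, G.e_a, G.e_b,
      G.e_K, map_zero, hw, hu, hv]
    ring
  · intro w u v T _ φ h
    simp [h.onW.z, h.onW.z₁, h.onW.z₂, h.onW.z₁₁, h.onW.z₁₂, h.onW.z₂₂, h.onU.z, h.onU.z₁, h.onU.z₂, h.onU.z₁₁, h.onU.z₁₂,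
      h.onU.z₂₂, h.onV.z, h.onV.z₁, h.onV.z₂, h.onV.z₁₁, h.onV.z₁₂, h.onV.z₂₂, h.onP.z, h.onP.z₁, h.onP.z₂, h.onP.z₁₁,
      h.onP.z₁₂, h.onP.z₂₂]
  · simp only [leadW₃]
    ring

lemma canonical_w_112 : G.Canonical (fun w u v => G.d₂ (G.d₁ (G.d₁ w)))
    (G.leadW₃) := by
  refine (((((G.canonical_w_122.smul (1)).add
      (G.canonical_w_2.smul (-G.K))).add
      (G.canonical_w.smul (-G.d₂ G.K)))).congr
    (fun w u v => G.d₂ (G.d₁ (G.d₁ w)))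
    (fun w u v => (G.d₂ (G.d₁ (G.eqW w)))) ?_ ?_).cast ?_
  · intro w u v hw hu hv
    simp only [eqW, eqU, eqV, eqP, Derivation.leibniz, map_add, map_sub, smul_eq_mul, G.comm, G.e_d₁, G.e_d₂, G.e_a, G.e_b,
      G.e_K, map_zero, hw, hu, hv]
    ring
  · intro w u v T _ φ h
    simp [h.onW.z, h.onW.z₁, h.onW.z₂, h.onW.z₁₁, h.onW.z₁₂, h.onW.z₂₂, h.onU.z, h.onU.z₁, h.onU.z₂, h.onU.z₁₁, h.onU.z₁₂,
      h.onU.z₂₂, h.onV.z, h.onV.z₁, h.onV.z₂, h.onV.z₁₁, h.onV.z₁₂, h.onV.z₂₂, h.onP.z, h.onP.z₁, h.onP.z₂, h.onP.z₁₁,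
      h.onP.z₁₂, h.onP.z₂₂]
  · simp only [leadW₃]
    ring

lemma canonical_u_122 : G.Canonical (fun w u v => G.d₂ (G.d₂ (G.d₁ u)))
    (G.leadU₃ * G.a + 3 * G.d₂ G.a * G.leadU) := by
  refine ((((((G.canonical_u_222.smul (G.a)).add
      (G.canonical_u_22.smul (3 * G.d₂ G.a))).add
      (G.canonical_u_2.smul (3 * G.d₂ (G.d₂ G.a)))).add
      (G.canonical_u.smul (G.d₂ (G.d₂ (G.d₂ G.a)))))).congr
    (fun w u v => G.d₂ (G.d₂ (G.d₁ u)))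
    (fun w u v => (G.d₂ (G.d₂ (G.eqU u)))) ?_ ?_).cast ?_
  · intro w u v hw hu hv
    simp only [eqW, eqU, eqV, eqP, Derivation.leibniz, map_add, map_sub, smul_eq_mul, G.comm, G.e_d₁, G.e_d₂, G.e_a, G.e_b,
      G.e_K, map_zero, hw, hu, hv]
    ring
  · intro w u v T _ φ h
    simp [h.onW.z, h.onW.z₁, h.onW.z₂, h.onW.z₁₁, h.onW.z₁₂, h.onW.z₂₂, h.onU.z, h.onU.z₁, h.onU.z₂, h.onU.z₁₁, h.onU.z₁₂,
      h.onU.z₂₂, h.onV.z, h.onV.z₁, h.onV.z₂, h.onV.z₁₁, h.onV.z₁₂, h.onV.z₂₂, h.onP.z, h.onP.z₁, h.onP.z₂, h.onP.z₁₁,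
      h.onP.z₁₂, h.onP.z₂₂]
  · ring

lemma canonical_u_112 : G.Canonical (fun w u v => G.d₂ (G.d₁ (G.d₁ u)))
    (G.leadU₃ * G.a ^ 2 + 5 * G.a * G.d₂ G.a * G.leadU + G.d₁ G.a * G.leadU) := by
  refine ((((((((G.canonical_u_122.smul (G.a)).add
      (G.canonical_u_22.smul (G.d₁ G.a))).add
      (G.canonical_u_12.smul (2 * G.d₂ G.a))).add
      (G.canonical_u_2.smul (2 * G.d₂ (G.d₁ G.a) - G.K * G.a))).add
      (G.canonical_u_1.smul (G.d₂ (G.d₂ G.a)))).add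
      (G.canonical_u.smul (G.d₂ (G.d₂ (G.d₁ G.a)) - G.K * G.d₂ G.a - G.d₂ G.K * G.a)))).congr
    (fun w u v => G.d₂ (G.d₁ (G.d₁ u)))
    (fun w u v => (G.d₂ (G.d₁ (G.eqU u)))) ?_ ?_).cast ?_
  · intro w u v hw hu hv
    simp only [eqW, eqU, eqV, eqP, Derivation.leibniz, map_add, map_sub, smul_eq_mul, G.comm, G.e_d₁, G.e_d₂, G.e_a, G.e_b,
      G.e_K, map_zero, hw, hu, hv]
    ring
  · intro w u v T _ φ h
    simp [h.onW.z, h.onW.z₁, h.onW.z₂, h.onW.z₁₁, h.onW.z₁₂, h.onW.z₂₂, h.onU.z, h.onU.z₁, h.onU.z₂, h.onU.z₁₁, h.onU.z₁₂,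
      h.onU.z₂₂, h.onV.z, h.onV.z₁, h.onV.z₂, h.onV.z₁₁, h.onV.z₁₂, h.onV.z₂₂, h.onP.z, h.onP.z₁, h.onP.z₂, h.onP.z₁₁,
      h.onP.z₁₂, h.onP.z₂₂]
  · ring

lemma canonical_v_122 : G.Canonical (fun w u v => G.d₂ (G.d₂ (G.d₁ v)))
    (G.leadV₃ * G.b + 3 * G.d₂ G.b * G.leadV) := by
  refine ((((((G.canonical_v_222.smul (G.b)).add
      (G.canonical_v_22.smul (3 * G.d₂ G.b))).add
      (G.canonical_v_2.smul (3 * G.d₂ (G.d₂ G.b)))).add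
      (G.canonical_v.smul (G.d₂ (G.d₂ (G.d₂ G.b)))))).congr
    (fun w u v => G.d₂ (G.d₂ (G.d₁ v)))
    (fun w u v => (G.d₂ (G.d₂ (G.eqV v)))) ?_ ?_).cast ?_
  · intro w u v hw hu hv
    simp only [eqW, eqU, eqV, eqP, Derivation.leibniz, map_add, map_sub, smul_eq_mul, G.comm, G.e_d₁, G.e_d₂, G.e_a, G.e_b,
      G.e_K, map_zero, hw, hu, hv]
    ring
  · intro w u v T _ φ h
    simp [h.onW.z, h.onW.z₁, h.onW.z₂, h.onW.z₁₁, h.onW.z₁₂, h.onW.z₂₂, h.onU.z, h.onU.z₁, h.onU.z₂, h.onU.z₁₁, h.onU.z₁₂,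
      h.onU.z₂₂, h.onV.z, h.onV.z₁, h.onV.z₂, h.onV.z₁₁, h.onV.z₁₂, h.onV.z₂₂, h.onP.z, h.onP.z₁, h.onP.z₂, h.onP.z₁₁,
      h.onP.z₁₂, h.onP.z₂₂]
  · ring

lemma canonical_v_112 : G.Canonical (fun w u v => G.d₂ (G.d₁ (G.d₁ v)))
    (G.leadV₃ * G.b ^ 2 + 5 * G.b * G.d₂ G.b * G.leadV + G.d₁ G.b * G.leadV) := by
  refine ((((((((G.canonical_v_122.smul (G.b)).add
      (G.canonical_v_22.smul (G.d₁ G.b))).add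
      (G.canonical_v_12.smul (2 * G.d₂ G.b))).add
      (G.canonical_v_2.smul (2 * G.d₂ (G.d₁ G.b) - G.K * G.b))).add
      (G.canonical_v_1.smul (G.d₂ (G.d₂ G.b)))).add
      (G.canonical_v.smul (G.d₂ (G.d₂ (G.d₁ G.b)) - G.K * G.d₂ G.b - G.d₂ G.K * G.b)))).congr
    (fun w u v => G.d₂ (G.d₁ (G.d₁ v)))
    (fun w u v => (G.d₂ (G.d₁ (G.eqV v)))) ?_ ?_).cast ?_
  · intro w u v hw hu hv
    simp only [eqW, eqU, eqV, eqP, Derivation.leibniz, map_add, map_sub, smul_eq_mul, G.comm, G.e_d₁, G.e_d₂, G.e_a, G.e_b,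
      G.e_K, map_zero, hw, hu, hv]
    ring
  · intro w u v T _ φ h
    simp [h.onW.z, h.onW.z₁, h.onW.z₂, h.onW.z₁₁, h.onW.z₁₂, h.onW.z₂₂, h.onU.z, h.onU.z₁, h.onU.z₂, h.onU.z₁₁, h.onU.z₁₂,
      h.onU.z₂₂, h.onV.z, h.onV.z₁, h.onV.z₂, h.onV.z₁₁, h.onV.z₁₂, h.onV.z₂₂, h.onP.z, h.onP.z₁, h.onP.z₂, h.onP.z₁₁,
      h.onP.z₁₂, h.onP.z₂₂]
  · ring

/-- The two products of operators have the same principal symbol, so their fourth-order parts cancel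
and the difference is a combination of jets of order at most three. This holds identically, so no
multiple of the equations is needed; the normal forms already found are then inserted. The same
applies to `u` and `v`. -/
lemma canonical_obstructionW : G.Canonical (fun w u v => G.obstructionW w)
    (6 * G.K * G.a + 6 * G.K * G.b + G.leadW₃ * G.a * G.d₁ G.b + G.leadW₃ * G.d₂ G.a + G.leadW₃ * G.d₁ G.a * G.b + G.leadW₃ * G.d₂ G.b + 2 * G.a * G.d₂ (G.d₁ G.b) + G.d₂ G.a * G.d₁ G.b + G.d₂ (G.d₂ G.a) + 2 * G.d₁ G.a * G.d₂ G.b + G.d₂ (G.d₁ G.a) * G.b + G.d₂ (G.d₂ G.b) - 6 * G.K - 6 * G.K * G.a * G.b - G.leadW₃ * G.a * G.d₂ G.b - G.leadW₃ * G.d₂ G.a * G.b - G.leadW₃ * G.d₁ G.a - G.leadW₃ * G.d₁ G.b - 2 * G.a * G.d₂ (G.d₂ G.b) - 3 * G.d₂ G.a * G.d₂ G.b - G.d₂ (G.d₂ G.a) * G.b - G.d₂ (G.d₁ G.a) - G.d₁ (G.d₁ G.b)) := by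
  refine (((((((((((G.canonical_w_222.smul (G.a * G.d₁ G.b + G.d₁ G.a * G.b)).add
      (G.canonical_w_122.smul (-G.a * G.d₂ G.b - G.d₂ G.a * G.b - G.d₁ G.a - G.d₁ G.b))).add
      (G.canonical_w_112.smul (G.d₂ G.a + G.d₂ G.b))).add
      (G.canonical_w_22.smul (2 * G.a * G.d₂ (G.d₁ G.b) + G.d₂ G.a * G.d₁ G.b + 2 * G.d₁ G.a * G.d₂ G.b + G.d₂ (G.d₁ G.a) * G.b - 6 * G.K * G.a * G.b - G.d₁ (G.d₁ G.b)))).add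
      (G.canonical_w_12.smul (6 * G.K * G.a + 6 * G.K * G.b - 2 * G.a * G.d₂ (G.d₂ G.b) - 3 * G.d₂ G.a * G.d₂ G.b - G.d₂ (G.d₂ G.a) * G.b - G.d₂ (G.d₁ G.a)))).add
      (G.canonical_w_11.smul (G.d₂ (G.d₂ G.a) + G.d₂ (G.d₂ G.b) - 6 * G.K))).add
      (G.canonical_w_2.smul (G.K * G.d₁ G.a + 7 * G.K * G.d₁ G.b + G.d₁ G.K * G.a + 3 * G.d₁ G.K * G.b + G.a * G.d₂ (G.d₂ (G.d₁ G.b)) + G.d₂ G.a * G.d₂ (G.d₁ G.b) + G.d₁ G.a * G.d₂ (G.d₂ G.b) + G.d₂ (G.d₁ G.a) * G.d₂ G.b - 7 * G.K * G.a * G.d₂ G.b - 3 * G.K * G.d₂ G.a * G.b - 4 * G.d₂ G.K * G.a * G.b - G.d₂ (G.d₁ (G.d₁ G.b))))).add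
      (G.canonical_w_1.smul (3 * G.K * G.d₂ G.a + G.K * G.d₂ G.b + 3 * G.d₂ G.K * G.a + G.d₂ G.K * G.b + G.d₂ (G.d₂ (G.d₁ G.b)) - 4 * G.d₁ G.K - G.a * G.d₂ (G.d₂ (G.d₂ G.b)) - 2 * G.d₂ G.a * G.d₂ (G.d₂ G.b) - G.d₂ (G.d₂ G.a) * G.d₂ G.b))).add
      (G.canonical_w.smul (G.K * G.d₂ (G.d₁ G.a) + 2 * G.K * G.d₂ (G.d₁ G.b) + G.d₂ G.K * G.d₁ G.a + 2 * G.d₂ G.K * G.d₁ G.b + G.d₁ G.K * G.d₂ G.a + G.d₁ G.K * G.d₂ G.b + G.d₂ (G.d₁ G.K) * G.a + G.d₂ (G.d₁ G.K) * G.b - 3 * G.K ^ 2 * G.a - 5 * G.K ^ 2 * G.b - G.K * G.a * G.d₂ (G.d₂ G.b) - G.K * G.d₂ G.a * G.d₂ G.b - 2 * G.d₂ G.K * G.a * G.d₂ G.b - G.d₂ G.K * G.d₂ G.a * G.b - G.d₂ (G.d₂ G.K) * G.a * G.b - G.d₁ (G.d₁ G.K))))).congr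
    (fun w u v => G.obstructionW w) (fun _ _ _ => 0) ?_ ?_).cast ?_
  · intro w u v hw hu hv
    simp only [obstructionW, Δ₁, Δ₂, Δ₃]
    simp only [eqW, eqU, eqV, eqP, Derivation.leibniz, map_add, map_sub, smul_eq_mul, G.comm, G.e_d₁, G.e_d₂, G.e_a, G.e_b,
      G.e_K, map_zero, hw, hu, hv]
    ring
  · intro w u v T _ φ h
    simp [h.onW.z, h.onW.z₁, h.onW.z₂, h.onW.z₁₁, h.onW.z₁₂, h.onW.z₂₂, h.onU.z, h.onU.z₁, h.onU.z₂, h.onU.z₁₁, h.onU.z₁₂,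
      h.onU.z₂₂, h.onV.z, h.onV.z₁, h.onV.z₂, h.onV.z₁₁, h.onV.z₁₂, h.onV.z₂₂, h.onP.z, h.onP.z₁, h.onP.z₂, h.onP.z₁₁,
      h.onP.z₁₂, h.onP.z₂₂]
  · ring

lemma canonical_obstructionU : G.Canonical (fun w u v => G.obstructionU u)
    (3 * G.K * G.a ^ 2 * G.b * G.leadU + 3 * G.K * G.a ^ 2 * G.leadU + G.leadU₃ * G.a ^ 3 * G.d₂ G.b + 2 * G.leadU₃ * G.a ^ 2 * G.d₁ G.a + G.leadU₃ * G.a * G.d₂ G.a * G.b + G.leadU₃ * G.a * G.d₁ G.b + G.leadU₃ * G.d₁ G.a * G.b + G.a ^ 3 * G.d₂ (G.d₂ G.b) * G.leadU + 5 * G.a ^ 2 * G.d₂ G.a * G.d₂ G.b * G.leadU + 2 * G.a ^ 2 * G.d₂ (G.d₁ G.a) * G.leadU + 10 * G.a * G.d₂ G.a * G.d₁ G.a * G.leadU + 2 * G.a * G.d₂ (G.d₂ G.a) * G.b * G.leadU + G.a * G.d₁ G.a * G.d₂ G.b * G.leadU + 3 * G.a * G.d₁ (G.d₁ G.a) * G.leadU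 + 2 * G.a * G.d₂ (G.d₁ G.b) * G.leadU + 3 * (G.d₂ G.a) ^ 2 * G.b * G.leadU + 3 * G.d₂ G.a * G.d₁ G.b * G.leadU + 2 * (G.d₁ G.a) ^ 2 * G.leadU + 2 * G.d₁ G.a * G.d₂ G.b * G.leadU + 3 * G.d₂ (G.d₁ G.a) * G.b * G.leadU - 3 * G.K * G.a ^ 3 * G.leadU - 3 * G.K * G.a * G.b * G.leadU - G.leadU₃ * G.a ^ 2 * G.d₂ G.a * G.b - G.leadU₃ * G.a ^ 2 * G.d₂ G.b - G.leadU₃ * G.a ^ 2 * G.d₁ G.b - 2 * G.leadU₃ * G.a * G.d₁ G.a - G.leadU₃ * G.a * G.d₁ G.a * G.b - G.a ^ 2 * G.d₂ (G.d₂ G.a) * G.b * G.leadU - 2 * G.a ^ 2 * G.d₂ (G.d₂ G.b) * G.leadU - 5 * G.a * (G.d₂ G.a) ^ 2 * G.b * G.leadU - 3 * G.a * G.d₂ G.a * G.d₂ G.b * G.leadU - 6 * G.a * G.d₂ G.a * G.d₁ G.b * G.leadU - 3 * G.a * G.d₂ (G.d₁ G.a) * G.b * G.leadU - 4 * G.a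 * G.d₂ (G.d₁ G.a) * G.leadU - G.a * G.d₁ (G.d₁ G.b) * G.leadU - 4 * G.d₂ G.a * G.d₁ G.a * G.b * G.leadU - 6 * G.d₂ G.a * G.d₁ G.a * G.leadU - 2 * G.d₁ G.a * G.d₁ G.b * G.leadU - G.d₁ (G.d₁ G.a) * G.b * G.leadU - G.d₁ (G.d₁ G.a) * G.leadU) := by
  refine (((((((((((G.canonical_u_222.smul (G.a * G.d₁ G.b + G.d₁ G.a * G.b)).add
      (G.canonical_u_122.smul (G.d₂ G.a * G.b - G.a * G.d₂ G.b - G.a * G.d₁ G.b - 2 * G.d₁ G.a - G.d₁ G.a * G.b))).add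
      (G.canonical_u_112.smul (G.a * G.d₂ G.b + 2 * G.d₁ G.a - G.d₂ G.a * G.b))).add
      (G.canonical_u_22.smul (2 * G.a * G.d₂ (G.d₁ G.b) + 3 * G.d₂ G.a * G.d₁ G.b + 2 * G.d₁ G.a * G.d₂ G.b + 3 * G.d₂ (G.d₁ G.a) * G.b - 3 * G.K * G.a * G.b - G.a * G.d₁ (G.d₁ G.b) - 2 * G.d₁ G.a * G.d₁ G.b - G.d₁ (G.d₁ G.a) - G.d₁ (G.d₁ G.a) * G.b))).add
      (G.canonical_u_12.smul (3 * G.K * G.a + 3 * G.K * G.a * G.b + 2 * G.d₂ (G.d₂ G.a) * G.b + 3 * G.d₁ (G.d₁ G.a) - 2 * G.a * G.d₂ (G.d₂ G.b) - 3 * G.d₂ G.a * G.d₁ G.b - 4 * G.d₂ (G.d₁ G.a) - 3 * G.d₂ (G.d₁ G.a) * G.b))).add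
      (G.canonical_u_11.smul (G.a * G.d₂ (G.d₂ G.b) + 2 * G.d₂ (G.d₁ G.a) - 3 * G.K * G.a - G.d₂ (G.d₂ G.a) * G.b))).add
      (G.canonical_u_2.smul (7 * G.K * G.a * G.d₁ G.b + 3 * G.K * G.d₁ G.a + 8 * G.K * G.d₁ G.a * G.b + G.d₁ G.K * G.a + 3 * G.d₁ G.K * G.a * G.b + G.a * G.d₂ (G.d₂ (G.d₁ G.b)) + 4 * G.d₂ G.a * G.d₂ (G.d₁ G.b) + 3 * G.d₂ (G.d₂ G.a) * G.d₁ G.b + G.d₁ G.a * G.d₂ (G.d₂ G.b) + 4 * G.d₂ (G.d₁ G.a) * G.d₂ G.b + 3 * G.d₂ (G.d₂ (G.d₁ G.a)) * G.b + G.d₁ (G.d₁ (G.d₁ G.a)) - 4 * G.K * G.a * G.d₂ G.b - 6 * G.K * G.d₂ G.a * G.b - 4 * G.d₂ G.K * G.a * G.b - G.a * G.d₂ (G.d₁ (G.d₁ G.b)) - 2 * G.d₂ G.a * G.d₁ (G.d₁ G.b) - 2 * G.d₁ G.a * G.d₂ (G.d₁ G.b) - 4 * G.d₂ (G.d₁ G.a)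 * G.d₁ G.b - G.d₁ (G.d₁ G.a) * G.d₂ G.b - 2 * G.d₂ (G.d₁ (G.d₁ G.a)) - 2 * G.d₂ (G.d₁ (G.d₁ G.a)) * G.b))).add
      (G.canonical_u_1.smul (3 * G.K * G.d₂ G.a + 6 * G.K * G.d₂ G.a * G.b + 3 * G.d₂ G.K * G.a + G.d₂ G.K * G.a * G.b + G.a * G.d₂ (G.d₂ (G.d₁ G.b)) + G.d₂ (G.d₂ G.a) * G.d₂ G.b + G.d₂ (G.d₂ (G.d₂ G.a)) * G.b + G.d₁ G.a * G.d₂ (G.d₂ G.b) + 3 * G.d₂ (G.d₁ (G.d₁ G.a)) - 2 * G.K * G.a * G.d₂ G.b - 12 * G.K * G.d₁ G.a - 4 * G.d₁ G.K * G.a - G.a * G.d₂ (G.d₂ (G.d₂ G.b)) - G.d₂ G.a * G.d₂ (G.d₂ G.b) - G.d₂ G.a * G.d₂ (G.d₁ G.b) - 2 * G.d₂ (G.d₂ G.a) * G.d₁ G.b - G.d₂ (G.d₁ G.a) * G.d₂ G.b - 2 * G.d₂ (G.d₂ (G.d₁ G.a)) - 2 * G.d₂ (G.d₂ (G.d₁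 G.a)) * G.b))).add
      (G.canonical_u.smul (2 * G.K * G.a * G.d₂ (G.d₁ G.b) + 7 * G.K * G.d₂ G.a * G.d₁ G.b + 3 * G.K * G.d₁ G.a * G.d₂ G.b + 3 * G.K * G.d₂ (G.d₁ G.a) + 8 * G.K * G.d₂ (G.d₁ G.a) * G.b + 2 * G.d₂ G.K * G.a * G.d₁ G.b + 3 * G.d₂ G.K * G.d₁ G.a + 3 * G.d₂ G.K * G.d₁ G.a * G.b + G.d₁ G.K * G.a * G.d₂ G.b + G.d₁ G.K * G.d₂ G.a + 3 * G.d₁ G.K * G.d₂ G.a * G.b + G.d₂ (G.d₁ G.K) * G.a + G.d₂ (G.d₁ G.K) * G.a * G.b + G.d₂ G.a * G.d₂ (G.d₂ (G.d₁ G.b)) + 2 * G.d₂ (G.d₂ G.a) * G.d₂ (G.d₁ G.b) + G.d₂ (G.d₂ (G.d₂ G.a)) * G.d₁ G.b + G.d₂ (G.d₁ G.a) * G.d₂ (G.d₂ G.b) + 2 * G.d₂ (G.d₂ (G.d₁ G.a)) * G.d₂ G.b + G.d₂ (G.d₂ (G.d₂ (G.d₁ G.a))) * G.b + G.d₂ (G.d₁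 (G.d₁ (G.d₁ G.a))) - 5 * G.K ^ 2 * G.a * G.b - G.K * G.a * G.d₂ (G.d₂ G.b) - 4 * G.K * G.d₂ G.a * G.d₂ G.b - 3 * G.K * G.d₂ (G.d₂ G.a) * G.b - 6 * G.K * G.d₁ (G.d₁ G.a) - 2 * G.d₂ G.K * G.a * G.d₂ G.b - 4 * G.d₂ G.K * G.d₂ G.a * G.b - G.d₂ (G.d₂ G.K) * G.a * G.b - 4 * G.d₁ G.K * G.d₁ G.a - G.d₁ (G.d₁ G.K) * G.a - G.d₂ G.a * G.d₂ (G.d₁ (G.d₁ G.b)) - G.d₂ (G.d₂ G.a) * G.d₁ (G.d₁ G.b) - 2 * G.d₂ (G.d₁ G.a) * G.d₂ (G.d₁ G.b) - 2 * G.d₂ (G.d₂ (G.d₁ G.a)) * G.d₁ G.b - G.d₂ (G.d₁ (G.d₁ G.a)) * G.d₂ G.b - G.d₂ (G.d₂ (G.d₁ (G.d₁ G.a))) - G.d₂ (G.d₂ (G.d₁ (G.d₁ G.a))) * G.b)))).congr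
    (fun w u v => G.obstructionU u) (fun _ _ _ => 0) ?_ ?_).cast ?_
  · intro w u v hw hu hv
    simp only [obstructionU, Δ₁, Δ₂, Δ₃]
    simp only [eqW, eqU, eqV, eqP, Derivation.leibniz, map_add, map_sub, smul_eq_mul, G.comm, G.e_d₁, G.e_d₂, G.e_a, G.e_b,
      G.e_K, map_zero, hw, hu, hv]
    ring
  · intro w u v T _ φ h
    simp [h.onW.z, h.onW.z₁, h.onW.z₂, h.onW.z₁₁, h.onW.z₁₂, h.onW.z₂₂, h.onU.z, h.onU.z₁, h.onU.z₂, h.onU.z₁₁, h.onU.z₁₂,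
      h.onU.z₂₂, h.onV.z, h.onV.z₁, h.onV.z₂, h.onV.z₁₁, h.onV.z₁₂, h.onV.z₂₂, h.onP.z, h.onP.z₁, h.onP.z₂, h.onP.z₁₁,
      h.onP.z₁₂, h.onP.z₂₂]
  · ring

lemma canonical_obstructionV : G.Canonical (fun w u v => G.obstructionV v)
    (G.K * G.a * G.b ^ 2 * G.leadV + G.K * G.b ^ 2 * G.leadV + G.leadV₃ * G.a * G.d₁ G.b + G.leadV₃ * G.b ^ 2 * G.d₁ G.b + 3 * G.a * G.d₂ (G.d₁ G.b) * G.leadV + 2 * G.d₂ G.a * G.d₁ G.b * G.leadV + G.b ^ 2 * G.d₂ (G.d₁ G.b) * G.leadV + 5 * G.b * G.d₂ G.b * G.d₁ G.b * G.leadV + 2 * G.b * G.d₁ (G.d₁ G.b) * G.leadV + (G.d₁ G.b) ^ 2 * G.leadV - G.K * G.a * G.b * G.leadV - G.K * G.b ^ 3 * G.leadV - G.leadV₃ * G.a * G.b * G.d₁ G.b - G.leadV₃ * G.b * G.d₁ G.b - 2 * G.a * G.b * G.d₂ (G.d₁ G.b) * G.leadV - 3 * G.a * G.d₂ G.b * G.d₁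 G.b * G.leadV - G.a * G.d₁ (G.d₁ G.b) * G.leadV - G.d₂ G.a * G.b * G.d₁ G.b * G.leadV - G.d₁ G.a * G.d₁ G.b * G.leadV - 2 * G.b * G.d₂ (G.d₁ G.b) * G.leadV - 3 * G.d₂ G.b * G.d₁ G.b * G.leadV - G.d₁ (G.d₁ G.b) * G.leadV) := by
  refine (((((((((((G.canonical_v_222.smul (G.a * G.d₁ G.b)).add
      (G.canonical_v_122.smul (-G.a * G.d₁ G.b - G.d₁ G.b))).add
      (G.canonical_v_112.smul (G.d₁ G.b))).add
      (G.canonical_v_22.smul (3 * G.a * G.d₂ (G.d₁ G.b) + 2 * G.d₂ G.a * G.d₁ G.b - G.K * G.a * G.b - G.a * G.d₁ (G.d₁ G.b) - G.d₁ G.a * G.d₁ G.b - G.d₁ (G.d₁ G.b)))).add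
      (G.canonical_v_12.smul (G.K * G.a * G.b + G.K * G.b + 2 * G.d₁ (G.d₁ G.b) - 2 * G.a * G.d₂ (G.d₁ G.b) - G.d₂ G.a * G.d₁ G.b - 2 * G.d₂ (G.d₁ G.b)))).add
      (G.canonical_v_11.smul (G.d₂ (G.d₁ G.b) - G.K * G.b))).add
      (G.canonical_v_2.smul (6 * G.K * G.a * G.d₁ G.b + G.K * G.d₁ G.a * G.b + 3 * G.K * G.d₁ G.b + G.d₁ G.K * G.a * G.b + G.d₁ G.K * G.b + 3 * G.a * G.d₂ (G.d₂ (G.d₁ G.b)) + 4 * G.d₂ G.a * G.d₂ (G.d₁ G.b) + G.d₂ (G.d₂ G.a) * G.d₁ G.b + G.d₁ (G.d₁ (G.d₁ G.b)) - 2 * G.K * G.a * G.d₂ G.b - 2 * G.K * G.d₂ G.a * G.b - 2 * G.d₂ G.K * G.a * G.b - 2 * G.a * G.d₂ (G.d₁ (G.d₁ G.b)) - G.d₂ G.a * G.d₁ (G.d₁ G.b) - 2 * G.d₁ G.a * G.d₂ (G.d₁ G.b) - G.d₂ (G.d₁ G.a) * G.d₁ G.b - 2 * G.d₂ (G.d₁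 (G.d₁ G.b))))).add
      (G.canonical_v_1.smul (G.K * G.a * G.d₂ G.b + G.K * G.d₂ G.a * G.b + G.K * G.d₂ G.b + G.d₂ G.K * G.a * G.b + G.d₂ G.K * G.b + 2 * G.d₂ (G.d₁ (G.d₁ G.b)) - 7 * G.K * G.d₁ G.b - 2 * G.d₁ G.K * G.b - G.a * G.d₂ (G.d₂ (G.d₁ G.b)) - G.d₂ G.a * G.d₂ (G.d₁ G.b) - G.d₂ (G.d₂ (G.d₁ G.b))))).add
      (G.canonical_v.smul (6 * G.K * G.a * G.d₂ (G.d₁ G.b) + 3 * G.K * G.d₂ G.a * G.d₁ G.b + G.K * G.d₁ G.a * G.d₂ G.b + G.K * G.d₂ (G.d₁ G.a) * G.b + 3 * G.K * G.d₂ (G.d₁ G.b) + 3 * G.d₂ G.K * G.a * G.d₁ G.b + G.d₂ G.K * G.d₁ G.a * G.b + 3 * G.d₂ G.K * G.d₁ G.b + G.d₁ G.K * G.a * G.d₂ G.b + G.d₁ G.K * G.d₂ G.a * G.b + G.d₁ G.K * G.d₂ G.b + G.d₂ (G.d₁ G.K) * G.a * G.b + G.d₂ (G.d₁ G.K) * G.b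 + G.a * G.d₂ (G.d₂ (G.d₂ (G.d₁ G.b))) + 2 * G.d₂ G.a * G.d₂ (G.d₂ (G.d₁ G.b)) + G.d₂ (G.d₂ G.a) * G.d₂ (G.d₁ G.b) + G.d₂ (G.d₁ (G.d₁ (G.d₁ G.b))) - 3 * G.K ^ 2 * G.a * G.b - G.K * G.a * G.d₂ (G.d₂ G.b) - 2 * G.K * G.d₂ G.a * G.d₂ G.b - G.K * G.d₂ (G.d₂ G.a) * G.b - 6 * G.K * G.d₁ (G.d₁ G.b) - 2 * G.d₂ G.K * G.a * G.d₂ G.b - 2 * G.d₂ G.K * G.d₂ G.a * G.b - G.d₂ (G.d₂ G.K) * G.a * G.b - 4 * G.d₁ G.K * G.d₁ G.b - G.d₁ (G.d₁ G.K) * G.b - G.a * G.d₂ (G.d₂ (G.d₁ (G.d₁ G.b))) - G.d₂ G.a * G.d₂ (G.d₁ (G.d₁ G.b)) - G.d₁ G.a * G.d₂ (G.d₂ (G.d₁ G.b)) - G.d₂ (G.d₁ G.a) * G.d₂ (G.d₁ G.b) - G.d₂ (G.d₂ (G.d₁ (G.d₁ G.b))))))).congr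
    (fun w u v => G.obstructionV v) (fun _ _ _ => 0) ?_ ?_).cast ?_
  · intro w u v hw hu hv
    simp only [obstructionV, Δ₁, Δ₂, Δ₃]
    simp only [eqW, eqU, eqV, eqP, Derivation.leibniz, map_add, map_sub, smul_eq_mul, G.comm, G.e_d₁, G.e_d₂, G.e_a, G.e_b,
      G.e_K, map_zero, hw, hu, hv]
    ring
  · intro w u v T _ φ h
    simp [h.onW.z, h.onW.z₁, h.onW.z₂, h.onW.z₁₁, h.onW.z₁₂, h.onW.z₂₂, h.onU.z, h.onU.z₁, h.onU.z₂, h.onU.z₁₁, h.onU.z₁₂,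
      h.onU.z₂₂, h.onV.z, h.onV.z₁, h.onV.z₂, h.onV.z₁₁, h.onV.z₁₂, h.onV.z₂₂, h.onP.z, h.onP.z₁, h.onP.z₂, h.onP.z₁₁,
      h.onP.z₁₂, h.onP.z₂₂]
  · ring

/-- The obstruction `ϰ`. -/
def obstruction (w u v : S) : S := G.obstructionW w + G.obstructionU u + G.obstructionV v

/-- The matrix rows of the covariant derivatives `d₁ w`, `d₁ u`, `d₁ v` of solutions. -/
def rows₁ : Fin 3 → Fin 6 → S :=
  ![![0, 1, 0, 0, 0, 0], ![0, -1, -G.b, 0, 0, -G.d₂ G.b], ![0, 0, G.b, 0, 0, G.d₂ G.b]]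

/-- The matrix rows of the covariant derivatives `d₂ w`, `d₂ u`, `d₂ v` of solutions. -/
def rows₂ : Fin 3 → Fin 6 → S :=
  ![![0, 1, 0, 0, 0, 0], ![0, -G.ia, -G.ia * G.b, 0, -G.ia * G.d₂ G.a, -G.ia * G.d₂ G.b],
    ![0, 0, 1, 0, 0, 0]]

lemma map_d₂_u {T : Type} [CommRing T] {φ : S →+* T} {w u v : S} (h : G.KillsAbelian φ w u v) :
    φ (G.d₂ u) = -φ G.ia * (φ (G.d₂ w) + φ G.b * φ (G.d₂ v) + φ (G.d₂ G.a) * φ u +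
      φ (G.d₂ G.b) * φ v) := by
  have h1 := h.onP.z
  simp only [eqP, Derivation.leibniz, map_add, smul_eq_mul, map_mul] at h1
  have h2 := congrArg φ G.a_mul_ia
  simp only [map_mul, map_one] at h2
  linear_combination φ G.ia * h1 - φ (G.d₂ u) * h2

/-- The system closes up because all jets of order three are expressed through the six coordinates.
The rows of `w`, `u`, `v` and the row `d₂ w₂ = w₂₂` are kept explicit, since they are what turns a
parallel section back into a solution. -/
lemma exists_connection : ∃ A₁ A₂ : Fin 6 → Fin 6 → S,
    (∀ j : Fin 3, A₁ (j.natAdd 3) = G.rows₁ j ∧ A₂ (j.natAdd 3) = G.rows₂ j) ∧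
    A₂ 1 = ![1, 0, 0, 0, 0, 0] ∧ ∀ w u v, G.e w = w → G.e u = u → G.e v = v →
      ∀ (T : Type) [CommRing T] (φ : S →+* T), G.KillsAbelian φ w u v → ∀ j,
        φ (G.d₁ (G.coord w u v j)) = ∑ i, φ (A₁ j i) * φ (G.coord w u v i) ∧
        φ (G.d₂ (G.coord w u v j)) = ∑ i, φ (A₂ j i) * φ (G.coord w u v i) := by
  -- Moving `d₁` past the two `d₂` yields `K w₂` once with weight 2 and once with weight 1, hence
  -- the coefficient `-3 K`.
  have h0 : G.Canonical (fun w _ _ => G.d₁ (G.d₂ (G.d₂ w))) (G.leadW₃) := by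
    refine (((G.canonical_w_122.add (G.canonical_w_2.smul (-3 * G.K))).add
      (G.canonical_w.smul (-G.d₂ G.K))).congr (fun w _ _ => G.d₁ (G.d₂ (G.d₂ w)))
      (fun _ _ _ => 0) ?_ ?_).cast ?_
    · intro w u v hw hu hv
      simp only [Derivation.leibniz, map_add, map_sub, smul_eq_mul, G.comm, G.e_d₁, G.e_d₂, hw]
      ring
    · intro w u v T _ φ h
      simp
    · ring
  have h1 : G.Canonical (fun w _ _ => G.d₁ (G.d₂ w)) 1 := by
    refine ((G.canonical_w_12.add (G.canonical_w.smul (-G.K))).congr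
      (fun w _ _ => G.d₁ (G.d₂ w)) (fun _ _ _ => 0) ?_ ?_).cast ?_
    · intro w u v hw hu hv
      simp only [G.comm, hw]
      ring
    · intro w u v T _ φ h
      simp
    · ring
  have h2 : G.Canonical (fun _ _ v => G.d₁ (G.d₂ v)) (G.b * G.leadV) := by
    refine ((G.canonical_v_12.add (G.canonical_v.smul (-G.K))).congr
      (fun _ _ v => G.d₁ (G.d₂ v)) (fun _ _ _ => 0) ?_ ?_).cast ?_
    · intro w u v hw hu hv
      simp only [G.comm, hv]
      ring
    · intro w u v T _ φ h
      simp
    · ring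
  obtain ⟨c0, -, h0⟩ := h0
  obtain ⟨c1, -, h1⟩ := h1
  obtain ⟨c2, -, h2⟩ := h2
  obtain ⟨e0, -, k0⟩ := G.canonical_w_222
  obtain ⟨e2, -, k2⟩ := G.canonical_v_22
  refine ⟨Fin.append ![c0, c1, c2] G.rows₁, Fin.append ![e0, ![1, 0, 0, 0, 0, 0], e2] G.rows₂, ?_, rfl, ?_⟩
  · intro j
    exact ⟨Fin.append_right _ _ j, Fin.append_right _ _ j⟩
  · intro w u v hw hu hv T _ φ h j
    have hW := h.onW.z
    have hU := h.onU.z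
    have hV := h.onV.z
    have hP := h.onP.z
    have hu2 := G.map_d₂_u h
    have hia := congrArg φ G.a_mul_ia
    simp only [eqW, eqU, eqV, eqP, Derivation.leibniz, map_add, smul_eq_mul, map_mul, map_sub,
      map_one] at hW hU hV hP hia
    fin_cases j
    · exact ⟨h0 w u v hw hu hv T φ h, k0 w u v hw hu hv T φ h⟩
    · exact ⟨h1 w u v hw hu hv T φ h, by
        change φ (G.d₂ (G.d₂ w)) = ∑ i, φ ((![1, 0, 0, 0, 0, 0] : Fin 6 → S) i) * _
        simp [coord, Fin.sum_univ_six]⟩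
    · exact ⟨h2 w u v hw hu hv T φ h, k2 w u v hw hu hv T φ h⟩
    · change φ (G.d₁ w) = ∑ i, φ (G.rows₁ 0 i) * _ ∧ φ (G.d₂ w) = ∑ i, φ (G.rows₂ 0 i) * _
      simp only [rows₁, rows₂, coord, Fin.sum_univ_six, Matrix.cons_val, map_zero, map_one,
        map_neg, map_mul]
      exact ⟨by linear_combination hW, by ring⟩
    · change φ (G.d₁ u) = ∑ i, φ (G.rows₁ 1 i) * _ ∧ φ (G.d₂ u) = ∑ i, φ (G.rows₂ 1 i) * _
      simp only [rows₁, rows₂, coord, Fin.sum_univ_six, Matrix.cons_val, map_zero, map_one,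
        map_neg, map_mul]
      exact ⟨by linear_combination hU + hP, by linear_combination hu2⟩
    · change φ (G.d₁ v) = ∑ i, φ (G.rows₁ 2 i) * _ ∧ φ (G.d₂ v) = ∑ i, φ (G.rows₂ 2 i) * _
      simp only [rows₁, rows₂, coord, Fin.sum_univ_six, Matrix.cons_val, map_zero, map_one,
        map_neg, map_mul]
      exact ⟨by linear_combination hV, by ring⟩

/-- The coefficient of `w₂₂` in the obstruction on solutions. -/
def leadObstruction : S :=
  6 * G.K * G.a + 3 * G.K * G.a ^ 2 * G.b * G.leadU + 3 * G.K * G.a ^ 2 * G.leadU + G.K * G.a * G.b ^ 2 * G.leadV + 6 * G.K * G.b + G.K * G.b ^ 2 * G.leadV + G.leadW₃ * G.a * G.d₁ G.b + G.leadW₃ * G.d₂ G.a + G.leadW₃ * G.d₁ G.a * G.b + G.leadW₃ * G.d₂ G.b + G.leadU₃ * G.a ^ 3 * G.d₂ G.b + 2 * G.leadU₃ * G.a ^ 2 * G.d₁ G.a + G.leadU₃ * G.a * G.d₂ G.a * G.b + G.leadU₃ * G.a * G.d₁ G.b + G.leadU₃ * G.d₁ G.a * G.b + G.leadV₃ * G.a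 * G.d₁ G.b + G.leadV₃ * G.b ^ 2 * G.d₁ G.b + G.a ^ 3 * G.d₂ (G.d₂ G.b) * G.leadU + 5 * G.a ^ 2 * G.d₂ G.a * G.d₂ G.b * G.leadU + 2 * G.a ^ 2 * G.d₂ (G.d₁ G.a) * G.leadU + 10 * G.a * G.d₂ G.a * G.d₁ G.a * G.leadU + 2 * G.a * G.d₂ (G.d₂ G.a) * G.b * G.leadU + G.a * G.d₁ G.a * G.d₂ G.b * G.leadU + 3 * G.a * G.d₁ (G.d₁ G.a) * G.leadU + 2 * G.a * G.d₂ (G.d₁ G.b) + 3 * G.a * G.d₂ (G.d₁ G.b) * G.leadV + 2 * G.a * G.d₂ (G.d₁ G.b) * G.leadU + 3 * (G.d₂ G.a) ^ 2 * G.b * G.leadU + G.d₂ G.a * G.d₁ G.b + 2 * G.d₂ G.a * G.d₁ G.b * G.leadV + 3 * G.d₂ G.a * G.d₁ G.b * G.leadU + G.d₂ (G.d₂ G.a) + 2 * (G.d₁ G.a) ^ 2 * G.leadU + 2 * G.d₁ G.a * G.d₂ G.b + 2 * G.d₁ G.a * G.d₂ G.b * G.leadU + G.d₂ (G.d₁ G.a)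 * G.b + 3 * G.d₂ (G.d₁ G.a) * G.b * G.leadU + G.b ^ 2 * G.d₂ (G.d₁ G.b) * G.leadV + 5 * G.b * G.d₂ G.b * G.d₁ G.b * G.leadV + 2 * G.b * G.d₁ (G.d₁ G.b) * G.leadV + G.d₂ (G.d₂ G.b) + (G.d₁ G.b) ^ 2 * G.leadV - 6 * G.K - 3 * G.K * G.a ^ 3 * G.leadU - 6 * G.K * G.a * G.b - G.K * G.a * G.b * G.leadV - 3 * G.K * G.a * G.b * G.leadU - G.K * G.b ^ 3 * G.leadV - G.leadW₃ * G.a * G.d₂ G.b - G.leadW₃ * G.d₂ G.a * G.b - G.leadW₃ * G.d₁ G.a - G.leadW₃ * G.d₁ G.b - G.leadU₃ * G.a ^ 2 * G.d₂ G.a * G.b - G.leadU₃ * G.a ^ 2 * G.d₂ G.b - G.leadU₃ * G.a ^ 2 * G.d₁ G.b - 2 * G.leadU₃ * G.a * G.d₁ G.a - G.leadU₃ * G.a * G.d₁ G.a * G.b - G.leadV₃ * G.a * G.b * G.d₁ G.b - G.leadV₃ * G.b * G.d₁ G.b - G.a ^ 2 * G.d₂ (G.d₂ G.a) * G.b * G.leadU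 - 2 * G.a ^ 2 * G.d₂ (G.d₂ G.b) * G.leadU - 5 * G.a * (G.d₂ G.a) ^ 2 * G.b * G.leadU - 3 * G.a * G.d₂ G.a * G.d₂ G.b * G.leadU - 6 * G.a * G.d₂ G.a * G.d₁ G.b * G.leadU - 3 * G.a * G.d₂ (G.d₁ G.a) * G.b * G.leadU - 4 * G.a * G.d₂ (G.d₁ G.a) * G.leadU - 2 * G.a * G.b * G.d₂ (G.d₁ G.b) * G.leadV - 3 * G.a * G.d₂ G.b * G.d₁ G.b * G.leadV - 2 * G.a * G.d₂ (G.d₂ G.b) - G.a * G.d₁ (G.d₁ G.b) * G.leadV - G.a * G.d₁ (G.d₁ G.b) * G.leadU - 4 * G.d₂ G.a * G.d₁ G.a * G.b * G.leadU - 6 * G.d₂ G.a * G.d₁ G.a * G.leadU - G.d₂ G.a * G.b * G.d₁ G.b * G.leadV - 3 * G.d₂ G.a * G.d₂ G.b - G.d₂ (G.d₂ G.a) * G.b - G.d₁ G.a * G.d₁ G.b * G.leadV - 2 * G.d₁ G.a * G.d₁ G.b * G.leadU - G.d₂ (G.d₁ G.a) - G.d₁ (G.d₁ G.a) * G.b *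 G.leadU - G.d₁ (G.d₁ G.a) * G.leadU - 2 * G.b * G.d₂ (G.d₁ G.b) * G.leadV - 3 * G.d₂ G.b * G.d₁ G.b * G.leadV - G.d₁ (G.d₁ G.b) - G.d₁ (G.d₁ G.b) * G.leadV

lemma canonical_obstruction : G.Canonical G.obstruction G.leadObstruction := by
  refine ((G.canonical_obstructionW.add G.canonical_obstructionU).add
    G.canonical_obstructionV).cast ?_
  simp only [leadObstruction]
  ring


end GradedWebAlgebra

end PlanarWebs

noncomputable section

namespace PlanarWebs

open TopologicalSpace (Opens)

/-! ### The ring of smooth functions on an open set -/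

/-- The ring of smooth functions on an open set of the plane. -/
def smoothRing (U : Opens Plane) : Subalgebra ℝ (U → ℝ) where
  carrier := {f | ∃ F : Plane → ℝ, ContDiffOn ℝ ∞ F U ∧ ∀ q : U, f q = F q}
  mul_mem' := by
    rintro f g ⟨F, hF, hf⟩ ⟨G, hG, hg⟩
    exact ⟨fun q => F q * G q, hF.mul hG, fun q => by simp [hf, hg]⟩
  add_mem' := by
    rintro f g ⟨F, hF, hf⟩ ⟨G, hG, hg⟩
    exact ⟨fun q => F q + G q, hF.add hG, fun q => by simp [hf, hg]⟩
  algebraMap_mem' c := ⟨fun _ => c, contDiffOn_const, fun _ => rfl⟩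

variable {U : Opens Plane}

/-- The element `f` of the ring of smooth functions on `U` is the restriction of `F`. -/
def Represents (f : smoothRing U) (F : Plane → ℝ) : Prop := ∀ q : U, f.1 q = F q

/-- The smooth function on `U` given by a function on the plane that is smooth on `U`. -/
def restrictTo (F : Plane → ℝ) (hF : ContDiffOn ℝ ∞ F U) : smoothRing U :=
  ⟨fun q => F q, F, hF, fun _ => rfl⟩

lemma represents_restrictTo (F : Plane → ℝ) (hF : ContDiffOn ℝ ∞ F U) :
    Represents (restrictTo F hF) F := fun _ => rfl

/-- The extension of a smooth function on `U` by zero. -/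
def extendZero (f : smoothRing U) : Plane → ℝ := Function.extend Subtype.val f.1 0

lemma represents_extendZero (f : smoothRing U) : Represents f (extendZero f) := fun q =>
  (Subtype.val_injective.extend_apply f.1 0 q).symm

lemma Represents.congr {f : smoothRing U} {F G : Plane → ℝ} (h : Represents f F)
    (hFG : ∀ q ∈ U, F q = G q) : Represents f G := fun q => (h q).trans (hFG q q.2)

lemma Represents.eqOn {f : smoothRing U} {F G : Plane → ℝ} (hF : Represents f F)
    (hG : Represents f G) {q : Plane} (hq : q ∈ U) : F q = G q :=
  (hF ⟨q, hq⟩).symm.trans (hG ⟨q, hq⟩)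

lemma Represents.ext {f g : smoothRing U} {F : Plane → ℝ} (hf : Represents f F)
    (hg : Represents g F) : f = g := Subtype.ext (funext fun q => (hf q).trans (hg q).symm)

lemma Represents.contDiffOn {f : smoothRing U} {F : Plane → ℝ} (h : Represents f F) :
    ContDiffOn ℝ ∞ F U := by
  obtain ⟨G, hG, hf⟩ := f.2
  exact hG.congr fun q hq => (h.eqOn (G := G) hf hq)

lemma Represents.contDiffAt {f : smoothRing U} {F : Plane → ℝ} (h : Represents f F) {q : Plane}
    (hq : q ∈ U) : ContDiffAt ℝ ∞ F q :=
  h.contDiffOn.contDiffAt (U.isOpen.mem_nhds hq)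

lemma Represents.differentiableAt {f : smoothRing U} {F : Plane → ℝ} (h : Represents f F)
    {q : Plane} (hq : q ∈ U) : DifferentiableAt ℝ F q :=
  (h.contDiffAt hq).differentiableAt (by simp)

lemma Represents.eventuallyEq {f : smoothRing U} {F G : Plane → ℝ} (hF : Represents f F)
    (hG : Represents f G) {q : Plane} (hq : q ∈ U) : F =ᶠ[𝓝 q] G := by
  filter_upwards [U.isOpen.mem_nhds hq] with r hr using hF.eqOn hG hr

lemma represents_zero : Represents (0 : smoothRing U) (fun _ => 0) := fun _ => rfl

lemma represents_natCast (n : ℕ) : Represents (n : smoothRing U) (fun _ => n) := fun q => by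
  change ((n : smoothRing U) : U → ℝ) q = n
  simp

lemma represents_algebraMap (c : ℝ) :
    Represents (algebraMap ℝ (smoothRing U) c) (fun _ => c) := fun _ => rfl

section

variable {f g : smoothRing U} {F G : Plane → ℝ}

lemma Represents.add (hf : Represents f F) (hg : Represents g G) :
    Represents (f + g) (F + G) := fun q => congrArg₂ (· + ·) (hf q) (hg q)

lemma Represents.sub (hf : Represents f F) (hg : Represents g G) :
    Represents (f - g) (F - G) := fun q => congrArg₂ (· - ·) (hf q) (hg q)

lemma Represents.mul (hf : Represents f F) (hg : Represents g G) :
    Represents (f * g) (F * G) := fun q => congrArg₂ (· * ·) (hf q) (hg q)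

lemma Represents.neg (hf : Represents f F) : Represents (-f) (-F) := fun q =>
  congrArg (- ·) (hf q)

end

/-- The partial derivative in the direction `v` on the ring of smooth functions. -/
def partialDeriv (U : Opens Plane) (v : Plane) : Derivation ℤ (smoothRing U) (smoothRing U) :=
  Derivation.mk'
    (AddMonoidHom.toIntLinearMap
      { toFun := fun f => restrictTo (fun q => fderiv ℝ (extendZero f) q v)
          (((represents_extendZero f).contDiffOn.fderiv_of_isOpen U.isOpen
            (by simp)).clm_apply contDiffOn_const)
        map_zero' := by
          refine Subtype.ext (funext fun q => ?_)
          change fderiv ℝ (extendZero 0) q v = 0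
          rw [((represents_extendZero _).eventuallyEq represents_zero q.2).fderiv_eq]
          simp
        map_add' := fun f g => by
          refine Subtype.ext (funext fun q => ?_)
          change fderiv ℝ (extendZero (f + g)) q v =
            fderiv ℝ (extendZero f) q v + fderiv ℝ (extendZero g) q v
          have hf := represents_extendZero f
          have hg := represents_extendZero g
          rw [((represents_extendZero _).eventuallyEq (hf.add hg) q.2).fderiv_eq,
            fderiv_add (hf.differentiableAt q.2) (hg.differentiableAt q.2)]
          rfl })
    fun f g => by
      refine Subtype.ext (funext fun q => ?_)
      have hf := represents_extendZero f
      have hg := represents_extendZero g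
      change fderiv ℝ (extendZero (f * g)) q v =
        f.1 q * fderiv ℝ (extendZero g) q v + g.1 q * fderiv ℝ (extendZero f) q v
      rw [((represents_extendZero _).eventuallyEq (hf.mul hg) q.2).fderiv_eq,
        fderiv_mul (hf.differentiableAt q.2) (hg.differentiableAt q.2), hf q, hg q]
      rfl

/-- On the open set `U` a derivative depends only on the germ, so the extension by zero in the
definition may be replaced by any function with the same restriction to `U`. -/
lemma Represents.partialDeriv {f : smoothRing U} {F : Plane → ℝ} (hf : Represents f F)
    (v : Plane) : Represents (partialDeriv U v f) (fun q => fderiv ℝ F q v) := fun q => by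
  change fderiv ℝ (extendZero f) q v = _
  rw [((represents_extendZero f).eventuallyEq hf q.2).fderiv_eq]

lemma partialDeriv_algebraMap (v : Plane) (c : ℝ) :
    partialDeriv U v (algebraMap ℝ (smoothRing U) c) = 0 :=
  Represents.ext ((represents_algebraMap c).partialDeriv v)
    (represents_zero.congr fun q _ => by simp)

lemma partialDeriv_smul (v : Plane) (c : ℝ) (f : smoothRing U) :
    partialDeriv U v (c • f) = c • partialDeriv U v f := by
  rw [Algebra.smul_def, Derivation.leibniz, partialDeriv_algebraMap, smul_zero, add_zero,
    smul_eq_mul, Algebra.smul_def]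

lemma partialDeriv_comm (v w : Plane) (f : smoothRing U) :
    partialDeriv U v (partialDeriv U w f) = partialDeriv U w (partialDeriv U v f) := by
  have hf := represents_extendZero f
  have key : ∀ v w : Plane, ∀ q ∈ U, fderiv ℝ (fun r => fderiv ℝ (extendZero f) r w) q v =
      fderiv ℝ (fderiv ℝ (extendZero f)) q v w := by
    intro v w q hq
    have h : DifferentiableAt ℝ (fderiv ℝ (extendZero f)) q :=
      ((hf.contDiffAt hq).fderiv_right (m := ∞) (by simp)).differentiableAt (by simp)
    rw [fderiv_clm_apply h (differentiableAt_const w)]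
    simp
  refine ((hf.partialDeriv w).partialDeriv v).ext
    (((hf.partialDeriv v).partialDeriv w).congr fun q hq => ?_)
  rw [key v w q hq, key w v q hq]
  exact ((hf.contDiffAt hq).isSymmSndFDerivAt (by simpa using ENat.LEInfty.out)) w v

/-- The value at a point, as a ring homomorphism. -/
def evalAt (q : U) : smoothRing U →+* ℝ where
  toFun f := f.1 q
  map_zero' := rfl
  map_one' := rfl
  map_add' _ _ := rfl
  map_mul' _ _ := rfl

lemma Represents.evalAt {f : smoothRing U} {F : Plane → ℝ} (h : Represents f F) (q : U) :
    evalAt q f = F q := h q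

lemma evalAt_smul (q : U) (c : ℝ) (f : smoothRing U) : evalAt q (c • f) = c * evalAt q f := rfl

lemma evalAt_algebraMap (q : U) (c : ℝ) : evalAt q (algebraMap ℝ (smoothRing U) c) = c := rfl

lemma smoothRing_ext {f g : smoothRing U} (h : ∀ q, evalAt q f = evalAt q g) : f = g :=
  Subtype.ext (funext h)

/-- The inverse of a smooth function without zeros. -/
def smoothInv (f : smoothRing U) (h : ∀ q, evalAt q f ≠ 0) : smoothRing U :=
  restrictTo (fun q => (extendZero f q)⁻¹) ((represents_extendZero f).contDiffOn.inv fun q hq =>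
    (represents_extendZero f).evalAt ⟨q, hq⟩ ▸ h ⟨q, hq⟩)

lemma Represents.smoothInv {f : smoothRing U} {F : Plane → ℝ} (hf : Represents f F)
    (h : ∀ q, PlanarWebs.evalAt q f ≠ 0) :
    Represents (smoothInv f h) (fun q => (F q)⁻¹) :=
  (represents_restrictTo _ _).congr fun _ hq => by rw [(represents_extendZero f).eqOn hf hq]

lemma evalAt_smoothInv (f : smoothRing U) (h : ∀ q, evalAt q f ≠ 0) (q : U) :
    evalAt q (smoothInv f h) = (evalAt q f)⁻¹ := by
  rw [(represents_extendZero f).evalAt, ((represents_extendZero f).smoothInv h).evalAt]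

lemma smoothInv_mul (f : smoothRing U) (h : ∀ q, evalAt q f ≠ 0) : smoothInv f h * f = 1 :=
  smoothRing_ext fun q => by
    rw [map_mul, evalAt_smoothInv, inv_mul_cancel₀ (h q), map_one]

end PlanarWebs

end

noncomputable section

namespace PlanarWebs

open Polynomial

/-! ### Weights -/

/-- The derivations of a commutative ring. -/
abbrev IntDerivation (S : Type) [CommRing S] : Type := Derivation ℤ S S

/-- An additive map that satisfies the Leibniz rule is a derivation. -/
def IntDerivation.ofAddMonoidHom {S : Type} [CommRing S] (f : S →+ S)
    (h : ∀ x y, f (x * y) = x * f y + y * f x) : IntDerivation S :=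
  Derivation.mk' f.toIntLinearMap h

/-- The derivation `X D - g X² d/dX` of the polynomial ring. On `r Xⁿ` it is the covariant
derivative of the function `r` of weight `n`. -/
def weightLift {R : Type} [CommRing R] (D : Derivation ℤ R R) (g : R) : IntDerivation R[X] :=
  IntDerivation.ofAddMonoidHom
    (letI : Differential R := ⟨D⟩
    (AddMonoidHom.mulLeft X).comp (Differential.mapCoeffs (A := R)).toLinearMap.toAddMonoidHom -
      (AddMonoidHom.mulLeft (C g * X ^ 2)).comp (derivative (R := R)).toAddMonoidHom)
    fun x y => by
      let _ : Differential R := ⟨D⟩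
      change X * Differential.mapCoeffs (x * y) - C g * X ^ 2 * derivative (x * y) =
        x * (X * Differential.mapCoeffs y - C g * X ^ 2 * derivative y) +
          y * (X * Differential.mapCoeffs x - C g * X ^ 2 * derivative x)
      rw [Derivation.leibniz, derivative_mul, smul_eq_mul, smul_eq_mul]
      ring

lemma weightLift_monomial {R : Type} [CommRing R] (D : Derivation ℤ R R) (g : R) (n : ℕ) (r : R) :
    weightLift D g (monomial n r) = monomial (n + 1) (D r - n * g * r) := by
  let _ : Differential R := ⟨D⟩
  have h : weightLift D g (monomial n r) = X * monomial n (D r) -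
      C g * X ^ 2 * derivative (monomial n r) := by
    rw [← show Differential.mapCoeffs (monomial n r) = monomial n (D r) from
      Differential.mapCoeffs_monomial n r]
    rfl
  rw [h, map_sub, derivative_monomial, X_mul_monomial]
  congr 1
  -- The derivative of `r Xⁿ` has the truncated exponent `n - 1`; for `n = 0` its coefficient is
  -- zero.
  cases n with
  | zero => simp
  | succ n =>
    rw [mul_assoc, X_pow_mul_monomial, C_mul_monomial]
    congr 1
    push_cast
    ring

/-- The derivation `X d/dX` of the polynomial ring, which measures the weight. -/
def weightDeriv (R : Type) [CommRing R] : IntDerivation R[X] :=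
  IntDerivation.ofAddMonoidHom
    ((AddMonoidHom.mulLeft X).comp (derivative (R := R)).toAddMonoidHom) fun x y => by
      change X * derivative (x * y) = x * (X * derivative y) + y * (X * derivative x)
      rw [derivative_mul]
      ring

lemma weightDeriv_monomial {R : Type} [CommRing R] (n : ℕ) (r : R) :
    weightDeriv R (monomial n r) = monomial n (n * r) := by
  change X * derivative (monomial n r) = _
  rw [derivative_monomial, X_mul_monomial]
  cases n with
  | zero => simp
  | succ n => simp [mul_comm]

/-- A commutative ring of functions with a moving frame `D₁`, `D₂` that satisfies the structure
equations of a `3`-web, the coefficients `g₁`, `g₂` of the Chern form, and the two basic invariants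
`a`, `b` of a `5`-web, together with the inverses of `a`, `b`, `1 - a`, `1 - b`, `a - b`. -/
structure FramedWebAlgebra (R : Type) [CommRing R] where
  /-- the first vector field of the frame -/
  D₁ : Derivation ℤ R R
  /-- the second vector field of the frame -/
  D₂ : Derivation ℤ R R
  /-- the first coefficient of the Chern form -/
  g₁ : R
  /-- the second coefficient of the Chern form -/
  g₂ : R
  /-- the first basic invariant -/
  a : R
  /-- the second basic invariant -/
  b : R
  /-- the inverse of `a` -/
  ia : R
  /-- the inverse of `b` -/
  ib : R
  /-- the inverse of `1 - a` -/
  i1a : R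
  /-- the inverse of `1 - b` -/
  i1b : R
  /-- the inverse of `a - b` -/
  iab : R
  comm : ∀ f, D₁ (D₂ f) = D₂ (D₁ f) + g₁ * D₂ f - g₂ * D₁ f
  a_mul_ia : ia * a = 1
  b_mul_ib : ib * b = 1
  one_sub_a_mul : i1a * (1 - a) = 1
  one_sub_b_mul : i1b * (1 - b) = 1
  sub_mul_iab : iab * (a - b) = 1

namespace FramedWebAlgebra

variable {R : Type} [CommRing R] (T : FramedWebAlgebra R)

/-- The covariant derivative `δ₁` on functions of weight `k`. -/
def δ₁ (k : ℕ) (f : R) : R := T.D₁ f - k * T.g₁ * f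

/-- The covariant derivative `δ₂` on functions of weight `k`. -/
def δ₂ (k : ℕ) (f : R) : R := T.D₂ f - k * T.g₂ * f

/-- The curvature. -/
def K : R := T.D₁ T.g₂ - T.D₂ T.g₁

/-- The weight grows by one after the first differentiation. The extra terms `g₂ D₁ f - g₁ D₂ f`
cancel the commutator of the frame, and only the curvature term survives. -/
lemma δ₁_δ₂ (k : ℕ) (f : R) :
    T.δ₁ (k + 1) (T.δ₂ k f) = T.δ₂ (k + 1) (T.δ₁ k f) - k * T.K * f := by
  simp only [δ₁, δ₂, K, map_sub, Derivation.leibniz, smul_eq_mul, T.comm, Derivation.map_natCast]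
  push_cast
  ring

/-- The graded algebra of a framed algebra: the function `r` of weight `n` is `r Xⁿ`. -/
def graded : GradedWebAlgebra R[X] where
  d₁ := weightLift T.D₁ T.g₁
  d₂ := weightLift T.D₂ T.g₂
  e := weightDeriv R
  K := monomial 2 T.K
  a := monomial 0 T.a
  b := monomial 0 T.b
  ia := monomial 0 T.ia
  ib := monomial 0 T.ib
  i1a := monomial 0 T.i1a
  i1b := monomial 0 T.i1b
  iab := monomial 0 T.iab
  comm f := by
    induction f using Polynomial.induction_on' with
    | add p q hp hq => simp only [map_add, hp, hq]; ring
    | monomial n r =>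
      simp only [weightLift_monomial, weightDeriv_monomial, monomial_mul_monomial]
      rw [add_comm 2 n, ← map_sub]
      congr 1
      have h := T.δ₁_δ₂ n r
      simp only [δ₁, δ₂] at h
      rw [h]
      ring
  e_d₁ f := by
    induction f using Polynomial.induction_on' with
    | add p q hp hq => simp only [map_add, hp, hq]; ring
    | monomial n r =>
      simp only [weightLift_monomial, weightDeriv_monomial]
      rw [← map_add]
      congr 1
      simp only [Derivation.leibniz, Derivation.map_natCast, smul_eq_mul]
      push_cast
      ring
  e_d₂ f := by
    induction f using Polynomial.induction_on' with
    | add p q hp hq => simp only [map_add, hp, hq]; ring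
    | monomial n r =>
      simp only [weightLift_monomial, weightDeriv_monomial]
      rw [← map_add]
      congr 1
      simp only [Derivation.leibniz, Derivation.map_natCast, smul_eq_mul]
      push_cast
      ring
  e_a := by rw [weightDeriv_monomial]; simp
  e_b := by rw [weightDeriv_monomial]; simp
  e_K := by
    rw [weightDeriv_monomial, ← map_add]
    congr 1
    push_cast
    ring
  a_mul_ia := by rw [monomial_mul_monomial, T.a_mul_ia]; rfl
  b_mul_ib := by rw [monomial_mul_monomial, T.b_mul_ib]; rfl
  one_sub_a_mul := by
    rw [← monomial_zero_one, ← map_sub, monomial_mul_monomial, T.one_sub_a_mul]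
  one_sub_b_mul := by
    rw [← monomial_zero_one, ← map_sub, monomial_mul_monomial, T.one_sub_b_mul]
  sub_mul_iab := by rw [← map_sub, monomial_mul_monomial, T.sub_mul_iab]; rfl

lemma graded_d₁ (n : ℕ) (r : R) : T.graded.d₁ (monomial n r) = monomial (n + 1) (T.δ₁ n r) :=
  weightLift_monomial _ _ _ _

lemma graded_d₂ (n : ℕ) (r : R) : T.graded.d₂ (monomial n r) = monomial (n + 1) (T.δ₂ n r) :=
  weightLift_monomial _ _ _ _

/-- `Δ₁ = δ₁ - δ₂`. -/
def Δ₁ (k : ℕ) (f : R) : R := T.δ₁ k f - T.δ₂ k f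

/-- `Δ₂ = δ₁ - δ₂ ∘ a`. -/
def Δ₂ (k : ℕ) (f : R) : R := T.δ₁ k f - T.δ₂ k (T.a * f)

/-- `Δ₃ = δ₁ - δ₂ ∘ b`. -/
def Δ₃ (k : ℕ) (f : R) : R := T.δ₁ k f - T.δ₂ k (T.b * f)

lemma graded_Δ₁ (n : ℕ) (r : R) : T.graded.Δ₁ (monomial n r) = monomial (n + 1) (T.Δ₁ n r) := by
  rw [GradedWebAlgebra.Δ₁, graded_d₁, graded_d₂, ← map_sub, Δ₁]

lemma graded_Δ₂ (n : ℕ) (r : R) : T.graded.Δ₂ (monomial n r) = monomial (n + 1) (T.Δ₂ n r) := by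
  rw [GradedWebAlgebra.Δ₂, graded_d₁, show T.graded.a = monomial 0 T.a from rfl,
    monomial_mul_monomial, zero_add, graded_d₂, ← map_sub, Δ₂]

lemma graded_Δ₃ (n : ℕ) (r : R) : T.graded.Δ₃ (monomial n r) = monomial (n + 1) (T.Δ₃ n r) := by
  rw [GradedWebAlgebra.Δ₃, graded_d₁, show T.graded.b = monomial 0 T.b from rfl,
    monomial_mul_monomial, zero_add, graded_d₂, ← map_sub, Δ₃]

/-- The obstruction `ϰ`. -/
def obstruction (w u v : R) : R :=
  (T.Δ₁ 4 (T.Δ₂ 3 (T.Δ₃ 2 (T.δ₁ 1 w))) - T.δ₁ 4 (T.Δ₂ 3 (T.Δ₃ 2 (T.Δ₁ 1 w)))) +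
  (T.Δ₁ 4 (T.Δ₂ 3 (T.Δ₃ 2 (T.δ₁ 1 u))) - T.Δ₁ 4 (T.δ₁ 3 (T.Δ₃ 2 (T.Δ₂ 1 u)))) +
  (T.Δ₁ 4 (T.Δ₂ 3 (T.Δ₃ 2 (T.δ₁ 1 v))) - T.Δ₁ 4 (T.Δ₂ 3 (T.δ₁ 2 (T.Δ₃ 1 v))))

lemma graded_obstruction (w u v : R) :
    T.graded.obstruction (monomial 1 w) (monomial 1 u) (monomial 1 v) =
      monomial 5 (T.obstruction w u v) := by
  simp only [GradedWebAlgebra.obstruction, GradedWebAlgebra.obstructionW,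
    GradedWebAlgebra.obstructionU, GradedWebAlgebra.obstructionV, graded_d₁, graded_Δ₁, graded_Δ₂,
    graded_Δ₃, obstruction, map_add, map_sub]

/-- The canonical coordinates `w₂₂, w₂, v₂, w, u, v` on the solution space. -/
def coord (w u v : R) : Fin 6 → R := ![T.δ₂ 2 (T.δ₂ 1 w), T.δ₂ 1 w, T.δ₂ 1 v, w, u, v]

/-- The weights of the canonical coordinates. -/
def coordWeight : Fin 6 → ℕ := ![3, 2, 2, 1, 1, 1]

lemma graded_coord (w u v : R) (i : Fin 6) :
    T.graded.coord (monomial 1 w) (monomial 1 u) (monomial 1 v) i =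
      monomial (coordWeight i) (T.coord w u v i) := by
  fin_cases i <;>
    simp [GradedWebAlgebra.coord, graded_d₂, coordWeight, coord]

/-- The ideal contains `f` (of weight `2`) and its covariant derivatives of order at most two. -/
def ContainsTwoJet (I : Ideal R) (f : R) : Prop :=
  f ∈ I ∧ T.D₁ f ∈ I ∧ T.D₂ f ∈ I ∧ T.D₁ (T.D₁ f) ∈ I ∧ T.D₂ (T.D₁ f) ∈ I ∧ T.D₂ (T.D₂ f) ∈ I

/-- The left hand sides of the abelian equation. -/
def abelianOp (w u v : R) : Fin 4 → R :=
  ![T.Δ₁ 1 w, T.Δ₂ 1 u, T.Δ₃ 1 v, T.δ₁ 1 w + T.δ₁ 1 u + T.δ₁ 1 v]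

/-- The value of a polynomial at `1`, modulo an ideal of the coefficient ring. -/
def evalOneMod (I : Ideal R) : R[X] →+* R ⧸ I := (Ideal.Quotient.mk I).comp (evalRingHom 1)

lemma evalOneMod_monomial (I : Ideal R) (n : ℕ) (r : R) :
    evalOneMod I (monomial n r) = Ideal.Quotient.mk I r := by
  simp [evalOneMod]

/-- Covariant and plain derivatives differ by multiples of derivatives of lower order, which already
lie in the ideal; the weight therefore does not matter. -/
lemma killsTwoJet {I : Ideal R} {f : R} (h : T.ContainsTwoJet I f) (n : ℕ) :
    T.graded.KillsTwoJet (evalOneMod I) (monomial n f) := by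
  obtain ⟨h0, h1, h2, h11, h12, h22⟩ := h
  have k1 : ∀ k, T.δ₁ k f ∈ I := fun k => I.sub_mem h1 (I.mul_mem_left _ h0)
  have k2 : ∀ k, T.δ₂ k f ∈ I := fun k => I.sub_mem h2 (I.mul_mem_left _ h0)
  refine ⟨?_, ?_, ?_, ?_, ?_, ?_⟩ <;>
    simp only [graded_d₁, graded_d₂, evalOneMod_monomial, Ideal.Quotient.eq_zero_iff_mem]
  · exact h0
  · exact k1 n
  · exact k2 n
  · refine I.sub_mem ?_ (I.mul_mem_left _ (k1 n))
    rw [δ₁, map_sub, Derivation.leibniz]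
    exact I.sub_mem h11 (I.add_mem (I.mul_mem_left _ h1) (I.mul_mem_right _ h0))
  · refine I.sub_mem ?_ (I.mul_mem_left _ (k1 n))
    rw [δ₁, map_sub, Derivation.leibniz]
    exact I.sub_mem h12 (I.add_mem (I.mul_mem_left _ h2) (I.mul_mem_right _ h0))
  · refine I.sub_mem ?_ (I.mul_mem_left _ (k2 n))
    rw [δ₂, map_sub, Derivation.leibniz]
    exact I.sub_mem h22 (I.add_mem (I.mul_mem_left _ h2) (I.mul_mem_right _ h0))

lemma ContainsTwoJet.add {I : Ideal R} {f g : R} (hf : T.ContainsTwoJet I f)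
    (hg : T.ContainsTwoJet I g) : T.ContainsTwoJet I (f + g) := by
  obtain ⟨h0, h1, h2, h11, h12, h22⟩ := hf
  obtain ⟨k0, k1, k2, k11, k12, k22⟩ := hg
  simp only [ContainsTwoJet, map_add]
  exact ⟨I.add_mem h0 k0, I.add_mem h1 k1, I.add_mem h2 k2, I.add_mem h11 k11, I.add_mem h12 k12,
    I.add_mem h22 k22⟩

lemma ContainsTwoJet.neg {I : Ideal R} {f : R} (hf : T.ContainsTwoJet I f) :
    T.ContainsTwoJet I (-f) := by
  simpa only [ContainsTwoJet, map_neg, neg_mem_iff] using hf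

lemma killsAbelian {I : Ideal R} {w u v : R}
    (h : ∀ j, T.ContainsTwoJet I (T.abelianOp w u v j)) :
    T.graded.KillsAbelian (evalOneMod I) (monomial 1 w) (monomial 1 u) (monomial 1 v) := by
  -- `P` is the fourth equation minus the sum of the other three.
  have hP : T.ContainsTwoJet I (T.δ₂ 1 w + T.δ₂ 1 (T.a * u) + T.δ₂ 1 (T.b * v)) := by
    convert! ContainsTwoJet.add T (h 3) (ContainsTwoJet.neg T (ContainsTwoJet.add T (h 0)
      (ContainsTwoJet.add T (h 1) (h 2)))) using 1
    simp only [abelianOp, Matrix.cons_val, Δ₁, Δ₂, Δ₃]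
    ring
  refine ⟨?_, ?_, ?_, ?_⟩
  · convert! T.killsTwoJet (h 0) 2 using 1
    exact T.graded_Δ₁ 1 w
  · convert! T.killsTwoJet (h 1) 2 using 1
    exact T.graded_Δ₂ 1 u
  · convert! T.killsTwoJet (h 2) 2 using 1
    exact T.graded_Δ₃ 1 v
  · convert! T.killsTwoJet hP 2 using 1
    simp only [GradedWebAlgebra.eqP, show T.graded.a = monomial 0 T.a from rfl,
      show T.graded.b = monomial 0 T.b from rfl, monomial_mul_monomial, graded_d₂, map_add,
      zero_add]

/-- This is the universal graded identity read at `X = 1` modulo `I`. The coefficients do not depend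
on `I` or on `w, u, v`, so `I` can later be an ideal of functions that vanish to some order at any
point. -/
lemma exists_obstruction_coeffs : ∃ c : Fin 6 → R,
    c 0 = eval 1 T.graded.leadObstruction ∧
    ∀ (I : Ideal R) (w u v : R), (∀ j, T.ContainsTwoJet I (T.abelianOp w u v j)) →
      T.obstruction w u v - ∑ i, c i * T.coord w u v i ∈ I := by
  obtain ⟨c, hc, h⟩ := T.graded.canonical_obstruction
  refine ⟨fun i => eval 1 (c i), congrArg (eval 1) hc, fun I w u v hI => ?_⟩
  have h1 : ∀ r : R, weightDeriv R (monomial 1 r) = monomial 1 r := fun r => by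
    rw [weightDeriv_monomial, Nat.cast_one, one_mul]
  have h2 := h _ _ _ (h1 w) (h1 u) (h1 v) _ _ (T.killsAbelian hI)
  simp only [graded_obstruction, graded_coord, evalOneMod_monomial] at h2
  rw [← Ideal.Quotient.eq_zero_iff_mem, map_sub, h2, map_sum, sub_eq_zero]
  exact Finset.sum_congr rfl fun i _ => by rw [map_mul]; rfl

/-- The matrix rows of the covariant derivatives `δ₁ w`, `δ₁ u`, `δ₁ v` of solutions. -/
def rows₁ : Fin 3 → Fin 6 → R :=
  ![![0, 1, 0, 0, 0, 0], ![0, -1, -T.b, 0, 0, -T.D₂ T.b], ![0, 0, T.b, 0, 0, T.D₂ T.b]]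

/-- The matrix rows of the covariant derivatives `δ₂ w`, `δ₂ u`, `δ₂ v` of solutions. -/
def rows₂ : Fin 3 → Fin 6 → R :=
  ![![0, 1, 0, 0, 0, 0], ![0, -T.ia, -T.ia * T.b, 0, -T.ia * T.D₂ T.a, -T.ia * T.D₂ T.b],
    ![0, 0, 1, 0, 0, 0]]

lemma eval_one_graded_d₂ (r : R) : eval 1 (T.graded.d₂ (monomial 0 r)) = T.D₂ r := by
  rw [graded_d₂]
  simp [δ₂]

lemma eval_rows (j : Fin 3) (i : Fin 6) :
    eval 1 (T.graded.rows₁ j i) = T.rows₁ j i ∧ eval 1 (T.graded.rows₂ j i) = T.rows₂ j i := by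
  have hb : eval 1 (T.graded.d₂ T.graded.b) = T.D₂ T.b := T.eval_one_graded_d₂ T.b
  have ha : eval 1 (T.graded.d₂ T.graded.a) = T.D₂ T.a := T.eval_one_graded_d₂ T.a
  have hb' : eval 1 T.graded.b = T.b := by simp [graded]
  have ha' : eval 1 T.graded.ia = T.ia := by simp [graded]
  constructor <;> fin_cases j <;> fin_cases i <;>
    simp [GradedWebAlgebra.rows₁, GradedWebAlgebra.rows₂, rows₁, rows₂, ha, hb, ha', hb']

lemma exists_connection : ∃ A₁ A₂ : Fin 6 → Fin 6 → R,
    (∀ j : Fin 3, A₁ (j.natAdd 3) = T.rows₁ j ∧ A₂ (j.natAdd 3) = T.rows₂ j) ∧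
    A₂ 1 = ![1, 0, 0, 0, 0, 0] ∧ ∀ (I : Ideal R) (w u v : R), (∀ j, T.ContainsTwoJet I (T.abelianOp w u v j)) → ∀ j,
      T.δ₁ (coordWeight j) (T.coord w u v j) - ∑ i, A₁ j i * T.coord w u v i ∈ I ∧
      T.δ₂ (coordWeight j) (T.coord w u v j) - ∑ i, A₂ j i * T.coord w u v i ∈ I := by
  obtain ⟨A₁, A₂, hA, hA', h⟩ := T.graded.exists_connection
  refine ⟨fun j i => eval 1 (A₁ j i), fun j i => eval 1 (A₂ j i), fun j => ?_, ?_,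
    fun I w u v hI j => ?_⟩
  · simp only [(hA j).1, (hA j).2]
    exact ⟨funext fun i => (T.eval_rows j i).1, funext fun i => (T.eval_rows j i).2⟩
  · funext i
    change eval 1 (A₂ 1 i) = _
    rw [hA']
    fin_cases i <;> simp
  have h1 : ∀ r : R, weightDeriv R (monomial 1 r) = monomial 1 r := fun r => by
    rw [weightDeriv_monomial, Nat.cast_one, one_mul]
  have h2 := h _ _ _ (h1 w) (h1 u) (h1 v) _ _ (T.killsAbelian hI) j
  simp only [graded_coord, graded_d₁, graded_d₂, evalOneMod_monomial] at h2
  constructor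
  · rw [← Ideal.Quotient.eq_zero_iff_mem, map_sub, h2.1, map_sum, sub_eq_zero]
    exact Finset.sum_congr rfl fun i _ => by rw [map_mul]; rfl
  · rw [← Ideal.Quotient.eq_zero_iff_mem, map_sub, h2.2, map_sum, sub_eq_zero]
    exact Finset.sum_congr rfl fun i _ => by rw [map_mul]; rfl

end FramedWebAlgebra

end PlanarWebs

end

noncomputable section

namespace PlanarWebs

open TopologicalSpace (Opens)

/-! ### Differential forms with smooth coefficients -/

/-- Dual form of the structure equations `dωᵢ = ωᵢ ∧ γ`: `X`, `Y` play the part of the coordinate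
fields, `(pᵢ, qᵢ)` are the components of `ωᵢ`, and `iA` is the inverse of the area coefficient. -/
lemma frame_comm {R : Type} [CommRing R] (X Y : Derivation ℤ R R) (hXY : ∀ f, X (Y f) = Y (X f))
    (p₁ q₁ p₂ q₂ iA : R) (h : iA * (p₁ * q₂ - q₁ * p₂) = 1) (f : R) :
    (iA * q₂) * X (iA * p₁ * Y f - iA * q₁ * X f) - (iA * p₂) * Y (iA * p₁ * Y f - iA * q₁ * X f) =
      iA * p₁ * Y (iA * q₂ * X f - iA * p₂ * Y f) - iA * q₁ * X (iA * q₂ * X f - iA * p₂ * Y f) +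
        -(iA * (X q₂ - Y p₂)) * (iA * p₁ * Y f - iA * q₁ * X f) -
        iA * (X q₁ - Y p₁) * (iA * q₂ * X f - iA * p₂ * Y f) := by
  have key : ∀ D : Derivation ℤ R R, D iA = -(iA ^ 2 * D (p₁ * q₂ - q₁ * p₂)) := by
    intro D
    have h1 := congrArg D h
    rw [Derivation.leibniz, Derivation.map_one_eq_zero, smul_eq_mul, smul_eq_mul] at h1
    linear_combination iA * h1 - D iA * h
  simp only [map_sub, Derivation.leibniz, smul_eq_mul, hXY, key]
  linear_combination (iA ^ 2 * (X f * (p₁ * Y q₂ + q₂ * Y p₁ - q₁ * Y p₂ - p₂ * Y q₁) -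
    Y f * (p₁ * X q₂ + q₂ * X p₁ - q₁ * X p₂ - p₂ * X q₁))) * h

variable {U : Opens Plane}

/-- The form `α` is `x dx + y dy` on `U`. -/
def RepresentsForm (x y : smoothRing U) (α : OneForm) : Prop :=
  Represents x (fun q => α q (1, 0)) ∧ Represents y (fun q => α q (0, 1))

lemma RepresentsForm.wedge {x y x' y' : smoothRing U} {α β : OneForm} (hα : RepresentsForm x y α)
    (hβ : RepresentsForm x' y' β) : Represents (x * y' - y * x') (wedge α β) :=
  (hα.1.mul hβ.2).sub (hα.2.mul hβ.1)

lemma RepresentsForm.smul {x y f : smoothRing U} {α : OneForm} {F : Plane → ℝ}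
    (hf : Represents f F) (hα : RepresentsForm x y α) :
    RepresentsForm (f * x) (f * y) (fun q => F q • α q) :=
  ⟨hf.mul hα.1, hf.mul hα.2⟩

lemma RepresentsForm.add {x y x' y' : smoothRing U} {α β : OneForm} (hα : RepresentsForm x y α)
    (hβ : RepresentsForm x' y' β) : RepresentsForm (x + x') (y + y') (fun q => α q + β q) :=
  ⟨hα.1.add hβ.1, hα.2.add hβ.2⟩

lemma RepresentsForm.congr {x y : smoothRing U} {α β : OneForm} (hα : RepresentsForm x y α)
    (h : ∀ q ∈ U, α q = β q) : RepresentsForm x y β :=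
  ⟨hα.1.congr fun q hq => by rw [h q hq], hα.2.congr fun q hq => by rw [h q hq]⟩

lemma RepresentsForm.contDiffOn {x y : smoothRing U} {α : OneForm} (h : RepresentsForm x y α) :
    ContDiffOn ℝ ∞ α U := by
  have h1 : α = fun q => α q (1, 0) • ContinuousLinearMap.fst ℝ ℝ ℝ +
      α q (0, 1) • ContinuousLinearMap.snd ℝ ℝ ℝ := by
    funext q
    ext <;> simp
  rw [h1]
  exact (h.1.contDiffOn.smul contDiffOn_const).add (h.2.contDiffOn.smul contDiffOn_const)

lemma fderiv_form_apply {α : OneForm} {q : Plane} (h : DifferentiableAt ℝ α q) (v w : Plane) :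
    fderiv ℝ (fun r => α r w) q v = fderiv ℝ α q v w := by
  rw [fderiv_clm_apply h (differentiableAt_const w)]
  simp

lemma RepresentsForm.extD {x y : smoothRing U} {α : OneForm} (h : RepresentsForm x y α) :
    Represents (partialDeriv U (1, 0) y - partialDeriv U (0, 1) x) (extD α) := by
  refine ((h.2.partialDeriv (1, 0)).sub (h.1.partialDeriv (0, 1))).congr fun q hq => ?_
  have hd : DifferentiableAt ℝ α q :=
    (h.contDiffOn.contDiffAt (U.isOpen.mem_nhds hq)).differentiableAt (by simp)
  simp only [Pi.sub_apply, fderiv_form_apply hd]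
  rfl

lemma representsForm_fderiv {f : smoothRing U} {F : Plane → ℝ} (hf : Represents f F) :
    RepresentsForm (partialDeriv U (1, 0) f) (partialDeriv U (0, 1) f) (fderiv ℝ F) :=
  ⟨hf.partialDeriv _, hf.partialDeriv _⟩

namespace Normalization

variable {W : PlanarWeb 5} (N : Normalization W)

lemma nform_contDiffOn (i : Fin 5) : ContDiffOn ℝ ∞ (N.nform i) W.domain :=
  (N.scale_smooth i).smul (W.smooth i)

lemma wedge_nform (i j : Fin 5) (p : Plane) :
    wedge (N.nform i) (N.nform j) p =
      N.scale i p * N.scale j p * wedge (W.form i) (W.form j) p := by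
  simp only [wedge, nform, smul_apply, smul_eq_mul]
  ring

lemma wedge_nform_ne_zero {i j : Fin 5} (h : i ≠ j) {p : Plane} (hp : p ∈ W.domain) :
    wedge (N.nform i) (N.nform j) p ≠ 0 := by
  rw [wedge_nform]
  exact mul_ne_zero (mul_ne_zero (N.scale_ne_zero i p hp) (N.scale_ne_zero j p hp))
    (W.transverse i j h p hp)

lemma area_ne_zero {p : Plane} (hp : p ∈ W.domain) : N.area p ≠ 0 :=
  N.wedge_nform_ne_zero (by decide) hp

lemma nform_two {p : Plane} (hp : p ∈ W.domain) : N.nform 2 p = -(N.nform 0 p + N.nform 1 p) := by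
  rw [eq_neg_iff_add_eq_zero, add_comm]
  exact N.eq_three p hp

lemma nform_three {p : Plane} (hp : p ∈ W.domain) :
    N.nform 3 p = -(N.a p • N.nform 0 p + N.nform 1 p) := by
  rw [eq_neg_iff_add_eq_zero, add_comm]
  exact N.eq_four p hp

lemma nform_four {p : Plane} (hp : p ∈ W.domain) :
    N.nform 4 p = -(N.b p • N.nform 0 p + N.nform 1 p) := by
  rw [eq_neg_iff_add_eq_zero, add_comm]
  exact N.eq_five p hp

/-- It exhibits `a` as a quotient of wedge products. This gives `a ≠ 0` by transversality, and also
the smoothness of `a`, which is not part of the data of a normalization. -/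
lemma wedge_three_one {p : Plane} (hp : p ∈ W.domain) :
    wedge (N.nform 3) (N.nform 1) p = -(N.a p * N.area p) := by
  simp only [wedge, area, N.nform_three hp, neg_apply, add_apply, smul_apply, smul_eq_mul]
  ring

lemma wedge_four_one {p : Plane} (hp : p ∈ W.domain) :
    wedge (N.nform 4) (N.nform 1) p = -(N.b p * N.area p) := by
  simp only [wedge, area, N.nform_four hp, neg_apply, add_apply, smul_apply, smul_eq_mul]
  ring

lemma a_ne_zero {p : Plane} (hp : p ∈ W.domain) : N.a p ≠ 0 := fun h =>
  N.wedge_nform_ne_zero (i := 3) (j := 1) (by decide) hp (by rw [N.wedge_three_one hp, h]; simp)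

lemma b_ne_zero {p : Plane} (hp : p ∈ W.domain) : N.b p ≠ 0 := fun h =>
  N.wedge_nform_ne_zero (i := 4) (j := 1) (by decide) hp (by rw [N.wedge_four_one hp, h]; simp)

lemma one_sub_a_ne_zero {p : Plane} (hp : p ∈ W.domain) : 1 - N.a p ≠ 0 := fun h =>
  N.wedge_nform_ne_zero (i := 2) (j := 3) (by decide) hp (by
    simp only [wedge, N.nform_two hp, N.nform_three hp, neg_apply, add_apply, smul_apply,
      smul_eq_mul]
    linear_combination (N.nform 0 p (1, 0) * N.nform 1 p (0, 1) -
      N.nform 0 p (0, 1) * N.nform 1 p (1, 0)) * h)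

lemma one_sub_b_ne_zero {p : Plane} (hp : p ∈ W.domain) : 1 - N.b p ≠ 0 := fun h =>
  N.wedge_nform_ne_zero (i := 2) (j := 4) (by decide) hp (by
    simp only [wedge, N.nform_two hp, N.nform_four hp, neg_apply, add_apply, smul_apply,
      smul_eq_mul]
    linear_combination (N.nform 0 p (1, 0) * N.nform 1 p (0, 1) -
      N.nform 0 p (0, 1) * N.nform 1 p (1, 0)) * h)

lemma a_sub_b_ne_zero {p : Plane} (hp : p ∈ W.domain) : N.a p - N.b p ≠ 0 := fun h =>
  N.wedge_nform_ne_zero (i := 3) (j := 4) (by decide) hp (by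
    simp only [wedge, N.nform_three hp, N.nform_four hp, neg_apply, add_apply, smul_apply,
      smul_eq_mul]
    linear_combination (N.nform 0 p (1, 0) * N.nform 1 p (0, 1) -
      N.nform 0 p (0, 1) * N.nform 1 p (1, 0)) * h)

lemma area_contDiffOn : ContDiffOn ℝ ∞ N.area W.domain := by
  have h := N.nform_contDiffOn
  exact (((h 0).clm_apply contDiffOn_const).mul ((h 1).clm_apply contDiffOn_const)).sub
    (((h 0).clm_apply contDiffOn_const).mul ((h 1).clm_apply contDiffOn_const))

lemma wedge_nform_contDiffOn (i j : Fin 5) :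
    ContDiffOn ℝ ∞ (wedge (N.nform i) (N.nform j)) W.domain := by
  have h := N.nform_contDiffOn
  exact (((h i).clm_apply contDiffOn_const).mul ((h j).clm_apply contDiffOn_const)).sub
    (((h i).clm_apply contDiffOn_const).mul ((h j).clm_apply contDiffOn_const))

lemma a_contDiffOn : ContDiffOn ℝ ∞ N.a W.domain :=
  ((N.wedge_nform_contDiffOn 3 1).neg.div N.area_contDiffOn fun _ hp => N.area_ne_zero hp).congr
    fun p hp => by
      change N.a p = -wedge (N.nform 3) (N.nform 1) p / N.area p
      rw [N.wedge_three_one hp, neg_neg, mul_div_cancel_right₀ _ (N.area_ne_zero hp)]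

lemma b_contDiffOn : ContDiffOn ℝ ∞ N.b W.domain :=
  ((N.wedge_nform_contDiffOn 4 1).neg.div N.area_contDiffOn fun _ hp => N.area_ne_zero hp).congr
    fun p hp => by
      change N.b p = -wedge (N.nform 4) (N.nform 1) p / N.area p
      rw [N.wedge_four_one hp, neg_neg, mul_div_cancel_right₀ _ (N.area_ne_zero hp)]

section

variable (hU : (U : Set Plane) ⊆ W.domain)

/-- A coefficient of a normalized form as a smooth function on `U`. -/
def coeff (i : Fin 5) (v : Plane) : smoothRing U :=
  restrictTo (fun q => N.nform i q v) (((N.nform_contDiffOn i).mono hU).clm_apply contDiffOn_const)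

lemma representsForm_nform (i : Fin 5) :
    RepresentsForm (N.coeff hU i (1, 0)) (N.coeff hU i (0, 1)) (N.nform i) :=
  ⟨represents_restrictTo _ _, represents_restrictTo _ _⟩

/-- The coefficient of `ω₁ ∧ ω₂` as a smooth function on `U`. -/
def areaR : smoothRing U :=
  N.coeff hU 0 (1, 0) * N.coeff hU 1 (0, 1) - N.coeff hU 0 (0, 1) * N.coeff hU 1 (1, 0)

lemma represents_area : Represents (N.areaR hU) N.area :=
  (N.representsForm_nform hU 0).wedge (N.representsForm_nform hU 1)

/-- The inverse of the coefficient of `ω₁ ∧ ω₂`. -/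
def invArea : smoothRing U :=
  smoothInv (N.areaR hU) fun q => by
    rw [(N.represents_area hU).evalAt]
    exact N.area_ne_zero (hU q.2)

lemma invArea_mul : N.invArea hU * N.areaR hU = 1 := smoothInv_mul _ _

lemma represents_invArea : Represents (N.invArea hU) (fun q => (N.area q)⁻¹) :=
  (N.represents_area hU).smoothInv _

/-- The framed algebra of smooth functions on `U` defined by the normalized forms of a web. -/
def framed : FramedWebAlgebra (smoothRing U) where
  D₁ := (N.invArea hU * N.coeff hU 1 (0, 1)) • partialDeriv U (1, 0) -
    (N.invArea hU * N.coeff hU 1 (1, 0)) • partialDeriv U (0, 1)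
  D₂ := (N.invArea hU * N.coeff hU 0 (1, 0)) • partialDeriv U (0, 1) -
    (N.invArea hU * N.coeff hU 0 (0, 1)) • partialDeriv U (1, 0)
  g₁ := -(N.invArea hU * (partialDeriv U (1, 0) (N.coeff hU 1 (0, 1)) -
    partialDeriv U (0, 1) (N.coeff hU 1 (1, 0))))
  g₂ := N.invArea hU * (partialDeriv U (1, 0) (N.coeff hU 0 (0, 1)) -
    partialDeriv U (0, 1) (N.coeff hU 0 (1, 0)))
  a := restrictTo N.a (N.a_contDiffOn.mono hU)
  b := restrictTo N.b (N.b_contDiffOn.mono hU)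
  ia := smoothInv (restrictTo N.a (N.a_contDiffOn.mono hU)) fun q => N.a_ne_zero (hU q.2)
  ib := smoothInv (restrictTo N.b (N.b_contDiffOn.mono hU)) fun q => N.b_ne_zero (hU q.2)
  i1a := smoothInv (1 - restrictTo N.a (N.a_contDiffOn.mono hU)) fun q =>
    N.one_sub_a_ne_zero (hU q.2)
  i1b := smoothInv (1 - restrictTo N.b (N.b_contDiffOn.mono hU)) fun q =>
    N.one_sub_b_ne_zero (hU q.2)
  iab := smoothInv (restrictTo N.a (N.a_contDiffOn.mono hU) -
    restrictTo N.b (N.b_contDiffOn.mono hU)) fun q => N.a_sub_b_ne_zero (hU q.2)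
  comm f := frame_comm (partialDeriv U (1, 0)) (partialDeriv U (0, 1))
    (fun f => partialDeriv_comm _ _ f) (N.coeff hU 0 (1, 0)) (N.coeff hU 0 (0, 1))
    (N.coeff hU 1 (1, 0)) (N.coeff hU 1 (0, 1)) (N.invArea hU) (N.invArea_mul hU) f
  a_mul_ia := smoothInv_mul _ _
  b_mul_ib := smoothInv_mul _ _
  one_sub_a_mul := smoothInv_mul _ _
  one_sub_b_mul := smoothInv_mul _ _
  sub_mul_iab := smoothInv_mul _ _

lemma represents_a : Represents (N.framed hU).a N.a := fun _ => rfl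

lemma represents_b : Represents (N.framed hU).b N.b := fun _ => rfl

lemma represents_D₁ {f : smoothRing U} {F : Plane → ℝ} (hf : Represents f F) :
    Represents ((N.framed hU).D₁ f) (N.pd₁ F) := by
  have h := (N.represents_invArea hU).mul
    ((representsForm_fderiv hf).wedge (N.representsForm_nform hU 1))
  have h2 : (N.framed hU).D₁ f = N.invArea hU * (partialDeriv U (1, 0) f * N.coeff hU 1 (0, 1) -
      partialDeriv U (0, 1) f * N.coeff hU 1 (1, 0)) := by
    change N.invArea hU * N.coeff hU 1 (0, 1) * partialDeriv U (1, 0) f -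
      N.invArea hU * N.coeff hU 1 (1, 0) * partialDeriv U (0, 1) f = _
    ring
  rw [h2]
  refine h.congr fun q _ => ?_
  rw [pd₁, div_eq_mul_inv, mul_comm]
  rfl

lemma represents_D₂ {f : smoothRing U} {F : Plane → ℝ} (hf : Represents f F) :
    Represents ((N.framed hU).D₂ f) (N.pd₂ F) := by
  have h := (N.represents_invArea hU).mul
    ((N.representsForm_nform hU 0).wedge (representsForm_fderiv hf))
  have h2 : (N.framed hU).D₂ f = N.invArea hU * (N.coeff hU 0 (1, 0) * partialDeriv U (0, 1) f -
      N.coeff hU 0 (0, 1) * partialDeriv U (1, 0) f) := by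
    change N.invArea hU * N.coeff hU 0 (1, 0) * partialDeriv U (0, 1) f -
      N.invArea hU * N.coeff hU 0 (0, 1) * partialDeriv U (1, 0) f = _
    ring
  rw [h2]
  refine h.congr fun q _ => ?_
  rw [pd₂, div_eq_mul_inv, mul_comm]
  rfl

lemma represents_g₁ : Represents (N.framed hU).g₁ (chernCoeff₁ (N.nform 0) (N.nform 1)) :=
  ((N.represents_invArea hU).mul (N.representsForm_nform hU 1).extD).neg.congr fun q _ => by
    simp only [chernCoeff₁, Pi.neg_apply, Pi.mul_apply, area]
    ring

lemma represents_g₂ : Represents (N.framed hU).g₂ (chernCoeff₂ (N.nform 0) (N.nform 1)) :=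
  ((N.represents_invArea hU).mul (N.representsForm_nform hU 0).extD).congr fun q _ => by
    simp only [chernCoeff₂, Pi.mul_apply, area]
    ring

variable {N hU} {f g : smoothRing U} {F G : Plane → ℝ}

lemma _root_.PlanarWebs.Represents.δ₁ (hf : Represents f F) (k : ℕ) :
    Represents ((N.framed hU).δ₁ k f) (N.δ₁ k F) :=
  (N.represents_D₁ hU hf).sub (((represents_natCast k).mul (N.represents_g₁ hU)).mul hf)

lemma _root_.PlanarWebs.Represents.δ₂ (hf : Represents f F) (k : ℕ) :
    Represents ((N.framed hU).δ₂ k f) (N.δ₂ k F) :=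
  (N.represents_D₂ hU hf).sub (((represents_natCast k).mul (N.represents_g₂ hU)).mul hf)

lemma _root_.PlanarWebs.Represents.Δ₁ (hf : Represents f F) (k : ℕ) :
    Represents ((N.framed hU).Δ₁ k f) (N.Δ₁ k F) :=
  (hf.δ₁ k).sub (hf.δ₂ k)

lemma _root_.PlanarWebs.Represents.Δ₂ (hf : Represents f F) (k : ℕ) :
    Represents ((N.framed hU).Δ₂ k f) (N.Δ₂ k F) :=
  (hf.δ₁ k).sub (((N.represents_a hU).mul hf).δ₂ k)

lemma _root_.PlanarWebs.Represents.Δ₃ (hf : Represents f F) (k : ℕ) :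
    Represents ((N.framed hU).Δ₃ k f) (N.Δ₃ k F) :=
  (hf.δ₁ k).sub (((N.represents_b hU).mul hf).δ₂ k)

variable {w u v : smoothRing U} {w' u' v' : Plane → ℝ}

lemma represents_abelianOp (hw : Represents w w') (hu : Represents u u') (hv : Represents v v')
    (j : Fin 4) : Represents ((N.framed hU).abelianOp w u v j) (N.abelianOp w' u' v' j) := by
  fin_cases j
  · exact hw.Δ₁ 1
  · exact hu.Δ₂ 1
  · exact hv.Δ₃ 1
  · exact ((hw.δ₁ 1).add (hu.δ₁ 1)).add (hv.δ₁ 1)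

lemma represents_obstruction (hw : Represents w w') (hu : Represents u u')
    (hv : Represents v v') :
    Represents ((N.framed hU).obstruction w u v) (N.obstruction w' u' v') :=
  ((((((hw.δ₁ 1).Δ₃ 2).Δ₂ 3).Δ₁ 4).sub ((((hw.Δ₁ 1).Δ₃ 2).Δ₂ 3).δ₁ 4)).add
    (((((hu.δ₁ 1).Δ₃ 2).Δ₂ 3).Δ₁ 4).sub ((((hu.Δ₂ 1).Δ₃ 2).δ₁ 3).Δ₁ 4))).add
    (((((hv.δ₁ 1).Δ₃ 2).Δ₂ 3).Δ₁ 4).sub ((((hv.Δ₃ 1).δ₁ 2).Δ₂ 3).Δ₁ 4))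

end

end Normalization

end PlanarWebs

end

noncomputable section

namespace PlanarWebs

open TopologicalSpace (Opens)

/-! ### Curvature of the 3-subwebs -/

lemma represents_of_evalAt {U : Opens Plane} {f : smoothRing U} {F : Plane → ℝ}
    (h : ∀ q, evalAt q f = F q) : Represents f F := h

namespace FramedWebAlgebra

variable {R : Type} [CommRing R] (T : FramedWebAlgebra R)

/-- The curvature function of the `3`-web with the Chern form `γ + ρ₁ ω₁ + ρ₂ ω₂`. -/
def twistedCurvature (ρ₁ ρ₂ : R) : R := T.K + T.δ₁ 1 ρ₂ - T.δ₂ 1 ρ₁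

/-- `d(A ω₁ + B ω₂) = (A ω₁ + B ω₂) ∧ (γ + ρ₁ ω₁ + ρ₂ ω₂)`. -/
def StructureEq (A B ρ₁ ρ₂ : R) : Prop := T.D₁ B - T.D₂ A = A * ρ₂ - B * ρ₁

lemma derivation_inv (D : Derivation ℤ R R) {x y : R} (h : y * x = 1) :
    D y = -(y ^ 2 * D x) := by
  have h1 := congrArg D h
  rw [Derivation.leibniz, Derivation.map_one_eq_zero, smul_eq_mul, smul_eq_mul] at h1
  linear_combination y * h1 - D y * h

end FramedWebAlgebra

namespace Normalization

variable {W : PlanarWeb 5} (N : Normalization W) {U : Opens Plane}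
  (hU : (U : Set Plane) ⊆ W.domain)

/-- The form `α` is `A ω₁ + B ω₂` on `U`. -/
def RepresentsFrame (A B : smoothRing U) (α : OneForm) : Prop :=
  RepresentsForm (A * N.coeff hU 0 (1, 0) + B * N.coeff hU 1 (1, 0))
    (A * N.coeff hU 0 (0, 1) + B * N.coeff hU 1 (0, 1)) α

variable {N hU}

lemma RepresentsFrame.smul {A B f : smoothRing U} {α : OneForm} {F : Plane → ℝ}
    (hα : N.RepresentsFrame hU A B α) (hf : Represents f F) :
    N.RepresentsFrame hU (f * A) (f * B) (fun q => F q • α q) := by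
  have h := RepresentsForm.smul hf hα
  simp only [mul_add, ← mul_assoc] at h
  exact h

lemma RepresentsFrame.wedge {A B A' B' : smoothRing U} {α β : OneForm}
    (hα : N.RepresentsFrame hU A B α) (hβ : N.RepresentsFrame hU A' B' β) :
    Represents (N.areaR hU * (A * B' - B * A')) (wedge α β) := by
  convert! RepresentsForm.wedge hα hβ using 1
  rw [areaR]
  ring

lemma D₁_apply (f : smoothRing U) : (N.framed hU).D₁ f =
    N.invArea hU * N.coeff hU 1 (0, 1) * partialDeriv U (1, 0) f -
      N.invArea hU * N.coeff hU 1 (1, 0) * partialDeriv U (0, 1) f := rfl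

lemma D₂_apply (f : smoothRing U) : (N.framed hU).D₂ f =
    N.invArea hU * N.coeff hU 0 (1, 0) * partialDeriv U (0, 1) f -
      N.invArea hU * N.coeff hU 0 (0, 1) * partialDeriv U (1, 0) f := rfl

lemma framed_g₁ : (N.framed hU).g₁ = -(N.invArea hU * (partialDeriv U (1, 0) (N.coeff hU 1 (0, 1)) -
    partialDeriv U (0, 1) (N.coeff hU 1 (1, 0)))) := rfl

lemma framed_g₂ : (N.framed hU).g₂ = N.invArea hU * (partialDeriv U (1, 0) (N.coeff hU 0 (0, 1)) -
    partialDeriv U (0, 1) (N.coeff hU 0 (1, 0))) := rfl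

lemma RepresentsFrame.extD {A B : smoothRing U} {α : OneForm}
    (hα : N.RepresentsFrame hU A B α) :
    Represents (N.areaR hU * ((N.framed hU).D₁ B - (N.framed hU).D₂ A + A * (N.framed hU).g₂ -
      B * (N.framed hU).g₁)) (extD α) := by
  convert! RepresentsForm.extD hα using 1
  rw [D₁_apply, D₂_apply, framed_g₁, framed_g₂]
  simp only [map_add, Derivation.leibniz, smul_eq_mul]
  generalize hX : partialDeriv U (1, 0) = X
  generalize hY : partialDeriv U (0, 1) = Y
  have h := N.invArea_mul hU
  rw [areaR] at h ⊢
  linear_combination (X A * N.coeff hU 0 (0, 1) + A * X (N.coeff hU 0 (0, 1)) +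
    X B * N.coeff hU 1 (0, 1) + B * X (N.coeff hU 1 (0, 1)) - Y A * N.coeff hU 0 (1, 0) -
    A * Y (N.coeff hU 0 (1, 0)) - Y B * N.coeff hU 1 (1, 0) - B * Y (N.coeff hU 1 (1, 0))) * h

variable (N hU)

lemma exists_representsFrame (A B : smoothRing U) :
    ∃ α : OneForm, N.RepresentsFrame hU A B α :=
  ⟨fun q => extendZero A q • N.nform 0 q + extendZero B q • N.nform 1 q,
    (RepresentsForm.smul (represents_extendZero A) (N.representsForm_nform hU 0)).add
      (RepresentsForm.smul (represents_extendZero B) (N.representsForm_nform hU 1))⟩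

variable {N hU}

/-- By `chernForm_unique` any `C₁ ω₁ + C₂ ω₂` that satisfies the two structure equations is the
Chern form on `U`. It can thus be differentiated without its definition as a quotient. -/
lemma extD_chernForm {A₁ B₁ A₂ B₂ C₁ C₂ : smoothRing U} {η₁ η₂ : OneForm}
    (h₁ : N.RepresentsFrame hU A₁ B₁ η₁) (h₂ : N.RepresentsFrame hU A₂ B₂ η₂)
    (e₁ : (N.framed hU).D₁ B₁ - (N.framed hU).D₂ A₁ + A₁ * (N.framed hU).g₂ -
      B₁ * (N.framed hU).g₁ = A₁ * C₂ - B₁ * C₁)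
    (e₂ : (N.framed hU).D₁ B₂ - (N.framed hU).D₂ A₂ + A₂ * (N.framed hU).g₂ -
      B₂ * (N.framed hU).g₁ = A₂ * C₂ - B₂ * C₁)
    (hne : ∀ q ∈ U, wedge η₁ η₂ q ≠ 0) :
    Represents (N.areaR hU * ((N.framed hU).D₁ C₂ - (N.framed hU).D₂ C₁ +
      C₁ * (N.framed hU).g₂ - C₂ * (N.framed hU).g₁)) (extD (chernForm η₁ η₂)) := by
  obtain ⟨γ, hγ⟩ := N.exists_representsFrame hU C₁ C₂
  have key : ∀ q ∈ U, γ q = chernForm η₁ η₂ q := by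
    intro q hq
    rw [← chernForm_unique η₁ η₂ γ q (hne q hq)]
    have k₁ := h₁.extD
    have k₂ := h₂.extD
    rw [e₁] at k₁
    rw [e₂] at k₂
    exact ⟨k₁.eqOn (h₁.wedge hγ) hq, k₂.eqOn (h₂.wedge hγ) hq⟩
  have hγ' : N.RepresentsFrame hU C₁ C₂ (chernForm η₁ η₂) := RepresentsForm.congr hγ key
  exact hγ'.extD

lemma wedge_smul_smul (α β χ : OneForm) (q : Plane) :
    wedge (fun q => wedge β χ q • α q) (fun q => wedge χ α q • β q) q =
      wedge β χ q * wedge χ α q * wedge α β q := by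
  simp only [wedge, smul_apply, smul_eq_mul]
  ring

/-- The normalized forms prescribed by `curvatureForm` are those of the model forms `Aᵢ ω₁ + Bᵢ ω₂`,
all multiplied by the same function `σ`. A common factor changes the Chern form by the closed form
`dσ / σ` only, so the curvature depends on the slopes `Aᵢ`, `Bᵢ` and not on the multipliers `τᵢ`. -/
lemma curvatureForm_eq {A₁ B₁ A₂ B₂ A₃ B₃ τ₁ τ₂ τ₃ ρ₁ ρ₂ : smoothRing U} {α β χ : OneForm}
    (hα : N.RepresentsFrame hU (τ₁ * A₁) (τ₁ * B₁) α)
    (hβ : N.RepresentsFrame hU (τ₂ * A₂) (τ₂ * B₂) β)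
    (hχ : N.RepresentsFrame hU (τ₃ * A₃) (τ₃ * B₃) χ)
    (hτ : ∀ q, evalAt q τ₁ ≠ 0 ∧ evalAt q τ₂ ≠ 0 ∧ evalAt q τ₃ ≠ 0)
    (hne : ∀ q ∈ U, wedge β χ q ≠ 0 ∧ wedge χ α q ≠ 0 ∧ wedge α β q ≠ 0)
    (e₁ : (N.framed hU).StructureEq ((A₂ * B₃ - B₂ * A₃) * A₁) ((A₂ * B₃ - B₂ * A₃) * B₁) ρ₁ ρ₂)
    (e₂ : (N.framed hU).StructureEq ((A₃ * B₁ - B₃ * A₁) * A₂) ((A₃ * B₁ - B₃ * A₁) * B₂) ρ₁ ρ₂) :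
    Represents (N.areaR hU * (N.framed hU).twistedCurvature ρ₁ ρ₂) (curvatureForm α β χ) := by
  set σ := N.areaR hU * τ₁ * τ₂ * τ₃
  have hσ : ∀ q, evalAt q σ ≠ 0 := by
    intro q
    simp only [σ, map_mul]
    refine mul_ne_zero (mul_ne_zero (mul_ne_zero ?_ (hτ q).1) (hτ q).2.1) (hτ q).2.2
    rw [(N.represents_area hU).evalAt]
    exact N.area_ne_zero (hU q.2)
  obtain ⟨ι, hι⟩ : ∃ ι, ι * σ = 1 := ⟨_, smoothInv_mul σ hσ⟩
  have h₁ := hα.smul (hβ.wedge hχ)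
  have h₂ := hβ.smul (hχ.wedge hα)
  simp only [FramedWebAlgebra.StructureEq] at e₁ e₂
  have s₁ : N.RepresentsFrame hU (σ * ((A₂ * B₃ - B₂ * A₃) * A₁)) (σ * ((A₂ * B₃ - B₂ * A₃) * B₁))
      (fun q => wedge β χ q • α q) := by
    convert! h₁ using 1 <;> simp only [σ] <;> ring
  have s₂ : N.RepresentsFrame hU (σ * ((A₃ * B₁ - B₃ * A₁) * A₂)) (σ * ((A₃ * B₁ - B₃ * A₁) * B₂))
      (fun q => wedge χ α q • β q) := by
    convert! h₂ using 1 <;> simp only [σ] <;> ring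
  generalize (A₂ * B₃ - B₂ * A₃) * A₁ = P₁ at *
  generalize (A₂ * B₃ - B₂ * A₃) * B₁ = Q₁ at *
  generalize (A₃ * B₁ - B₃ * A₁) * A₂ = P₂ at *
  generalize (A₃ * B₁ - B₃ * A₁) * B₂ = Q₂ at *
  -- These are the coefficients of `γ + ρ₁ ω₁ + ρ₂ ω₂ - dσ / σ`, where `ι` is the inverse of `σ`.
  have h := extD_chernForm (C₁ := (N.framed hU).g₁ + ρ₁ - ι * (N.framed hU).D₁ σ) (C₂ := (N.framed hU).g₂ + ρ₂ - ι * (N.framed hU).D₂ σ) s₁ s₂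
    (by
      simp only [Derivation.leibniz, smul_eq_mul]
      linear_combination σ * e₁ + (Q₁ * (N.framed hU).D₁ σ - P₁ * (N.framed hU).D₂ σ) * (-hι))
    (by
      simp only [Derivation.leibniz, smul_eq_mul]
      linear_combination σ * e₂ + (Q₂ * (N.framed hU).D₁ σ - P₂ * (N.framed hU).D₂ σ) * (-hι))
    (fun q hq => by
      rw [wedge_smul_smul]
      exact mul_ne_zero (mul_ne_zero (hne q hq).1 (hne q hq).2.1) (hne q hq).2.2)
  convert! h using 1
  congr 1
  simp only [FramedWebAlgebra.twistedCurvature, FramedWebAlgebra.K, FramedWebAlgebra.δ₁,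
    FramedWebAlgebra.δ₂, map_add, map_sub, Derivation.leibniz, smul_eq_mul, (N.framed hU).comm,
    FramedWebAlgebra.derivation_inv _ hι]
  push_cast
  ring

variable (N hU)

/-- The forms of the web are multiples of `A ω₁ + B ω₂` with these functions `A`. -/
def slopeA : Fin 5 → smoothRing U := ![1, 0, 1, (N.framed hU).a, (N.framed hU).b]

/-- The forms of the web are multiples of `A ω₁ + B ω₂` with these functions `B`. -/
def slopeB : Fin 5 → smoothRing U := ![0, 1, 1, 1, 1]

/-- The multipliers in the expression of the forms of the web. -/
def slopeScale (i : Fin 5) : smoothRing U :=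
  (![1, 1, -1, -1, -1] : Fin 5 → smoothRing U) i *
    restrictTo (fun q => (N.scale i q)⁻¹) (((N.scale_smooth i).mono hU).inv fun q hq =>
      N.scale_ne_zero i q (hU hq))

lemma slopeScale_ne_zero (i : Fin 5) (q : U) : evalAt q (N.slopeScale hU i) ≠ 0 := by
  rw [slopeScale, map_mul, (represents_restrictTo _ _).evalAt]
  refine mul_ne_zero ?_ (inv_ne_zero (N.scale_ne_zero i q (hU q.2)))
  fin_cases i <;> simp

lemma evalAt_coeff (i : Fin 5) (v : Plane) (q : U) :
    evalAt q (N.coeff hU i v) = N.nform i q v := rfl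

lemma representsFrame_form (i : Fin 5) :
    N.RepresentsFrame hU (N.slopeScale hU i * N.slopeA hU i) (N.slopeScale hU i * slopeB i)
      (W.form i) := by
  have hA : ∀ q : U, evalAt q (N.slopeA hU i) = (![1, 0, 1, N.a q, N.b q] : Fin 5 → ℝ) i := by
    intro q
    fin_cases i <;> rfl
  have hB : ∀ q : U, evalAt q (slopeB i) = (![0, 1, 1, 1, 1] : Fin 5 → ℝ) i := by
    intro q
    fin_cases i <;> rfl
  have hS : ∀ q : U, evalAt q (N.slopeScale hU i) =
      (![1, 1, -1, -1, -1] : Fin 5 → ℝ) i * (N.scale i q)⁻¹ := by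
    intro q
    rw [slopeScale, map_mul, (represents_restrictTo _ _).evalAt]
    fin_cases i <;> simp
  have key : ∀ (q : U) (v : Plane), W.form i q v =
      (![1, 1, -1, -1, -1] : Fin 5 → ℝ) i * (N.scale i q)⁻¹ *
        ((![1, 0, 1, N.a q, N.b q] : Fin 5 → ℝ) i * N.nform 0 q v +
          (![0, 1, 1, 1, 1] : Fin 5 → ℝ) i * N.nform 1 q v) := by
    intro q v
    have hs := N.scale_ne_zero i q (hU q.2)
    have h1 : W.form i q v = (N.scale i q)⁻¹ * N.nform i q v := by
      simp only [nform, smul_apply, smul_eq_mul]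
      field_simp
    have h2 := N.nform_two (hU q.2)
    have h3 := N.nform_three (hU q.2)
    have h4 := N.nform_four (hU q.2)
    rw [h1]
    fin_cases i <;> simp [h2, h3, h4] <;> ring
  constructor <;> refine represents_of_evalAt fun q => ?_
  · simp only [map_add, map_mul, hA, hB, hS, evalAt_coeff]
    rw [key q (1, 0)]
    ring
  · simp only [map_add, map_mul, hA, hB, hS, evalAt_coeff]
    rw [key q (0, 1)]
    ring

lemma subwebCurvature_eq {i j k : Fin 5} (hij : i ≠ j) (hjk : j ≠ k) (hki : k ≠ i)
    {ρ₁ ρ₂ : smoothRing U}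
    (e₁ : (N.framed hU).StructureEq
      ((N.slopeA hU j * slopeB k - slopeB j * N.slopeA hU k) * N.slopeA hU i)
      ((N.slopeA hU j * slopeB k - slopeB j * N.slopeA hU k) * slopeB i) ρ₁ ρ₂)
    (e₂ : (N.framed hU).StructureEq
      ((N.slopeA hU k * slopeB i - slopeB k * N.slopeA hU i) * N.slopeA hU j)
      ((N.slopeA hU k * slopeB i - slopeB k * N.slopeA hU i) * slopeB j) ρ₁ ρ₂) (q : U) :
    N.subwebCurvature i j k q = evalAt q ((N.framed hU).twistedCurvature ρ₁ ρ₂) := by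
  have h := curvatureForm_eq (N.representsFrame_form hU i) (N.representsFrame_form hU j)
    (N.representsFrame_form hU k) (fun q => ⟨N.slopeScale_ne_zero hU i q,
      N.slopeScale_ne_zero hU j q, N.slopeScale_ne_zero hU k q⟩)
    (fun q hq => ⟨W.transverse j k hjk q (hU hq), W.transverse k i hki q (hU hq),
      W.transverse i j hij q (hU hq)⟩) e₁ e₂
  rw [subwebCurvature, ← h.evalAt q, map_mul, (N.represents_area hU).evalAt,
    mul_div_cancel_left₀ _ (N.area_ne_zero (hU q.2))]

end Normalization

end PlanarWebs

end

/-! ### The mean curvature as the coefficient of `w₂₂` in the obstruction -/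

noncomputable section

namespace PlanarWebs

open TopologicalSpace (Opens)

namespace FramedWebAlgebra

variable {R : Type} [CommRing R] (T : FramedWebAlgebra R)

/-- The sum of the curvature functions of the ten `3`-subwebs. -/
def curvatureSum : R :=
    10 * T.K + T.a * T.δ₂ 0 T.a * T.δ₂ 0 T.b * T.i1a ^ 2 * T.i1b + 2 * T.a * T.δ₂ 0 T.a * T.δ₂ 0
    T.b * T.iab ^ 2 + T.a * T.δ₂ 1 (T.δ₂ 0 T.a) * T.iab + T.a * T.δ₁ 0 T.a * T.δ₂ 0 T.b * T.ia ^
    2 * T.ib + T.a * (T.δ₂ 0 T.b) ^ 2 * T.i1a * T.i1b ^ 2 + T.a * T.δ₂ 0 T.b * T.δ₁ 0 T.b * T.ia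
    * T.ib ^ 2 + T.a * T.δ₂ 1 (T.δ₂ 0 T.b) * T.i1a * T.i1b + (T.δ₂ 0 T.a) ^ 2 * T.b * T.i1a ^ 2
    * T.i1b + (T.δ₂ 0 T.a) ^ 2 * T.i1a ^ 2 * T.iab + (T.δ₂ 0 T.a) ^ 2 * T.iab + (T.δ₂ 0 T.a) ^ 2
    * T.iab ^ 2 + T.δ₂ 0 T.a * T.δ₁ 0 T.a * T.b * T.ia ^ 2 * T.ib + T.δ₂ 0 T.a * T.δ₁ 0 T.a *
    T.i1a ^ 2 * T.i1b + 2 * T.δ₂ 0 T.a * T.δ₁ 0 T.a * T.i1a * T.iab ^ 2 + 2 * T.δ₂ 0 T.a * T.δ₁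
    0 T.a * T.ia ^ 2 + T.δ₂ 0 T.a * T.b * T.δ₂ 0 T.b * T.i1a * T.i1b ^ 2 + T.δ₂ 0 T.a * T.b *
    T.δ₁ 0 T.b * T.ia * T.ib ^ 2 + 2 * T.δ₂ 0 T.a * T.δ₂ 0 T.b * T.i1a * T.i1b + 2 * T.δ₂ 0 T.a
    * T.δ₂ 0 T.b * T.i1a * T.iab ^ 2 + T.δ₂ 0 T.a * T.δ₁ 0 T.b * T.i1a ^ 2 * T.iab + T.δ₂ 0 T.a
    * T.δ₁ 0 T.b * T.i1a * T.i1b ^ 2 + T.δ₂ 0 T.a * T.δ₁ 0 T.b * T.iab ^ 2 + T.δ₂ 1 (T.δ₂ 0 T.a)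
    * T.b * T.i1a * T.i1b + T.δ₂ 1 (T.δ₂ 0 T.a) * T.i1a * T.iab + (T.δ₁ 0 T.a) ^ 2 * T.b * T.ia
    ^ 2 * T.iab * T.ib + (T.δ₁ 0 T.a) ^ 2 * T.b * T.ia * T.iab ^ 2 * T.ib + (T.δ₁ 0 T.a) ^ 2 *
    T.i1a ^ 2 + (T.δ₁ 0 T.a) ^ 2 * T.i1a ^ 2 * T.iab + T.δ₁ 0 T.a * T.b * T.δ₁ 0 T.b * T.ia *
    T.iab * T.ib ^ 2 + T.δ₁ 0 T.a * T.δ₂ 0 T.b * T.i1a ^ 2 * T.iab + T.δ₁ 0 T.a * T.δ₂ 0 T.b *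
    T.iab ^ 2 + T.δ₁ 0 T.a * T.δ₁ 0 T.b * T.i1a ^ 2 * T.i1b + 2 * T.δ₁ 0 T.a * T.δ₁ 0 T.b *
    T.i1a * T.iab ^ 2 + T.δ₂ 1 (T.δ₁ 0 T.a) * T.i1a * T.i1b + T.δ₂ 1 (T.δ₁ 0 T.a) * T.iab + T.δ₁
    1 (T.δ₁ 0 T.a) * T.i1a + T.δ₁ 1 (T.δ₁ 0 T.a) * T.i1a * T.iab + T.δ₁ 1 (T.δ₁ 0 T.a) * T.ia +
    T.b * (T.δ₁ 0 T.b) ^ 2 * T.ia * T.iab ^ 2 * T.ib + T.b * T.δ₁ 1 (T.δ₁ 0 T.b) * T.ia * T.iab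
    * T.ib + (T.δ₂ 0 T.b) ^ 2 * T.iab ^ 2 + 2 * T.δ₂ 0 T.b * T.δ₁ 0 T.b * T.i1a * T.iab ^ 2 + 2
    * T.δ₂ 0 T.b * T.δ₁ 0 T.b * T.ib ^ 2 + T.δ₂ 1 (T.δ₂ 0 T.b) * T.iab + (T.δ₁ 0 T.b) ^ 2 *
    T.i1a * T.i1b ^ 2 + (T.δ₁ 0 T.b) ^ 2 * T.i1b ^ 2 + (T.δ₁ 0 T.b) ^ 2 * T.ia * T.iab * T.ib +
    2 * T.δ₂ 1 (T.δ₁ 0 T.b) * T.i1a * T.iab + T.δ₁ 1 (T.δ₁ 0 T.b) * T.i1a * T.i1b + T.δ₁ 1 (T.δ₁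
    0 T.b) * T.i1b + T.δ₁ 1 (T.δ₁ 0 T.b) * T.ia * T.ib + T.δ₁ 1 (T.δ₁ 0 T.b) * T.ib - T.a *
    (T.δ₂ 0 T.a) ^ 2 * T.iab ^ 2 - T.a * T.δ₁ 0 T.a * T.δ₂ 0 T.b * T.i1a ^ 2 * T.i1b - T.a *
    (T.δ₂ 0 T.b) ^ 2 * T.iab ^ 2 - T.a * T.δ₂ 0 T.b * T.δ₁ 0 T.b * T.i1a * T.i1b ^ 2 - T.a *
    T.δ₂ 1 (T.δ₂ 0 T.b) * T.iab - T.a * T.δ₂ 1 (T.δ₁ 0 T.b) * T.i1a * T.i1b - T.a * T.δ₂ 1 (T.δ₁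
    0 T.b) * T.ia * T.ib - (T.δ₂ 0 T.a) ^ 2 * T.i1a ^ 2 - (T.δ₂ 0 T.a) ^ 2 * T.i1a ^ 2 * T.i1b -
    (T.δ₂ 0 T.a) ^ 2 * T.i1a * T.iab ^ 2 - T.δ₂ 0 T.a * T.δ₁ 0 T.a * T.b * T.i1a ^ 2 * T.i1b - 2
    * T.δ₂ 0 T.a * T.δ₁ 0 T.a * T.i1a ^ 2 * T.iab - T.δ₂ 0 T.a * T.δ₁ 0 T.a * T.iab ^ 2 - T.δ₂ 0
    T.a * T.b * T.δ₁ 0 T.b * T.i1a * T.i1b ^ 2 - T.δ₂ 0 T.a * T.δ₂ 0 T.b * T.i1a ^ 2 * T.iab -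
    T.δ₂ 0 T.a * T.δ₂ 0 T.b * T.i1a * T.i1b ^ 2 - T.δ₂ 0 T.a * T.δ₂ 0 T.b * T.iab - 2 * T.δ₂ 0
    T.a * T.δ₂ 0 T.b * T.iab ^ 2 - T.δ₂ 0 T.a * T.δ₁ 0 T.b * T.i1a ^ 2 * T.i1b - T.δ₂ 0 T.a *
    T.δ₁ 0 T.b * T.i1a * T.i1b - 2 * T.δ₂ 0 T.a * T.δ₁ 0 T.b * T.i1a * T.iab ^ 2 - T.δ₂ 0 T.a *
    T.δ₁ 0 T.b * T.ia * T.ib - T.δ₂ 1 (T.δ₂ 0 T.a) - T.δ₂ 1 (T.δ₂ 0 T.a) * T.i1a - T.δ₂ 1 (T.δ₂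
    0 T.a) * T.i1a * T.i1b - T.δ₂ 1 (T.δ₂ 0 T.a) * T.iab - (T.δ₁ 0 T.a) ^ 2 * T.i1a * T.iab ^ 2
    - (T.δ₁ 0 T.a) ^ 2 * T.ia ^ 2 - T.δ₁ 0 T.a * T.b * T.δ₁ 0 T.b * T.ia ^ 2 * T.iab * T.ib - 2
    * T.δ₁ 0 T.a * T.b * T.δ₁ 0 T.b * T.ia * T.iab ^ 2 * T.ib - T.δ₁ 0 T.a * T.δ₂ 0 T.b * T.i1a
    * T.i1b - 2 * T.δ₁ 0 T.a * T.δ₂ 0 T.b * T.i1a * T.iab ^ 2 - T.δ₁ 0 T.a * T.δ₂ 0 T.b * T.ia *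
    T.ib - T.δ₁ 0 T.a * T.δ₁ 0 T.b * T.i1a ^ 2 * T.iab - T.δ₁ 0 T.a * T.δ₁ 0 T.b * T.ia ^ 2 *
    T.ib - T.δ₁ 0 T.a * T.δ₁ 0 T.b * T.ia * T.iab * T.ib - T.δ₂ 1 (T.δ₁ 0 T.a) * T.b * T.i1a *
    T.i1b - T.δ₂ 1 (T.δ₁ 0 T.a) * T.b * T.ia * T.ib - 2 * T.δ₂ 1 (T.δ₁ 0 T.a) * T.i1a * T.iab -
    2 * T.δ₂ 1 (T.δ₁ 0 T.a) * T.ia - T.δ₁ 1 (T.δ₁ 0 T.a) * T.b * T.ia * T.iab * T.ib - T.b *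
    (T.δ₁ 0 T.b) ^ 2 * T.ia * T.iab * T.ib ^ 2 - (T.δ₂ 0 T.b) ^ 2 * T.i1a * T.iab ^ 2 - (T.δ₂ 0
    T.b) ^ 2 * T.i1b ^ 2 - T.δ₂ 0 T.b * T.δ₁ 0 T.b * T.i1a * T.i1b ^ 2 - T.δ₂ 0 T.b * T.δ₁ 0 T.b
    * T.iab ^ 2 - T.δ₂ 1 (T.δ₂ 0 T.b) * T.i1a * T.iab - T.δ₂ 1 (T.δ₂ 0 T.b) * T.i1b - (T.δ₁ 0
    T.b) ^ 2 * T.i1a * T.iab ^ 2 - (T.δ₁ 0 T.b) ^ 2 * T.ia * T.ib ^ 2 - (T.δ₁ 0 T.b) ^ 2 * T.ib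
    ^ 2 - T.δ₂ 1 (T.δ₁ 0 T.b) * T.i1a * T.i1b - T.δ₂ 1 (T.δ₁ 0 T.b) * T.iab - 2 * T.δ₂ 1 (T.δ₁ 0
    T.b) * T.ib - T.δ₁ 1 (T.δ₁ 0 T.b) * T.i1a * T.iab

/-- The coefficients `ρ₁`, `ρ₂` in the Chern form of the subweb `[1,4,5]`. -/
def rho₁₄₅ : Fin 2 → R :=
  ![T.D₂ T.a - T.a * (T.iab * (T.D₂ T.a - T.D₂ T.b)), -(T.iab * (T.D₂ T.a - T.D₂ T.b))]

/-- The coefficients `ρ₁`, `ρ₂` in the Chern form of the subweb `[2,4,5]`. -/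
def rho₂₄₅ : Fin 2 → R :=
  ![-(T.iab * (T.D₁ T.a - T.D₁ T.b)),
    T.ia * T.ib * (T.D₁ T.b - (T.D₂ T.a * T.b + T.a * T.D₂ T.b) -
      T.b * (T.iab * (T.D₁ T.a - T.D₁ T.b)))]

/-- The difference of the coefficients `ρ₂` and `ρ₁` in the Chern form of the subweb `[3,4,5]`. -/
def rhoDiff : R := T.iab * (T.D₁ T.a - T.D₁ T.b - T.D₂ T.a + T.D₂ T.b)

/-- The coefficient `ρ₂` in the Chern form of the subweb `[3,4,5]`. -/
def rho₃₄₅ : R :=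
  T.i1a * (T.i1b * (T.D₁ T.b - (T.D₂ T.b * T.a + (T.b - 1) * T.D₂ T.a)) + T.rhoDiff)

lemma derivation_invs (D : Derivation ℤ R R) :
    D T.ia = -(T.ia ^ 2 * D T.a) ∧ D T.ib = -(T.ib ^ 2 * D T.b) ∧
      D T.i1a = T.i1a ^ 2 * D T.a ∧ D T.i1b = T.i1b ^ 2 * D T.b ∧
      D T.iab = -(T.iab ^ 2 * (D T.a - D T.b)) := by
  refine ⟨derivation_inv D T.a_mul_ia, derivation_inv D T.b_mul_ib, ?_, ?_, ?_⟩
  · rw [derivation_inv D T.one_sub_a_mul, map_sub, Derivation.map_one_eq_zero]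
    ring
  · rw [derivation_inv D T.one_sub_b_mul, map_sub, Derivation.map_one_eq_zero]
    ring
  · rw [derivation_inv D T.sub_mul_iab, map_sub]

/-- The summands belong to the subwebs `123, 124, 125, 134, 135, 145, 234, 235, 245, 345`, in this
order. The expanded polynomial in the covariant derivatives of `a` and `b` is the form that can be
compared with the elimination. -/
lemma curvatureSum_eq : T.curvatureSum =
    T.twistedCurvature 0 0 + T.twistedCurvature 0 (-(T.ia * T.D₂ T.a)) +
      T.twistedCurvature 0 (-(T.ib * T.D₂ T.b)) +
      T.twistedCurvature (T.i1a * T.D₂ T.a) (T.i1a * T.D₂ T.a) +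
      T.twistedCurvature (T.i1b * T.D₂ T.b) (T.i1b * T.D₂ T.b) +
      T.twistedCurvature (T.rho₁₄₅ 0) (T.rho₁₄₅ 1) +
      T.twistedCurvature (T.i1a * T.D₁ T.a) (T.i1a * T.D₁ T.a + T.ia * (T.D₁ T.a - T.D₂ T.a)) +
      T.twistedCurvature (T.i1b * T.D₁ T.b) (T.i1b * T.D₁ T.b + T.ib * (T.D₁ T.b - T.D₂ T.b)) +
      T.twistedCurvature (T.rho₂₄₅ 0) (T.rho₂₄₅ 1) +
      T.twistedCurvature (T.rho₃₄₅ - T.rhoDiff) T.rho₃₄₅ := by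
  obtain ⟨h1, h2, h3, h4, h5⟩ := T.derivation_invs T.D₁
  obtain ⟨k1, k2, k3, k4, k5⟩ := T.derivation_invs T.D₂
  simp only [curvatureSum, twistedCurvature, rho₁₄₅, rho₂₄₅, rho₃₄₅, rhoDiff, δ₁, δ₂,
    Matrix.cons_val_zero, Matrix.cons_val_one, map_add, map_sub, map_neg, map_zero,
    Derivation.map_one_eq_zero, Derivation.map_natCast, Derivation.leibniz, smul_eq_mul, T.comm,
    h1, h2, h3, h4, h5, k1, k2, k3, k4, k5, Nat.cast_zero, Nat.cast_one, zero_mul, sub_zero]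
  ring

/-- This is where `c₀` becomes the curvature. Once the first and second covariant derivatives of
`a`, `b` and the curvature `K` are regarded as independent variables, the claim is an identity of
rational functions with denominators built from `a`, `b`, `1 - a`, `1 - b`, `a - b`. The field `ℝ`
as target allows these denominators to be cleared. -/
lemma map_leadObstruction (φ : R →+* ℝ) :
    φ (Polynomial.eval 1 T.graded.leadObstruction) =
      -(1 - φ T.a) * (1 - φ T.b) * φ T.curvatureSum := by
  have ha : T.graded.a = Polynomial.monomial 0 T.a := rfl
  have hb : T.graded.b = Polynomial.monomial 0 T.b := rfl
  have hK : T.graded.K = Polynomial.monomial 2 T.K := rfl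
  have e1 : T.graded.ia = Polynomial.monomial 0 T.ia := rfl
  have e2 : T.graded.ib = Polynomial.monomial 0 T.ib := rfl
  have e3 : T.graded.i1a = Polynomial.monomial 0 T.i1a := rfl
  have e4 : T.graded.i1b = Polynomial.monomial 0 T.i1b := rfl
  have e5 : T.graded.iab = Polynomial.monomial 0 T.iab := rfl
  have f1 := congrArg φ T.a_mul_ia
  have f2 := congrArg φ T.b_mul_ib
  have f3 := congrArg φ T.one_sub_a_mul
  have f4 := congrArg φ T.one_sub_b_mul
  have f5 := congrArg φ T.sub_mul_iab
  simp only [map_mul, map_one, map_sub] at f1 f2 f3 f4 f5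
  have n1 := right_ne_zero_of_mul_eq_one f1
  have n2 := right_ne_zero_of_mul_eq_one f2
  have n3 := right_ne_zero_of_mul_eq_one f3
  have n4 := right_ne_zero_of_mul_eq_one f4
  have n5 := right_ne_zero_of_mul_eq_one f5
  simp only [GradedWebAlgebra.leadObstruction, GradedWebAlgebra.leadU, GradedWebAlgebra.leadV,
    GradedWebAlgebra.leadW₃, GradedWebAlgebra.leadU₃, GradedWebAlgebra.leadV₃, ha, hb, hK, e1, e2,
    e3, e4, e5, graded_d₁, graded_d₂, Polynomial.eval_add, Polynomial.eval_sub,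
    Polynomial.eval_mul, Polynomial.eval_neg, Polynomial.eval_pow, Polynomial.eval_monomial,
    Polynomial.eval_one, Polynomial.eval_ofNat, one_pow, mul_one, zero_add, curvatureSum, map_add,
    map_sub, map_mul, map_neg, map_pow, map_one, map_ofNat, Nat.reduceAdd,
    eq_inv_of_mul_eq_one_left f1, eq_inv_of_mul_eq_one_left f2, eq_inv_of_mul_eq_one_left f3,
    eq_inv_of_mul_eq_one_left f4, eq_inv_of_mul_eq_one_left f5]
  generalize φ T.a = a at *
  generalize φ T.b = b at *
  generalize φ (T.δ₁ 0 T.a) = a₁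
  generalize φ (T.δ₂ 0 T.a) = a₂
  generalize φ (T.δ₁ 0 T.b) = b₁
  generalize φ (T.δ₂ 0 T.b) = b₂
  generalize φ (T.δ₁ 1 (T.δ₁ 0 T.a)) = a₁₁
  generalize φ (T.δ₂ 1 (T.δ₁ 0 T.a)) = a₁₂
  generalize φ (T.δ₂ 1 (T.δ₂ 0 T.a)) = a₂₂
  generalize φ (T.δ₁ 1 (T.δ₁ 0 T.b)) = b₁₁
  generalize φ (T.δ₂ 1 (T.δ₁ 0 T.b)) = b₁₂
  generalize φ (T.δ₂ 1 (T.δ₂ 0 T.b)) = b₂₂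
  generalize φ T.K = k
  clear f1 f2 f3 f4 f5
  field_simp
  ring

end FramedWebAlgebra

namespace Normalization

variable {W : PlanarWeb 5} (N : Normalization W) {U : Opens Plane}
  (hU : (U : Set Plane) ⊆ W.domain)

/-- For each triple the two structure equations are linear in `ρ₁`, `ρ₂`, and their solution is
inserted. The checks use nothing but the relations that define the inverses of `a`, `b`, `1 - a`, `1
- b`, `a - b`. -/
lemma evalAt_curvatureSum (q : U) :
    evalAt q (N.framed hU).curvatureSum = 10 * N.curvature q := by
  have ha := (N.framed hU).a_mul_ia
  have hb := (N.framed hU).b_mul_ib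
  have h1a := (N.framed hU).one_sub_a_mul
  have h1b := (N.framed hU).one_sub_b_mul
  have hab := (N.framed hU).sub_mul_iab
  have s0 := N.subwebCurvature_eq hU (i := 0) (j := 1) (k := 2) (by decide) (by decide) (by decide)
    (ρ₁ := 0) (ρ₂ := 0)
    (by simp only [FramedWebAlgebra.StructureEq, FramedWebAlgebra.rho₁₄₅, FramedWebAlgebra.rho₂₄₅,
          FramedWebAlgebra.rho₃₄₅, FramedWebAlgebra.rhoDiff, slopeA, slopeB, Matrix.cons_val,
          map_sub, map_zero, Derivation.map_one_eq_zero, Derivation.leibniz, smul_eq_mul]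
        ring)
    (by simp only [FramedWebAlgebra.StructureEq, FramedWebAlgebra.rho₁₄₅, FramedWebAlgebra.rho₂₄₅,
          FramedWebAlgebra.rho₃₄₅, FramedWebAlgebra.rhoDiff, slopeA, slopeB, Matrix.cons_val,
          map_sub, map_zero, Derivation.map_one_eq_zero, Derivation.leibniz, smul_eq_mul]
        ring) q
  have s1 := N.subwebCurvature_eq hU (i := 0) (j := 1) (k := 3) (by decide) (by decide) (by decide)
    (ρ₁ := 0) (ρ₂ := -((N.framed hU).ia * (N.framed hU).D₂ (N.framed hU).a))
    (by simp only [FramedWebAlgebra.StructureEq, FramedWebAlgebra.rho₁₄₅, FramedWebAlgebra.rho₂₄₅,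
          FramedWebAlgebra.rho₃₄₅, FramedWebAlgebra.rhoDiff, slopeA, slopeB, Matrix.cons_val,
          map_sub, map_zero, Derivation.map_one_eq_zero, Derivation.leibniz, smul_eq_mul]
        linear_combination -(N.framed hU).D₂ (N.framed hU).a * ha)
    (by simp only [FramedWebAlgebra.StructureEq, FramedWebAlgebra.rho₁₄₅, FramedWebAlgebra.rho₂₄₅,
          FramedWebAlgebra.rho₃₄₅, FramedWebAlgebra.rhoDiff, slopeA, slopeB, Matrix.cons_val,
          map_sub, map_zero, Derivation.map_one_eq_zero, Derivation.leibniz, smul_eq_mul]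
        ring) q
  have s2 := N.subwebCurvature_eq hU (i := 0) (j := 1) (k := 4) (by decide) (by decide) (by decide)
    (ρ₁ := 0) (ρ₂ := -((N.framed hU).ib * (N.framed hU).D₂ (N.framed hU).b))
    (by simp only [FramedWebAlgebra.StructureEq, FramedWebAlgebra.rho₁₄₅, FramedWebAlgebra.rho₂₄₅,
          FramedWebAlgebra.rho₃₄₅, FramedWebAlgebra.rhoDiff, slopeA, slopeB, Matrix.cons_val,
          map_sub, map_zero, Derivation.map_one_eq_zero, Derivation.leibniz, smul_eq_mul]
        linear_combination -(N.framed hU).D₂ (N.framed hU).b * hb)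
    (by simp only [FramedWebAlgebra.StructureEq, FramedWebAlgebra.rho₁₄₅, FramedWebAlgebra.rho₂₄₅,
          FramedWebAlgebra.rho₃₄₅, FramedWebAlgebra.rhoDiff, slopeA, slopeB, Matrix.cons_val,
          map_sub, map_zero, Derivation.map_one_eq_zero, Derivation.leibniz, smul_eq_mul]
        ring) q
  have s3 := N.subwebCurvature_eq hU (i := 0) (j := 2) (k := 3) (by decide) (by decide) (by decide)
    (ρ₁ := (N.framed hU).i1a * (N.framed hU).D₂ (N.framed hU).a) (ρ₂ := (N.framed hU).i1a * (N.framed hU).D₂ (N.framed hU).a)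
    (by simp only [FramedWebAlgebra.StructureEq, FramedWebAlgebra.rho₁₄₅, FramedWebAlgebra.rho₂₄₅,
          FramedWebAlgebra.rho₃₄₅, FramedWebAlgebra.rhoDiff, slopeA, slopeB, Matrix.cons_val,
          map_sub, map_zero, Derivation.map_one_eq_zero, Derivation.leibniz, smul_eq_mul]
        linear_combination -(N.framed hU).D₂ (N.framed hU).a * h1a)
    (by simp only [FramedWebAlgebra.StructureEq, FramedWebAlgebra.rho₁₄₅, FramedWebAlgebra.rho₂₄₅,
          FramedWebAlgebra.rho₃₄₅, FramedWebAlgebra.rhoDiff, slopeA, slopeB, Matrix.cons_val,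
          map_sub, map_zero, Derivation.map_one_eq_zero, Derivation.leibniz, smul_eq_mul]
        ring) q
  have s4 := N.subwebCurvature_eq hU (i := 0) (j := 2) (k := 4) (by decide) (by decide) (by decide)
    (ρ₁ := (N.framed hU).i1b * (N.framed hU).D₂ (N.framed hU).b) (ρ₂ := (N.framed hU).i1b * (N.framed hU).D₂ (N.framed hU).b)
    (by simp only [FramedWebAlgebra.StructureEq, FramedWebAlgebra.rho₁₄₅, FramedWebAlgebra.rho₂₄₅,
          FramedWebAlgebra.rho₃₄₅, FramedWebAlgebra.rhoDiff, slopeA, slopeB, Matrix.cons_val,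
          map_sub, map_zero, Derivation.map_one_eq_zero, Derivation.leibniz, smul_eq_mul]
        linear_combination -(N.framed hU).D₂ (N.framed hU).b * h1b)
    (by simp only [FramedWebAlgebra.StructureEq, FramedWebAlgebra.rho₁₄₅, FramedWebAlgebra.rho₂₄₅,
          FramedWebAlgebra.rho₃₄₅, FramedWebAlgebra.rhoDiff, slopeA, slopeB, Matrix.cons_val,
          map_sub, map_zero, Derivation.map_one_eq_zero, Derivation.leibniz, smul_eq_mul]
        ring) q
  have s5 := N.subwebCurvature_eq hU (i := 0) (j := 3) (k := 4) (by decide) (by decide) (by decide)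
    (ρ₁ := (N.framed hU).rho₁₄₅ 0) (ρ₂ := (N.framed hU).rho₁₄₅ 1)
    (by simp only [FramedWebAlgebra.StructureEq, FramedWebAlgebra.rho₁₄₅, FramedWebAlgebra.rho₂₄₅,
          FramedWebAlgebra.rho₃₄₅, FramedWebAlgebra.rhoDiff, slopeA, slopeB, Matrix.cons_val,
          map_sub, map_zero, Derivation.map_one_eq_zero, Derivation.leibniz, smul_eq_mul]
        linear_combination ((N.framed hU).D₂ (N.framed hU).a - (N.framed hU).D₂ (N.framed hU).b) * hab)
    (by simp only [FramedWebAlgebra.StructureEq, FramedWebAlgebra.rho₁₄₅, FramedWebAlgebra.rho₂₄₅,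
          FramedWebAlgebra.rho₃₄₅, FramedWebAlgebra.rhoDiff, slopeA, slopeB, Matrix.cons_val,
          map_sub, map_zero, Derivation.map_one_eq_zero, Derivation.leibniz, smul_eq_mul]
        ring) q
  have s6 := N.subwebCurvature_eq hU (i := 1) (j := 2) (k := 3) (by decide) (by decide) (by decide)
    (ρ₁ := (N.framed hU).i1a * (N.framed hU).D₁ (N.framed hU).a) (ρ₂ := (N.framed hU).i1a * (N.framed hU).D₁ (N.framed hU).a + (N.framed hU).ia * ((N.framed hU).D₁ (N.framed hU).a - (N.framed hU).D₂ (N.framed hU).a))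
    (by simp only [FramedWebAlgebra.StructureEq, FramedWebAlgebra.rho₁₄₅, FramedWebAlgebra.rho₂₄₅,
          FramedWebAlgebra.rho₃₄₅, FramedWebAlgebra.rhoDiff, slopeA, slopeB, Matrix.cons_val,
          map_sub, map_zero, Derivation.map_one_eq_zero, Derivation.leibniz, smul_eq_mul]
        linear_combination (N.framed hU).D₁ (N.framed hU).a * h1a)
    (by simp only [FramedWebAlgebra.StructureEq, FramedWebAlgebra.rho₁₄₅, FramedWebAlgebra.rho₂₄₅,
          FramedWebAlgebra.rho₃₄₅, FramedWebAlgebra.rhoDiff, slopeA, slopeB, Matrix.cons_val,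
          map_sub, map_zero, Derivation.map_one_eq_zero, Derivation.leibniz, smul_eq_mul]
        linear_combination -((N.framed hU).D₁ (N.framed hU).a - (N.framed hU).D₂ (N.framed hU).a) * ha) q
  have s7 := N.subwebCurvature_eq hU (i := 1) (j := 2) (k := 4) (by decide) (by decide) (by decide)
    (ρ₁ := (N.framed hU).i1b * (N.framed hU).D₁ (N.framed hU).b) (ρ₂ := (N.framed hU).i1b * (N.framed hU).D₁ (N.framed hU).b + (N.framed hU).ib * ((N.framed hU).D₁ (N.framed hU).b - (N.framed hU).D₂ (N.framed hU).b))
    (by simp only [FramedWebAlgebra.StructureEq, FramedWebAlgebra.rho₁₄₅, FramedWebAlgebra.rho₂₄₅,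
          FramedWebAlgebra.rho₃₄₅, FramedWebAlgebra.rhoDiff, slopeA, slopeB, Matrix.cons_val,
          map_sub, map_zero, Derivation.map_one_eq_zero, Derivation.leibniz, smul_eq_mul]
        linear_combination (N.framed hU).D₁ (N.framed hU).b * h1b)
    (by simp only [FramedWebAlgebra.StructureEq, FramedWebAlgebra.rho₁₄₅, FramedWebAlgebra.rho₂₄₅,
          FramedWebAlgebra.rho₃₄₅, FramedWebAlgebra.rhoDiff, slopeA, slopeB, Matrix.cons_val,
          map_sub, map_zero, Derivation.map_one_eq_zero, Derivation.leibniz, smul_eq_mul]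
        linear_combination -((N.framed hU).D₁ (N.framed hU).b - (N.framed hU).D₂ (N.framed hU).b) * hb) q
  have s8 := N.subwebCurvature_eq hU (i := 1) (j := 3) (k := 4) (by decide) (by decide) (by decide)
    (ρ₁ := (N.framed hU).rho₂₄₅ 0) (ρ₂ := (N.framed hU).rho₂₄₅ 1)
    (by simp only [FramedWebAlgebra.StructureEq, FramedWebAlgebra.rho₁₄₅, FramedWebAlgebra.rho₂₄₅,
          FramedWebAlgebra.rho₃₄₅, FramedWebAlgebra.rhoDiff, slopeA, slopeB, Matrix.cons_val,
          map_sub, map_zero, Derivation.map_one_eq_zero, Derivation.leibniz, smul_eq_mul]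
        linear_combination -((N.framed hU).D₁ (N.framed hU).a - (N.framed hU).D₁ (N.framed hU).b) * hab)
    (by simp only [FramedWebAlgebra.StructureEq, FramedWebAlgebra.rho₁₄₅, FramedWebAlgebra.rho₂₄₅,
          FramedWebAlgebra.rho₃₄₅, FramedWebAlgebra.rhoDiff, slopeA, slopeB, Matrix.cons_val,
          map_sub, map_zero, Derivation.map_one_eq_zero, Derivation.leibniz, smul_eq_mul]
        linear_combination -((N.framed hU).D₁ (N.framed hU).b - ((N.framed hU).D₂ (N.framed hU).a * (N.framed hU).b + (N.framed hU).a * (N.framed hU).D₂ (N.framed hU).b) - (N.framed hU).b * ((N.framed hU).iab * ((N.framed hU).D₁ (N.framed hU).a - (N.framed hU).D₁ (N.framed hU).b))) * ((N.framed hU).ia * (N.framed hU).a * hb + ha)) q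
  have s9 := N.subwebCurvature_eq hU (i := 2) (j := 3) (k := 4) (by decide) (by decide) (by decide)
    (ρ₁ := (N.framed hU).rho₃₄₅ - (N.framed hU).rhoDiff) (ρ₂ := (N.framed hU).rho₃₄₅)
    (by simp only [FramedWebAlgebra.StructureEq, FramedWebAlgebra.rho₁₄₅, FramedWebAlgebra.rho₂₄₅,
          FramedWebAlgebra.rho₃₄₅, FramedWebAlgebra.rhoDiff, slopeA, slopeB, Matrix.cons_val,
          map_sub, map_zero, Derivation.map_one_eq_zero, Derivation.leibniz, smul_eq_mul]
        linear_combination -((N.framed hU).D₁ (N.framed hU).a - (N.framed hU).D₁ (N.framed hU).b - (N.framed hU).D₂ (N.framed hU).a + (N.framed hU).D₂ (N.framed hU).b) * hab)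
    (by simp only [FramedWebAlgebra.StructureEq, FramedWebAlgebra.rho₁₄₅, FramedWebAlgebra.rho₂₄₅,
          FramedWebAlgebra.rho₃₄₅, FramedWebAlgebra.rhoDiff, slopeA, slopeB, Matrix.cons_val,
          map_sub, map_zero, Derivation.map_one_eq_zero, Derivation.leibniz, smul_eq_mul]
        linear_combination -((N.framed hU).b - 1) * (-((N.framed hU).i1b * ((N.framed hU).D₁ (N.framed hU).b - ((N.framed hU).D₂ (N.framed hU).b * (N.framed hU).a + ((N.framed hU).b - 1) * (N.framed hU).D₂ (N.framed hU).a))) - (N.framed hU).iab * ((N.framed hU).D₁ (N.framed hU).a - (N.framed hU).D₁ (N.framed hU).b - (N.framed hU).D₂ (N.framed hU).a + (N.framed hU).D₂ (N.framed hU).b)) * h1a - ((N.framed hU).D₁ (N.framed hU).b - ((N.framed hU).D₂ (N.framed hU).b * (N.framed hU).a + ((N.framed hU).b - 1) * (N.framed hU).D₂ (N.framed hU).a)) * h1b) q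
  have hsum : N.curvature q = (N.subwebCurvature 0 1 2 q + N.subwebCurvature 0 1 3 q + N.subwebCurvature 0 1 4 q + N.subwebCurvature 0 2 3 q + N.subwebCurvature 0 2 4 q + N.subwebCurvature 0 3 4 q + N.subwebCurvature 1 2 3 q + N.subwebCurvature 1 2 4 q + N.subwebCurvature 1 3 4 q + N.subwebCurvature 2 3 4 q) / 10 := by
    simp [curvature, Finset.sum_filter, Fintype.sum_prod_type, Fin.sum_univ_five]
    ring
  rw [hsum, (N.framed hU).curvatureSum_eq, s0, s1, s2, s3, s4, s5, s6, s7, s8, s9]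
  simp only [map_add]
  ring

end Normalization

end PlanarWebs

end

noncomputable section

namespace PlanarWebs

open TopologicalSpace (Opens)

/-! ### Jets -/

section Jets

variable {U : Opens Plane}

/-- The smooth function `f` vanishes at `q` with all its derivatives of order less than `n`. -/
def VanishesTo (q : U) : ℕ → smoothRing U → Prop
  | 0, _ => True
  | n + 1, f => evalAt q f = 0 ∧ VanishesTo q n (partialDeriv U (1, 0) f) ∧
      VanishesTo q n (partialDeriv U (0, 1) f)

variable {q : U}

lemma VanishesTo.of_succ {n : ℕ} : ∀ {f : smoothRing U}, VanishesTo q (n + 1) f →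
    VanishesTo q n f := by
  induction n with
  | zero => intros; trivial
  | succ n ih => exact fun h => ⟨h.1, ih h.2.1, ih h.2.2⟩

lemma VanishesTo.mono {m n : ℕ} (hmn : m ≤ n) {f : smoothRing U} (h : VanishesTo q n f) :
    VanishesTo q m f := by
  induction n, hmn using Nat.le_induction with
  | base => exact h
  | succ n _ ih => exact ih h.of_succ

lemma vanishesTo_zero (n : ℕ) : VanishesTo q n (0 : smoothRing U) := by
  induction n with
  | zero => trivial
  | succ n ih => exact ⟨map_zero _, by rwa [map_zero], by rwa [map_zero]⟩

lemma VanishesTo.add {n : ℕ} : ∀ {f g : smoothRing U}, VanishesTo q n f → VanishesTo q n g →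
    VanishesTo q n (f + g) := by
  induction n with
  | zero => intros; trivial
  | succ n ih =>
    intro f g hf hg
    refine ⟨?_, ?_, ?_⟩
    · rw [map_add, hf.1, hg.1, add_zero]
    · rw [map_add]
      exact ih hf.2.1 hg.2.1
    · rw [map_add]
      exact ih hf.2.2 hg.2.2

lemma VanishesTo.mul_left {n : ℕ} : ∀ {f : smoothRing U} (g : smoothRing U), VanishesTo q n f →
    VanishesTo q n (g * f) := by
  induction n with
  | zero => intros; trivial
  | succ n ih =>
    intro f g hf
    refine ⟨?_, ?_, ?_⟩
    · rw [map_mul, hf.1, mul_zero]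
    · rw [Derivation.leibniz, smul_eq_mul, smul_eq_mul]
      refine (ih g hf.2.1).add ?_
      rw [mul_comm]
      exact ih _ hf.of_succ
    · rw [Derivation.leibniz, smul_eq_mul, smul_eq_mul]
      refine (ih g hf.2.2).add ?_
      rw [mul_comm]
      exact ih _ hf.of_succ

/-- The ideal of the smooth functions that vanish at `q` with all their derivatives of order less
than `n`. -/
def vanishingIdeal (q : U) (n : ℕ) : Ideal (smoothRing U) where
  carrier := {f | VanishesTo q n f}
  zero_mem' := vanishesTo_zero n
  add_mem' := VanishesTo.add
  smul_mem' g _ hf := VanishesTo.mul_left g hf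

lemma mem_vanishingIdeal {n : ℕ} {f : smoothRing U} :
    f ∈ vanishingIdeal q n ↔ VanishesTo q n f := Iff.rfl

lemma vanishesTo_one {f : smoothRing U} : VanishesTo q 1 f ↔ evalAt q f = 0 :=
  ⟨fun h => h.1, fun h => ⟨h, trivial, trivial⟩⟩

/-- Since partial derivatives commute, mixed derivatives can be ordered. This passes from the
recursive definition to the finite list of derivatives that makes up `jet`. -/
lemma vanishesTo_iff_iterate {n : ℕ} : ∀ {f : smoothRing U}, VanishesTo q n f ↔
    ∀ i j, i + j < n →
      evalAt q ((partialDeriv U (1, 0))^[i] ((partialDeriv U (0, 1))^[j] f)) = 0 := by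
  induction n with
  | zero => exact fun {f} => ⟨fun _ i j h => absurd h (Nat.not_lt_zero _), fun _ => trivial⟩
  | succ n ih =>
    intro f
    have comm : ∀ (j : ℕ) (g : smoothRing U), (partialDeriv U (0, 1))^[j]
        (partialDeriv U (1, 0) g) = partialDeriv U (1, 0) ((partialDeriv U (0, 1))^[j] g) := by
      intro j
      induction j with
      | zero => exact fun _ => rfl
      | succ j ih =>
        intro g
        rw [Function.iterate_succ_apply, partialDeriv_comm, ih, ← Function.iterate_succ_apply]
    constructor
    · rintro ⟨h0, h1, h2⟩ i j hij
      rw [ih] at h1 h2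
      rcases i with _ | i
      · rcases j with _ | j
        · exact h0
        · exact h2 0 j (by omega)
      · rw [Function.iterate_succ_apply, ← comm]
        exact h1 i j (by omega)
    · intro h
      refine ⟨h 0 0 (by omega), ?_, ?_⟩
      · rw [ih]
        intro i j hij
        rw [comm, ← Function.iterate_succ_apply]
        exact h (i + 1) j (by omega)
      · rw [ih]
        intro i j hij
        rw [← Function.iterate_succ_apply]
        exact h i (j + 1) (by omega)

lemma iteratedFDeriv_fderiv_eq_zero_iff {F : Plane → ℝ} {q : Plane} (hF : ContDiffAt ℝ ∞ F q)
    (m : ℕ) : iteratedFDeriv ℝ (m + 1) F q = 0 ↔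
      iteratedFDeriv ℝ m (fun r => fderiv ℝ F r (1, 0)) q = 0 ∧
      iteratedFDeriv ℝ m (fun r => fderiv ℝ F r (0, 1)) q = 0 := by
  have hd : ContDiffAt ℝ m (fderiv ℝ F) q := hF.fderiv_right (by exact_mod_cast le_top)
  have key : ∀ v : Plane, iteratedFDeriv ℝ m (fun r => fderiv ℝ F r v) q =
      (ContinuousLinearMap.apply ℝ ℝ v).compContinuousMultilinearMap
        (iteratedFDeriv ℝ m (fderiv ℝ F) q) := fun v =>
    (ContinuousLinearMap.apply ℝ ℝ v).iteratedFDeriv_comp_left hd le_rfl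
  rw [← norm_eq_zero, ← norm_iteratedFDeriv_fderiv, norm_eq_zero, key, key]
  constructor
  · intro h
    rw [h]
    constructor <;> ext <;> simp
  · rintro ⟨h1, h2⟩
    ext x
    · simpa using congrArg (fun g => g x) h1
    · simpa using congrArg (fun g => g x) h2

/-- Translates the iterated Fréchet derivatives in `JetSolves` into membership of `vanishingIdeal`,
where the algebra applies. -/
lemma Represents.vanishesTo_iff {n : ℕ} : ∀ {f : smoothRing U} {F : Plane → ℝ},
    Represents f F → (VanishesTo q n f ↔ ∀ m < n, iteratedFDeriv ℝ m F q = 0) := by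
  induction n with
  | zero => exact fun _ => ⟨fun _ m h => absurd h (Nat.not_lt_zero _), fun _ => trivial⟩
  | succ n ih =>
    intro f F hf
    have h0 : PlanarWebs.evalAt q f = 0 ↔ iteratedFDeriv ℝ 0 F q = 0 := by
      rw [hf.evalAt, ← norm_eq_zero (a := iteratedFDeriv ℝ 0 F q), norm_iteratedFDeriv_zero,
        norm_eq_zero]
    rw [VanishesTo, ih (hf.partialDeriv _), ih (hf.partialDeriv _), h0]
    constructor
    · rintro ⟨h, h1, h2⟩ m hm
      rcases m with _ | m
      · exact h
      · rw [iteratedFDeriv_fderiv_eq_zero_iff (hf.contDiffAt q.2)]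
        exact ⟨h1 m (by omega), h2 m (by omega)⟩
    · intro h
      refine ⟨h 0 (by omega), fun m hm => ?_, fun m hm => ?_⟩
      · exact ((iteratedFDeriv_fderiv_eq_zero_iff (hf.contDiffAt q.2) m).1
          (h (m + 1) (by omega))).1
      · exact ((iteratedFDeriv_fderiv_eq_zero_iff (hf.contDiffAt q.2) m).1
          (h (m + 1) (by omega))).2

/-- The exponents of the monomials of degree less than `n` in two variables. -/
abbrev JetIndex (n : ℕ) : Type := {p : Fin n × Fin n // p.1.1 + p.2.1 < n}

/-- The partial derivatives of order less than `n` at `q`. -/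
def jet (q : U) (n : ℕ) : smoothRing U →ₗ[ℝ] (JetIndex n → ℝ) where
  toFun f p := evalAt q ((partialDeriv U (1, 0))^[p.1.1] ((partialDeriv U (0, 1))^[p.1.2] f))
  map_add' f g := by
    funext p
    rw [iterate_map_add, iterate_map_add, map_add]
    rfl
  map_smul' c f := by
    have h : ∀ (v : Plane) (i : ℕ) (f : smoothRing U),
        (partialDeriv U v)^[i] (c • f) = c • (partialDeriv U v)^[i] f := by
      intro v i
      induction i with
      | zero => exact fun _ => rfl
      | succ i ih =>
        intro f
        rw [Function.iterate_succ_apply, partialDeriv_smul, ih, ← Function.iterate_succ_apply]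
    funext p
    rw [h, h, evalAt_smul]
    rfl

lemma jet_eq_zero_iff {n : ℕ} {f : smoothRing U} : jet q n f = 0 ↔ VanishesTo q n f := by
  rw [vanishesTo_iff_iterate]
  constructor
  · intro h i j hij
    exact congrFun h ⟨(⟨i, by omega⟩, ⟨j, by omega⟩), hij⟩
  · exact fun h => funext fun p => h _ _ p.2

/-- The polynomial function with the given coefficients in the coordinates centred at `q`. -/
def polyFun (q : Plane) (n : ℕ) (c : JetIndex n → ℝ) (r : Plane) : ℝ :=
  ∑ p : JetIndex n, c p * ((r.1 - q.1) ^ p.1.1.1 * (r.2 - q.2) ^ p.1.2.1)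

lemma contDiff_polyFun (q : Plane) (n : ℕ) (c : JetIndex n → ℝ) :
    ContDiff ℝ ∞ (polyFun q n c) := by
  refine ContDiff.sum fun p _ => contDiff_const.mul (ContDiff.mul ?_ ?_)
  · exact (contDiff_fst.sub contDiff_const).pow _
  · exact (contDiff_snd.sub contDiff_const).pow _

/-- The polynomial functions as smooth functions on `U`. -/
def polyMap (q : U) (n : ℕ) : (JetIndex n → ℝ) →ₗ[ℝ] smoothRing U where
  toFun c := restrictTo (polyFun q n c) (contDiff_polyFun q n c).contDiffOn
  map_add' c d := Subtype.ext (funext fun r => by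
    change polyFun q n (c + d) r = polyFun q n c r + polyFun q n d r
    simp only [polyFun, Pi.add_apply, add_mul, Finset.sum_add_distrib])
  map_smul' t c := Subtype.ext (funext fun r => by
    change polyFun q n (t • c) r = t * polyFun q n c r
    simp only [polyFun, Pi.smul_apply, smul_eq_mul, mul_assoc, Finset.mul_sum])

lemma represents_polyMap (q : U) (n : ℕ) (c : JetIndex n → ℝ) :
    Represents (polyMap q n c) (polyFun q n c) := fun _ => rfl

/-- The coordinate functions centred at `q`. -/
def shiftX (q : U) : smoothRing U :=
  restrictTo (fun r => r.1 - q.1.1) (contDiff_fst.sub contDiff_const).contDiffOn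

/-- The coordinate functions centred at `q`. -/
def shiftY (q : U) : smoothRing U :=
  restrictTo (fun r => r.2 - q.1.2) (contDiff_snd.sub contDiff_const).contDiffOn

lemma partialDeriv_shiftX (v : Plane) :
    partialDeriv U v (shiftX q) = algebraMap ℝ _ v.1 := by
  refine ((represents_restrictTo _ _).partialDeriv v).ext
    ((represents_algebraMap v.1).congr fun r _ => ?_)
  rw [fderiv_sub_const, fderiv_fst]
  rfl

lemma partialDeriv_shiftY (v : Plane) :
    partialDeriv U v (shiftY q) = algebraMap ℝ _ v.2 := by
  refine ((represents_restrictTo _ _).partialDeriv v).ext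
    ((represents_algebraMap v.2).congr fun r _ => ?_)
  rw [fderiv_sub_const, fderiv_snd]
  rfl

lemma iterate_derivation_pow (D : Derivation ℤ (smoothRing U) (smoothRing U))
    (x g : smoothRing U) (hx : D x = 1) (hg : D g = 0) (k i : ℕ) :
    D^[k] (x ^ i * g) = (i.descFactorial k : smoothRing U) * (x ^ (i - k) * g) := by
  induction k with
  | zero => simp
  | succ k ih =>
    rw [Function.iterate_succ_apply', ih, Derivation.leibniz, Derivation.map_natCast,
      Derivation.leibniz, hg, Derivation.leibniz_pow, hx, Nat.descFactorial_succ, ← Nat.sub_sub]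
    simp only [smul_eq_mul, nsmul_eq_mul]
    push_cast
    ring

/-- In the monomial basis the Taylor map is diagonal, with nonzero factorials as entries; a
polynomial of degree less than `n` is hence determined by its jet. -/
lemma jet_polyMap (n : ℕ) (c : JetIndex n → ℝ) (p : JetIndex n) :
    jet q n (polyMap q n c) p = c p * (p.1.1.1.factorial * p.1.2.1.factorial : ℝ) := by
  have h : polyMap q n c = ∑ p : JetIndex n,
      c p • (shiftX q ^ p.1.1.1 * shiftY q ^ p.1.2.1) := by
    refine smoothRing_ext fun r => ?_
    rw [(represents_polyMap q n c).evalAt, map_sum]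
    rfl
  rw [h, map_sum, Finset.sum_apply]
  rw [Finset.sum_eq_single p]
  · rw [map_smul, Pi.smul_apply, smul_eq_mul]
    congr 1
    change evalAt q ((partialDeriv U (1, 0))^[p.1.1] ((partialDeriv U (0, 1))^[p.1.2] _)) = _
    rw [mul_comm, iterate_derivation_pow _ _ _ (by simp [partialDeriv_shiftY])
      (by simp [partialDeriv_shiftX, Derivation.leibniz_pow])]
    simp only [Nat.sub_self, pow_zero, one_mul, Nat.descFactorial_self]
    rw [mul_comm, iterate_derivation_pow _ _ _ (by simp [partialDeriv_shiftX])
      (Derivation.map_natCast _ _)]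
    simp [Nat.descFactorial_self]
  · intro p' _ hp
    rw [map_smul, Pi.smul_apply, smul_eq_mul]
    refine mul_eq_zero_of_right _ ?_
    change evalAt q ((partialDeriv U (1, 0))^[p.1.1] ((partialDeriv U (0, 1))^[p.1.2] _)) = _
    rw [mul_comm, iterate_derivation_pow _ _ _ (by simp [partialDeriv_shiftY])
      (by simp [partialDeriv_shiftX, Derivation.leibniz_pow]), ← mul_assoc, mul_comm,
      iterate_derivation_pow _ _ _ (by simp [partialDeriv_shiftX])
        (by simp [partialDeriv_shiftY, Derivation.leibniz_pow])]
    have hX : evalAt q (shiftX q) = 0 := sub_self _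
    have hY : evalAt q (shiftY q) = 0 := sub_self _
    simp only [map_mul, map_pow, hX, hY, map_natCast]
    by_contra hne
    apply hp
    have h1 : p'.1.1.1 = p.1.1.1 := by
      by_contra h
      apply hne
      rcases lt_or_gt_of_ne h with h | h
      · rw [Nat.descFactorial_eq_zero_iff_lt.2 h]
        simp
      · rw [zero_pow (Nat.sub_ne_zero_of_lt h)]
        simp
    have h2 : p'.1.2.1 = p.1.2.1 := by
      by_contra h
      apply hne
      rcases lt_or_gt_of_ne h with h | h
      · rw [Nat.descFactorial_eq_zero_iff_lt.2 h]
        simp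
      · rw [zero_pow (Nat.sub_ne_zero_of_lt h)]
        simp
    exact Subtype.ext (Prod.ext (Fin.ext h1) (Fin.ext h2))
  · simp

lemma polyMap_eq_zero {n : ℕ} {c : JetIndex n → ℝ} (h : VanishesTo q n (polyMap q n c)) :
    c = 0 := by
  funext p
  have h1 := congrFun (jet_eq_zero_iff.2 h) p
  rw [jet_polyMap] at h1
  have h2 : (p.1.1.1.factorial * p.1.2.1.factorial : ℝ) ≠ 0 := by positivity
  exact (mul_eq_zero.1 h1).resolve_right h2

/-- Turns uniqueness into existence: the kernel of `Φ` has dimension at least `m`, so a map from it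
to `ℝᵐ` that is injective is also surjective. -/
lemma exists_of_finrank {V B : Type} [AddCommGroup V] [Module ℝ V] [AddCommGroup B] [Module ℝ B]
    [FiniteDimensional ℝ V] [FiniteDimensional ℝ B] {m : ℕ} (Φ : V →ₗ[ℝ] B)
    (Z : V →ₗ[ℝ] (Fin m → ℝ)) (hdim : Module.finrank ℝ B + m ≤ Module.finrank ℝ V)
    (hinj : ∀ v, Φ v = 0 → Z v = 0 → v = 0) (z : Fin m → ℝ) : ∃ v, Φ v = 0 ∧ Z v = z := by
  set Z' : LinearMap.ker Φ →ₗ[ℝ] (Fin m → ℝ) := Z.domRestrict _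
  have h1 := Φ.finrank_range_add_finrank_ker
  have h2 := Submodule.finrank_le (LinearMap.range Φ)
  have hinj' : Function.Injective Z' := by
    rw [← LinearMap.ker_eq_bot, LinearMap.ker_eq_bot']
    exact fun v hv => Subtype.ext (hinj v v.2 hv)
  have h3 := LinearMap.finrank_range_of_inj hinj'
  have h4 : LinearMap.range Z' = ⊤ := by
    apply Submodule.eq_top_of_finrank_eq
    have h5 := Submodule.finrank_le (LinearMap.range Z')
    rw [Module.finrank_fin_fun] at *
    omega
  obtain ⟨v, hv⟩ : z ∈ LinearMap.range Z' := h4 ▸ Submodule.mem_top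
  exact ⟨v, v.2, hv⟩

end Jets

end PlanarWebs

end

noncomputable section

namespace PlanarWebs

open TopologicalSpace (Opens)

/-! ### Realization of the jets of solutions -/

namespace FramedWebAlgebra

variable {R : Type} [CommRing R] (T : FramedWebAlgebra R)

lemma abelianOp_add (w u v w' u' v' : R) (j : Fin 4) :
    T.abelianOp (w + w') (u + u') (v + v') j = T.abelianOp w u v j + T.abelianOp w' u' v' j := by
  fin_cases j <;> simp only [abelianOp, Δ₁, Δ₂, Δ₃, δ₁, δ₂, mul_add, map_add, Fin.zero_eta,
    Fin.mk_one, Fin.reduceFinMk, Matrix.cons_val] <;> ring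

lemma coord_add (w u v w' u' v' : R) (j : Fin 6) :
    T.coord (w + w') (u + u') (v + v') j = T.coord w u v j + T.coord w' u' v' j := by
  fin_cases j <;> simp only [coord, δ₂, map_add, mul_add, map_sub, Fin.zero_eta,
    Fin.mk_one, Fin.reduceFinMk, Matrix.cons_val] <;> ring

lemma abelianOp_const_mul {r : R} (h₁ : T.D₁ r = 0) (h₂ : T.D₂ r = 0) (w u v : R) (j : Fin 4) :
    T.abelianOp (r * w) (r * u) (r * v) j = r * T.abelianOp w u v j := by
  fin_cases j <;> simp only [abelianOp, Δ₁, Δ₂, Δ₃, δ₁, δ₂, Derivation.leibniz, smul_eq_mul, h₁,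
    h₂, Fin.zero_eta, Fin.mk_one, Fin.reduceFinMk, Matrix.cons_val] <;> ring

lemma coord_const_mul {r : R} (h₂ : T.D₂ r = 0) (w u v : R) (j : Fin 6) :
    T.coord (r * w) (r * u) (r * v) j = r * T.coord w u v j := by
  fin_cases j <;> simp only [coord, δ₂, Derivation.leibniz, smul_eq_mul,
    h₂, map_sub, map_add, map_zero, Derivation.map_natCast, Fin.zero_eta, Fin.mk_one, Fin.reduceFinMk, Matrix.cons_val] <;> ring

lemma map_eq_zero_of_mul {S : Type} [CommRing S] {φ : R →+* S} {x y z : R} (h : y * x = 1)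
    (hz : φ x * φ z = 0) : φ z = 0 := by
  have h3 := congrArg φ h
  rw [map_mul, map_one] at h3
  linear_combination φ y * hz - φ z * h3

/-- The derivatives of a solution are combinations of the canonical coordinates. -/
lemma derivative_mem {I : Ideal R} {w u v : R} (hE : ∀ j, T.abelianOp w u v j ∈ I)
    (hc : ∀ j : Fin 5, T.coord w u v j.succ ∈ I) :
    (T.D₁ w ∈ I ∧ T.D₂ w ∈ I) ∧ (T.D₁ u ∈ I ∧ T.D₂ u ∈ I) ∧ (T.D₁ v ∈ I ∧ T.D₂ v ∈ I) := by
  simp only [← Ideal.Quotient.eq_zero_iff_mem] at hE hc ⊢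
  generalize Ideal.Quotient.mk I = φ at *
  have hw : φ w = 0 := hc 2
  have hu : φ u = 0 := hc 3
  have hv : φ v = 0 := hc 4
  have hw2 : φ (T.D₂ w) = 0 := by simpa [coord, δ₂, hw] using hc 0
  have hv2 : φ (T.D₂ v) = 0 := by simpa [coord, δ₂, hv] using hc 1
  have h0 := hE 0
  have h1 := hE 1
  have h2 := hE 2
  have h3 := hE 3
  simp only [abelianOp, Δ₁, Δ₂, Δ₃, δ₁, δ₂, Matrix.cons_val, Derivation.leibniz, smul_eq_mul,
    map_add, map_sub, map_mul, hw, hu, hv, hw2, hv2, mul_zero, zero_mul, sub_zero, add_zero]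
    at h0 h1 h2 h3
  rw [h0, h2, zero_add, add_zero] at h3
  exact ⟨⟨h0, hw2⟩, ⟨h3, map_eq_zero_of_mul T.a_mul_ia (by linear_combination h3 - h1)⟩, h2, hv2⟩

/-- The derivatives of the canonical coordinates other than `w₂₂` of solutions are combinations
of the canonical coordinates. -/
lemma derivative_coord_mem {I : Ideal R} {w u v : R}
    (hE : ∀ j, T.abelianOp w u v j ∈ I ∧ T.D₁ (T.abelianOp w u v j) ∈ I ∧
      T.D₂ (T.abelianOp w u v j) ∈ I) (hc : ∀ j, T.coord w u v j ∈ I) (j : Fin 5) :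
    T.D₁ (T.coord w u v j.succ) ∈ I ∧ T.D₂ (T.coord w u v j.succ) ∈ I := by
  obtain ⟨⟨hw1, hw2⟩, ⟨hu1, hu2⟩, hv1, hv2⟩ := T.derivative_mem (fun j => (hE j).1)
    fun j => hc j.succ
  simp only [← Ideal.Quotient.eq_zero_iff_mem] at *
  generalize Ideal.Quotient.mk I = φ at *
  have hw : φ w = 0 := hc 3
  have hu : φ u = 0 := hc 4
  have hv : φ v = 0 := hc 5
  have hw22 : φ (T.D₂ (T.D₂ w)) = 0 := by
    simpa [coord, δ₂, hw, hw2, Derivation.leibniz] using hc 0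
  obtain ⟨-, h01, h02⟩ := hE 0
  obtain ⟨-, h11, h12⟩ := hE 1
  obtain ⟨-, h21, h22⟩ := hE 2
  obtain ⟨-, h31, h32⟩ := hE 3
  simp only [abelianOp, Δ₁, Δ₂, Δ₃, δ₁, δ₂, Matrix.cons_val, Derivation.leibniz, smul_eq_mul,
    map_add, map_sub, map_mul, map_natCast, Derivation.map_natCast, hw, hu, hv, hw2, hv2, hw22,
    hu2, hw1, hv1, hu1, mul_zero, zero_mul, sub_zero, add_zero, T.comm]
    at h01 h02 h11 h12 h21 h22 h31 h32
  -- The elimination that determines `v₂₂`, with every canonical coordinate set to zero: `a d₂ P -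
  -- d₁ P` removes `u₂₂` and leaves `(a - b) b v₂₂`.
  have hv22 : φ (T.D₂ (T.D₂ v)) = 0 := by
    refine map_eq_zero_of_mul T.b_mul_ib ?_
    rw [← map_mul]
    refine map_eq_zero_of_mul T.sub_mul_iab ?_
    rw [map_mul, map_sub]
    linear_combination -h31 + h01 + h11 + h21 + φ T.a * h32 + (1 - φ T.a) * h02 +
      (φ T.b - φ T.a) * h22
  fin_cases j <;>
    simp [coord, δ₂, Derivation.leibniz, T.comm, hw, hv, hw2, hv2, hw22, hw1, hv1, hu1, hu2,
      hv22, h02]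
  linear_combination h22 + φ T.b * hv22

end FramedWebAlgebra

section

variable {U : Opens Plane} {q : U} {T : FramedWebAlgebra (smoothRing U)}

/-- The vector fields of the frame span the plane at `q`. -/
def FramedWebAlgebra.SpansAt (T : FramedWebAlgebra (smoothRing U)) (q : U) : Prop :=
  ∀ (n : ℕ) (f : smoothRing U), f ∈ vanishingIdeal q (n + 1) ↔
    evalAt q f = 0 ∧ T.D₁ f ∈ vanishingIdeal q n ∧ T.D₂ f ∈ vanishingIdeal q n

lemma mem_vanishingIdeal_of_succ {n : ℕ} {f : smoothRing U}
    (h : f ∈ vanishingIdeal q (n + 1)) : f ∈ vanishingIdeal q n := VanishesTo.of_succ h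

lemma FramedWebAlgebra.SpansAt.containsTwoJet (hT : T.SpansAt q) {n : ℕ} {f : smoothRing U}
    (h : f ∈ vanishingIdeal q (n + 2)) : T.ContainsTwoJet (vanishingIdeal q n) f := by
  obtain ⟨-, h1, h2⟩ := (hT _ _).1 h
  obtain ⟨-, h11, h12⟩ := (hT _ _).1 h1
  obtain ⟨-, h21, h22⟩ := (hT _ _).1 h2
  exact ⟨mem_vanishingIdeal_of_succ (mem_vanishingIdeal_of_succ h),
    mem_vanishingIdeal_of_succ h1, mem_vanishingIdeal_of_succ h2, h11, h12, h22⟩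

/-- A triple that satisfies the abelian equation to high order at a point and whose canonical
coordinates vanish there vanishes to high order. -/
lemma FramedWebAlgebra.SpansAt.mem_of_coord_eq_zero (hT : T.SpansAt q) {k : ℕ}
    {w u v : smoothRing U} (hE : ∀ j, T.abelianOp w u v j ∈ vanishingIdeal q (k + 2))
    (hc : ∀ j, evalAt q (T.coord w u v j) = 0) :
    w ∈ vanishingIdeal q (k + 3) ∧ u ∈ vanishingIdeal q (k + 3) ∧
      v ∈ vanishingIdeal q (k + 3) := by
  obtain ⟨A₁, A₂, -, -, hA⟩ := T.exists_connection
  have hA := hA (vanishingIdeal q k) w u v fun j => hT.containsTwoJet (hE j)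
  -- Up to order `k` the derivatives of the coordinates are combinations of the coordinates
  -- themselves. Each round therefore raises the order of vanishing by one, until `k + 1` is
  -- reached.
  have step : ∀ m ≤ k, ∀ j, T.coord w u v j ∈ vanishingIdeal q (m + 1) := by
    intro m hm
    induction m with
    | zero => exact fun j => vanishesTo_one.2 (hc j)
    | succ m ih =>
      have ih := ih (by omega)
      intro j
      have key : ∀ (B : Fin 6 → smoothRing U) (g F : smoothRing U),
          F - FramedWebAlgebra.coordWeight j * g * T.coord w u v j -
            ∑ i, B i * T.coord w u v i ∈ vanishingIdeal q k → F ∈ vanishingIdeal q (m + 1) := by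
        intro B g F h
        have h1 : _ ∈ vanishingIdeal q (m + 1) := VanishesTo.mono hm (mem_vanishingIdeal.1 h)
        have h2 : ∑ i, B i * T.coord w u v i ∈ vanishingIdeal q (m + 1) :=
          Ideal.sum_mem _ fun i _ => Ideal.mul_mem_left _ _ (ih i)
        have h3 := Ideal.add_mem _ (Ideal.add_mem _ h1 h2)
          (Ideal.mul_mem_left _ (FramedWebAlgebra.coordWeight j * g) (ih j))
        rwa [sub_add_cancel, sub_add_cancel] at h3
      exact (hT _ _).2 ⟨hc j, key _ _ _ (hA j).1, key _ _ _ (hA j).2⟩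
  -- The coordinates other than `w₂₂` have derivatives controlled by only one differentiation of the
  -- equation, which gains one order; `w`, `u`, `v` gain another one, whence `k + 3`.
  have hD := T.derivative_coord_mem (I := vanishingIdeal q (k + 1))
    (fun j => ⟨mem_vanishingIdeal_of_succ (hE j), ((hT _ _).1 (hE j)).2⟩) (step k le_rfl)
  have hs : ∀ j : Fin 5, T.coord w u v j.succ ∈ vanishingIdeal q (k + 2) := fun j =>
    (hT _ _).2 ⟨hc _, hD j⟩
  obtain ⟨h1, h2, h3⟩ := T.derivative_mem hE hs
  exact ⟨(hT _ _).2 ⟨hc 3, h1⟩, (hT _ _).2 ⟨hc 4, h2⟩, (hT _ _).2 ⟨hc 5, h3⟩⟩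

end

section

variable {U : Opens Plane} {q : U}

lemma VanishesTo.sub {n : ℕ} {f g : smoothRing U} (hf : VanishesTo q n f)
    (hg : VanishesTo q n g) : VanishesTo q n (f - g) := (vanishingIdeal q n).sub_mem hf hg

end

namespace Normalization

variable {W : PlanarWeb 5} {N : Normalization W} {U : Opens Plane}
  {hU : (U : Set Plane) ⊆ W.domain}

lemma partialDeriv_eq_frame (f : smoothRing U) :
    partialDeriv U (1, 0) f = N.coeff hU 0 (1, 0) * (N.framed hU).D₁ f +
      N.coeff hU 1 (1, 0) * (N.framed hU).D₂ f ∧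
    partialDeriv U (0, 1) f = N.coeff hU 0 (0, 1) * (N.framed hU).D₁ f +
      N.coeff hU 1 (0, 1) * (N.framed hU).D₂ f := by
  have h := N.invArea_mul hU
  rw [areaR] at h
  rw [D₁_apply, D₂_apply]
  constructor
  · linear_combination -partialDeriv U (1, 0) f * h
  · linear_combination -partialDeriv U (0, 1) f * h

lemma vanishesTo_succ_iff {q : U} {n : ℕ} {f : smoothRing U} : VanishesTo q (n + 1) f ↔
    evalAt q f = 0 ∧ VanishesTo q n ((N.framed hU).D₁ f) ∧ VanishesTo q n ((N.framed hU).D₂ f) := by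
  constructor
  · rintro ⟨h0, h1, h2⟩
    rw [D₁_apply, D₂_apply]
    exact ⟨h0, (h1.mul_left _).sub (h2.mul_left _), (h2.mul_left _).sub (h1.mul_left _)⟩
  · rintro ⟨h0, h1, h2⟩
    have h := partialDeriv_eq_frame (N := N) (hU := hU) f
    refine ⟨h0, ?_, ?_⟩
    · rw [h.1]
      exact (h1.mul_left _).add (h2.mul_left _)
    · rw [h.2]
      exact (h1.mul_left _).add (h2.mul_left _)

variable (N hU) in
lemma spansAt (q : U) : (N.framed hU).SpansAt q := fun _ _ => vanishesTo_succ_iff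

end Normalization

end PlanarWebs

end

/-! ### Counting dimensions: jets that solve the equation to orders three and four -/

noncomputable section

namespace PlanarWebs

open TopologicalSpace (Opens)

section

variable {U : Opens Plane} {q : U} {T : FramedWebAlgebra (smoothRing U)}

namespace FramedWebAlgebra

lemma δ₁_add {R : Type} [CommRing R] (T : FramedWebAlgebra R) (k : ℕ) (f g : R) :
    T.δ₁ k (f + g) = T.δ₁ k f + T.δ₁ k g := by
  simp only [δ₁, map_add]
  ring

lemma δ₂_add {R : Type} [CommRing R] (T : FramedWebAlgebra R) (k : ℕ) (f g : R) :
    T.δ₂ k (f + g) = T.δ₂ k f + T.δ₂ k g := by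
  simp only [δ₂, map_add]
  ring

/-- The obstruction is the compatibility condition of the system: a combination of third derivatives
of the four left-hand sides. It must vanish as soon as the equation holds to order four, although it
is already a function on `𝔄₃`. -/
lemma obstruction_eq {R : Type} [CommRing R] (T : FramedWebAlgebra R) (w u v : R) :
    T.obstruction w u v = T.Δ₁ 4 (T.Δ₂ 3 (T.Δ₃ 2 (T.abelianOp w u v 3))) -
      T.δ₁ 4 (T.Δ₂ 3 (T.Δ₃ 2 (T.abelianOp w u v 0))) -
      T.Δ₁ 4 (T.δ₁ 3 (T.Δ₃ 2 (T.abelianOp w u v 1))) -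
      T.Δ₁ 4 (T.Δ₂ 3 (T.δ₁ 2 (T.abelianOp w u v 2))) := by
  have h1 : ∀ k f g, T.Δ₁ k (f + g) = T.Δ₁ k f + T.Δ₁ k g := fun k f g => by
    simp only [Δ₁, δ₁_add, δ₂_add]
    ring
  have h2 : ∀ k f g, T.Δ₂ k (f + g) = T.Δ₂ k f + T.Δ₂ k g := fun k f g => by
    simp only [Δ₂, mul_add, δ₁_add, δ₂_add]
    ring
  have h3 : ∀ k f g, T.Δ₃ k (f + g) = T.Δ₃ k f + T.Δ₃ k g := fun k f g => by
    simp only [Δ₃, mul_add, δ₁_add, δ₂_add]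
    ring
  change _ = T.Δ₁ 4 (T.Δ₂ 3 (T.Δ₃ 2 (T.δ₁ 1 w + T.δ₁ 1 u + T.δ₁ 1 v))) -
      T.δ₁ 4 (T.Δ₂ 3 (T.Δ₃ 2 (T.Δ₁ 1 w))) - T.Δ₁ 4 (T.δ₁ 3 (T.Δ₃ 2 (T.Δ₂ 1 u))) -
      T.Δ₁ 4 (T.Δ₂ 3 (T.δ₁ 2 (T.Δ₃ 1 v)))
  simp only [obstruction, h1, h2, h3]
  ring

namespace SpansAt

variable (hT : T.SpansAt q)
include hT

lemma δ₁_mem {n k : ℕ} {f : smoothRing U} (h : f ∈ vanishingIdeal q (n + 1)) :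
    T.δ₁ k f ∈ vanishingIdeal q n :=
  Ideal.sub_mem _ ((hT _ _).1 h).2.1 (Ideal.mul_mem_left _ _ (mem_vanishingIdeal_of_succ h))

lemma δ₂_mem {n k : ℕ} {f : smoothRing U} (h : f ∈ vanishingIdeal q (n + 1)) :
    T.δ₂ k f ∈ vanishingIdeal q n :=
  Ideal.sub_mem _ ((hT _ _).1 h).2.2 (Ideal.mul_mem_left _ _ (mem_vanishingIdeal_of_succ h))

lemma Δ₁_mem {n k : ℕ} {f : smoothRing U} (h : f ∈ vanishingIdeal q (n + 1)) :
    T.Δ₁ k f ∈ vanishingIdeal q n := Ideal.sub_mem _ (hT.δ₁_mem h) (hT.δ₂_mem h)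

lemma Δ₂_mem {n k : ℕ} {f : smoothRing U} (h : f ∈ vanishingIdeal q (n + 1)) :
    T.Δ₂ k f ∈ vanishingIdeal q n :=
  Ideal.sub_mem _ (hT.δ₁_mem h) (hT.δ₂_mem (Ideal.mul_mem_left _ _ h))

lemma Δ₃_mem {n k : ℕ} {f : smoothRing U} (h : f ∈ vanishingIdeal q (n + 1)) :
    T.Δ₃ k f ∈ vanishingIdeal q n :=
  Ideal.sub_mem _ (hT.δ₁_mem h) (hT.δ₂_mem (Ideal.mul_mem_left _ _ h))

lemma eval_Δ₁Δ₂Δ₃_eq_zero {e₀ e₁ e₂ e₃ : smoothRing U} (h₀ : e₀ ∈ vanishingIdeal q 4)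
    (h₁ : e₁ ∈ vanishingIdeal q 4) (h₂ : e₂ ∈ vanishingIdeal q 4)
    (h : evalAt q (T.Δ₁ 4 (T.Δ₂ 3 (T.Δ₃ 2 e₃)) - T.δ₁ 4 (T.Δ₂ 3 (T.Δ₃ 2 e₀)) -
      T.Δ₁ 4 (T.δ₁ 3 (T.Δ₃ 2 e₁)) - T.Δ₁ 4 (T.Δ₂ 3 (T.δ₁ 2 e₂))) = 0) :
    evalAt q (T.Δ₁ 4 (T.Δ₂ 3 (T.Δ₃ 2 e₃))) = 0 := by
  rwa [map_sub, map_sub, map_sub, vanishesTo_one.1 (hT.δ₁_mem (hT.Δ₂_mem (hT.Δ₃_mem h₀))),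
    vanishesTo_one.1 (hT.Δ₁_mem (hT.δ₁_mem (hT.Δ₃_mem h₁))),
    vanishesTo_one.1 (hT.Δ₁_mem (hT.Δ₂_mem (hT.δ₁_mem h₂))), sub_zero, sub_zero, sub_zero] at h

/-- The function `f` and its derivatives of order at most three vanish if the derivatives of order
at most two, three derivatives of order three, and `Δ₁Δ₂Δ₃ f` vanish. -/
lemma mem_four {f : smoothRing U} (h : f ∈ vanishingIdeal q 3)
    (h₁ : evalAt q (T.D₂ (T.D₂ (T.D₂ f))) = 0) (h₂ : evalAt q (T.D₂ (T.D₂ (T.D₁ f))) = 0)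
    (h₃ : evalAt q (T.D₂ (T.D₁ (T.D₁ f))) = 0)
    (hΔ : evalAt q (T.Δ₁ 4 (T.Δ₂ 3 (T.Δ₃ 2 f))) = 0) : f ∈ vanishingIdeal q 4 := by
  have h0 := h
  simp only [hT 3 f, hT 2, hT 1, hT 0] at h0 ⊢
  obtain ⟨e0, ⟨e1, ⟨e11, -⟩, e21, -⟩, e2, ⟨e12, -⟩, e22, -⟩ := h0
  -- In `Δ₁Δ₂Δ₃ f` the derivative `D₁³ f` has coefficient one, and all other terms vanish at `q` by
  -- hypothesis; so `hΔ` reduces to the vanishing of `D₁³ f`.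
  simp only [Δ₁, Δ₂, Δ₃, δ₁, δ₂, map_sub, map_add, map_mul, Derivation.leibniz, smul_eq_mul,
    Derivation.map_natCast, T.comm, e0, e1, e2, e11, e21, e22, h₁, h₂, h₃, mul_zero, zero_mul,
    sub_zero, add_zero] at hΔ
  have hz : ∀ g, g ∈ vanishingIdeal q 0 := fun _ => trivial
  simp only [T.comm, map_sub, map_add, map_mul, Derivation.leibniz, smul_eq_mul, hz, hΔ, e0, e1,
    e2, e11, e21, e22, h₁, h₂, h₃, mul_zero, zero_mul, sub_self, add_zero, and_self]

end SpansAt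

/-- The frame is linear over the real numbers. -/
def IsRealLinear (T : FramedWebAlgebra (smoothRing U)) : Prop :=
  ∀ c : ℝ, T.D₁ (algebraMap ℝ _ c) = 0 ∧ T.D₂ (algebraMap ℝ _ c) = 0

namespace IsRealLinear

variable (hR : T.IsRealLinear)

/-- The first vector field of the frame as a linear map. -/
def D₁L : smoothRing U →ₗ[ℝ] smoothRing U where
  toFun := T.D₁
  map_add' := map_add _
  map_smul' c f := by
    rw [RingHom.id_apply, Algebra.smul_def, Derivation.leibniz, (hR c).1, smul_zero, add_zero,
      smul_eq_mul, ← Algebra.smul_def]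

/-- The second vector field of the frame as a linear map. -/
def D₂L : smoothRing U →ₗ[ℝ] smoothRing U where
  toFun := T.D₂
  map_add' := map_add _
  map_smul' c f := by
    rw [RingHom.id_apply, Algebra.smul_def, Derivation.leibniz, (hR c).2, smul_zero, add_zero,
      smul_eq_mul, ← Algebra.smul_def]

/-- The value at a point as a linear map. -/
def _root_.PlanarWebs.evalLin (q : U) : smoothRing U →ₗ[ℝ] ℝ where
  toFun := evalAt q
  map_add' := map_add _
  map_smul' _ _ := rfl

variable (q) in
/-- The left hand side of the abelian equation on polynomials, as a linear map. -/
def abelianLin (n : ℕ) (j : Fin 4) : (Fin 3 → JetIndex n → ℝ) →ₗ[ℝ] smoothRing U where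
  toFun x := T.abelianOp (polyMap q n (x 0)) (polyMap q n (x 1)) (polyMap q n (x 2)) j
  map_add' x y := by simp only [Pi.add_apply, map_add, abelianOp_add]
  map_smul' c x := by
    simp only [Pi.smul_apply, map_smul, Algebra.smul_def (A := smoothRing U),
      T.abelianOp_const_mul (hR c).1 (hR c).2, RingHom.id_apply]

variable (q) in
/-- The values of the canonical coordinates of polynomials, as a linear map. -/
def coordLin (n : ℕ) : (Fin 3 → JetIndex n → ℝ) →ₗ[ℝ] (Fin 6 → ℝ) where
  toFun x j := evalAt q
    (T.coord (polyMap q n (x 0)) (polyMap q n (x 1)) (polyMap q n (x 2)) j)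
  map_add' x y := by
    funext j
    simp only [Pi.add_apply, map_add, coord_add]
  map_smul' c x := by
    funext j
    simp only [Pi.smul_apply, map_smul, Algebra.smul_def (A := smoothRing U),
      T.coord_const_mul (hR c).2, RingHom.id_apply, map_mul, smul_eq_mul]
    rfl

end IsRealLinear

lemma SpansAt.eq_zero_of_coordLin (hT : T.SpansAt q) (hR : T.IsRealLinear) {k : ℕ}
    {x : Fin 3 → JetIndex (k + 3) → ℝ}
    (hE : ∀ j, hR.abelianLin q (k + 3) j x ∈ vanishingIdeal q (k + 2))
    (hx : hR.coordLin q (k + 3) x = 0) : x = 0 := by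
  obtain ⟨h0, h1, h2⟩ := hT.mem_of_coord_eq_zero hE (congrFun hx)
  funext j
  fin_cases j
  · exact polyMap_eq_zero h0
  · exact polyMap_eq_zero h1
  · exact polyMap_eq_zero h2

/-- Every value of the canonical coordinates is attained by polynomials that satisfy the abelian
equation to third order. -/
lemma SpansAt.exists_solution_order_three (hT : T.SpansAt q) (hR : T.IsRealLinear)
    (z : Fin 6 → ℝ) : ∃ x : Fin 3 → JetIndex 4 → ℝ,
      (∀ j, T.abelianOp (polyMap q 4 (x 0)) (polyMap q 4 (x 1)) (polyMap q 4 (x 2)) j ∈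
        vanishingIdeal q 3) ∧
      ∀ j, evalAt q (T.coord (polyMap q 4 (x 0)) (polyMap q 4 (x 1)) (polyMap q 4 (x 2)) j) =
        z j := by
  -- Three polynomials of degree at most 3 have 30 coefficients. The 2-jets of four equations are 24
  -- conditions, and 24 + 6 = 30.
  obtain ⟨x, hx, hz⟩ := exists_of_finrank
    (LinearMap.pi fun j : Fin 4 => (jet q 3).comp (hR.abelianLin q 4 j)) (hR.coordLin q 4)
    (by
      simp only [Module.finrank_pi_fintype, Module.finrank_self, Finset.sum_const, smul_eq_mul,
        Finset.card_univ, mul_one]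
      decide)
    (fun x hx hz => hT.eq_zero_of_coordLin hR (k := 1)
      (fun j => jet_eq_zero_iff.1 (congrFun hx j)) hz) z
  exact ⟨x, fun j => jet_eq_zero_iff.1 (congrFun hx j), congrFun hz⟩

/-- Where the obstruction vanishes, every value of the canonical coordinates is attained by
polynomials that satisfy the abelian equation to fourth order. -/
lemma SpansAt.exists_solution_order_four (hT : T.SpansAt q) (hR : T.IsRealLinear)
    (hκ : ∀ w u v, (∀ j, T.abelianOp w u v j ∈ vanishingIdeal q 3) →
      evalAt q (T.obstruction w u v) = 0) (z : Fin 6 → ℝ) :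
    ∃ w u v : smoothRing U, (∀ j, T.abelianOp w u v j ∈ vanishingIdeal q 4) ∧
      ∀ j, evalAt q (T.coord w u v j) = z j := by
  -- Three polynomials of degree at most 4 have 45 coefficients, but the 3-jets of four equations
  -- are 40 conditions, one more than 45 - 6. For the fourth equation the condition on `D₁³` is
  -- therefore left out, which leaves 30 + 6 + 3 = 39. The vanishing of the obstruction restores it
  -- in `key`.
  set Φ : (Fin 3 → JetIndex 5 → ℝ) →ₗ[ℝ]
      (Fin 3 → JetIndex 4 → ℝ) × (JetIndex 3 → ℝ) × (Fin 3 → ℝ) :=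
    (LinearMap.pi fun j : Fin 3 => (jet q 4).comp (hR.abelianLin q 5 j.castSucc)).prod
      (((jet q 3).comp (hR.abelianLin q 5 3)).prod
        (LinearMap.pi ![(evalLin q).comp (hR.D₂L.comp (hR.D₂L.comp (hR.D₂L.comp
            (hR.abelianLin q 5 3)))),
          (evalLin q).comp (hR.D₂L.comp (hR.D₂L.comp (hR.D₁L.comp (hR.abelianLin q 5 3)))),
          (evalLin q).comp (hR.D₂L.comp (hR.D₁L.comp (hR.D₁L.comp (hR.abelianLin q 5 3))))]))
    with hΦ
  have key : ∀ x, Φ x = 0 → ∀ j, hR.abelianLin q 5 j x ∈ vanishingIdeal q 4 := by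
    intro x hx
    have h0 : ∀ j : Fin 3, hR.abelianLin q 5 j.castSucc x ∈ vanishingIdeal q 4 := fun j =>
      jet_eq_zero_iff.1 (congrFun (congrArg Prod.fst hx) j)
    have h3 : hR.abelianLin q 5 3 x ∈ vanishingIdeal q 3 :=
      jet_eq_zero_iff.1 (congrArg (fun y => y.2.1) hx)
    have hΔ := hκ _ _ _ (fun j => by
      cases j using Fin.lastCases with
      | last => exact h3
      | cast j => exact mem_vanishingIdeal_of_succ (h0 j))
    rw [obstruction_eq] at hΔ
    have hΔ := hT.eval_Δ₁Δ₂Δ₃_eq_zero (h0 0) (h0 1) (h0 2) hΔ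
    have h := congrArg (fun y => y.2.2) hx
    intro j
    cases j using Fin.lastCases with
    | last => exact hT.mem_four h3 (congrFun h 0) (congrFun h 1) (congrFun h 2) hΔ
    | cast j => exact h0 j
  obtain ⟨x, hx, hz⟩ := exists_of_finrank Φ (hR.coordLin q 5)
    (by
      simp only [Module.finrank_prod, Module.finrank_pi_fintype, Module.finrank_self,
        Finset.sum_const, smul_eq_mul, Finset.card_univ, mul_one]
      decide)
    (fun x hx hz => hT.eq_zero_of_coordLin hR (k := 2) (key x hx) hz) z
  exact ⟨_, _, _, key x hx, congrFun hz⟩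

end FramedWebAlgebra

end

end PlanarWebs

end

noncomputable section

namespace PlanarWebs

/-! ### Flat linear connections -/

section LinearConnection

variable {E : Type*} [NormedAddCommGroup E] [NormedSpace ℝ E]

/-- A coarse form of Grönwall's inequality. The assumption `1 ≤ K` serves to replace `ε / K` by `ε`,
so that the bound is linear in the initial value and the error. -/
lemma norm_le_exp_of_hasDerivAt_right {e e' : ℝ → E} {t₀ r K ε : ℝ} (hK : 1 ≤ K) (hε : 0 ≤ ε)
    (h : ∀ t, |t - t₀| < r → HasDerivAt e (e' t) t ∧ ‖e' t‖ ≤ K * ‖e t‖ + ε) {t : ℝ}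
    (ht₀ : t₀ ≤ t) (ht : |t - t₀| < r) : ‖e t‖ ≤ (‖e t₀‖ + ε) * Real.exp (K * r) := by
  have hmem : ∀ s ∈ Set.Icc t₀ t, |s - t₀| < r := by
    rintro s ⟨h1, h2⟩
    rw [abs_of_nonneg (by linarith)] at ht ⊢
    linarith
  have h1 := norm_le_gronwallBound_of_norm_deriv_right_le (f := e) (f' := e') (δ := ‖e t₀‖) (K := K)
    (ε := ε) (a := t₀) (b := t) (fun s hs => (h s (hmem s hs)).1.continuousAt.continuousWithinAt)
    (fun s hs => (h s (hmem s (Set.Ico_subset_Icc_self hs))).1.hasDerivWithinAt) le_rfl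
    (fun s hs => (h s (hmem s (Set.Ico_subset_Icc_self hs))).2) t ⟨ht₀, le_rfl⟩
  rw [gronwallBound_of_K_ne_0 (by positivity)] at h1
  have h2 : Real.exp (K * (t - t₀)) ≤ Real.exp (K * r) := by
    apply Real.exp_le_exp.2
    have := le_abs_self (t - t₀)
    gcongr
    linarith
  have h3 : ε / K ≤ ε := div_le_self hε hK
  have h4 : 0 ≤ ε / K := by positivity
  calc ‖e t‖ ≤ ‖e t₀‖ * Real.exp (K * (t - t₀)) + ε / K * (Real.exp (K * (t - t₀)) - 1) := h1
    _ ≤ ‖e t₀‖ * Real.exp (K * r) + ε / K * Real.exp (K * r) := by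
      gcongr
      linarith
    _ ≤ ‖e t₀‖ * Real.exp (K * r) + ε * Real.exp (K * r) := by gcongr
    _ = _ := by ring

lemma norm_le_exp_of_hasDerivAt {e e' : ℝ → E} {t₀ r K ε : ℝ} (hK : 1 ≤ K) (hε : 0 ≤ ε)
    (h : ∀ t, |t - t₀| < r → HasDerivAt e (e' t) t ∧ ‖e' t‖ ≤ K * ‖e t‖ + ε) {t : ℝ}
    (ht : |t - t₀| < r) : ‖e t‖ ≤ (‖e t₀‖ + ε) * Real.exp (K * r) := by
  rcases le_total t₀ t with h0 | h0
  · exact norm_le_exp_of_hasDerivAt_right hK hε h h0 ht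
  -- Times before `t₀` are reflected in `t₀`.
  · have h1 := norm_le_exp_of_hasDerivAt_right (e := fun s => e (2 * t₀ - s))
      (e' := fun s => -e' (2 * t₀ - s)) (t₀ := t₀) (r := r) (t := 2 * t₀ - t) hK hε
      (fun s hs => by
        have h2 := h (2 * t₀ - s) (by rw [← abs_neg]; convert! hs using 2; ring)
        refine ⟨?_, by rw [norm_neg]; exact h2.2⟩
        have h3 := h2.1.scomp s ((hasDerivAt_id s).const_sub (2 * t₀))
        simpa using! h3)
      (by linarith) (by rw [← abs_neg]; convert! ht using 2; ring)
    simpa [two_mul] using h1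

/-- Picard–Lindelöf on the ball of radius `‖z‖ + 1` about `z`. There the speed is at most `K (2 ‖z‖
+ 1)`, and `K r ≤ 1 / 2` keeps the solution inside during the time `r`. -/
lemma exists_hasDerivAt_linear [CompleteSpace E] {B : ℝ → E →L[ℝ] E} (hB : Continuous B)
    {t₀ r K : ℝ} (hr : 0 < r) (hK : 0 ≤ K) (hKr : K * r ≤ 1 / 2)
    (hBK : ∀ t, |t - t₀| ≤ r → ‖B t‖ ≤ K) (z : E) :
    ∃ α : ℝ → E, α t₀ = z ∧ ∀ t, |t - t₀| < r → HasDerivAt α (B t (α t)) t := by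
  have hmem : ∀ t ∈ Set.Icc (t₀ - r) (t₀ + r), |t - t₀| ≤ r := fun t ht => by
    rw [abs_le]
    constructor <;> linarith [ht.1, ht.2]
  have hPL : IsPicardLindelof (fun t x => B t x) (tmin := t₀ - r) (tmax := t₀ + r)
      ⟨t₀, by constructor <;> linarith⟩ z ⟨‖z‖ + 1, by positivity⟩ 0
      ⟨K * (2 * ‖z‖ + 1), by positivity⟩ ⟨K, hK⟩ := by
    refine ⟨fun t ht => ?_, fun x _ => ?_, fun t ht x hx => ?_, ?_⟩
    · exact ((B t).lipschitz.weaken (hBK t (hmem t ht))).lipschitzOnWith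
    · exact (hB.clm_apply continuous_const).continuousOn
    · have h1 : ‖x‖ ≤ 2 * ‖z‖ + 1 := by
        have h2 : dist x z ≤ ‖z‖ + 1 := hx
        rw [dist_eq_norm] at h2
        have h3 := norm_le_norm_add_norm_sub' x z
        linarith
      calc ‖B t x‖ ≤ ‖B t‖ * ‖x‖ := (B t).le_opNorm x
        _ ≤ K * (2 * ‖z‖ + 1) := by
          have := hBK t (hmem t ht)
          gcongr
    · change K * (2 * ‖z‖ + 1) * max (t₀ + r - t₀) (t₀ - (t₀ - r)) ≤ ‖z‖ + 1 - 0
      rw [add_sub_cancel_left, sub_sub_cancel, max_self]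
      nlinarith [norm_nonneg z]
  obtain ⟨α, h0, hα⟩ := hPL.exists_eq_forall_mem_Icc_hasDerivWithinAt₀
  refine ⟨α, h0, fun t ht => ?_⟩
  rw [abs_lt] at ht
  exact (hα t ⟨by linarith, by linarith⟩).hasDerivAt
    (Icc_mem_nhds (by linarith) (by linarith))

/-- Taylor estimates of first and second order with one constant for the whole ball. This uniformity
makes the error of the difference quotients in `hasDerivAt_of_flat` of order `h²`. -/
lemma exists_norm_shift_sub_le {F : Type*} [NormedAddCommGroup F] [NormedSpace ℝ F] {B : Plane → F}
    (hB : ContDiff ℝ ∞ B) (p : Plane) (r : ℝ) : ∃ C, 0 ≤ C ∧ ∀ x y h,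
      (x, y) ∈ Metric.closedBall p r → (x + h, y) ∈ Metric.closedBall p r →
      ‖B (x + h, y) - B (x, y)‖ ≤ C * |h| ∧
        ‖B (x + h, y) - B (x, y) - h • fderiv ℝ B (x, y) (1, 0)‖ ≤ C * |h| * |h| := by
  have hB' : ContDiff ℝ ∞ (fderiv ℝ B) := hB.fderiv_right (by simp)
  have hcpt := isCompact_closedBall p r
  obtain ⟨C₁, hC₁⟩ := hcpt.exists_bound_of_continuousOn hB'.continuous.continuousOn
  obtain ⟨C₂, hC₂⟩ := hcpt.exists_bound_of_continuousOn
    (hB'.continuous_fderiv (by simp)).continuousOn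
  refine ⟨max 0 (max C₁ C₂), le_max_left _ _, fun x y h h0 h1 => ?_⟩
  have hC : C₁ ≤ max 0 (max C₁ C₂) ∧ C₂ ≤ max 0 (max C₁ C₂) :=
    ⟨(le_max_left _ _).trans (le_max_right _ _), (le_max_right _ _).trans (le_max_right _ _)⟩
  have hC0 : 0 ≤ max 0 (max C₁ C₂) := le_max_left _ _
  generalize max 0 (max C₁ C₂) = C at hC hC0 ⊢
  have hsub : (x + h, y) - (x, y) = h • ((1, 0) : Plane) := by
    ext <;> simp
  have hn : ‖(x + h, y) - (x, y)‖ = |h| := by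
    rw [hsub, norm_smul, Prod.norm_def]
    simp
  have hconv := convex_closedBall p r
  have hd : Differentiable ℝ B := hB.differentiable (by simp)
  constructor
  · rw [← hn]
    exact hconv.norm_image_sub_le_of_norm_fderiv_le (fun q _ => hd q)
      (fun q hq => (hC₁ q hq).trans hC.1) h0 h1
  · rw [← map_smul, ← hsub, ← hn]
    refine (convex_segment (x, y) (x + h, y)).norm_image_sub_le_of_norm_fderiv_le'
      (fun q _ => hd q) (fun q hq => ?_) (left_mem_segment ..) (right_mem_segment ..)
    have h2 := hconv.norm_image_sub_le_of_norm_fderiv_le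
      (fun q _ => hB'.differentiable (by simp) q)
      (fun q hq => (hC₂ q hq).trans hC.2) h0 (hconv.segment_subset h0 h1 hq)
    refine h2.trans ?_
    gcongr
    exact norm_sub_le_of_mem_segment hq

lemma mem_ball_plane {x y : ℝ} {p : Plane} {r : ℝ} :
    (x, y) ∈ Metric.ball p r ↔ |x - p.1| < r ∧ |y - p.2| < r := by
  rw [Metric.mem_ball, Prod.dist_eq, max_lt_iff]
  rfl

/-- A family of solutions of the second equation of a flat linear system that satisfies the first
equation initially satisfies it everywhere. -/
lemma hasDerivAt_of_flat {A B : Plane → E →L[ℝ] E} (hA : ContDiff ℝ ∞ A)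
    {p : Plane} {r K C : ℝ} (hK : 1 ≤ K) (hC0 : 0 ≤ C)
    (hAK : ∀ q ∈ Metric.closedBall p r, ‖A q‖ ≤ K) (hBK : ∀ q ∈ Metric.closedBall p r, ‖B q‖ ≤ K)
    (hC : ∀ x y h, (x, y) ∈ Metric.closedBall p r → (x + h, y) ∈ Metric.closedBall p r →
      ‖B (x + h, y) - B (x, y)‖ ≤ C * |h| ∧
        ‖B (x + h, y) - B (x, y) - h • fderiv ℝ B (x, y) (1, 0)‖ ≤ C * |h| * |h|)
    (flat : ∀ q ∈ Metric.closedBall p r,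
      fderiv ℝ A q (0, 1) + A q ∘L B q = fderiv ℝ B q (1, 0) + B q ∘L A q)
    {s : ℝ → ℝ → E} (hs₁ : ∀ x, |x - p.1| < r →
      HasDerivAt (fun x => s x p.2) (A (x, p.2) (s x p.2)) x)
    (hs₂ : ∀ x y, |x - p.1| < r → |y - p.2| < r → HasDerivAt (s x) (B (x, y) (s x y)) y)
    {x y : ℝ} (hx : |x - p.1| < r) (hy : |y - p.2| < r) :
    HasDerivAt (fun x => s x y) (A (x, y) (s x y)) x := by
  have hball : ∀ {x y : ℝ}, |x - p.1| < r → |y - p.2| < r → (x, y) ∈ Metric.closedBall p r :=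
    fun h1 h2 => Metric.ball_subset_closedBall (mem_ball_plane.2 ⟨h1, h2⟩)
  have hr : 0 < r := (abs_nonneg _).trans_lt hx
  have hp : |p.2 - p.2| < r := by simpa using hr
  set S := ‖s x p.2‖ * Real.exp (K * r)
  have hS : ∀ η, |η - p.2| < r → ‖s x η‖ ≤ S := by
    intro η hη
    have h := norm_le_exp_of_hasDerivAt (e := s x) (e' := fun η => B (x, η) (s x η)) (t₀ := p.2)
      (r := r) (ε := 0) hK le_rfl (fun t ht => ⟨hs₂ x t hx ht, by
        rw [add_zero]
        exact ((B (x, t)).le_opNorm _).trans (by gcongr; exact hBK _ (hball hx ht))⟩) hη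
    rwa [add_zero] at h
  have hS0 : 0 ≤ S := by positivity
  set ex := Real.exp (K * r)
  -- The defect `s (x + h) η - s x η - h A s` satisfies in `η` the linear equation with coefficient
  -- `B` up to an error of order `h²`. Grönwall bounds it at height `y` by its value at height
  -- `p.2`, where it is `o(h)` by `hs₁`.
  have key : ∀ h : ℝ, |x + h - p.1| < r →
      ‖s (x + h) y - s x y - h • A (x, y) (s x y)‖ ≤
        (‖s (x + h) p.2 - s x p.2 - h • A (x, p.2) (s x p.2)‖ + C * (1 + K) * S * (|h| * |h|)) *
          ex := by
    intro h hh
    refine norm_le_exp_of_hasDerivAt (t₀ := p.2) (t := y) (r := r)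
      (e := fun η => s (x + h) η - s x η - h • A (x, η) (s x η))
      (e' := fun η => B (x + h, η) (s (x + h) η) - B (x, η) (s x η) -
        h • (fderiv ℝ A (x, η) (0, 1) (s x η) + A (x, η) (B (x, η) (s x η)))) hK
      (by positivity) (fun η hη => ⟨?_, ?_⟩) hy
    · refine ((hs₂ _ _ hh hη).sub (hs₂ _ _ hx hη)).sub (HasDerivAt.const_smul h ?_)
      have h1 : HasDerivAt (fun η => A (x, η)) (fderiv ℝ A (x, η) (0, 1)) η := by
        have h2 := (hA.differentiable (by simp) (x, η)).hasFDerivAt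
        exact h2.comp_hasDerivAt η ((hasDerivAt_const η x).prodMk (hasDerivAt_id η))
      exact h1.clm_apply (hs₂ _ _ hx hη)
    · obtain ⟨b1, b2⟩ := hC _ _ _ (hball hx hη) (hball hh hη)
      have hf := congrArg (fun L => L (s x η)) (flat (x, η) (hball hx hη))
      simp only [add_apply, ContinuousLinearMap.comp_apply] at hf
      rw [hf]
      set e := s (x + h) η - s x η - h • A (x, η) (s x η) with he
      -- Flatness has replaced `∂₂A + A B` by `∂₁B + B A`; now all terms of first order in `h` are
      -- absorbed into `B e`.
      have e1 : B (x + h, η) (s (x + h) η) - B (x, η) (s x η) -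
          h • (fderiv ℝ B (x, η) (1, 0) (s x η) + B (x, η) (A (x, η) (s x η))) =
          B (x + h, η) e + (B (x + h, η) - B (x, η) - h • fderiv ℝ B (x, η) (1, 0)) (s x η) +
            h • (B (x + h, η) - B (x, η)) (A (x, η) (s x η)) := by
        simp only [he, map_sub, map_smul, sub_apply, smul_apply, smul_sub, smul_add]
        abel
      rw [e1]
      have hAs : ‖A (x, η) (s x η)‖ ≤ K * S :=
        ((A (x, η)).le_opNorm _).trans (mul_le_mul (hAK _ (hball hx hη)) (hS η hη)
          (norm_nonneg _) (by linarith))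
      refine (norm_add₃_le).trans ?_
      have t1 : ‖B (x + h, η) e‖ ≤ K * ‖e‖ :=
        ((B (x + h, η)).le_opNorm _).trans (by gcongr; exact hBK _ (hball hh hη))
      have t2 := ((B (x + h, η) - B (x, η) - h • fderiv ℝ B (x, η) (1, 0)).le_opNorm
        (s x η)).trans (mul_le_mul b2 (hS η hη) (norm_nonneg _) (by positivity))
      have t3 := ((B (x + h, η) - B (x, η)).le_opNorm (A (x, η) (s x η))).trans
        (mul_le_mul b1 hAs (norm_nonneg _) (by positivity))
      rw [norm_smul, Real.norm_eq_abs]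
      have t4 := mul_le_mul_of_nonneg_left t3 (abs_nonneg h)
      linarith
  rw [hasDerivAt_iff_isLittleO_nhds_zero]
  have h0 := hasDerivAt_iff_isLittleO_nhds_zero.1 (hs₁ x hx)
  have h2 : (fun h : ℝ => C * (1 + K) * S * (|h| * |h|)) =o[𝓝 0] fun h => h := by
    refine Asymptotics.IsLittleO.const_mul_left ?_ _
    simp only [abs_mul_abs_self]
    simpa [pow_two] using Asymptotics.isLittleO_pow_id (𝕜 := ℝ) (n := 2) (by norm_num)
  refine Asymptotics.IsBigO.trans_isLittleO ?_ (h0.norm_left.add h2)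
  refine Asymptotics.IsBigO.of_bound ex ?_
  have hopen : ∀ᶠ h in 𝓝 (0 : ℝ), |x + h - p.1| < r := by
    have hcont : Continuous fun h : ℝ => |x + h - p.1| := by fun_prop
    exact hcont.continuousAt.eventually_lt continuousAt_const (by simpa using hx)
  filter_upwards [hopen] with h hh
  rw [mul_comm]
  refine (key h hh).trans ?_
  gcongr
  exact le_abs_self _

/-- Bootstrapping: if `s` is of class `Cⁿ`, its derivative `M s` is of class `Cⁿ`, so `s` is of
class `Cⁿ⁺¹`. -/
lemma contDiffOn_of_hasFDerivAt {M : Plane → E →L[ℝ] (Plane →L[ℝ] E)} (hM : ContDiff ℝ ∞ M)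
    {s : Plane → E} {Q : Set Plane} (hQ : IsOpen Q)
    (hs : ∀ q ∈ Q, HasFDerivAt s (M q (s q)) q) : ContDiffOn ℝ ∞ s Q := by
  rw [contDiffOn_infty]
  intro n
  induction n with
  | zero =>
    rw [Nat.cast_zero, contDiffOn_zero]
    exact fun q hq => (hs q hq).continuousAt.continuousWithinAt
  | succ n ih =>
    rw [Nat.cast_succ, contDiffOn_succ_iff_fderiv_of_isOpen hQ]
    refine ⟨fun q hq => (hs q hq).differentiableAt.differentiableWithinAt, by simp, ?_⟩
    exact ((hM.of_le (by exact_mod_cast le_top)).contDiffOn.clm_apply ih).congr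
      fun q hq => (hs q hq).fderiv

/-- The form `A dx + B dy` with values in the endomorphisms. -/
def connectionForm (A B : Plane → E →L[ℝ] E) (q : Plane) : E →L[ℝ] (Plane →L[ℝ] E) :=
  ContinuousLinearMap.smulRightL ℝ Plane E (ContinuousLinearMap.fst ℝ ℝ ℝ) ∘L A q +
    ContinuousLinearMap.smulRightL ℝ Plane E (ContinuousLinearMap.snd ℝ ℝ ℝ) ∘L B q

lemma connectionForm_apply (A B : Plane → E →L[ℝ] E) (q : Plane) (z : E) (v : Plane) :
    connectionForm A B q z v = v.1 • A q z + v.2 • B q z := rfl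

lemma contDiff_connectionForm {A B : Plane → E →L[ℝ] E} (hA : ContDiff ℝ ∞ A)
    (hB : ContDiff ℝ ∞ B) : ContDiff ℝ ∞ (connectionForm A B) :=
  (contDiff_const.clm_comp hA).add (contDiff_const.clm_comp hB)

/-- A flat linear system has a solution with any given value at a point. -/
theorem exists_parallel_section [CompleteSpace E] {A B : Plane → E →L[ℝ] E}
    (hA : ContDiff ℝ ∞ A) (hB : ContDiff ℝ ∞ B) {p : Plane}
    (flat : ∀ᶠ q in 𝓝 p, fderiv ℝ A q (0, 1) + A q ∘L B q = fderiv ℝ B q (1, 0) + B q ∘L A q)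
    (z : E) : ∃ s : Plane → E, s p = z ∧ ∀ᶠ q in 𝓝 p, ContDiffAt ℝ ∞ s q ∧
      HasFDerivAt s (connectionForm A B q (s q)) q := by
  obtain ⟨r₀, hr₀, flat⟩ := Metric.nhds_basis_closedBall.eventually_iff.1 flat
  have hcpt := isCompact_closedBall p r₀
  obtain ⟨KA, hKA⟩ := hcpt.exists_bound_of_continuousOn hA.continuous.continuousOn
  obtain ⟨KB, hKB⟩ := hcpt.exists_bound_of_continuousOn hB.continuous.continuousOn
  obtain ⟨C, hC0, hC⟩ : ∃ C, 0 ≤ C ∧ ∀ x y h, (x, y) ∈ Metric.closedBall p r₀ →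
      (x + h, y) ∈ Metric.closedBall p r₀ → ‖B (x + h, y) - B (x, y)‖ ≤ C * |h| ∧
        ‖B (x + h, y) - B (x, y) - h • fderiv ℝ B (x, y) (1, 0)‖ ≤ C * |h| * |h| := by
    exact exists_norm_shift_sub_le hB p r₀
  obtain ⟨K, hK, hKA', hKB'⟩ : ∃ K : ℝ, 1 ≤ K ∧ KA ≤ K ∧ KB ≤ K :=
    ⟨max 1 (max KA KB), le_max_left _ _, (le_max_left _ _).trans (le_max_right _ _),
      (le_max_right _ _).trans (le_max_right _ _)⟩
  obtain ⟨r, hr, hrr, hKr⟩ : ∃ r : ℝ, 0 < r ∧ r ≤ r₀ ∧ K * r ≤ 1 / 2 := by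
    refine ⟨min r₀ (1 / (2 * K)), by positivity, min_le_left _ _, ?_⟩
    calc K * min r₀ (1 / (2 * K)) ≤ K * (1 / (2 * K)) := by
          gcongr
          exact min_le_right _ _
      _ = 1 / 2 := by field_simp
  have hsub := Metric.closedBall_subset_closedBall (x := p) hrr
  have hAK : ∀ q ∈ Metric.closedBall p r, ‖A q‖ ≤ K := fun q hq => (hKA q (hsub hq)).trans hKA'
  have hBK : ∀ q ∈ Metric.closedBall p r, ‖B q‖ ≤ K := fun q hq => (hKB q (hsub hq)).trans hKB'
  have hmem : ∀ {x y : ℝ}, |x - p.1| ≤ r → |y - p.2| ≤ r → (x, y) ∈ Metric.closedBall p r := by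
    intro x y h1 h2
    rw [Metric.mem_closedBall, Prod.dist_eq]
    exact max_le h1 h2
  have hp2 : |p.2 - p.2| ≤ r := by simpa using hr.le
  -- The section is built by integrating along the horizontal line through `p` and then along every
  -- vertical line; flatness supplies the horizontal equation at the other heights.
  obtain ⟨X, hX0, hX⟩ := exists_hasDerivAt_linear (B := fun x => A (x, p.2)) (t₀ := p.1) (r := r)
    (hA.continuous.comp (by fun_prop)) hr (by linarith) hKr
    (fun t ht => hAK _ (hmem ht hp2)) z
  have hY : ∀ x, ∃ Y : ℝ → E, Y p.2 = X x ∧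
      (|x - p.1| < r → ∀ y, |y - p.2| < r → HasDerivAt Y (B (x, y) (Y y)) y) := by
    intro x
    by_cases hx : |x - p.1| < r
    · obtain ⟨Y, h0, h⟩ := exists_hasDerivAt_linear (B := fun y => B (x, y)) (t₀ := p.2) (r := r)
        (hB.continuous.comp (by fun_prop)) hr (by linarith) hKr
        (fun t ht => hBK _ (hmem hx.le ht)) (X x)
      exact ⟨Y, h0, fun _ => h⟩
    · exact ⟨fun _ => X x, rfl, fun h => absurd h hx⟩
  choose s hs0 hs₂ using hY
  have hs₂' : ∀ x y, |x - p.1| < r → |y - p.2| < r → HasDerivAt (s x) (B (x, y) (s x y)) y :=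
    fun x y hx hy => hs₂ x hx y hy
  have hs₁ : ∀ x y, |x - p.1| < r → |y - p.2| < r →
      HasDerivAt (fun x => s x y) (A (x, y) (s x y)) x := by
    intro x y hx hy
    refine hasDerivAt_of_flat hA hK hC0 hAK hBK (fun x y h h1 h2 => hC x y h (hsub h1) (hsub h2))
      (fun q hq => flat (hsub hq)) (fun x hx => ?_) hs₂' hx hy
    simp only [hs0]
    exact hX x hx
  have hbound : ∀ x y, |x - p.1| < r → |y - p.2| < r →
      ‖s x y‖ ≤ ‖z‖ * Real.exp (K * r) * Real.exp (K * r) := by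
    intro x y hx hy
    have h1 := norm_le_exp_of_hasDerivAt (e := s x) (e' := fun η => B (x, η) (s x η)) (t₀ := p.2)
      (r := r) (ε := 0) hK le_rfl (fun t ht => ⟨hs₂' x t hx ht, by
        rw [add_zero]
        exact ((B (x, t)).le_opNorm _).trans
          (by gcongr; exact hBK _ (hmem hx.le ht.le))⟩) hy
    have h2 := norm_le_exp_of_hasDerivAt (e := X) (e' := fun t => A (t, p.2) (X t)) (t₀ := p.1)
      (r := r) (ε := 0) hK le_rfl (fun t ht => ⟨hX t ht, by
        rw [add_zero]
        exact ((A (t, p.2)).le_opNorm _).trans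
          (by gcongr; exact hAK _ (hmem ht.le hp2))⟩) hx
    rw [add_zero, hs0] at h1
    rw [add_zero, hX0] at h2
    exact h1.trans (by gcongr)
  set Q := Metric.ball p r
  -- Joint continuity comes from a Lipschitz bound in `y` that is uniform in `x`. It makes the
  -- partial derivatives continuous, which upgrades them to a total derivative.
  have hcont : ContinuousOn (fun q : Plane => s q.1 q.2) Q := by
    have hQ : Q = Metric.ball p.1 r ×ˢ Metric.ball p.2 r := (ball_prod_same p.1 p.2 r).symm
    rw [hQ]
    refine continuousOn_prod_of_continuousOn_lipschitzOnWith' _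
      ⟨K * (‖z‖ * Real.exp (K * r) * Real.exp (K * r)), by positivity⟩ (fun x hx => ?_)
      fun y hy x hx => (hs₁ x y hx hy).continuousAt.continuousWithinAt
    refine (convex_ball p.2 r).lipschitzOnWith_of_nnnorm_hasDerivWithin_le
      (f' := fun y => B (x, y) (s x y))
      (fun y hy => (hs₂' x y hx hy).hasDerivWithinAt) fun y hy => ?_
    have h1 : ‖B (x, y) (s x y)‖ ≤ K * (‖z‖ * Real.exp (K * r) * Real.exp (K * r)) :=
      ((B (x, y)).le_opNorm _).trans (mul_le_mul (hBK _ (hmem (le_of_lt hx) (le_of_lt hy)))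
        (hbound x y hx hy) (norm_nonneg _) (by linarith))
    exact h1
  have hderiv : ∀ q ∈ Q, HasFDerivAt (fun q : Plane => s q.1 q.2)
      (connectionForm A B q (s q.1 q.2)) q := by
    intro q hq
    have hQn : Q ∈ 𝓝 q := Metric.isOpen_ball.mem_nhds hq
    have hc := hcont.continuousAt hQn
    have h := hasStrictFDerivAt_uncurry_coprod (𝕜 := ℝ) (u := q) (f := s)
      (f₁ := fun x y => ContinuousLinearMap.toSpanSingleton ℝ (A (x, y) (s x y)))
      (f₂ := fun x y => ContinuousLinearMap.toSpanSingleton ℝ (B (x, y) (s x y)))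
      (by
        filter_upwards [hQn] with v hv
        obtain ⟨h1, h2⟩ := mem_ball_plane.1 hv
        exact (hs₁ v.1 v.2 h1 h2).hasFDerivAt)
      (by
        filter_upwards [hQn] with v hv
        obtain ⟨h1, h2⟩ := mem_ball_plane.1 hv
        exact (hs₂' v.1 v.2 h1 h2).hasFDerivAt)
      ((ContinuousLinearMap.toSpanSingletonCLE (𝕜 := ℝ)).continuous.continuousAt.comp
        (hA.continuous.continuousAt.clm_apply hc))
      ((ContinuousLinearMap.toSpanSingletonCLE (𝕜 := ℝ)).continuous.continuousAt.comp
        (hB.continuous.continuousAt.clm_apply hc))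
    refine h.hasFDerivAt.congr_fderiv ?_
    exact ContinuousLinearMap.ext fun v => rfl
  have hsm := contDiffOn_of_hasFDerivAt (contDiff_connectionForm hA hB) Metric.isOpen_ball hderiv
  refine ⟨fun q => s q.1 q.2, (hs0 p.1).trans hX0, ?_⟩
  filter_upwards [Metric.ball_mem_nhds p hr] with q hq
  exact ⟨hsm.contDiffAt (Metric.isOpen_ball.mem_nhds hq), hderiv q hq⟩

/-- A solution of a linear system that vanishes at a point vanishes. -/
lemma parallel_section_eq_zero {A B : Plane → E →L[ℝ] E} {Q : Set Plane} (hQ : Convex ℝ Q)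
    (hA : ContinuousOn A Q) (hB : ContinuousOn B Q) {s : Plane → E}
    (hs : ∀ q ∈ Q, HasFDerivAt s (connectionForm A B q (s q)) q) {q₀ : Plane} (hq₀ : q₀ ∈ Q)
    (h0 : s q₀ = 0) {q : Plane} (hq : q ∈ Q) : s q = 0 := by
  -- Along the segment from `q₀` to `q` the section solves a linear ordinary differential equation
  -- with zero initial value.
  set γ : ℝ → Plane := fun t => q₀ + t • (q - q₀) with hγ
  have hmem : ∀ t ∈ Set.Icc (0 : ℝ) 1, γ t ∈ Q := fun t ht => hQ.add_smul_sub_mem hq₀ hq ht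
  have hcont : Continuous γ := by fun_prop
  obtain ⟨KA, hKA⟩ := isCompact_Icc.exists_bound_of_continuousOn
    (hA.comp (hcont.continuousOn (s := Set.Icc (0 : ℝ) 1)) hmem)
  obtain ⟨KB, hKB⟩ := isCompact_Icc.exists_bound_of_continuousOn
    (hB.comp (hcont.continuousOn (s := Set.Icc (0 : ℝ) 1)) hmem)
  have hd : ∀ t ∈ Set.Icc (0 : ℝ) 1, HasDerivAt (fun t => s (γ t))
      (connectionForm A B (γ t) (s (γ t)) (q - q₀)) t := by
    intro t ht
    have h1 : HasDerivAt γ ((1 : ℝ) • (q - q₀)) t :=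
      ((hasDerivAt_id t).smul_const (q - q₀)).const_add q₀
    rw [one_smul] at h1
    exact (hs _ (hmem t ht)).comp_hasDerivAt t h1
  have hb : ∀ t ∈ Set.Icc (0 : ℝ) 1, ‖connectionForm A B (γ t) (s (γ t)) (q - q₀)‖ ≤
      (|(q - q₀).1| * KA + |(q - q₀).2| * KB) * ‖s (γ t)‖ := by
    intro t ht
    rw [connectionForm_apply]
    refine (norm_add_le _ _).trans ?_
    rw [norm_smul, norm_smul, add_mul, mul_assoc, mul_assoc, Real.norm_eq_abs, Real.norm_eq_abs]
    have h1 := ContinuousLinearMap.le_of_opNorm_le _ (hKA t ht) (s (γ t))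
    have h2 := ContinuousLinearMap.le_of_opNorm_le _ (hKB t ht) (s (γ t))
    exact add_le_add (mul_le_mul_of_nonneg_left h1 (abs_nonneg _))
      (mul_le_mul_of_nonneg_left h2 (abs_nonneg _))
  have h := eq_zero_of_abs_deriv_le_mul_abs_self_of_eq_zero_right (f := fun t => s (γ t))
    (a := 0) (b := 1) (fun t ht => (hd t ht).continuousAt.continuousWithinAt)
    (fun t ht => (hd t (Set.Ico_subset_Icc_self ht)).hasDerivWithinAt) (by simpa [hγ] using h0)
    (fun t ht => hb t (Set.Ico_subset_Icc_self ht)) 1 ⟨zero_le_one, le_rfl⟩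
  simpa [hγ] using h

end LinearConnection

/-- A function that is smooth near a point agrees there with a function that is smooth
everywhere. -/
lemma exists_contDiff_eventuallyEq {F : Type*} [NormedAddCommGroup F] [NormedSpace ℝ F]
    {f : Plane → F} {p : Plane} (hf : ∀ᶠ q in 𝓝 p, ContDiffAt ℝ ∞ f q) :
    ∃ g : Plane → F, ContDiff ℝ ∞ g ∧ g =ᶠ[𝓝 p] f := by
  obtain ⟨r, hr, hf⟩ := Metric.nhds_basis_closedBall.eventually_iff.1 hf
  let χ : ContDiffBump p := ⟨r / 2, r, by positivity, by linarith⟩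
  refine ⟨fun q => χ q • f q, ?_, ?_⟩
  · rw [contDiff_iff_contDiffAt]
    intro q
    by_cases hq : q ∈ Metric.closedBall p r
    · exact χ.contDiff.contDiffAt.smul (hf hq)
    · have h : (fun q => χ q • f q) =ᶠ[𝓝 q] fun _ => 0 := by
        filter_upwards [Metric.isClosed_closedBall.isOpen_compl.mem_nhds hq] with q' hq'
        have : χ q' = 0 := χ.zero_of_le_dist (le_of_lt (not_le.1 fun h => hq' h))
        rw [this, zero_smul]
      exact contDiffAt_const.congr_of_eventuallyEq h
  · filter_upwards [χ.eventuallyEq_one] with q hq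
    rw [hq]
    simp

end PlanarWebs

end

noncomputable section

namespace PlanarWebs

open TopologicalSpace (Opens)

namespace Normalization

variable {W : PlanarWeb 5} (N : Normalization W) {U : Opens Plane}
  (hU : (U : Set Plane) ⊆ W.domain)

/-! ### The invariants -/

lemma isRealLinear : (N.framed hU).IsRealLinear := fun c => by
  constructor
  · rw [D₁_apply, partialDeriv_algebraMap, partialDeriv_algebraMap, mul_zero, mul_zero, sub_zero]
  · rw [D₂_apply, partialDeriv_algebraMap, partialDeriv_algebraMap, mul_zero, mul_zero, sub_zero]

/-- The coefficients are those of the elimination divided by `-10 (1 - a) (1 - b)`. Since the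
coefficient of `w₂₂` is `-(1 - a) (1 - b)` times the sum of the ten curvatures, the quotient is
their mean. -/
lemma exists_coeffs : ∃ c : Fin 6 → smoothRing U, (∀ q : U, evalAt q (c 0) = N.curvature q) ∧
    ∀ (q : U) (w u v : smoothRing U),
      (∀ j, (N.framed hU).abelianOp w u v j ∈ vanishingIdeal q 3) →
      evalAt q ((N.framed hU).obstruction w u v) = -10 * (1 - N.a q) * (1 - N.b q) *
        ∑ i, evalAt q (c i) * evalAt q ((N.framed hU).coord w u v i) := by
  obtain ⟨c, hc, h⟩ := (N.framed hU).exists_obstruction_coeffs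
  have ha : ∀ q : U, evalAt q (N.framed hU).i1a * (1 - N.a q) = 1 := fun q => by
    have := congrArg (evalAt q) (N.framed hU).one_sub_a_mul
    rwa [map_mul, map_sub, map_one, (N.represents_a hU).evalAt] at this
  have hb : ∀ q : U, evalAt q (N.framed hU).i1b * (1 - N.b q) = 1 := fun q => by
    have := congrArg (evalAt q) (N.framed hU).one_sub_b_mul
    rwa [map_mul, map_sub, map_one, (N.represents_b hU).evalAt] at this
  refine ⟨fun i => algebraMap ℝ _ (-1 / 10) * (N.framed hU).i1a * (N.framed hU).i1b * c i, ?_, ?_⟩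
  · intro q
    rw [map_mul, map_mul, map_mul, hc, FramedWebAlgebra.map_leadObstruction,
      N.evalAt_curvatureSum hU, evalAt_algebraMap, (N.represents_a hU).evalAt,
      (N.represents_b hU).evalAt]
    linear_combination evalAt q (N.framed hU).i1b * (1 - N.b q) * N.curvature q * ha q +
      N.curvature q * hb q
  · intro q w u v hE
    -- The identity is needed only at `q`, so the ideal is that of functions vanishing at `q`; two
    -- derivatives of the equation account for the order `3 = 1 + 2`.
    have h1 := vanishesTo_one.1 (h (vanishingIdeal q 1) w u v fun j =>
      (N.spansAt hU q).containsTwoJet (hE j))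
    rw [map_sub, sub_eq_zero] at h1
    rw [h1, map_sum, Finset.mul_sum]
    refine Finset.sum_congr rfl fun i _ => ?_
    simp only [map_mul, evalAt_algebraMap]
    linear_combination -(evalAt q (c i) * evalAt q ((N.framed hU).coord w u v i)) *
      (evalAt q (N.framed hU).i1b * (1 - N.b q) * ha q + hb q)

variable {N hU} in
lemma jetSolves_iff {k : ℕ} {w u v : smoothRing U} {w' u' v' : Plane → ℝ} (hw : Represents w w')
    (hu : Represents u u') (hv : Represents v v') {q : U} : N.JetSolves k w' u' v' q ↔
      ∀ j, (N.framed hU).abelianOp w u v j ∈ vanishingIdeal q k :=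
  forall_congr' fun j => ((represents_abelianOp hw hu hv j).vanishesTo_iff).symm

/-- The values of the canonical coordinates `w₂₂, w₂, v₂, w, u, v`. -/
def coords (w u v : Plane → ℝ) : Fin 6 → Plane → ℝ :=
  ![N.δ₂ 2 (N.δ₂ 1 w), N.δ₂ 1 w, N.δ₂ 1 v, w, u, v]

variable {N hU} in
lemma represents_coords {w u v : smoothRing U} {w' u' v' : Plane → ℝ} (hw : Represents w w')
    (hu : Represents u u') (hv : Represents v v') (j : Fin 6) :
    Represents ((N.framed hU).coord w u v j) (N.coords w' u' v' j) := by
  fin_cases j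
  · exact (hw.δ₂ 1).δ₂ 2
  · exact hw.δ₂ 1
  · exact hv.δ₂ 1
  · exact hw
  · exact hu
  · exact hv

lemma isObstructionCoeffs_iff (c : Fin 6 → Plane → ℝ) : N.IsObstructionCoeffs c ↔
    ∀ p ∈ W.domain, ∀ w u v : Plane → ℝ,
      ContDiff ℝ ∞ w → ContDiff ℝ ∞ u → ContDiff ℝ ∞ v → N.JetSolves 3 w u v p →
      N.obstruction w u v p = -10 * (1 - N.a p) * (1 - N.b p) *
        ∑ i, c i p * N.coords w u v i p := by
  simp only [IsObstructionCoeffs, Fin.sum_univ_six]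
  rfl

/-- The domain of the web as an open set. -/
def _root_.PlanarWebs.PlanarWeb.opens {d : ℕ} (W : PlanarWeb d) : Opens Plane :=
  ⟨W.domain, W.isOpen_domain⟩

lemma isObstructionCoeffs_of_framed {c : Fin 6 → smoothRing U} (hU' : (U : Set Plane) = W.domain)
    (hc : ∀ (q : U) (w u v : smoothRing U),
      (∀ j, (N.framed hU).abelianOp w u v j ∈ vanishingIdeal q 3) →
      evalAt q ((N.framed hU).obstruction w u v) = -10 * (1 - N.a q) * (1 - N.b q) *
        ∑ i, evalAt q (c i) * evalAt q ((N.framed hU).coord w u v i)) :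
    N.IsObstructionCoeffs fun i => extendZero (c i) := by
  rw [isObstructionCoeffs_iff]
  intro p hp w u v hw hu hv hE
  have hp' : p ∈ U := by
    rw [← hU'] at hp
    exact hp
  have rw' := represents_restrictTo w (U := U) hw.contDiffOn
  have ru' := represents_restrictTo u (U := U) hu.contDiffOn
  have rv' := represents_restrictTo v (U := U) hv.contDiffOn
  have h := hc ⟨p, hp'⟩ _ _ _ ((jetSolves_iff (hU := hU) rw' ru' rv').1 hE)
  rw [(represents_obstruction rw' ru' rv').evalAt] at h
  rw [h]
  refine congrArg _ (Finset.sum_congr rfl fun i _ => ?_)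
  rw [(represents_coords rw' ru' rv' i).evalAt, (represents_extendZero (c i)).evalAt]

/-- The invariants are unique. -/
lemma IsObstructionCoeffs.unique {c c' : Fin 6 → Plane → ℝ} (hc : N.IsObstructionCoeffs c)
    (hc' : N.IsObstructionCoeffs c') (i : Fin 6) {p : Plane} (hp : p ∈ W.domain) :
    c i p = c' i p := by
  rw [isObstructionCoeffs_iff] at hc hc'
  have hU : ((W.opens : Opens Plane) : Set Plane) ⊆ W.domain := subset_rfl
  let q : W.opens := ⟨p, hp⟩
  -- A jet in `𝔄₃` whose only nonzero coordinate is the `i`-th one isolates `cᵢ`.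
  obtain ⟨x, hE, hx⟩ := (N.spansAt hU q).exists_solution_order_three (N.isRealLinear hU)
    (Pi.single i 1)
  have r := fun j : Fin 3 => represents_polyMap q 4 (x j)
  have hs := fun j : Fin 3 => contDiff_polyFun (q : Plane) 4 (x j)
  have hJ := (jetSolves_iff (hU := hU) (r 0) (r 1) (r 2)).2 hE
  have h := (hc p hp _ _ _ (hs 0) (hs 1) (hs 2) hJ).symm.trans
    (hc' p hp _ _ _ (hs 0) (hs 1) (hs 2) hJ)
  have hne : -10 * (1 - N.a p) * (1 - N.b p) ≠ 0 :=
    mul_ne_zero (mul_ne_zero (by norm_num) (N.one_sub_a_ne_zero hp)) (N.one_sub_b_ne_zero hp)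
  have h := mul_left_cancel₀ hne h
  have hz : ∀ j, N.coords (polyFun q 4 (x 0)) (polyFun q 4 (x 1)) (polyFun q 4 (x 2)) j p =
      (Pi.single i 1 : Fin 6 → ℝ) j := fun j => by
    rw [← hx j, (represents_coords (hU := hU) (r 0) (r 1) (r 2) j).evalAt]
  simpa [hz, Pi.single_apply] using h

/-! ### The connection -/

/-- The coefficient matrix of the connection in the direction `v`, where `A₁` and `A₂` are
the matrices of the covariant derivatives. -/
def connectionMatrix (A₁ A₂ : Fin 6 → Fin 6 → smoothRing U) (v : Plane) :
    Matrix (Fin 6) (Fin 6) (smoothRing U) := fun j i =>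
  N.coeff hU 0 v * (A₁ j i + if i = j then FramedWebAlgebra.coordWeight j * (N.framed hU).g₁ else 0) +
    N.coeff hU 1 v *
      (A₂ j i + if i = j then FramedWebAlgebra.coordWeight j * (N.framed hU).g₂ else 0)

variable {N hU} in
lemma partialDeriv_coord_sub_mem {A₁ A₂ : Fin 6 → Fin 6 → smoothRing U} {I : Ideal (smoothRing U)}
    {w u v : smoothRing U} (h : ∀ j,
      (N.framed hU).δ₁ (FramedWebAlgebra.coordWeight j) ((N.framed hU).coord w u v j) -
        ∑ i, A₁ j i * (N.framed hU).coord w u v i ∈ I ∧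
      (N.framed hU).δ₂ (FramedWebAlgebra.coordWeight j) ((N.framed hU).coord w u v j) -
        ∑ i, A₂ j i * (N.framed hU).coord w u v i ∈ I) (j : Fin 6) :
    partialDeriv U (1, 0) ((N.framed hU).coord w u v j) -
      ∑ i, N.connectionMatrix hU A₁ A₂ (1, 0) j i * (N.framed hU).coord w u v i ∈ I ∧
    partialDeriv U (0, 1) ((N.framed hU).coord w u v j) -
      ∑ i, N.connectionMatrix hU A₁ A₂ (0, 1) j i * (N.framed hU).coord w u v i ∈ I := by
  have key : ∀ v' : Plane, ∑ i, N.connectionMatrix hU A₁ A₂ v' j i * (N.framed hU).coord w u v i =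
      N.coeff hU 0 v' * (∑ i, A₁ j i * (N.framed hU).coord w u v i +
        FramedWebAlgebra.coordWeight j * (N.framed hU).g₁ * (N.framed hU).coord w u v j) +
      N.coeff hU 1 v' * (∑ i, A₂ j i * (N.framed hU).coord w u v i +
        FramedWebAlgebra.coordWeight j * (N.framed hU).g₂ * (N.framed hU).coord w u v j) := by
    intro v'
    simp only [connectionMatrix, add_mul, mul_add, Finset.sum_add_distrib, Finset.mul_sum, ite_mul,
      mul_ite, zero_mul, mul_zero, Finset.sum_ite_eq', Finset.mem_univ, if_true, mul_assoc]
  have hp := partialDeriv_eq_frame (N := N) (hU := hU) ((N.framed hU).coord w u v j)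
  rw [key, key, hp.1, hp.2]
  constructor
  · convert! I.add_mem (I.mul_mem_left (N.coeff hU 0 (1, 0)) (h j).1)
      (I.mul_mem_left (N.coeff hU 1 (1, 0)) (h j).2) using 1
    simp only [FramedWebAlgebra.δ₁, FramedWebAlgebra.δ₂]
    ring
  · convert! I.add_mem (I.mul_mem_left (N.coeff hU 0 (0, 1)) (h j).1)
      (I.mul_mem_left (N.coeff hU 1 (0, 1)) (h j).2) using 1
    simp only [FramedWebAlgebra.δ₁, FramedWebAlgebra.δ₂]
    ring

variable {N hU} in
/-- The connection is flat where the obstruction vanishes. -/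
lemma connectionMatrix_flat {A₁ A₂ : Fin 6 → Fin 6 → smoothRing U}
    (hA : ∀ (I : Ideal (smoothRing U)) (w u v : smoothRing U),
      (∀ j, (N.framed hU).ContainsTwoJet I ((N.framed hU).abelianOp w u v j)) → ∀ j,
      (N.framed hU).δ₁ (FramedWebAlgebra.coordWeight j) ((N.framed hU).coord w u v j) -
        ∑ i, A₁ j i * (N.framed hU).coord w u v i ∈ I ∧
      (N.framed hU).δ₂ (FramedWebAlgebra.coordWeight j) ((N.framed hU).coord w u v j) -
        ∑ i, A₂ j i * (N.framed hU).coord w u v i ∈ I) {q : U}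
    (hκ : ∀ w u v, (∀ j, (N.framed hU).abelianOp w u v j ∈ vanishingIdeal q 3) →
      evalAt q ((N.framed hU).obstruction w u v) = 0) (j k : Fin 6) :
    evalAt q (partialDeriv U (0, 1) (N.connectionMatrix hU A₁ A₂ (1, 0) j k) +
        (N.connectionMatrix hU A₁ A₂ (1, 0) * N.connectionMatrix hU A₁ A₂ (0, 1)) j k) =
      evalAt q (partialDeriv U (1, 0) (N.connectionMatrix hU A₁ A₂ (0, 1) j k) +
        (N.connectionMatrix hU A₁ A₂ (0, 1) * N.connectionMatrix hU A₁ A₂ (1, 0)) j k) := by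
  -- The coordinates `z` of this jet equal the `k`-th basis vector at `q`, and `∂z = Xz`, `∂z = Yz`
  -- hold in the two directions modulo functions vanishing to second order. Each relation can be
  -- differentiated once at `q`, and equality of the mixed derivatives is the `k`-th column of the
  -- flatness identity.
  obtain ⟨w, u, v, hE, hz⟩ := (N.spansAt hU q).exists_solution_order_four (N.isRealLinear hU) hκ
    (Pi.single k 1)
  have h := partialDeriv_coord_sub_mem (hA (vanishingIdeal q 2) w u v fun j =>
    (N.spansAt hU q).containsTwoJet (hE j))
  generalize (N.framed hU).coord w u v = z at *
  generalize N.connectionMatrix hU A₁ A₂ (1, 0) = X at *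
  generalize N.connectionMatrix hU A₁ A₂ (0, 1) = Y at *
  have hX : ∀ i, evalAt q (partialDeriv U (1, 0) (z i)) = evalAt q (X i k) := fun i => by
    have h1 := (h i).1.1
    simpa [map_sub, map_sum, hz, Pi.single_apply, sub_eq_zero] using h1
  have hY : ∀ i, evalAt q (partialDeriv U (0, 1) (z i)) = evalAt q (Y i k) := fun i => by
    have h1 := (h i).2.1
    simpa [map_sub, map_sum, hz, Pi.single_apply, sub_eq_zero] using h1
  have hXY := (h j).1.2.2.1
  have hYX := (h j).2.2.1.1
  rw [map_sub (partialDeriv U (0, 1)), partialDeriv_comm (0, 1) (1, 0)] at hXY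
  simp only [map_sub, map_sum, Derivation.leibniz, smul_eq_mul, map_add, map_mul, hz, hX, hY,
    Finset.sum_add_distrib, Pi.single_apply, ite_mul, one_mul, zero_mul, Finset.sum_ite_eq',
    Finset.mem_univ, if_true] at hXY hYX
  simp only [map_add, Matrix.mul_apply, map_sum, map_mul]
  linear_combination hYX - hXY

end Normalization

end PlanarWebs

end

noncomputable section

namespace PlanarWebs

open TopologicalSpace (Opens)

/-! ### Solutions of the abelian equation as parallel sections -/

/-- The matrix unit as a continuous linear map. -/
def matrixUnit (j k : Fin 6) : (Fin 6 → ℝ) →L[ℝ] (Fin 6 → ℝ) :=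
  (ContinuousLinearMap.proj k).smulRight (Pi.single j 1)

/-- The linear map with the given matrix. -/
def matrixMap (X : Fin 6 → Fin 6 → Plane → ℝ) (q : Plane) : (Fin 6 → ℝ) →L[ℝ] (Fin 6 → ℝ) :=
  ∑ j, ∑ k, X j k q • matrixUnit j k

lemma matrixMap_apply (X : Fin 6 → Fin 6 → Plane → ℝ) (q : Plane) (z : Fin 6 → ℝ) (j : Fin 6) :
    matrixMap X q z j = ∑ k, X j k q * z k := by
  simp [matrixMap, matrixUnit, Finset.sum_apply, Pi.single_apply]

lemma contDiffOn_matrixMap {X : Fin 6 → Fin 6 → Plane → ℝ} {Q : Set Plane}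
    (hX : ∀ j k, ContDiffOn ℝ ∞ (X j k) Q) : ContDiffOn ℝ ∞ (matrixMap X) Q :=
  ContDiffOn.sum fun j _ => ContDiffOn.sum fun k _ => (hX j k).smul contDiffOn_const

lemma fderiv_matrixMap_apply {X : Fin 6 → Fin 6 → Plane → ℝ} {q : Plane}
    (hX : ∀ j k, DifferentiableAt ℝ (X j k) q) (v : Plane) (z : Fin 6 → ℝ) (j : Fin 6) :
    fderiv ℝ (matrixMap X) q v z j = ∑ k, fderiv ℝ (X j k) q v * z k := by
  have h : HasFDerivAt (matrixMap X)
      (∑ j, ∑ k, (fderiv ℝ (X j k) q).smulRight (matrixUnit j k)) q := by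
    unfold matrixMap
    refine HasFDerivAt.fun_sum fun j _ => HasFDerivAt.fun_sum fun k _ => ?_
    exact (hX j k).hasFDerivAt.smul_const (matrixUnit j k)
  rw [h.fderiv]
  simp [matrixUnit, Finset.sum_apply, Pi.single_apply]

lemma PlanarWeb.opens_subset {d : ℕ} (W : PlanarWeb d) : (W.opens : Set Plane) ⊆ W.domain :=
  subset_rfl

namespace Normalization

variable {W : PlanarWeb 5} (N : Normalization W)

/-- The triples `(w, u, v)` of smooth functions that solve the abelian equation near `p`. -/
def IsSolution (p : Plane) (t : Fin 3 → Plane → ℝ) : Prop :=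
  (∀ i, ContDiff ℝ ∞ (t i)) ∧ ∀ᶠ q in 𝓝 p, ∀ j, N.abelianOp (t 0) (t 1) (t 2) j q = 0

/-- The matrices of the covariant derivatives of the canonical coordinates of solutions. -/
structure IsConnection (A₁ A₂ : Fin 6 → Fin 6 → smoothRing W.opens) : Prop where
  rows : ∀ j : Fin 3, A₁ (j.natAdd 3) = (N.framed W.opens_subset).rows₁ j ∧
    A₂ (j.natAdd 3) = (N.framed W.opens_subset).rows₂ j
  row_one : A₂ 1 = ![1, 0, 0, 0, 0, 0]
  sub_mem : ∀ (I : Ideal (smoothRing W.opens)) (w u v : smoothRing W.opens),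
    (∀ j, (N.framed W.opens_subset).ContainsTwoJet I ((N.framed W.opens_subset).abelianOp w u v j)) → ∀ j,
      (N.framed W.opens_subset).δ₁ (FramedWebAlgebra.coordWeight j)
          ((N.framed W.opens_subset).coord w u v j) -
        ∑ i, A₁ j i * (N.framed W.opens_subset).coord w u v i ∈ I ∧
      (N.framed W.opens_subset).δ₂ (FramedWebAlgebra.coordWeight j)
          ((N.framed W.opens_subset).coord w u v j) -
        ∑ i, A₂ j i * (N.framed W.opens_subset).coord w u v i ∈ I

lemma exists_isConnection : ∃ A₁ A₂, N.IsConnection A₁ A₂ := by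
  obtain ⟨A₁, A₂, h1, h2, h3⟩ := (N.framed (U := W.opens) W.opens_subset).exists_connection
  exact ⟨A₁, A₂, h1, h2, h3⟩

/-- The coefficient of the connection form in the direction `v`. -/
def connectionMap (A₁ A₂ : Fin 6 → Fin 6 → smoothRing W.opens) (v : Plane) :
    Plane → (Fin 6 → ℝ) →L[ℝ] (Fin 6 → ℝ) :=
  matrixMap fun j k => extendZero (N.connectionMatrix W.opens_subset A₁ A₂ v j k)

variable {N} {A₁ A₂ : Fin 6 → Fin 6 → smoothRing W.opens}

lemma connectionMap_apply (v : Plane) (q : W.opens) (z : Fin 6 → ℝ) (j : Fin 6) :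
    N.connectionMap A₁ A₂ v q z j =
      ∑ k, evalAt q (N.connectionMatrix W.opens_subset A₁ A₂ v j k) * z k := by
  rw [connectionMap, matrixMap_apply]
  exact Finset.sum_congr rfl fun k _ => by rw [(represents_extendZero _).evalAt]

lemma contDiffOn_connectionMap (v : Plane) :
    ContDiffOn ℝ ∞ (N.connectionMap A₁ A₂ v) W.domain :=
  contDiffOn_matrixMap fun _ _ => (represents_extendZero _).contDiffOn

lemma jetSolves_of_eventually {w u v : Plane → ℝ} {q : Plane}
    (h : ∀ᶠ r in 𝓝 q, ∀ j, N.abelianOp w u v j r = 0) (k : ℕ) : N.JetSolves k w u v q := by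
  intro j m _
  have h1 : N.abelianOp w u v j =ᶠ[𝓝 q] fun _ => 0 := h.mono fun r hr => hr j
  rw [(h1.iteratedFDeriv ℝ m).eq_of_nhds]
  simp

/-- The canonical coordinates of solutions are parallel. -/
lemma IsConnection.hasFDerivAt_coords (hA : N.IsConnection A₁ A₂) {w u v : Plane → ℝ}
    (hw : ContDiff ℝ ∞ w) (hu : ContDiff ℝ ∞ u) (hv : ContDiff ℝ ∞ v) {q : Plane}
    (hq : q ∈ W.domain) (h : ∀ᶠ r in 𝓝 q, ∀ j, N.abelianOp w u v j r = 0) :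
    HasFDerivAt (fun r i => N.coords w u v i r)
      (connectionForm (N.connectionMap A₁ A₂ (1, 0)) (N.connectionMap A₁ A₂ (0, 1)) q
        (fun i => N.coords w u v i q)) q := by
  have rw' := represents_restrictTo w (U := W.opens) hw.contDiffOn
  have ru' := represents_restrictTo u (U := W.opens) hu.contDiffOn
  have rv' := represents_restrictTo v (U := W.opens) hv.contDiffOn
  let q' : W.opens := ⟨q, hq⟩
  have rc := fun j => represents_coords (N := N) (hU := W.opens_subset) rw' ru' rv' j
  have hE' := (jetSolves_iff (hU := W.opens_subset) rw' ru' rv' (q := q')).1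
    (jetSolves_of_eventually h 3)
  have hm := partialDeriv_coord_sub_mem (hA.sub_mem (vanishingIdeal q' 1) _ _ _ fun j =>
    (N.spansAt W.opens_subset q').containsTwoJet (hE' j))
  rw [hasFDerivAt_pi']
  intro j
  have hd := ((rc j).differentiableAt hq).hasFDerivAt
  refine hd.congr_fderiv ?_
  have h1 := vanishesTo_one.1 (hm j).1
  have h2 := vanishesTo_one.1 (hm j).2
  rw [map_sub, ((rc j).partialDeriv _).evalAt, sub_eq_zero, map_sum] at h1 h2
  refine ContinuousLinearMap.ext fun v' => ?_
  have h3 : v' = v'.1 • ((1, 0) : Plane) + v'.2 • ((0, 1) : Plane) := by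
    ext <;> simp
  conv_lhs => rw [h3, map_add, map_smul, map_smul]
  have h4 : ∀ v'' : Plane, N.connectionMap A₁ A₂ v'' q (fun i => N.coords w u v i q) j =
      ∑ i, evalAt q' (N.connectionMatrix W.opens_subset A₁ A₂ v'' j i *
        (N.framed W.opens_subset).coord (restrictTo w hw.contDiffOn) (restrictTo u hu.contDiffOn)
          (restrictTo v hv.contDiffOn) i) := fun v'' => by
    rw [connectionMap_apply (q := q')]
    exact Finset.sum_congr rfl fun i _ => by rw [map_mul, (rc i).evalAt]
  have h5 : fderiv ℝ (N.coords w u v j) q (1, 0) =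
      N.connectionMap A₁ A₂ (1, 0) q (fun i => N.coords w u v i q) j := h1.trans (h4 _).symm
  have h6 : fderiv ℝ (N.coords w u v j) q (0, 1) =
      N.connectionMap A₁ A₂ (0, 1) q (fun i => N.coords w u v i q) j := h2.trans (h4 _).symm
  rw [h5, h6]
  rfl

/-- A solution whose canonical coordinates vanish at a point vanishes. -/
lemma eq_zero_of_coords_eq_zero {w u v : Plane → ℝ} (hw : ContDiff ℝ ∞ w) (hu : ContDiff ℝ ∞ u)
    (hv : ContDiff ℝ ∞ v) {p : Plane} {r : ℝ} (hr : Metric.ball p r ⊆ W.domain)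
    (hE : ∀ q ∈ Metric.ball p r, ∀ j, N.abelianOp w u v j q = 0) {q₀ : Plane}
    (hq₀ : q₀ ∈ Metric.ball p r) (h0 : ∀ i, N.coords w u v i q₀ = 0) {q : Plane}
    (hq : q ∈ Metric.ball p r) : w q = 0 ∧ u q = 0 ∧ v q = 0 := by
  obtain ⟨A₁, A₂, hA⟩ := N.exists_isConnection
  have h := parallel_section_eq_zero (convex_ball p r)
    ((contDiffOn_connectionMap (N := N) (A₁ := A₁) (A₂ := A₂) (1, 0)).continuousOn.mono hr)
    ((contDiffOn_connectionMap (N := N) (A₁ := A₁) (A₂ := A₂) (0, 1)).continuousOn.mono hr)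
    (fun q hq => hA.hasFDerivAt_coords hw hu hv (hr hq)
      (Filter.eventually_of_mem (Metric.isOpen_ball.mem_nhds hq) hE)) hq₀ (funext h0) hq
  exact ⟨congrFun h 3, congrFun h 4, congrFun h 5⟩

lemma pd_eq_of_fderiv {F : Plane → ℝ} {q : Plane} (hq : q ∈ W.domain) {α β : ℝ}
    (h : ∀ v, fderiv ℝ F q v = α * N.nform 0 q v + β * N.nform 1 q v) :
    N.pd₁ F q = α ∧ N.pd₂ F q = β := by
  have ha := N.area_ne_zero hq
  rw [pd₁, pd₂, div_eq_iff ha, div_eq_iff ha]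
  simp only [area, wedge, h] at *
  constructor <;> ring

lemma δ₂_congr {F G : Plane → ℝ} {q : Plane} (h : F =ᶠ[𝓝 q] G) (k : ℕ) :
    N.δ₂ k F q = N.δ₂ k G q := by
  have h1 : fderiv ℝ F q = fderiv ℝ G q := h.fderiv_eq
  simp only [δ₂, pd₂, wedge, h1, h.eq_of_nhds]

lemma δ₂_mul {F G : Plane → ℝ} {q : Plane} (hF : DifferentiableAt ℝ F q)
    (hG : DifferentiableAt ℝ G q) (k : ℕ) :
    N.δ₂ k (F * G) q = F q * N.δ₂ k G q + N.pd₂ F q * G q := by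
  simp only [δ₂, pd₂, wedge, fderiv_mul hF hG, add_apply, smul_apply, smul_eq_mul, Pi.mul_apply]
  ring

/-- The covariant derivatives of a parallel section. -/
lemma δ_section {s : Plane → Fin 6 → ℝ} (q : W.opens) (hs : HasFDerivAt s (connectionForm
      (N.connectionMap A₁ A₂ (1, 0)) (N.connectionMap A₁ A₂ (0, 1)) q (s q)) q) (j : Fin 6) :
    N.δ₁ (FramedWebAlgebra.coordWeight j) (fun r => s r j) q = ∑ k, evalAt q (A₁ j k) * s q k ∧
    N.δ₂ (FramedWebAlgebra.coordWeight j) (fun r => s r j) q =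
      ∑ k, evalAt q (A₂ j k) * s q k := by
  have hd := (hasFDerivAt_pi'.1 hs j).fderiv
  have key : ∀ v : Plane, N.connectionMap A₁ A₂ v q (s q) j =
      N.nform 0 q v * (∑ k, evalAt q (A₁ j k) * s q k + FramedWebAlgebra.coordWeight j *
        chernCoeff₁ (N.nform 0) (N.nform 1) q * s q j) +
      N.nform 1 q v * (∑ k, evalAt q (A₂ j k) * s q k + FramedWebAlgebra.coordWeight j *
        chernCoeff₂ (N.nform 0) (N.nform 1) q * s q j) := by
    intro v
    have hif : ∀ (i : Fin 6) (x : smoothRing W.opens),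
        evalAt q (if i = j then x else 0) = if i = j then evalAt q x else 0 := fun i x => by
      split_ifs
      · rfl
      · rw [map_zero]
    rw [connectionMap_apply]
    simp only [connectionMatrix, map_add, map_mul, evalAt_coeff, hif, add_mul, mul_add,
      Finset.sum_add_distrib, Finset.mul_sum, ite_mul, mul_ite, zero_mul, mul_zero,
      Finset.sum_ite_eq', Finset.mem_univ, if_true, mul_assoc, map_natCast,
      (N.represents_g₁ W.opens_subset).evalAt, (N.represents_g₂ W.opens_subset).evalAt]
  obtain ⟨h1, h2⟩ := N.pd_eq_of_fderiv (F := fun r => s r j) (q := q) q.2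
    (α := ∑ k, evalAt q (A₁ j k) * s q k + FramedWebAlgebra.coordWeight j *
        chernCoeff₁ (N.nform 0) (N.nform 1) q * s q j)
    (β := ∑ k, evalAt q (A₂ j k) * s q k + FramedWebAlgebra.coordWeight j *
        chernCoeff₂ (N.nform 0) (N.nform 1) q * s q j) (fun v => by
      rw [hd]
      change v.1 • N.connectionMap A₁ A₂ (1, 0) q (s q) j +
        v.2 • N.connectionMap A₁ A₂ (0, 1) q (s q) j = _
      have h3 : v = v.1 • ((1, 0) : Plane) + v.2 • ((0, 1) : Plane) := by
        ext <;> simp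
      have h4 : ∀ i, N.nform i q v = v.1 * N.nform i q (1, 0) + v.2 * N.nform i q (0, 1) := by
        intro i
        conv_lhs => rw [h3, map_add, map_smul, map_smul]
        rfl
      rw [key, key, h4, h4, smul_eq_mul, smul_eq_mul]
      ring)
  simp only [δ₁, δ₂, h1, h2, add_sub_cancel_right, and_self]

/-- A parallel section gives a solution of the abelian equation. -/
lemma IsConnection.abelianOp_eq_zero (hA : N.IsConnection A₁ A₂) {s : Plane → Fin 6 → ℝ}
    {p : Plane} (hp : p ∈ W.domain) (hs : ∀ᶠ q in 𝓝 p, HasFDerivAt s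
      (connectionForm (N.connectionMap A₁ A₂ (1, 0)) (N.connectionMap A₁ A₂ (0, 1)) q (s q)) q) :
    ∀ᶠ q in 𝓝 p, (∀ j, N.abelianOp (fun r => s r 3) (fun r => s r 4) (fun r => s r 5) j q = 0) ∧
      ∀ i, N.coords (fun r => s r 3) (fun r => s r 4) (fun r => s r 5) i q = s q i := by
  have hdom : ∀ᶠ q in 𝓝 p, q ∈ W.domain := W.isOpen_domain.mem_nhds hp
  filter_upwards [hdom.eventually_nhds, hs.eventually_nhds] with q hq hsq
  -- The explicit rows of the connection are the first-order system itself, with `s 1` and `s 2` in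
  -- the roles of `w₂` and `v₂`. The row of `δ₂ u` is multiplied by `a` to clear the inverse.
  have hrows : ∀ r ∈ W.domain, HasFDerivAt s (connectionForm (N.connectionMap A₁ A₂ (1, 0))
      (N.connectionMap A₁ A₂ (0, 1)) r (s r)) r →
      (N.δ₁ 1 (fun r => s r 3) r = s r 1 ∧ N.δ₂ 1 (fun r => s r 3) r = s r 1) ∧
      (N.δ₁ 1 (fun r => s r 4) r = -s r 1 - N.b r * s r 2 - N.pd₂ N.b r * s r 5 ∧
        N.a r * N.δ₂ 1 (fun r => s r 4) r = -(s r 1 + N.b r * s r 2 + N.pd₂ N.a r * s r 4 +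
          N.pd₂ N.b r * s r 5)) ∧
      (N.δ₁ 1 (fun r => s r 5) r = N.b r * s r 2 + N.pd₂ N.b r * s r 5 ∧
        N.δ₂ 1 (fun r => s r 5) r = s r 2) ∧ N.δ₂ 2 (fun r => s r 1) r = s r 0 := by
    intro r hr h
    let r' : W.opens := ⟨r, hr⟩
    have hsec := δ_section (A₁ := A₁) (A₂ := A₂) r' h
    have h3 := hsec 3
    have h4 := hsec 4
    have h5 := hsec 5
    have h1 := (hsec 1).2
    have e3 := hA.rows 0
    have e4 := hA.rows 1
    have e5 := hA.rows 2
    have hb : evalAt r' (N.framed W.opens_subset).b = N.b r := rfl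
    have ha : N.a r * evalAt r' (N.framed W.opens_subset).ia = 1 := by
      have := congrArg (evalAt r') (N.framed W.opens_subset).a_mul_ia
      rwa [map_mul, map_one, (N.represents_a W.opens_subset).evalAt, mul_comm] at this
    have h2b : evalAt r' ((N.framed W.opens_subset).D₂ (N.framed W.opens_subset).b) = N.pd₂ N.b r :=
      (N.represents_D₂ W.opens_subset (N.represents_b W.opens_subset)).evalAt r'
    have h2a : evalAt r' ((N.framed W.opens_subset).D₂ (N.framed W.opens_subset).a) = N.pd₂ N.a r :=
      (N.represents_D₂ W.opens_subset (N.represents_a W.opens_subset)).evalAt r'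
    change A₁ 3 = _ ∧ A₂ 3 = _ at e3
    change A₁ 4 = _ ∧ A₂ 4 = _ at e4
    change A₁ 5 = _ ∧ A₂ 5 = _ at e5
    rw [e3.1, e3.2] at h3
    rw [e4.1, e4.2] at h4
    rw [e5.1, e5.2] at h5
    rw [hA.row_one] at h1
    simp only [FramedWebAlgebra.rows₁, FramedWebAlgebra.rows₂, Fin.sum_univ_six,
      Matrix.cons_val, map_zero, map_one, map_neg, map_mul, zero_mul, one_mul, add_zero, zero_add,
      hb, h2a, h2b] at h1 h3 h4 h5
    refine ⟨h3, ⟨h4.1.trans (by ring), ?_⟩, h5, h1⟩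
    have h42 : N.δ₂ 1 (fun r => s r 4) r = _ := h4.2
    rw [h42]
    linear_combination -(s r 1 + N.b r * s r 2 + N.pd₂ N.a r * s r 4 + N.pd₂ N.b r * s r 5) * ha
  have hq0 := hq.self_of_nhds
  have hs0 := hsq.self_of_nhds
  obtain ⟨⟨w1, w2⟩, ⟨u1, u2⟩, ⟨v1, v2⟩, w22⟩ := hrows q hq0 hs0
  have hd : ∀ j, DifferentiableAt ℝ (fun r => s r j) q := fun j =>
    (hasFDerivAt_pi'.1 hs0 j).differentiableAt
  have ha := (N.a_contDiffOn.contDiffAt (W.isOpen_domain.mem_nhds hq0)).differentiableAt (by simp)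
  have hb := (N.b_contDiffOn.contDiffAt (W.isOpen_domain.mem_nhds hq0)).differentiableAt (by simp)
  constructor
  · intro j
    fin_cases j
    · change N.δ₁ 1 _ q - N.δ₂ 1 _ q = 0
      rw [w1, w2, sub_self]
    · change N.δ₁ 1 _ q - N.δ₂ 1 (N.a * _) q = 0
      rw [u1, δ₂_mul ha (hd 4), u2]
      ring
    · change N.δ₁ 1 _ q - N.δ₂ 1 (N.b * _) q = 0
      rw [v1, δ₂_mul hb (hd 5), v2]
      ring
    · change N.δ₁ 1 _ q + N.δ₁ 1 _ q + N.δ₁ 1 _ q = 0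
      rw [w1, u1, v1]
      ring
  -- The identity is needed on a neighbourhood, since it is differentiated once more to identify `s
  -- 0` with `w₂₂`.
  · have hw2 : N.δ₂ 1 (fun r => s r 3) =ᶠ[𝓝 q] fun r => s r 1 := by
      filter_upwards [hq, hsq] with r h1 h2 using (hrows r h1 h2).1.2
    intro i
    fin_cases i
    · exact (δ₂_congr hw2 2).trans w22
    · exact w2
    · exact v2
    all_goals rfl

end Normalization

end PlanarWebs

end

/-! ### Existence of solutions where the obstruction vanishes -/

noncomputable section

namespace PlanarWebs

open TopologicalSpace (Opens)

namespace Normalization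

variable {W : PlanarWeb 5} (N : Normalization W)

/-- The obstruction vanishes on the prolongation of the abelian equation at a point. -/
def ObstructionVanishesAt (q : W.opens) : Prop :=
  ∀ w u v : smoothRing W.opens,
    (∀ j, (N.framed W.opens_subset).abelianOp w u v j ∈ vanishingIdeal q 3) →
      evalAt q ((N.framed W.opens_subset).obstruction w u v) = 0

variable {N} {A₁ A₂ : Fin 6 → Fin 6 → smoothRing W.opens}

lemma fderiv_connectionMap_apply (v' v : Plane) (q : W.opens) (z : Fin 6 → ℝ) (j : Fin 6) :
    fderiv ℝ (N.connectionMap A₁ A₂ v') q v z j = ∑ k, evalAt q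
      (partialDeriv W.opens v (N.connectionMatrix W.opens_subset A₁ A₂ v' j k)) * z k := by
  refine (fderiv_matrixMap_apply
    (fun j k => (represents_extendZero _).differentiableAt q.2) v z j).trans ?_
  exact Finset.sum_congr rfl fun k _ => by
    rw [((represents_extendZero _).partialDeriv v).evalAt]

lemma connectionMap_comp_apply (v' v : Plane) (q : W.opens) (z : Fin 6 → ℝ) (j : Fin 6) :
    (N.connectionMap A₁ A₂ v' q ∘L N.connectionMap A₁ A₂ v q) z j =
      ∑ k, evalAt q ((N.connectionMatrix W.opens_subset A₁ A₂ v' *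
        N.connectionMatrix W.opens_subset A₁ A₂ v) j k) * z k := by
  rw [ContinuousLinearMap.comp_apply, connectionMap_apply]
  simp only [connectionMap_apply, Matrix.mul_apply, map_sum, map_mul, Finset.mul_sum,
    Finset.sum_mul]
  rw [Finset.sum_comm]
  simp only [mul_assoc]

lemma IsConnection.flat (hA : N.IsConnection A₁ A₂) {q : W.opens}
    (hκ : N.ObstructionVanishesAt q) :
    fderiv ℝ (N.connectionMap A₁ A₂ (1, 0)) q (0, 1) +
        N.connectionMap A₁ A₂ (1, 0) q ∘L N.connectionMap A₁ A₂ (0, 1) q =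
      fderiv ℝ (N.connectionMap A₁ A₂ (0, 1)) q (1, 0) +
        N.connectionMap A₁ A₂ (0, 1) q ∘L N.connectionMap A₁ A₂ (1, 0) q := by
  refine ContinuousLinearMap.ext fun z => funext fun j => ?_
  rw [add_apply, add_apply, Pi.add_apply, Pi.add_apply, connectionMap_comp_apply,
    connectionMap_comp_apply, fderiv_connectionMap_apply, fderiv_connectionMap_apply,
    ← Finset.sum_add_distrib, ← Finset.sum_add_distrib]
  refine Finset.sum_congr rfl fun k _ => ?_
  rw [← add_mul, ← add_mul, ← map_add, ← map_add, connectionMatrix_flat hA.sub_mem hκ]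

/-- Where the obstruction vanishes, solutions with arbitrary canonical coordinates exist. -/
lemma exists_isSolution {p : Plane} (hp : p ∈ W.domain)
    (hκ : ∀ᶠ q in 𝓝 p, ∀ hq : q ∈ W.domain, N.ObstructionVanishesAt ⟨q, hq⟩) (z : Fin 6 → ℝ) :
    ∃ t, N.IsSolution p t ∧ ∀ i, N.coords (t 0) (t 1) (t 2) i p = z i := by
  obtain ⟨A₁, A₂, hA⟩ := N.exists_isConnection
  have hdom : ∀ᶠ q in 𝓝 p, q ∈ W.domain := W.isOpen_domain.mem_nhds hp
  -- The connection is smooth on the domain of the web only; it is cut off outside a neighbourhood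
  -- of `p` because `exists_parallel_section` takes coefficients smooth on the whole plane.
  have hglob : ∀ v, ∃ g : Plane → (Fin 6 → ℝ) →L[ℝ] (Fin 6 → ℝ), ContDiff ℝ ∞ g ∧
      g =ᶠ[𝓝 p] N.connectionMap A₁ A₂ v := fun v =>
    exists_contDiff_eventuallyEq (hdom.mono fun q hq =>
      (contDiffOn_connectionMap v).contDiffAt (W.isOpen_domain.mem_nhds hq))
  obtain ⟨X, hX, hX'⟩ := hglob (1, 0)
  obtain ⟨Y, hY, hY'⟩ := hglob (0, 1)
  have hflat : ∀ᶠ q in 𝓝 p, fderiv ℝ X q (0, 1) + X q ∘L Y q =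
      fderiv ℝ Y q (1, 0) + Y q ∘L X q := by
    filter_upwards [hdom, hκ, hX', hY', hX'.fderiv (𝕜 := ℝ), hY'.fderiv (𝕜 := ℝ)]
      with q hq h1 h2 h3 h4 h5
    have h6 := hA.flat (h1 hq)
    rw [h2, h3, h4, h5]
    with_reducible exact h6
  obtain ⟨s, hsp, hs⟩ := exists_parallel_section hX hY hflat z
  obtain ⟨s', hs', hss'⟩ := exists_contDiff_eventuallyEq (hs.mono fun q hq => hq.1)
  have hpar : ∀ᶠ q in 𝓝 p, HasFDerivAt s' (connectionForm (N.connectionMap A₁ A₂ (1, 0))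
      (N.connectionMap A₁ A₂ (0, 1)) q (s' q)) q := by
    filter_upwards [hs, hss'.eventually_nhds, hX', hY'] with q h1 h2 h3 h4
    have h5 := h1.2.congr_of_eventuallyEq h2
    have h6 : s' q = s q := h2.self_of_nhds
    rw [h6]
    refine h5.congr_fderiv (ContinuousLinearMap.ext fun v => ?_)
    rw [connectionForm_apply, connectionForm_apply, h3, h4]
  have h := hA.abelianOp_eq_zero hp hpar
  refine ⟨![fun r => s' r 3, fun r => s' r 4, fun r => s' r 5], ⟨?_, h.mono fun q hq => hq.1⟩, ?_⟩
  · intro i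
    fin_cases i
    · exact contDiff_pi.1 hs' 3
    · exact contDiff_pi.1 hs' 4
    · exact contDiff_pi.1 hs' 5
  · intro i
    have h1 := h.self_of_nhds.2 i
    rw [hss'.self_of_nhds, hsp] at h1
    exact h1

end Normalization

end PlanarWebs

end

noncomputable section

namespace PlanarWebs

open TopologicalSpace (Opens)

/-! ### The rank in terms of the canonical coordinates -/

namespace Normalization

variable {W : PlanarWeb 5} (N : Normalization W)

/-- The multipliers `w + a u + b v, w + u + v, w, u, v` of the normalized forms. -/
def multiplier (t : Fin 3 → Plane → ℝ) : Fin 5 → Plane → ℝ :=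
  ![t 0 + N.a * t 1 + N.b * t 2, t 0 + t 1 + t 2, t 0, t 1, t 2]

/-- The abelian function given by a solution `(w, u, v)`. -/
def abelianFunction (t : Fin 3 → Plane → ℝ) (q : Plane) (i : Fin 5) : ℝ :=
  N.multiplier t i q * N.scale i q

variable {N}

lemma RepresentsFrame.of_eq {U : Opens Plane} {hU : (U : Set Plane) ⊆ W.domain}
    {A B : smoothRing U} {F G : Plane → ℝ} {α : OneForm} (hA : Represents A F)
    (hB : Represents B G) (h : ∀ q ∈ U, F q • N.nform 0 q + G q • N.nform 1 q = α q) :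
    N.RepresentsFrame hU A B α :=
  ((RepresentsForm.smul hA (N.representsForm_nform hU 0)).add
    (RepresentsForm.smul hB (N.representsForm_nform hU 1))).congr h

lemma contDiffOn_multiplier {t : Fin 3 → Plane → ℝ} (ht : ∀ i, ContDiff ℝ ∞ (t i)) (i : Fin 5) :
    ContDiffOn ℝ ∞ (N.multiplier t i) W.domain := by
  have h := fun i => (ht i).contDiffOn (s := W.domain)
  fin_cases i
  · exact ((h 0).add (N.a_contDiffOn.mul (h 1))).add (N.b_contDiffOn.mul (h 2))
  · exact ((h 0).add (h 1)).add (h 2)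
  · exact h 0
  · exact h 1
  · exact h 2

lemma contDiffOn_abelianFunction {t : Fin 3 → Plane → ℝ} (ht : ∀ i, ContDiff ℝ ∞ (t i)) :
    ContDiffOn ℝ ∞ (N.abelianFunction t) W.domain :=
  contDiffOn_pi.2 fun i => (contDiffOn_multiplier ht i).mul (N.scale_smooth i)

lemma sum_multiplier_smul (t : Fin 3 → Plane → ℝ) {q : Plane} (hq : q ∈ W.domain) :
    ∑ i, N.multiplier t i q • N.nform i q = 0 := by
  rw [Fin.sum_univ_five, N.nform_two hq, N.nform_three hq, N.nform_four hq]
  simp only [multiplier, Matrix.cons_val, Pi.add_apply, Pi.mul_apply]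
  module

lemma abelianFunction_smul (t : Fin 3 → Plane → ℝ) (q : Plane) (i : Fin 5) :
    N.abelianFunction t q i • W.form i q = N.multiplier t i q • N.nform i q := by
  rw [abelianFunction, mul_smul]
  rfl

/-- Up to sign, the exterior derivatives of the last four terms are the four left-hand sides times
the area coefficient. The derivative of the first term is a combination of these, because the five
terms add up to zero. -/
lemma extD_abelianFunction_iff {t : Fin 3 → Plane → ℝ} (ht : ∀ i, ContDiff ℝ ∞ (t i)) {q : Plane}
    (hq : q ∈ W.domain) : (∀ i, extD (fun r => N.abelianFunction t r i • W.form i r) q = 0) ↔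
      ∀ j, N.abelianOp (t 0) (t 1) (t 2) j q = 0 := by
  have rt := fun i => represents_restrictTo (t i) (U := W.opens) (ht i).contDiffOn
  generalize hx : (fun i => restrictTo (t i) (U := W.opens) (ht i).contDiffOn) = x at rt
  have rt : ∀ i, Represents (x i) (t i) := fun i => hx ▸ rt i
  clear hx
  set T := N.framed W.opens_subset with hT
  have ra := N.represents_a W.opens_subset
  have rb := N.represents_b W.opens_subset
  have rE := represents_abelianOp (N := N) (hU := W.opens_subset) (rt 0) (rt 1) (rt 2)
  have rf : ∀ i, N.RepresentsFrame W.opens_subset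
      ((![x 0 + T.a * x 1 + T.b * x 2, 0, -x 0, -(T.a * x 1), -(T.b * x 2)] : Fin 5 → _) i)
      ((![0, x 0 + x 1 + x 2, -x 0, -x 1, -x 2] : Fin 5 → _) i)
      (fun r => N.abelianFunction t r i • W.form i r) := by
    simp only [abelianFunction_smul]
    intro i
    fin_cases i
    · refine .of_eq (((rt 0).add (ra.mul (rt 1))).add (rb.mul (rt 2))) represents_zero
        fun r _ => ?_
      simp [multiplier]
    · refine .of_eq represents_zero (((rt 0).add (rt 1)).add (rt 2)) fun r _ => ?_
      simp [multiplier]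
    · refine .of_eq (rt 0).neg (rt 0).neg fun r hr => ?_
      simp only [Fin.reduceFinMk, N.nform_two hr]
      simp only [multiplier, Matrix.cons_val, Pi.neg_apply]
      module
    · refine .of_eq (ra.mul (rt 1)).neg (rt 1).neg fun r hr => ?_
      simp only [Fin.reduceFinMk, N.nform_three hr]
      simp only [multiplier, Matrix.cons_val, Pi.neg_apply, Pi.mul_apply]
      module
    · refine .of_eq (rb.mul (rt 2)).neg (rt 2).neg fun r hr => ?_
      simp only [Fin.reduceFinMk, N.nform_four hr]
      simp only [multiplier, Matrix.cons_val, Pi.neg_apply, Pi.mul_apply]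
      module
  let q' : W.opens := ⟨q, hq⟩
  have he := fun i => (rf i).extD.evalAt q'
  have hE := fun j => (rE j).evalAt q'
  have hz : evalAt q' (N.areaR W.opens_subset) ≠ 0 := by
    rw [(N.represents_area W.opens_subset).evalAt]
    exact N.area_ne_zero hq
  have h0 := he 0
  have h1 := he 1
  have h2 := he 2
  have h3 := he 3
  have h4 := he 4
  simp only [Matrix.cons_val, map_mul (evalAt q'), ← hT] at h0 h1 h2 h3 h4
  have e0 := hE 0
  have e1 := hE 1
  have e2 := hE 2
  have e3 := hE 3
  simp only [← hT, FramedWebAlgebra.abelianOp, FramedWebAlgebra.Δ₁, FramedWebAlgebra.Δ₂,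
    FramedWebAlgebra.Δ₃, FramedWebAlgebra.δ₁, FramedWebAlgebra.δ₂, Matrix.cons_val, map_add,
    map_sub, map_neg, map_mul, Nat.cast_one, one_mul, map_zero, zero_mul]
    at e0 e1 e2 e3 h0 h1 h2 h3 h4
  set r := evalAt q' (N.areaR W.opens_subset)
  have k0 : extD (fun r => N.abelianFunction t r 0 • W.form 0 r) q =
      r * (N.abelianOp (t 0) (t 1) (t 2) 0 q + N.abelianOp (t 0) (t 1) (t 2) 1 q +
        N.abelianOp (t 0) (t 1) (t 2) 2 q - N.abelianOp (t 0) (t 1) (t 2) 3 q) := by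
    linear_combination -h0 + r * (e0 + e1 + e2 - e3)
  have k1 : extD (fun r => N.abelianFunction t r 1 • W.form 1 r) q =
      r * N.abelianOp (t 0) (t 1) (t 2) 3 q := by
    linear_combination -h1 + r * e3
  have k2 : extD (fun r => N.abelianFunction t r 2 • W.form 2 r) q =
      -(r * N.abelianOp (t 0) (t 1) (t 2) 0 q) := by
    linear_combination -h2 - r * e0
  have k3 : extD (fun r => N.abelianFunction t r 3 • W.form 3 r) q =
      -(r * N.abelianOp (t 0) (t 1) (t 2) 1 q) := by
    linear_combination -h3 - r * e1
  have k4 : extD (fun r => N.abelianFunction t r 4 • W.form 4 r) q =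
      -(r * N.abelianOp (t 0) (t 1) (t 2) 2 q) := by
    linear_combination -h4 - r * e2
  constructor
  · intro h j
    fin_cases j
    · simpa [h, hz] using k2
    · simpa [h, hz] using k3
    · simpa [h, hz] using k4
    · simpa [h, hz] using k1
  · intro h i
    fin_cases i
    · exact k0.trans (by simp [h])
    · exact k1.trans (by simp [h])
    · exact k2.trans (by simp [h])
    · exact k3.trans (by simp [h])
    · exact k4.trans (by simp [h])

lemma IsSolution.solvesAbelianNear {p : Plane} (hp : p ∈ W.domain) {t : Fin 3 → Plane → ℝ}
    (ht : N.IsSolution p t) : SolvesAbelianNear W p (N.abelianFunction t) := by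
  filter_upwards [W.isOpen_domain.mem_nhds hp, ht.2] with q hq h
  refine ⟨(contDiffOn_abelianFunction ht.1).contDiffAt (W.isOpen_domain.mem_nhds hq), ?_,
    (extD_abelianFunction_iff ht.1 hq).2 h⟩
  simp only [abelianFunction_smul]
  exact sum_multiplier_smul t hq

/-- Since `ω₁` and `ω₂` are independent, the last three multipliers determine the first two. -/
lemma eq_multiplier_of_sum_eq_zero {μ : Fin 5 → ℝ} {t : Fin 3 → Plane → ℝ} {q : Plane}
    (hq : q ∈ W.domain) (h : ∑ i, μ i • N.nform i q = 0)
    (ht : t 0 q = μ 2 ∧ t 1 q = μ 3 ∧ t 2 q = μ 4) (i : Fin 5) : μ i = N.multiplier t i q := by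
  rw [Fin.sum_univ_five, N.nform_two hq, N.nform_three hq, N.nform_four hq] at h
  have h1 : (μ 0 - μ 2 - N.a q * μ 3 - N.b q * μ 4) • N.nform 0 q +
      (μ 1 - μ 2 - μ 3 - μ 4) • N.nform 1 q = 0 := by
    rw [← h]
    module
  have hx := congrArg (fun θ : Plane →L[ℝ] ℝ => θ (1, 0)) h1
  have hy := congrArg (fun θ : Plane →L[ℝ] ℝ => θ (0, 1)) h1
  simp only [add_apply, smul_apply, smul_eq_mul, zero_apply] at hx hy
  have ha := N.area_ne_zero hq
  simp only [area, wedge] at ha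
  have h0 : μ 0 - μ 2 - N.a q * μ 3 - N.b q * μ 4 = 0 := by
    apply mul_right_cancel₀ ha
    linear_combination N.nform 1 q (0, 1) * hx - N.nform 1 q (1, 0) * hy
  have h2 : μ 1 - μ 2 - μ 3 - μ 4 = 0 := by
    apply mul_right_cancel₀ ha
    linear_combination N.nform 0 q (1, 0) * hy - N.nform 0 q (0, 1) * hx
  obtain ⟨t0, t1, t2⟩ := ht
  fin_cases i
  · change μ 0 = t 0 q + N.a q * t 1 q + N.b q * t 2 q
    rw [t0, t1, t2]
    linear_combination h0
  · change μ 1 = t 0 q + t 1 q + t 2 q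
    rw [t0, t1, t2]
    linear_combination h2
  · exact t0.symm
  · exact t1.symm
  · exact t2.symm

/-- The multipliers of the last three normalized forms are `λᵢ` divided by the scale, cut off to
functions smooth on the whole plane; only germs matter. -/
lemma exists_isSolution_of_solvesAbelianNear {p : Plane} (hp : p ∈ W.domain)
    {lam : Plane → Fin 5 → ℝ} (h : SolvesAbelianNear W p lam) :
    ∃ t, N.IsSolution p t ∧ N.abelianFunction t =ᶠ[𝓝 p] lam := by
  have hdom : ∀ᶠ q in 𝓝 p, q ∈ W.domain := W.isOpen_domain.mem_nhds hp
  have hglob : ∀ i : Fin 3, ∃ g : Plane → ℝ, ContDiff ℝ ∞ g ∧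
      g =ᶠ[𝓝 p] fun q => lam q (i.natAdd 2) / N.scale (i.natAdd 2) q := fun i => by
    apply exists_contDiff_eventuallyEq
    filter_upwards [hdom, h] with q hq h1
    exact (contDiffAt_pi.1 h1.1 _).div
      ((N.scale_smooth _).contDiffAt (W.isOpen_domain.mem_nhds hq)) (N.scale_ne_zero _ q hq)
  choose t ht ht' using hglob
  have heq : N.abelianFunction t =ᶠ[𝓝 p] lam := by
    filter_upwards [hdom, h, ht' 0, ht' 1, ht' 2] with q hq h1 h2 h3 h4
    have hs := fun i => N.scale_ne_zero i q hq
    refine funext fun i => ?_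
    rw [abelianFunction, ← N.eq_multiplier_of_sum_eq_zero
      (μ := fun i => lam q i / N.scale i q) hq ?_ ⟨h2, h3, h4⟩ i, div_mul_cancel₀ _ (hs i)]
    rw [← h1.2.1]
    refine Finset.sum_congr rfl fun i _ => ?_
    rw [nform, smul_smul, div_mul_cancel₀ _ (hs i)]
  refine ⟨t, ⟨ht, ?_⟩, heq⟩
  filter_upwards [hdom, h, heq.eventually_nhds] with q hq h1 h2
  refine (extD_abelianFunction_iff ht hq).1 fun i => ?_
  rw [← h1.2.2 i]
  have h3 : (fun r => N.abelianFunction t r i • W.form i r) =ᶠ[𝓝 q]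
      fun r => lam r i • W.form i r := h2.mono fun r hr => by
    simp only [hr]
  rw [extD, extD, h3.fderiv_eq]

end Normalization

end PlanarWebs

end

/-! ### Maximum rank in terms of the canonical coordinates and the invariants -/

noncomputable section

namespace PlanarWebs

open TopologicalSpace (Opens)

namespace Normalization

variable {W : PlanarWeb 5} {N : Normalization W}

lemma abelianOp_coords_add {t t' : Fin 3 → Plane → ℝ} (ht : ∀ i, ContDiff ℝ ∞ (t i))
    (ht' : ∀ i, ContDiff ℝ ∞ (t' i)) {q : Plane} (hq : q ∈ W.domain) :
    (∀ j, N.abelianOp (t 0 + t' 0) (t 1 + t' 1) (t 2 + t' 2) j q =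
      N.abelianOp (t 0) (t 1) (t 2) j q + N.abelianOp (t' 0) (t' 1) (t' 2) j q) ∧
    ∀ j, N.coords (t 0 + t' 0) (t 1 + t' 1) (t 2 + t' 2) j q =
      N.coords (t 0) (t 1) (t 2) j q + N.coords (t' 0) (t' 1) (t' 2) j q := by
  have r := fun i => represents_restrictTo (t i) (U := W.opens) (ht i).contDiffOn
  have r' := fun i => represents_restrictTo (t' i) (U := W.opens) (ht' i).contDiffOn
  let q' : W.opens := ⟨q, hq⟩
  have hU := W.opens_subset
  constructor <;> intro j
  · rw [← (represents_abelianOp (hU := hU) (r 0) (r 1) (r 2) j).evalAt q',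
      ← (represents_abelianOp (hU := hU) (r' 0) (r' 1) (r' 2) j).evalAt q', ← map_add,
      ← FramedWebAlgebra.abelianOp_add]
    exact ((represents_abelianOp (hU := hU) ((r 0).add (r' 0)) ((r 1).add (r' 1))
      ((r 2).add (r' 2)) j).evalAt q').symm
  · rw [← (represents_coords (hU := hU) (r 0) (r 1) (r 2) j).evalAt q',
      ← (represents_coords (hU := hU) (r' 0) (r' 1) (r' 2) j).evalAt q', ← map_add,
      ← FramedWebAlgebra.coord_add]
    exact ((represents_coords (hU := hU) ((r 0).add (r' 0)) ((r 1).add (r' 1))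
      ((r 2).add (r' 2)) j).evalAt q').symm

lemma abelianOp_coords_smul (c : ℝ) {t : Fin 3 → Plane → ℝ} (ht : ∀ i, ContDiff ℝ ∞ (t i))
    {q : Plane} (hq : q ∈ W.domain) :
    (∀ j, N.abelianOp (c • t 0) (c • t 1) (c • t 2) j q =
      c * N.abelianOp (t 0) (t 1) (t 2) j q) ∧
    ∀ j, N.coords (c • t 0) (c • t 1) (c • t 2) j q = c * N.coords (t 0) (t 1) (t 2) j q := by
  have r := fun i => represents_restrictTo (t i) (U := W.opens) (ht i).contDiffOn
  let q' : W.opens := ⟨q, hq⟩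
  have hU := W.opens_subset
  have hR := N.isRealLinear hU c
  have rc := fun i => (represents_algebraMap (U := W.opens) c).mul (r i)
  constructor <;> intro j
  · rw [← (represents_abelianOp (hU := hU) (r 0) (r 1) (r 2) j).evalAt q',
      ← evalAt_algebraMap q' c, ← map_mul, ← FramedWebAlgebra.abelianOp_const_mul _ hR.1 hR.2]
    exact ((represents_abelianOp (hU := hU) (rc 0) (rc 1) (rc 2) j).evalAt q').symm
  · rw [← (represents_coords (hU := hU) (r 0) (r 1) (r 2) j).evalAt q',
      ← evalAt_algebraMap q' c, ← map_mul, ← FramedWebAlgebra.coord_const_mul _ hR.2]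
    exact ((represents_coords (hU := hU) (rc 0) (rc 1) (rc 2) j).evalAt q').symm

variable (N) {p : Plane}

/-- The space of the triples of smooth functions that solve the abelian equation near `p`. -/
def solutions (hp : p ∈ W.domain) : Submodule ℝ (Fin 3 → Plane → ℝ) where
  carrier := {t | N.IsSolution p t}
  zero_mem' := by
    refine ⟨fun i => contDiff_const, ?_⟩
    filter_upwards [W.isOpen_domain.mem_nhds hp] with q hq j
    have h := (abelianOp_coords_smul (N := N) 0 (t := 0) (fun i => contDiff_const) hq).1 j
    simpa using h
  add_mem' := by
    rintro t t' ⟨h1, h2⟩ ⟨h3, h4⟩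
    refine ⟨fun i => (h1 i).add (h3 i), ?_⟩
    filter_upwards [W.isOpen_domain.mem_nhds hp, h2, h4] with q hq h5 h6 j
    exact ((abelianOp_coords_add h1 h3 hq).1 j).trans (by rw [h5, h6, add_zero])
  smul_mem' := by
    rintro c t ⟨h1, h2⟩
    refine ⟨fun i => (h1 i).const_smul c, ?_⟩
    filter_upwards [W.isOpen_domain.mem_nhds hp, h2] with q hq h5 j
    exact ((abelianOp_coords_smul c h1 hq).1 j).trans (by rw [h5, mul_zero])

/-- The canonical coordinates at `p` of the solutions near `p`. -/
def coordsAt (hp : p ∈ W.domain) : N.solutions hp →ₗ[ℝ] (Fin 6 → ℝ) where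
  toFun t i := N.coords (t.1 0) (t.1 1) (t.1 2) i p
  map_add' t t' := funext fun i => (abelianOp_coords_add t.2.1 t'.2.1 hp).2 i
  map_smul' c t := funext fun i => (abelianOp_coords_smul c t.2.1 hp).2 i

/-- The germ of the abelian function given by a solution. -/
def toGerm (hp : p ∈ W.domain) : N.solutions hp →ₗ[ℝ] abelianGerms W hp where
  toFun t := ⟨(N.abelianFunction t.1 : Filter.Germ (𝓝 p) (Fin 5 → ℝ)), _, rfl,
    IsSolution.solvesAbelianNear hp t.2⟩
  map_add' t t' := by
    refine Subtype.ext (congrArg (Filter.Germ.ofFun (l := 𝓝 p)) (funext fun q => funext fun i => ?_))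
    change N.abelianFunction (t.1 + t'.1) q i = N.abelianFunction t.1 q i +
      N.abelianFunction t'.1 q i
    fin_cases i <;> simp [abelianFunction, multiplier] <;> ring
  map_smul' c t := by
    refine Subtype.ext (congrArg (Filter.Germ.ofFun (l := 𝓝 p)) (funext fun q => funext fun i => ?_))
    change N.abelianFunction (c • t.1) q i = c * N.abelianFunction t.1 q i
    fin_cases i <;> simp [abelianFunction, multiplier] <;> ring

lemma toGerm_surjective (hp : p ∈ W.domain) : Function.Surjective (N.toGerm hp) := by
  rintro ⟨_, lam, rfl, h⟩
  obtain ⟨t, ht, heq⟩ := exists_isSolution_of_solvesAbelianNear (N := N) hp h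
  exact ⟨⟨t, ht⟩, Subtype.ext (Filter.Germ.coe_eq.2 heq)⟩

lemma toGerm_eq_zero_iff {hp : p ∈ W.domain} {t : N.solutions hp} :
    N.toGerm hp t = 0 ↔ ∀ᶠ q in 𝓝 p, ∀ i, t.1 i q = 0 := by
  have h1 : N.toGerm hp t = 0 ↔ ∀ᶠ q in 𝓝 p, N.abelianFunction t.1 q = 0 := by
    rw [Subtype.ext_iff]
    exact Filter.Germ.coe_eq
  rw [h1]
  refine Filter.eventually_congr ?_
  filter_upwards [W.isOpen_domain.mem_nhds hp] with q hq
  have hs := fun i => N.scale_ne_zero i q hq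
  constructor
  · intro h i
    have h2 := fun j => (mul_eq_zero.1 (congrFun h j)).resolve_right (hs j)
    fin_cases i
    · exact h2 2
    · exact h2 3
    · exact h2 4
  · intro h
    refine funext fun i => ?_
    fin_cases i <;> simp [abelianFunction, multiplier, h]

/-- The coordinates of a solution form a parallel section on a ball about `p`, so they vanish on the
ball once they vanish at `p`. This makes the rank at most six. -/
lemma coordsAt_eq_zero_iff {hp : p ∈ W.domain} {t : N.solutions hp} :
    N.coordsAt hp t = 0 ↔ ∀ᶠ q in 𝓝 p, ∀ i, t.1 i q = 0 := by
  constructor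
  · intro h
    have hdom : ∀ᶠ q in 𝓝 p, q ∈ W.domain := W.isOpen_domain.mem_nhds hp
    obtain ⟨r, hr, hball⟩ := Metric.nhds_basis_ball.eventually_iff.1 (hdom.and t.2.2)
    filter_upwards [Metric.ball_mem_nhds p hr] with q hq
    obtain ⟨h0, h1, h2⟩ := eq_zero_of_coords_eq_zero (N := N) (t.2.1 0) (t.2.1 1) (t.2.1 2)
      (fun q hq => (hball hq).1) (fun q hq => (hball hq).2) (Metric.mem_ball_self hr)
      (congrFun h) hq
    intro i
    fin_cases i
    · exact h0
    · exact h1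
    · exact h2
  · intro h
    have hz : ∀ i, t.1 i =ᶠ[𝓝 p] 0 := fun i => h.mono fun q hq => hq i
    have hδ : ∀ {F : Plane → ℝ} (k : ℕ), F =ᶠ[𝓝 p] 0 → N.δ₂ k F =ᶠ[𝓝 p] 0 := fun k hF => by
      filter_upwards [hF.eventually_nhds] with q hq
      rw [δ₂_congr hq k]
      simp [δ₂, pd₂, wedge]
    refine funext fun i => ?_
    fin_cases i
    · exact (hδ 2 (hδ 1 (hz 0))).self_of_nhds
    · exact (hδ 1 (hz 0)).self_of_nhds
    · exact (hδ 1 (hz 2)).self_of_nhds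
    · exact (hz 0).self_of_nhds
    · exact (hz 1).self_of_nhds
    · exact (hz 2).self_of_nhds

/-- The rank is maximal if and only if solutions have arbitrary canonical coordinates. -/
lemma isMaxRankAt_iff_surjective (hp : p ∈ W.domain) :
    IsMaxRankAt W hp ↔ Function.Surjective (N.coordsAt hp) := by
  -- `solutions` consists of functions on the whole plane and is not a space of germs, so the
  -- comparison is between its quotients by the triples with zero germ. Thus the rank is the
  -- dimension of the range of `coordsAt` in `ℝ⁶`, and `(5 - 1) (5 - 2) / 2 = 6`.
  have hker : LinearMap.ker (N.toGerm hp) = LinearMap.ker (N.coordsAt hp) := by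
    ext t
    rw [LinearMap.mem_ker, LinearMap.mem_ker, toGerm_eq_zero_iff, coordsAt_eq_zero_iff]
  have e := ((N.toGerm hp).quotKerEquivOfSurjective (N.toGerm_surjective hp)).symm.trans
    ((Submodule.quotEquivOfEq _ _ hker).trans (N.coordsAt hp).quotKerEquivRange)
  rw [IsMaxRankAt, rankAt, e.finrank_eq, ← LinearMap.range_eq_top]
  constructor
  · intro h
    exact Submodule.eq_top_of_finrank_eq (h.trans (by simp))
  · intro h
    rw [h, finrank_top]
    simp

/-- The condition that the solutions have arbitrary canonical coordinates is open. -/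
lemma eventually_surjective {hp : p ∈ W.domain}
    (h : Function.Surjective (N.coordsAt hp)) :
    ∀ᶠ q in 𝓝 p, ∀ hq : q ∈ W.domain, Function.Surjective (N.coordsAt hq) := by
  obtain ⟨A₁, A₂, hA⟩ := N.exists_isConnection
  choose t ht using fun i : Fin 6 => h (Pi.single i 1)
  -- The columns are the coordinates of six solutions that form the standard basis at `p`; the
  -- determinant is one at `p` and continuous there, so nearby these solutions still have
  -- independent coordinates.
  let M : Plane → Matrix (Fin 6) (Fin 6) ℝ := fun q =>
    Matrix.of fun j i => N.coords ((t i).1 0) ((t i).1 1) ((t i).1 2) j q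
  have hM : ContinuousAt M p := by
    have h1 := fun i => continuousAt_pi.1 (hA.hasFDerivAt_coords ((t i).2.1 0) ((t i).2.1 1)
      ((t i).2.1 2) hp (t i).2.2).continuousAt
    exact continuousAt_pi.2 fun j => continuousAt_pi.2 fun i => h1 i j
  have hMp : M p = 1 := by
    ext j i
    refine (congrFun (ht i) j).trans ?_
    rw [Matrix.one_apply, Pi.single_apply]
  have hcont : Continuous fun X : Matrix (Fin 6) (Fin 6) ℝ => X.det := continuous_id.matrix_det
  have hdet : ContinuousAt (fun q => (M q).det) p := hcont.continuousAt.comp hM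
  have hsol : ∀ᶠ q in 𝓝 p, ∀ i, N.IsSolution q (t i).1 :=
    Filter.eventually_all.2 fun i => (t i).2.2.eventually_nhds.mono fun q hq => ⟨(t i).2.1, hq⟩
  filter_upwards [hdet.eventually_ne (by simp [hMp] : (M p).det ≠ 0), hsol] with q hne hsol hq z
  refine ⟨∑ i, ((M q)⁻¹.mulVec z) i • (⟨(t i).1, hsol i⟩ : N.solutions hq), ?_⟩
  have h2 : z = (M q).mulVec ((M q)⁻¹.mulVec z) := by
    rw [Matrix.mulVec_mulVec, Matrix.mul_nonsing_inv _ (isUnit_iff_ne_zero.2 hne),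
      Matrix.one_mulVec]
  conv_rhs => rw [h2]
  rw [map_sum (N.coordsAt hq)]
  refine funext fun j => ?_
  rw [Finset.sum_apply, Matrix.mulVec, dotProduct]
  refine Finset.sum_congr rfl fun i _ => ?_
  rw [map_smul]
  exact mul_comm _ _

variable {N}

/-- The obstruction vanishes on solutions of the abelian equation. -/
lemma evalAt_obstruction_eq_zero {q : W.opens} {w u v : smoothRing W.opens}
    (h : ∀ j, (N.framed W.opens_subset).abelianOp w u v j ∈ vanishingIdeal q 4) :
    evalAt q ((N.framed W.opens_subset).obstruction w u v) = 0 := by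
  have hT := N.spansAt W.opens_subset q
  rw [FramedWebAlgebra.obstruction_eq, ← vanishesTo_one]
  exact Ideal.sub_mem _ (Ideal.sub_mem _ (Ideal.sub_mem _
    (hT.Δ₁_mem (hT.Δ₂_mem (hT.Δ₃_mem (h 3)))) (hT.δ₁_mem (hT.Δ₂_mem (hT.Δ₃_mem (h 0)))))
    (hT.Δ₁_mem (hT.δ₁_mem (hT.Δ₃_mem (h 1))))) (hT.Δ₁_mem (hT.Δ₂_mem (hT.δ₁_mem (h 2))))

/-- The rank is maximal if and only if the invariants vanish. -/
theorem isMaxRankAt_iff {c : Fin 6 → smoothRing W.opens}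
    (hc : ∀ (q : W.opens) (w u v : smoothRing W.opens),
      (∀ j, (N.framed W.opens_subset).abelianOp w u v j ∈ vanishingIdeal q 3) →
      evalAt q ((N.framed W.opens_subset).obstruction w u v) = -10 * (1 - N.a q) * (1 - N.b q) *
        ∑ i, evalAt q (c i) * evalAt q ((N.framed W.opens_subset).coord w u v i))
    (hp : p ∈ W.domain) :
    IsMaxRankAt W hp ↔ ∀ i, ∀ᶠ q in 𝓝 p, extendZero (c i) q = 0 := by
  have hdom : ∀ᶠ q in 𝓝 p, q ∈ W.domain := W.isOpen_domain.mem_nhds hp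
  rw [N.isMaxRankAt_iff_surjective hp]
  constructor
  · intro h i
    filter_upwards [hdom, N.eventually_surjective h] with q hq h1
    obtain ⟨t, ht⟩ := h1 hq (Pi.single i 1)
    let q' : W.opens := ⟨q, hq⟩
    have r := fun i => represents_restrictTo (t.1 i) (U := W.opens) (t.2.1 i).contDiffOn
    have hE := fun k => (jetSolves_iff (hU := W.opens_subset) (r 0) (r 1) (r 2) (q := q')).1
      (jetSolves_of_eventually t.2.2 k)
    -- On a genuine solution the obstruction is zero, and here its value is a nonzero factor times
    -- `cᵢ`.
    have h2 := (hc q' _ _ _ (hE 3)).symm.trans (evalAt_obstruction_eq_zero (hE 4))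
    have hz : ∀ j, evalAt q' ((N.framed W.opens_subset).coord (restrictTo (t.1 0) (t.2.1 0).contDiffOn)
        (restrictTo (t.1 1) (t.2.1 1).contDiffOn) (restrictTo (t.1 2) (t.2.1 2).contDiffOn) j) =
        (Pi.single i 1 : Fin 6 → ℝ) j := fun j => by
      rw [(represents_coords (r 0) (r 1) (r 2) j).evalAt]
      exact congrFun ht j
    have hne : -10 * (1 - N.a q) * (1 - N.b q) ≠ 0 :=
      mul_ne_zero (mul_ne_zero (by norm_num) (N.one_sub_a_ne_zero hq)) (N.one_sub_b_ne_zero hq)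
    have h3 := (mul_eq_zero.1 h2).resolve_left hne
    simp only [hz, Pi.single_apply, mul_ite, mul_one, mul_zero, Finset.sum_ite_eq',
      Finset.mem_univ, if_true] at h3
    rw [← h3, (represents_extendZero (c i)).evalAt]
  · intro h z
    have hκ : ∀ᶠ q in 𝓝 p, ∀ hq : q ∈ W.domain, N.ObstructionVanishesAt ⟨q, hq⟩ := by
      filter_upwards [Filter.eventually_all.2 h] with q h1 hq w u v hE
      rw [hc _ _ _ _ hE, Finset.sum_eq_zero fun i _ => ?_, mul_zero]
      rw [(represents_extendZero (c i)).evalAt, h1, zero_mul]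
    obtain ⟨t, ht, hz⟩ := exists_isSolution hp hκ z
    exact ⟨⟨t, ht⟩, funext hz⟩

end Normalization

end PlanarWebs

end

noncomputable section

namespace PlanarWebs

open TopologicalSpace (Opens)

/-! ### Webs with constant basic invariants -/

namespace FramedWebAlgebra

variable {R : Type} [CommRing R] (T : FramedWebAlgebra R)

lemma δ₁_δ₂_of_K_eq_zero (hK : T.K = 0) (k : ℕ) (f : R) :
    T.δ₁ (k + 1) (T.δ₂ k f) = T.δ₂ (k + 1) (T.δ₁ k f) := by
  rw [δ₁_δ₂, hK, mul_zero, zero_mul, sub_zero]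

/-- With constant `a`, `b` and no curvature, `δ₁` and `δ₂` commute and each `Δᵢ` is a combination of
them with constant coefficients. All the products in the obstruction can then be reordered and
cancel. -/
lemma obstruction_eq_zero_of_flat (ha₁ : T.D₁ T.a = 0) (ha₂ : T.D₂ T.a = 0) (hb₁ : T.D₁ T.b = 0)
    (hb₂ : T.D₂ T.b = 0) (hK : T.K = 0) (w u v : R) : T.obstruction w u v = 0 := by
  have hΔ₂ : ∀ k f, T.Δ₂ k f = T.δ₁ k f - T.a * T.δ₂ k f := fun k f => by
    simp only [Δ₂, δ₂, Derivation.leibniz, smul_eq_mul, ha₂]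
    ring
  have hΔ₃ : ∀ k f, T.Δ₃ k f = T.δ₁ k f - T.b * T.δ₂ k f := fun k f => by
    simp only [Δ₃, δ₂, Derivation.leibniz, smul_eq_mul, hb₂]
    ring
  have a1 : ∀ k f, T.δ₁ k (T.a * f) = T.a * T.δ₁ k f := fun k f => by
    simp only [δ₁, Derivation.leibniz, smul_eq_mul, ha₁]
    ring
  have a2 : ∀ k f, T.δ₂ k (T.a * f) = T.a * T.δ₂ k f := fun k f => by
    simp only [δ₂, Derivation.leibniz, smul_eq_mul, ha₂]
    ring
  have b1 : ∀ k f, T.δ₁ k (T.b * f) = T.b * T.δ₁ k f := fun k f => by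
    simp only [δ₁, Derivation.leibniz, smul_eq_mul, hb₁]
    ring
  have b2 : ∀ k f, T.δ₂ k (T.b * f) = T.b * T.δ₂ k f := fun k f => by
    simp only [δ₂, Derivation.leibniz, smul_eq_mul, hb₂]
    ring
  have s1 : ∀ k f g, T.δ₁ k (f - g) = T.δ₁ k f - T.δ₁ k g := fun k f g => by
    simp only [δ₁, map_sub]
    ring
  have s2 : ∀ k f g, T.δ₂ k (f - g) = T.δ₂ k f - T.δ₂ k g := fun k f g => by
    simp only [δ₂, map_sub]
    ring
  have c1 := fun f => T.δ₁_δ₂_of_K_eq_zero hK 1 f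
  have c2 := fun f => T.δ₁_δ₂_of_K_eq_zero hK 2 f
  have c3 := fun f => T.δ₁_δ₂_of_K_eq_zero hK 3 f
  simp only [Nat.reduceAdd] at c1 c2 c3
  simp only [obstruction, Δ₁, hΔ₂, hΔ₃, s1, s2, a1, a2, b1, b2, c1, c2, c3]
  ring

lemma curvatureSum_of_const (ha₁ : T.D₁ T.a = 0) (ha₂ : T.D₂ T.a = 0) (hb₁ : T.D₁ T.b = 0)
    (hb₂ : T.D₂ T.b = 0) : T.curvatureSum = 10 * T.K := by
  simp [curvatureSum_eq, twistedCurvature, rho₁₄₅, rho₂₄₅, rho₃₄₅, rhoDiff, ha₁, ha₂, hb₁, hb₂,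
    δ₁, δ₂]
  ring

/-- Three functions that are constant along the leaves of the first three foliations and satisfy
a linear relation make the curvature vanish. -/
lemma K_mul_eq_zero {x y z α β χ : R} (hx : T.D₂ x = 0) (hy : T.D₁ y = 0) (hz : T.D₁ z = T.D₂ z)
    (h : α * x + β * y + χ * z = 0) (hα₁ : T.D₁ α = 0) (hα₂ : T.D₂ α = 0) (hβ₁ : T.D₁ β = 0)
    (hβ₂ : T.D₂ β = 0) (hχ₁ : T.D₁ χ = 0) (hχ₂ : T.D₂ χ = 0) : T.K * (α * T.D₁ x) = 0 := by
  have h1 := congrArg T.D₁ h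
  have h2 := congrArg T.D₂ h
  simp only [map_add, map_zero, Derivation.leibniz, smul_eq_mul, hx, hy, hz, hα₁, hα₂, hβ₁, hβ₂,
    hχ₁, hχ₂, mul_zero, add_zero, zero_add] at h1 h2
  have k1 : T.δ₁ 1 (T.δ₂ 0 y) = T.δ₂ 1 (T.δ₁ 0 y) := by simpa using T.δ₁_δ₂ 0 y
  have k2 : T.δ₁ 1 (T.δ₂ 0 x) = T.δ₂ 1 (T.δ₁ 0 x) := by simpa using T.δ₁_δ₂ 0 x
  -- The relation identifies `α D₁ x` with `β D₂ y`. As a function of weight one it is killed by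
  -- `δ₂` through the first expression and by `δ₁` through the second; the commutator then gives `K`
  -- times it equal to zero.
  have e2 : T.δ₂ 1 (α * T.D₁ x) = 0 := by
    simp only [δ₁, δ₂, hx, Nat.cast_zero, zero_mul, sub_zero, map_zero, mul_zero] at k2
    simp only [δ₂, Derivation.leibniz, smul_eq_mul, hα₂]
    linear_combination -α * k2
  have e1 : T.δ₁ 1 (α * T.D₁ x) = 0 := by
    have : α * T.D₁ x = β * T.D₂ y := by linear_combination h1 - h2
    rw [this]
    simp only [δ₁, δ₂, hy, Nat.cast_zero, zero_mul, sub_zero, map_zero, mul_zero] at k1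
    simp only [δ₁, Derivation.leibniz, smul_eq_mul, hβ₁]
    linear_combination β * k1
  have h3 := T.δ₁_δ₂ 1 (α * T.D₁ x)
  rw [e1, e2] at h3
  simp only [δ₁, δ₂, map_zero, mul_zero, Nat.cast_one, one_mul] at h3
  linear_combination h3

end FramedWebAlgebra

namespace Normalization

variable {W : PlanarWeb 5} {N : Normalization W} {U : Opens Plane}
  {hU : (U : Set Plane) ⊆ W.domain}

lemma derivatives_of_const {f : smoothRing U} {c : ℝ} (h : ∀ q, evalAt q f = c) :
    (N.framed hU).D₁ f = 0 ∧ (N.framed hU).D₂ f = 0 := by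
  rw [show f = algebraMap ℝ _ c from smoothRing_ext h]
  exact N.isRealLinear hU c

lemma derivatives_of_eq_const {a₀ b₀ : ℝ} (h : ∀ q ∈ U, N.a q = a₀ ∧ N.b q = b₀) :
    ((N.framed hU).D₁ (N.framed hU).a = 0 ∧ (N.framed hU).D₂ (N.framed hU).a = 0) ∧
      (N.framed hU).D₁ (N.framed hU).b = 0 ∧ (N.framed hU).D₂ (N.framed hU).b = 0 :=
  ⟨derivatives_of_const fun q => (h q q.2).1, derivatives_of_const fun q => (h q q.2).2⟩

/-- If the curvature vanishes and the basic invariants are constant, the obstruction vanishes. -/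
lemma IsObstructionCoeffs.eq_zero {c : Fin 6 → Plane → ℝ} (hc : N.IsObstructionCoeffs c)
    {a₀ b₀ : ℝ} (h : ∀ q ∈ U, N.a q = a₀ ∧ N.b q = b₀) (hK : (N.framed hU).K = 0) (i : Fin 6)
    {q : Plane} (hq : q ∈ U) : c i q = 0 := by
  classical
  obtain ⟨⟨ha₁, ha₂⟩, hb₁, hb₂⟩ := derivatives_of_eq_const (hU := hU) h
  -- Replacing the coefficients by zero at the single point `q` is harmless because the obstruction
  -- vanishes there. Uniqueness then gives the value of `c i` at `q`.
  have hc' : N.IsObstructionCoeffs fun i r => if r = q then 0 else c i r := by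
    intro r hr w u v hw hu hv hE
    by_cases hrq : r = q
    · subst hrq
      have h1 := (represents_obstruction (N := N) (hU := hU)
        (represents_restrictTo w (U := U) hw.contDiffOn)
        (represents_restrictTo u (U := U) hu.contDiffOn)
        (represents_restrictTo v (U := U) hv.contDiffOn)).evalAt ⟨r, hq⟩
      rw [FramedWebAlgebra.obstruction_eq_zero_of_flat _ ha₁ ha₂ hb₁ hb₂ hK, map_zero] at h1
      rw [← h1]
      simp
    · simpa only [hrq, if_false] using hc r hr w u v hw hu hv hE
  simpa using hc.unique N hc' i (hU hq)

lemma form_apply (θ : Plane →L[ℝ] ℝ) (v : Plane) : θ v = v.1 * θ (1, 0) + v.2 * θ (0, 1) := by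
  have h : v = v.1 • ((1, 0) : Plane) + v.2 • ((0, 1) : Plane) := by
    ext <;> simp
  conv_lhs => rw [h, map_add, map_smul, map_smul]
  rfl

lemma wedge_eq_zero_of_ker {α β : OneForm} {q : Plane} (h : ∀ v, α q v = 0 → β q v = 0) :
    wedge α β q = 0 := by
  have h2 := h (-(α q (0, 1)), α q (1, 0)) (by rw [form_apply]; ring)
  rw [form_apply] at h2
  rw [wedge]
  linear_combination h2

/-- The curvature of a parallelizable web vanishes. -/
lemma K_eq_zero_of_parallel {e : OpenPartialHomeomorph Plane Plane} {ℓ : Fin 5 → Plane →L[ℝ] ℝ}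
    (hUe : (U : Set Plane) ⊆ e.source) (he : ContDiffOn ℝ ∞ e e.source) (hℓ : ∀ i, ℓ i ≠ 0)
    (h : ∀ i, ∀ q ∈ e.source, ∀ v, W.form i q v = 0 ↔ ℓ i (fderiv ℝ e q v) = 0) :
    (N.framed hU).K = 0 := by
  have hX : ∀ i, ContDiffOn ℝ ∞ (fun q => ℓ i (e q)) U := fun i =>
    (ℓ i).contDiff.comp_contDiffOn (he.mono hUe)
  set x : Fin 5 → smoothRing U := fun i => restrictTo _ (hX i) with hx
  have rx : ∀ i, Represents (x i) (fun q => ℓ i (e q)) := fun i => represents_restrictTo _ _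
  have hd : ∀ i, ∀ q ∈ U, ∀ v, fderiv ℝ (fun q => ℓ i (e q)) q v = ℓ i (fderiv ℝ e q v) := by
    intro i q hq v
    have h1 : DifferentiableAt ℝ e q :=
      (he.contDiffAt (e.open_source.mem_nhds (hUe hq))).differentiableAt (by simp)
    have h2 : HasFDerivAt (fun q => ℓ i (e q)) (ℓ i ∘L fderiv ℝ e q) q :=
      (ℓ i).hasFDerivAt.comp q h1.hasFDerivAt
    rw [h2.fderiv]
    rfl
  have hker : ∀ i, ∀ q ∈ U, wedge (N.nform i) (fderiv ℝ fun q => ℓ i (e q)) q = 0 := by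
    intro i q hq
    refine wedge_eq_zero_of_ker fun v hv => ?_
    have h1 : N.scale i q * W.form i q v = 0 := hv
    rw [hd i q hq, ← h i q (hUe hq)]
    exact (mul_eq_zero.1 h1).resolve_left (N.scale_ne_zero i q (hU hq))
  have hx0 : (N.framed hU).D₂ (x 0) = 0 := smoothRing_ext fun q => by
    rw [(N.represents_D₂ hU (rx 0)).evalAt, pd₂, hker 0 q q.2, zero_div, map_zero]
  have hx1 : (N.framed hU).D₁ (x 1) = 0 := smoothRing_ext fun q => by
    have h1 := hker 1 q q.2
    rw [(N.represents_D₁ hU (rx 1)).evalAt, pd₁, map_zero, div_eq_zero_iff]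
    left
    simp only [wedge] at h1 ⊢
    linear_combination -h1
  have hx2 : (N.framed hU).D₁ (x 2) = (N.framed hU).D₂ (x 2) := smoothRing_ext fun q => by
    have h1 := hker 2 q q.2
    rw [(N.represents_D₁ hU (rx 2)).evalAt, (N.represents_D₂ hU (rx 2)).evalAt, pd₁, pd₂]
    congr 1
    simp only [wedge, N.nform_two (hU q.2), neg_apply, add_apply] at h1 ⊢
    linear_combination h1
  -- Three linear forms on the plane are related by their `2 × 2` minors, so three first integrals
  -- of the parallel web satisfy a relation with constant coefficients.
  let m : Fin 5 → Fin 5 → ℝ := fun i j => ℓ i (1, 0) * ℓ j (0, 1) - ℓ i (0, 1) * ℓ j (1, 0)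
  have hrel : algebraMap ℝ _ (m 1 2) * x 0 + algebraMap ℝ _ (m 2 0) * x 1 +
      algebraMap ℝ _ (m 0 1) * x 2 = 0 := smoothRing_ext fun q => by
    simp only [map_add, map_mul, evalAt_algebraMap, (rx _).evalAt, map_zero, m]
    rw [form_apply (ℓ 0) (e q), form_apply (ℓ 1) (e q), form_apply (ℓ 2) (e q)]
    ring
  have hR := N.isRealLinear hU
  have hK := FramedWebAlgebra.K_mul_eq_zero _ hx0 hx1 hx2 hrel (hR _).1 (hR _).2 (hR _).1 (hR _).2
    (hR _).1 (hR _).2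
  refine smoothRing_ext fun q => ?_
  have hK := congrArg (evalAt q) hK
  rw [map_mul, map_mul, map_zero, evalAt_algebraMap] at hK
  rw [map_zero]
  -- A vanishing minor would make the second and third foliations tangent; a vanishing `D₁ (x 0)`
  -- would make the first form zero at `q`. Both contradict transversality.
  refine (mul_eq_zero.1 hK).resolve_right (mul_ne_zero (fun hm => ?_) fun hD => ?_)
  · refine W.transverse 1 2 (by decide) q (hU q.2) (wedge_eq_zero_of_ker fun v hv => ?_)
    rw [h _ _ (hUe q.2)] at hv ⊢
    generalize fderiv ℝ e q v = w at hv ⊢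
    have hne : ℓ 1 (1, 0) ≠ 0 ∨ ℓ 1 (0, 1) ≠ 0 := by
      by_contra! hcon
      refine hℓ 1 (ContinuousLinearMap.ext fun v => ?_)
      rw [form_apply, hcon.1, hcon.2]
      simp
    rw [form_apply] at hv ⊢
    simp only [m] at hm
    rcases hne with hne | hne
    · apply mul_left_cancel₀ hne
      linear_combination ℓ 2 (1, 0) * hv + w.2 * hm
    · apply mul_left_cancel₀ hne
      linear_combination ℓ 2 (0, 1) * hv - w.1 * hm
  · have hp := partialDeriv_eq_frame (N := N) (hU := hU) (x 0)
    rw [hx0] at hp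
    have h1 := congrArg (evalAt q) hp.1
    have h2 := congrArg (evalAt q) hp.2
    rw [((rx 0).partialDeriv _).evalAt, map_add, map_mul, map_mul, hD, map_zero, mul_zero,
      mul_zero, add_zero] at h1 h2
    refine W.transverse 0 1 (by decide) q (hU q.2) ?_
    have h3 : ∀ v, W.form 0 q v = 0 := fun v => by
      rw [h _ _ (hUe q.2), ← hd 0 q q.2, form_apply, h1, h2]
      ring
    rw [wedge, h3, h3]
    ring

end Normalization

end PlanarWebs

end

/-! ### Straightening a flat web with constant basic invariants -/

noncomputable section

namespace PlanarWebs

open TopologicalSpace (Opens)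

/-- A closed form on a convex open set is exact. -/
lemma exists_primitive {U : Opens Plane} (hconv : Convex ℝ (U : Set Plane)) {α : OneForm}
    (hα : ContDiffOn ℝ ∞ α U) (h : ∀ q ∈ U, extD α q = 0) :
    ∃ f : Plane → ℝ, ContDiffOn ℝ ∞ f U ∧ ∀ q ∈ U, HasFDerivAt f (α q) q := by
  obtain ⟨f, hf⟩ := hconv.exists_forall_hasFDerivAt_of_fderiv_symmetric U.isOpen
    (hα.differentiableOn (by simp)) fun q hq x y => by
      have h1 := h q hq
      rw [extD] at h1
      have h2 : ∀ v w : Plane, fderiv ℝ α q v w = v.1 * (w.1 * fderiv ℝ α q (1, 0) (1, 0) +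
          w.2 * fderiv ℝ α q (1, 0) (0, 1)) + v.2 * (w.1 * fderiv ℝ α q (0, 1) (1, 0) +
          w.2 * fderiv ℝ α q (0, 1) (0, 1)) := by
        intro v w
        have h3 : v = v.1 • ((1, 0) : Plane) + v.2 • ((0, 1) : Plane) := by
          ext <;> simp
        conv_lhs => rw [h3, map_add, map_smul, map_smul]
        rw [add_apply, smul_apply, smul_apply, Normalization.form_apply _ w,
          Normalization.form_apply (fderiv ℝ α q (0, 1)) w]
        rfl
      rw [h2 x y, h2 y x]
      linear_combination (x.1 * y.2 - x.2 * y.1) * h1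
  refine ⟨f, ?_, hf⟩
  rw [contDiffOn_infty_iff_fderiv_of_isOpen U.isOpen]
  exact ⟨fun q hq => (hf q hq).differentiableAt.differentiableWithinAt,
    hα.congr fun q hq => (hf q hq).fderiv⟩

lemma exists_equiv_prod {θ₁ θ₂ : Plane →L[ℝ] ℝ}
    (h : θ₁ (1, 0) * θ₂ (0, 1) - θ₁ (0, 1) * θ₂ (1, 0) ≠ 0) :
    ∃ E : Plane ≃L[ℝ] Plane, (E : Plane →L[ℝ] Plane) = θ₁.prod θ₂ := by
  have hinj : Function.Injective (θ₁.prod θ₂ : Plane →ₗ[ℝ] Plane) := by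
    rw [← LinearMap.ker_eq_bot, LinearMap.ker_eq_bot']
    intro v hv
    have h1 : θ₁ v = 0 := congrArg Prod.fst hv
    have h2 : θ₂ v = 0 := congrArg Prod.snd hv
    rw [Normalization.form_apply] at h1 h2
    ext
    · apply mul_right_cancel₀ h
      change _ = 0 * _
      linear_combination θ₂ (0, 1) * h1 - θ₁ (0, 1) * h2
    · apply mul_right_cancel₀ h
      change _ = 0 * _
      linear_combination θ₁ (1, 0) * h2 - θ₂ (1, 0) * h1
  exact ⟨(LinearEquiv.ofInjectiveEndo _ hinj).toContinuousLinearEquiv, by ext <;> rfl⟩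

namespace Normalization

variable {W : PlanarWeb 5} {N : Normalization W} {U : Opens Plane}
  {hU : (U : Set Plane) ⊆ W.domain}

/-- If the curvature vanishes, the first two forms have proportional primitives. -/
lemma exists_scaled_primitives (hconv : Convex ℝ (U : Set Plane)) (hK : (N.framed hU).K = 0) :
    ∃ F X Y : Plane → ℝ, (∀ q, F q ≠ 0) ∧ ContDiffOn ℝ ∞ X U ∧ ContDiffOn ℝ ∞ Y U ∧
      ∀ q ∈ U, HasFDerivAt X (F q • N.nform 0 q) q ∧ HasFDerivAt Y (F q • N.nform 1 q) q := by
  have hγ : N.RepresentsFrame hU (N.framed hU).g₁ (N.framed hU).g₂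
      (chernForm (N.nform 0) (N.nform 1)) :=
    .of_eq (N.represents_g₁ hU) (N.represents_g₂ hU) fun q _ => rfl
  -- Vanishing curvature means `dγ = 0`, so `γ = dφ` on the convex set. Then `d (e^φ ωᵢ) = e^φ (γ ∧
  -- ωᵢ + ωᵢ ∧ γ) = 0` for `i = 1, 2`.
  obtain ⟨φ, hφ, hφ'⟩ := exists_primitive hconv (RepresentsForm.contDiffOn hγ) fun q hq => by
    rw [← hγ.extD.evalAt ⟨q, hq⟩]
    rw [FramedWebAlgebra.K] at hK
    rw [hK, zero_add, mul_comm (N.framed hU).g₁, sub_self, mul_zero, map_zero]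
  have hF : ContDiffOn ℝ ∞ (fun q => Real.exp (φ q)) U := hφ.exp
  have rF := represents_restrictTo _ hF
  have hpd : ∀ q ∈ U, N.pd₁ (fun q => Real.exp (φ q)) q =
        Real.exp (φ q) * chernCoeff₁ (N.nform 0) (N.nform 1) q ∧
      N.pd₂ (fun q => Real.exp (φ q)) q =
        Real.exp (φ q) * chernCoeff₂ (N.nform 0) (N.nform 1) q := fun q hq => by
    refine N.pd_eq_of_fderiv (hU hq) fun v => ?_
    rw [(hφ' q hq).exp.fderiv]
    simp only [chernForm, smul_apply, add_apply, smul_eq_mul]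
    ring
  have h1 : (N.framed hU).D₁ (restrictTo _ hF) = restrictTo _ hF * (N.framed hU).g₁ :=
    ((N.represents_D₁ hU rF).congr fun q hq => (hpd q hq).1).ext (rF.mul (N.represents_g₁ hU))
  have h2 : (N.framed hU).D₂ (restrictTo _ hF) = restrictTo _ hF * (N.framed hU).g₂ :=
    ((N.represents_D₂ hU rF).congr fun q hq => (hpd q hq).2).ext (rF.mul (N.represents_g₂ hU))
  have r0 : N.RepresentsFrame hU (restrictTo _ hF) 0
      (fun q => Real.exp (φ q) • N.nform 0 q) :=
    .of_eq rF represents_zero fun q _ => by rw [zero_smul, add_zero]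
  have r1 : N.RepresentsFrame hU 0 (restrictTo _ hF)
      (fun q => Real.exp (φ q) • N.nform 1 q) :=
    .of_eq represents_zero rF fun q _ => by rw [zero_smul, zero_add]
  obtain ⟨X, hX, hX'⟩ := exists_primitive hconv (RepresentsForm.contDiffOn r0) fun q hq => by
    rw [← r0.extD.evalAt ⟨q, hq⟩, h2, map_zero, zero_mul, sub_zero, zero_sub, neg_add_cancel,
      mul_zero, map_zero]
  obtain ⟨Y, hY, hY'⟩ := exists_primitive hconv (RepresentsForm.contDiffOn r1) fun q hq => by
    rw [← r1.extD.evalAt ⟨q, hq⟩, h1, map_zero, zero_mul, sub_zero, add_zero, sub_self,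
      mul_zero, map_zero]
  exact ⟨_, X, Y, fun q => Real.exp_ne_zero _, hX, hY, fun q hq => ⟨hX' q hq, hY' q hq⟩⟩

/-- If the curvature vanishes and the basic invariants are constant, the web is parallelizable. -/
lemma isParallelizableAt_of_flat (hconv : Convex ℝ (U : Set Plane)) {p : Plane} (hp : p ∈ U)
    {a₀ b₀ : ℝ} (h : ∀ q ∈ U, N.a q = a₀ ∧ N.b q = b₀) (hK : (N.framed hU).K = 0) :
    IsParallelizableAt W p := by
  obtain ⟨F, X, Y, hF, hX, hY, hXY⟩ := exists_scaled_primitives hconv hK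
  have hd : ∀ q ∈ U, HasFDerivAt (fun q => (X q, Y q))
      ((F q • N.nform 0 q).prod (F q • N.nform 1 q)) q := fun q hq =>
    (hXY q hq).1.prodMk (hXY q hq).2
  have hc : ∀ q ∈ U, ContDiffAt ℝ ∞ (fun q => (X q, Y q)) q := fun q hq =>
    (hX.prodMk hY).contDiffAt (U.isOpen.mem_nhds hq)
  have hE : ∀ q ∈ U, ∃ E : Plane ≃L[ℝ] Plane, HasFDerivAt (fun q => (X q, Y q))
      (E : Plane →L[ℝ] Plane) q := fun q hq => by
    obtain ⟨E, hE⟩ := exists_equiv_prod (θ₁ := F q • N.nform 0 q) (θ₂ := F q • N.nform 1 q) (by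
      have h1 := mul_ne_zero (pow_ne_zero 2 (hF q)) (N.area_ne_zero (hU hq))
      convert! h1 using 1
      simp only [smul_apply, smul_eq_mul, area, wedge]
      ring)
    exact ⟨E, hE ▸ hd q hq⟩
  obtain ⟨E, hEp⟩ := hE p hp
  let e := ((hc p hp).toOpenPartialHomeomorph _ hEp (by simp)).restrOpen U U.isOpen
  have hesrc : e.source ⊆ U := fun q hq => hq.2
  have hecoe : (e : Plane → Plane) = fun q => (X q, Y q) := rfl
  -- The components of the five normalized forms in the basis `ω₁, ω₂`. They are constant here,
  -- hence define linear forms in the coordinates `(X, Y)`.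
  let A : Fin 5 → ℝ := ![1, 0, -1, -a₀, -b₀]
  let B : Fin 5 → ℝ := ![0, 1, -1, -1, -1]
  refine ⟨e, fun i => A i • ContinuousLinearMap.fst ℝ ℝ ℝ + B i • ContinuousLinearMap.snd ℝ ℝ ℝ,
    ⟨(hc p hp).mem_toOpenPartialHomeomorph_source hEp (by simp), hp⟩, hesrc.trans hU,
    (hX.prodMk hY).mono hesrc, fun y hy => ?_, fun i => ?_, fun i q hq v => ?_⟩
  · obtain ⟨E', hE'⟩ := hE (e.symm y) (hesrc (e.map_target hy))
    exact (e.contDiffAt_symm hy hE' (hc _ (hesrc (e.map_target hy)))).contDiffWithinAt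
  · intro h0
    have h1 := congrArg (fun θ : Plane →L[ℝ] ℝ => θ (1, 0)) h0
    have h2 := congrArg (fun θ : Plane →L[ℝ] ℝ => θ (0, 1)) h0
    fin_cases i <;> simp [A, B] at h1 h2
  · have hq' := hesrc hq
    have h1 : N.nform i q v = A i * N.nform 0 q v + B i * N.nform 1 q v := by
      fin_cases i
      · simp [A, B]
      · simp [A, B]
      · simp only [Fin.reduceFinMk, N.nform_two (hU hq')]
        simp [A, B]
        ring
      · simp only [Fin.reduceFinMk, N.nform_three (hU hq'), (h q hq').1]
        simp [A, B]
        ring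
      · simp only [Fin.reduceFinMk, N.nform_four (hU hq'), (h q hq').2]
        simp [A, B]
        ring
    have h2 : N.nform i q v = N.scale i q * W.form i q v := rfl
    rw [hecoe, (hd q hq').fderiv]
    have h3 : (A i • ContinuousLinearMap.fst ℝ ℝ ℝ + B i • ContinuousLinearMap.snd ℝ ℝ ℝ)
        (((F q • N.nform 0 q).prod (F q • N.nform 1 q)) v) =
        F q * (N.scale i q * W.form i q v) := by
      rw [← h2, h1]
      simp only [add_apply, smul_apply, smul_eq_mul, ContinuousLinearMap.prod_apply,
        ContinuousLinearMap.coe_fst', ContinuousLinearMap.coe_snd']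
      ring
    rw [h3, mul_eq_zero, mul_eq_zero, or_iff_right (hF q),
      or_iff_right (N.scale_ne_zero i q (hU hq'))]

end Normalization

end PlanarWebs

end

/-! ### Parallelizability for constant invariants, and the theorem -/

noncomputable section

namespace PlanarWebs

open TopologicalSpace (Opens)

namespace Normalization

variable {W : PlanarWeb 5} {N : Normalization W}

/-- For constant basic invariants, the invariants vanish if and only if the web is
parallelizable. -/
theorem IsObstructionCoeffs.eventually_eq_zero_iff_isParallelizableAt {c : Fin 6 → Plane → ℝ}
    (hc : N.IsObstructionCoeffs c) (hc₀ : ∀ q ∈ W.domain, c 0 q = N.curvature q) {p : Plane}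
    (hp : p ∈ W.domain) {a₀ b₀ : ℝ} (hab : ∀ᶠ q in 𝓝 p, N.a q = a₀ ∧ N.b q = b₀) :
    (∀ i, ∀ᶠ q in 𝓝 p, c i q = 0) ↔ IsParallelizableAt W p := by
  have hdom : ∀ᶠ q in 𝓝 p, q ∈ W.domain := W.isOpen_domain.mem_nhds hp
  constructor
  · intro h
    obtain ⟨r, hr, hball⟩ :=
      Metric.nhds_basis_ball.eventually_iff.1 ((hdom.and hab).and (h 0))
    let U : Opens Plane := ⟨Metric.ball p r, Metric.isOpen_ball⟩
    have hU : (U : Set Plane) ⊆ W.domain := fun q hq => (hball hq).1.1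
    have hU' : ∀ q ∈ U, N.a q = a₀ ∧ N.b q = b₀ := fun q hq => (hball hq).1.2
    refine isParallelizableAt_of_flat (hU := hU) (convex_ball p r) (Metric.mem_ball_self hr) hU' ?_
    obtain ⟨⟨ha₁, ha₂⟩, hb₁, hb₂⟩ := derivatives_of_eq_const (hU := hU) hU'
    refine smoothRing_ext fun q => ?_
    have h1 := N.evalAt_curvatureSum hU q
    -- For constant `a` and `b` all ten subwebs have curvature `K`, so the vanishing of `c₀` alone
    -- already gives `K = 0`.
    rw [FramedWebAlgebra.curvatureSum_of_const _ ha₁ ha₂ hb₁ hb₂, map_mul, map_ofNat,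
      ← hc₀ q (hU q.2), (hball q.2).2] at h1
    rw [map_zero]
    linear_combination h1 / 10
  · rintro ⟨e, ℓ, hpe, -, he, -, hℓ, h⟩ i
    obtain ⟨r, hr, hball⟩ := Metric.nhds_basis_ball.eventually_iff.1
      ((hdom.and hab).and (e.open_source.mem_nhds hpe))
    let U : Opens Plane := ⟨Metric.ball p r, Metric.isOpen_ball⟩
    have hU : (U : Set Plane) ⊆ W.domain := fun q hq => (hball hq).1.1
    have hK := K_eq_zero_of_parallel (N := N) (hU := hU) (fun q hq => (hball hq).2) he hℓ h
    filter_upwards [Metric.ball_mem_nhds p hr] with q hq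
    exact hc.eq_zero (hU := hU) (fun q hq => (hball hq).1.2) hK i hq

end Normalization

end PlanarWebs

end

theorem mainTheorem10 (W : PlanarWebs.PlanarWeb 5) (N : PlanarWebs.Normalization W) :
    ∃ c : Fin 6 → PlanarWebs.Plane → ℝ,
      -- the invariants `c₀, …, c₅` exist, are smooth, and are unique
      (∀ i, ContDiffOn ℝ ∞ (c i) W.domain) ∧
      N.IsObstructionCoeffs c ∧
      (∀ c' : Fin 6 → PlanarWebs.Plane → ℝ, N.IsObstructionCoeffs c' →
        ∀ i, Set.EqOn (c' i) (c i) W.domain) ∧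
      -- maximum rank is equivalent to the vanishing of the invariants
      (∀ (p : PlanarWebs.Plane) (hp : p ∈ W.domain),
        PlanarWebs.IsMaxRankAt W hp ↔ ∀ i, ∀ᶠ q in 𝓝 p, c i q = 0) ∧
      -- `c₀` is the curvature function of the web
      (∀ p ∈ W.domain, c 0 p = N.curvature p) ∧
      (∀ (p : PlanarWebs.Plane) (hp : p ∈ W.domain),
        PlanarWebs.IsMaxRankAt W hp → ∀ᶠ q in 𝓝 p, N.curvature q = 0) ∧
      -- webs with constant basic invariants
      (∀ (p : PlanarWebs.Plane) (hp : p ∈ W.domain),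
        (∃ a₀ b₀ : ℝ, ∀ᶠ q in 𝓝 p, N.a q = a₀ ∧ N.b q = b₀) →
          ((∀ i, ∀ᶠ q in 𝓝 p, c i q = 0) ↔ PlanarWebs.IsParallelizableAt W p) ∧
          (PlanarWebs.IsMaxRankAt W hp ↔ PlanarWebs.IsParallelizableAt W p)) := by
  obtain ⟨c, hc₀, hc⟩ := N.exists_coeffs W.opens_subset
  have hcoeffs := N.isObstructionCoeffs_of_framed W.opens_subset rfl hc
  have hcurv : ∀ p ∈ W.domain, PlanarWebs.extendZero (c 0) p = N.curvature p := fun p hp =>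
    ((PlanarWebs.represents_extendZero (c 0)).evalAt ⟨p, hp⟩).symm.trans (hc₀ ⟨p, hp⟩)
  have hrank := fun (p : PlanarWebs.Plane) (hp : p ∈ W.domain) =>
    PlanarWebs.Normalization.isMaxRankAt_iff hc hp
  refine ⟨fun i => PlanarWebs.extendZero (c i),
    fun i => (PlanarWebs.represents_extendZero (c i)).contDiffOn, hcoeffs,
    fun c' hc' i p hp => hc'.unique N hcoeffs i hp, hrank, hcurv, fun p hp h => ?_,
    fun p hp ⟨a₀, b₀, hab⟩ => ?_⟩
  · filter_upwards [(hrank p hp).1 h 0, W.isOpen_domain.mem_nhds hp] with q h1 hq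
    rw [← hcurv q hq, h1]
  · have h := hcoeffs.eventually_eq_zero_iff_isParallelizableAt hcurv hp hab
    exact ⟨h, (hrank p hp).trans h⟩
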